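/- **Setting.** Let $d\ge 3$, $\langle k\rangle=(|k|^2+1)^{1/2}$ and $\log^*t=\max\{1,\log t\}$. Let $e,\omega:\mathbb R^d\to[0,\infty)$ and $Q:\mathbb R^d\to\mathbb R$ be even functions of class $C^{2d}$, let $\beta>0$, $\mu\in\mathbb R$, and put $\Phi_\pm(p,k)=e(k+p)\pm\omega(k)$. Assume that for constants $C_1,\dots,C_8$ and $\varrho>0$ (with $C_3,C_6>0$): * $|\nabla^\ell e(k)|\le C_1(1+\langle k\rangle^{2-\ell})$, $|\nabla^\ell\omega(k)|\le C_2(1+\langle k\rangle^{2-\ell})$ and $|\nabla^\ell Q(k)|\le C_7\langle k\rangle^{-2d-12}$ for $0\le\ell\le 2d$; * $\Phi_\pm(p,k)\to\infty$ as $|k|\to\infty$, and $C_3\le \mathrm{Hess}_k\,\Phi_\pm(p,k)\le C_4$; * (transversality) with $E_\pm(p,\theta,\delta)=\{k:|\Phi_\pm(p,k)-\theta|\le\delta\}$ and for all choices of the two signs, $|E_\pm(p_1,\theta_1,\delta_1)\cap E_\pm(p_2,\theta_2,\delta_2)\cap B(q,r)|\le C_5\,\delta_1\delta_2/|p_1-p_2|$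 for all $p_1\ne p_2$ and $q$ in $\mathbb R^d$, $\theta_1,\theta_2\in\mathbb R$ and $0<\delta_1,\delta_2,r\le\varrho$; * $\inf_k\omega(k)-\mu\beta^{-1}\ge C_6$. For $L>0$ let $\Lambda_L^*=(\sqrt{2\pi}L^{-1}\mathbb Z)^d$ and $\int_{\Lambda_L^*}dk=L^{-d}\sum_{k\in\Lambda^*_L}$. Let $\gamma_L$ be a density matrix (a positive operator of trace one) on $L^2_{per}$ of the box $[-\sqrt{2\pi}L/2,\sqrt{2\pi}L/2]^d$, with momentum kernel $\widehat\gamma_L(p,q)$ normalized by $\int_{\Lambda_L^*}\widehat\gamma_L(p,p)\,dp=1$, such that $\limsup_{L\to\infty}\int_{\Lambda_L^*}\langle p\rangle^{3d+12}\widehat\gamma_L(p,p)\,dp\le C_8$. Let $\mathcal N(k)=e^{-\beta\omega(k)+\mu}/(1-e^{-\beta\omega(k)+\mu})$ and, for $\sigma=\pm1$, $M(k,\sigma)=|Q(k)|^2\big(\mathcal N(k)+\tfrac{\sigma+1}2\big)$ and $$\Theta(s,p,\Omega)=\sum_{\sigma=\pm}\int_{\Lambda_L^*}e^{-is[\Phi_\sigma(p,k)+\Omega]}M(k,\sigma)\,dk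 .$$ For $n\le N$ let $\mathcal M(n,N)$ be the set of $\underline m=(m_0,\dots,m_n)\in\mathbb N_0^{n+1}$ with $n+2\sum_jm_j=N$. Put $\mu(j)=j+2\sum_{i<j}m_i$, $I_j=\{\mu(j)+1,\mu(j)+3,\dots,\mu(j)+2m_j-1\}$ and $I_j^c=\{\mu(j),\mu(j)+2,\dots,\mu(j)+2m_j\}$. For momenta $p,k_1,\dots,k_n$ and signs $\sigma_1,\dots,\sigma_n$ put $p_j=p+\sum_{\ell>j}k_\ell$, $\Omega_j=\sum_{\ell>j}\sigma_\ell\omega(k_\ell)$ and $$A_{\underline m}(t;p,\underline k,\underline\sigma)=\int_{[0,t]^{N+1}}\prod_{b=0}^N ds_b\ \delta\Big(t-\sum_{b=0}^N s_b\Big)\prod_{j=0}^n\Big[\prod_{b\in I_j^c}e^{-is_b[e(p_j)+\Omega_j]}\prod_{b\in I_j}\Theta(s_b,p_j,\Omega_j)\Big].$$ For a permutation $\pi$ of $\{1,\dots,n\}$, $\underline m,\underline{\tilde m}\in\mathcal M(n,N)$ and $\lambda\in\mathbb R$ let $$C^{L}_{\underline m,\underline{\tilde m},\pi}(t)=\lambda^{2N}\sum_{\sigma\in\{\pm\}^n}\int_{\Lambda_L^*}dp\;\widehat\gamma_L(p,p)\int_{(\Lambda_L^*)^n}\prod_{j=1}^nM(k_j,\sigma_j)\,dk_j\;A_{\underline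 m}(t;p,\underline k,\underline\sigma)\,\overline{A_{\underline{\tilde m}}(t;p,\underline k\circ\pi^{-1},\underline\sigma\circ\pi^{-1})} .$$ An index $1<a<n$ is a *peak* of $\pi$ if $\pi(a-1)<\pi(a)>\pi(a+1)$. **Proposition.** There is a constant $C>0$, depending only on $d$, $\beta$, $C_1,\dots,C_8$ and $\varrho$, with the following property. Suppose that the above assumptions hold, that $\omega$ is constant, that $\underline m,\underline{\tilde m}\in\mathcal M(n,N)$, and that $\pi$ has peaks $a_1<\dots<a_\kappa$ with $\pi(a_1)<\dots<\pi(a_\kappa)$ or with $\pi(a_1)>\dots>\pi(a_\kappa)$. Then for all $\lambda\in\mathbb R$ and all $t>0$ $$\limsup_{L\to\infty}\big|C^{L}_{\underline m,\underline{\tilde m},\pi}(t)\big|\le t^{-\kappa}\,(C\lambda^2t)^N(\log^*t)^{n+\kappa+2}.$$ -/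

import Mathlib

open Filter MeasureTheory
open scoped BigOperators Topology ENNReal

noncomputable section

namespace ElectronPhonon

/-- Momentum space `ℝ^d` with its Euclidean norm. -/
abbrev Momentum (d : ℕ) : Type := EuclideanSpace ℝ (Fin d)

/-- The Japanese bracket `⟨k⟩ = (|k|² + 1)^{1/2}`. -/
def bracket {d : ℕ} (k : Momentum d) : ℝ := Real.sqrt (‖k‖ ^ 2 + 1)

/-- `log* t = max {1, log t}`. -/
def logStar (t : ℝ) : ℝ := max 1 (Real.log t)

/-- The data of the model: electron dispersion relation `e`, phonon dispersion relation `ω`,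
interaction function `Q`, inverse temperature `β` and chemical potential `μ`. -/
structure Model (d : ℕ) where
  e : Momentum d → ℝ
  ω : Momentum d → ℝ
  Q : Momentum d → ℝ
  β : ℝ
  μ : ℝ

namespace Model

variable {d : ℕ}

/-- The sign `±` as a real number. -/
def sgn (σ : ℤˣ) : ℝ := ((σ : ℤ) : ℝ)

/-- `Φ_σ(p, k) = e(k + p) + σ ω(k)`. -/
def Phi (S : Model d) (σ : ℤˣ) (p k : Momentum d) : ℝ := S.e (k + p) + sgn σ * S.ω k

/-- The expected number of phonons in mode `k`. -/
def phononNumber (S : Model d) (k : Momentum d) : ℝ :=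
  Real.exp (-S.β * S.ω k + S.μ) / (1 - Real.exp (-S.β * S.ω k + S.μ))

/-- `M(k, σ) = |Q(k)|² (𝒩(k) + (σ + 1)/2)`. -/
def M (S : Model d) (k : Momentum d) (σ : ℤˣ) : ℝ :=
  |S.Q k| ^ 2 * (S.phononNumber k + (sgn σ + 1) / 2)

/-- The layer `{k : |Φ_σ(p, k) - θ| ≤ δ}` around a level set. -/
def layer (S : Model d) (σ : ℤˣ) (p : Momentum d) (θ δ : ℝ) : Set (Momentum d) :=
  {k | |S.Phi σ p k - θ| ≤ δ}

end Model

/-- The constants which quantify the standing assumptions. -/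
structure Bounds where
  C₁ : ℝ
  C₂ : ℝ
  C₃ : ℝ
  C₄ : ℝ
  C₅ : ℝ
  C₆ : ℝ
  C₇ : ℝ
  C₈ : ℝ
  ρ : ℝ

/-- The standing assumptions on the dispersion relations, on the phonon equilibrium state and on
the interaction function. -/
structure StandingAssumptions {d : ℕ} (c : Bounds) (S : Model d) : Prop where
  e_nonneg : ∀ k, 0 ≤ S.e k
  ω_nonneg : ∀ k, 0 ≤ S.ω k
  e_even : ∀ k, S.e (-k) = S.e k
  ω_even : ∀ k, S.ω (-k) = S.ω k
  e_smooth : ContDiff ℝ ((2 * d : ℕ) : WithTop ℕ∞) S.e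
  ω_smooth : ContDiff ℝ ((2 * d : ℕ) : WithTop ℕ∞) S.ω
  e_bound : ∀ l : ℕ, l ≤ 2 * d → ∀ k,
    ‖iteratedFDeriv ℝ l S.e k‖ ≤ c.C₁ * (1 + bracket k ^ (2 - (l : ℤ)))
  ω_bound : ∀ l : ℕ, l ≤ 2 * d → ∀ k,
    ‖iteratedFDeriv ℝ l S.ω k‖ ≤ c.C₂ * (1 + bracket k ^ (2 - (l : ℤ)))
  phi_tendsto : ∀ (σ : ℤˣ) (p : Momentum d),
    Tendsto (fun k => S.Phi σ p k) (cocompact (Momentum d)) atTop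
  C₃_pos : 0 < c.C₃
  phi_hess : ∀ (σ : ℤˣ) (p k v : Momentum d),
    c.C₃ * ‖v‖ ^ 2 ≤ iteratedFDeriv ℝ 2 (fun k' => S.Phi σ p k') k ![v, v] ∧
    iteratedFDeriv ℝ 2 (fun k' => S.Phi σ p k') k ![v, v] ≤ c.C₄ * ‖v‖ ^ 2
  ρ_pos : 0 < c.ρ
  /-- Transversality of two layers. -/
  transversal : ∀ (σ₁ σ₂ : ℤˣ) (p₁ p₂ : Momentum d) (θ₁ θ₂ δ₁ δ₂ r : ℝ) (q : Momentum d),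
    p₁ ≠ p₂ → 0 < δ₁ → δ₁ ≤ c.ρ → 0 < δ₂ → δ₂ ≤ c.ρ → 0 < r → r ≤ c.ρ →
    volume (S.layer σ₁ p₁ θ₁ δ₁ ∩ S.layer σ₂ p₂ θ₂ δ₂ ∩ Metric.ball q r) ≤
      ENNReal.ofReal (c.C₅ * δ₁ * δ₂ / ‖p₁ - p₂‖)
  β_pos : 0 < S.β
  C₆_pos : 0 < c.C₆
  gap : ∀ k, c.C₆ ≤ S.ω k - S.μ * S.β⁻¹
  Q_smooth : ContDiff ℝ ((2 * d : ℕ) : WithTop ℕ∞) S.Q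
  Q_even : ∀ k, S.Q (-k) = S.Q k
  Q_bound : ∀ l : ℕ, l ≤ 2 * d → ∀ k,
    ‖iteratedFDeriv ℝ l S.Q k‖ ≤ c.C₇ * bracket k ^ (-(2 * (d : ℤ)) - 12)

/-! ### Finite volume: the dual lattice and the electron state -/

/-- Labels of the points of the dual lattice `Λ_L^* = (√(2π) L⁻¹ ℤ)^d`. -/
abbrev LatticeIndex (d : ℕ) : Type := Fin d → ℤ

/-- The point of `Λ_L^*` with label `x`. -/
def latticePoint {d : ℕ} (L : ℝ) (x : LatticeIndex d) : Momentum d :=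
  WithLp.toLp 2 (fun i => Real.sqrt (2 * Real.pi) / L * (x i : ℝ))

/-- The normalized sum `∫_{Λ_L^*} dk = L^{-d} ∑_{k ∈ Λ_L^*}`. -/
def latticeInt {d : ℕ} (L : ℝ) (f : LatticeIndex d → ℂ) : ℂ :=
  ((L : ℂ) ^ d)⁻¹ * ∑' x, f x

/-- The normalized sum `∫_{(Λ_L^*)^n} dk_1 ⋯ dk_n`. -/
def latticeIntMulti {d : ℕ} (L : ℝ) (n : ℕ) (f : (Fin n → LatticeIndex d) → ℂ) : ℂ :=
  ((L : ℂ) ^ (d * n))⁻¹ * ∑' x, f x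

/-- The one-electron space `L²_per(Λ_L)` in momentum representation, with respect to the
orthonormal basis of plane waves, which are labelled by the points of `Λ_L^*`. -/
abbrev ElectronSpace (d : ℕ) : Type := lp (fun _ : LatticeIndex d => ℂ) 2

/-- The normalized plane wave with momentum label `x`. -/
def planeWave {d : ℕ} (x : LatticeIndex d) : ElectronSpace d := lp.single 2 x (1 : ℂ)

/-- A density matrix: a positive operator of trace one. -/
structure IsDensityMatrix {d : ℕ} (γ : ElectronSpace d →L[ℂ] ElectronSpace d) : Prop where
  positive : γ.IsPositive
  trace_one : HasSum (fun x => inner ℂ (planeWave x) (γ (planeWave x))) (1 : ℂ)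

/-- The momentum kernel `γ̂(p, q)`, `p, q ∈ Λ_L^*`, of an operator, with respect to the measure
`∫_{Λ_L^*}`; so `∫_{Λ_L^*} γ̂(p, p) dp` is the trace. -/
def kernel {d : ℕ} (L : ℝ) (γ : ElectronSpace d →L[ℂ] ElectronSpace d)
    (x y : LatticeIndex d) : ℂ :=
  (L : ℂ) ^ d * inner ℂ (planeWave x) (γ (planeWave y))

/-- The moment `∫_{Λ_L^*} ⟨p⟩^{3d+12} γ̂(p, p) dp`, in `[0, ∞]`. -/
def momentumMoment {d : ℕ} (L : ℝ) (γ : ElectronSpace d →L[ℂ] ElectronSpace d) : ℝ≥0∞ :=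
  ENNReal.ofReal (L ^ d)⁻¹ * ∑' x : LatticeIndex d,
    ENNReal.ofReal (bracket (latticePoint L x) ^ (3 * d + 12) * (kernel L γ x x).re)

/-! ### Immediate recollision patterns -/

/-- `ℳ(n, N)`: the tuples `(m_0, …, m_n)` with `n + 2 |m| = N`. -/
def patterns (n N : ℕ) : Set (Fin (n + 1) → ℕ) := {m | n + 2 * ∑ j, m j = N}

/-- `μ(j) = j + 2 ∑_{i < j} m_i`. -/
def externalIndex {n : ℕ} (m : Fin (n + 1) → ℕ) (j : Fin (n + 1)) : ℕ :=
  j + 2 * ∑ i ∈ Finset.univ.filter (fun i : Fin (n + 1) => i < j), m i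

/-- `I_j = {μ(j) + 1, μ(j) + 3, …, μ(j) + 2 m_j - 1}`. -/
def recollisionSlots {n : ℕ} (m : Fin (n + 1) → ℕ) (j : Fin (n + 1)) : Finset ℕ :=
  (Finset.range (m j)).image (fun i => externalIndex m j + 2 * i + 1)

/-- `I_j^c = {μ(j), μ(j) + 2, …, μ(j) + 2 m_j}`. -/
def freeSlots {n : ℕ} (m : Fin (n + 1) → ℕ) (j : Fin (n + 1)) : Finset ℕ :=
  (Finset.range (m j + 1)).image (fun i => externalIndex m j + 2 * i)

/-! ### Values of Feynman graphs -/

/-- The sequence `s_0, s_1, …, s_N` with `s_0 = t - ∑_{j=1}^N s_j` (and `0` beyond `N`). -/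
def timeSeq (t : ℝ) {N : ℕ} (s : Fin N → ℝ) : ℕ → ℝ
  | 0 => t - ∑ i, s i
  | b + 1 => if h : b < N then s ⟨b, h⟩ else 0

/-- `∫_0^{t*} [ds_j]_0^N f = ∫_0^t ⋯ ∫_0^t ∏ ds_j δ(t - ∑_{j=0}^N s_j) f`: the delta function is
used to integrate out `s_0`, which leaves the simplex `s_j ≥ 0`, `∑_{j=1}^N s_j ≤ t`. -/
def timeInt (t : ℝ) (N : ℕ) (f : (ℕ → ℝ) → ℂ) : ℂ :=
  ∫ s in {s : Fin N → ℝ | (∀ i, 0 ≤ s i) ∧ ∑ i, s i ≤ t}, f (timeSeq t s)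

section Graphs

variable {d : ℕ}

/-- `p_j = p_n + ∑_{l=j+1}^n k_l`; here `k_l` is `k ⟨l - 1, _⟩`. -/
def electronMomentum {n : ℕ} (p : Momentum d) (k : Fin n → Momentum d) (j : Fin (n + 1)) :
    Momentum d :=
  p + ∑ l ∈ Finset.univ.filter (fun l : Fin n => (j : ℕ) ≤ (l : ℕ)), k l

/-- `Ω_j = ∑_{l=j+1}^n σ_l ω(k_l)`. -/
def phononEnergy (S : Model d) {n : ℕ} (k : Fin n → Momentum d) (σ : Fin n → ℤˣ)
    (j : Fin (n + 1)) : ℝ :=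
  ∑ l ∈ Finset.univ.filter (fun l : Fin n => (j : ℕ) ≤ (l : ℕ)), Model.sgn (σ l) * S.ω (k l)

/-- `Θ(s, p, Ω) = ∑_σ ∫_{Λ_L^*} exp(-i s [Φ_σ(p, k) + Ω]) M(k, σ) dk`. -/
def Theta (S : Model d) (L s : ℝ) (p : Momentum d) (Ω : ℝ) : ℂ :=
  ∑ σ : ℤˣ, latticeInt L fun x : LatticeIndex d =>
    Complex.exp (-Complex.I * ((s * (S.Phi σ p (latticePoint L x) + Ω) : ℝ) : ℂ)) *
      ((S.M (latticePoint L x) σ : ℝ) : ℂ)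

/-- The time integral of one electron line:
`∫_0^{t*} [ds_b]_0^N ∏_j [∏_{b ∈ I_j^c} exp(-i s_b [e(p_j) + Ω_j]) ∏_{b ∈ I_j} Θ(s_b, p_j, Ω_j)]`. -/
def lineAmplitude (S : Model d) (L t : ℝ) {n : ℕ} (N : ℕ) (m : Fin (n + 1) → ℕ)
    (p : Momentum d) (k : Fin n → Momentum d) (σ : Fin n → ℤˣ) : ℂ :=
  timeInt t N fun s => ∏ j : Fin (n + 1),
    ((∏ b ∈ freeSlots m j, Complex.exp (-Complex.I *
        ((s b * (S.e (electronMomentum p k j) + phononEnergy S k σ j) : ℝ) : ℂ))) *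
      ∏ b ∈ recollisionSlots m j,
        Theta S L (s b) (electronMomentum p k j) (phononEnergy S k σ j))

/-- `Y_{m, m̃, π}`: the product of the amplitude of the upper line and the complex conjugate of the
amplitude of the lower line. The delta functions of the pairing have been used to set
`p̃_n = p_n` and `k̃_{π(j)} = k_j`; the lower line carries the signs `σ ∘ π⁻¹`. -/
def Y (S : Model d) (L t : ℝ) {n : ℕ} (N : ℕ) (m m' : Fin (n + 1) → ℕ)
    (π : Equiv.Perm (Fin n)) (p : Momentum d) (k : Fin n → Momentum d) (σ : Fin n → ℤˣ) : ℂ :=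
  lineAmplitude S L t N m p k σ *
    (starRingEnd ℂ) (lineAmplitude S L t N m' p (k ∘ π.symm) (σ ∘ π.symm))

/-- The value `C_{m, m̃, π}(t)` of the pairing graph in the box of size `L`:
`λ^{2N} ∑_σ ∫ dp_n γ̂_e(p_n, p_n) ∫ ∏_j M(k_j, σ_j) dk_j Y_{m, m̃, π}`. -/
def graphValue (S : Model d) (L : ℝ) (γ : ElectronSpace d →L[ℂ] ElectronSpace d) (lam t : ℝ)
    {n : ℕ} (N : ℕ) (m m' : Fin (n + 1) → ℕ) (π : Equiv.Perm (Fin n)) : ℂ :=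
  (lam : ℂ) ^ (2 * N) * ∑ σ : Fin n → ℤˣ,
    latticeInt L fun x : LatticeIndex d => kernel L γ x x *
      latticeIntMulti L n fun y : Fin n → LatticeIndex d =>
        (∏ j, ((S.M (latticePoint L (y j)) (σ j) : ℝ) : ℂ)) *
          Y S L t N m m' π (latticePoint L x) (fun j => latticePoint L (y j)) σ

end Graphs

/-! ### Peaks -/

/-- `a` is a peak of `π` if `π(a - 1) < π(a) > π(a + 1)`; the endpoints are never peaks. -/
def IsPeak {n : ℕ} (π : Equiv.Perm (Fin n)) (a : Fin n) : Prop :=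
  ∃ b c : Fin n, (b : ℕ) + 1 = a ∧ (a : ℕ) + 1 = c ∧ π b < π a ∧ π c < π a

/-- `π` has an increasing or a decreasing sequence of `κ` peaks. -/
def HasMonotonePeaks {n : ℕ} (π : Equiv.Perm (Fin n)) (κ : ℕ) : Prop :=
  ∃ a : Fin κ → Fin n, StrictMono a ∧ (∀ i, IsPeak π (a i)) ∧
    (StrictMono (fun i => π (a i)) ∨ StrictAnti (fun i => π (a i)))

end ElectronPhonon

end

/-! Since `ω` is constant, all phonon energies are numbers fixed by the signs. The momenta enter a
line only through the electron energies, and `e` itself inherits the Hessian bounds and the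
transversality of Φ_±.

One line. A time integral over the simplex is an iterated convolution. Damping by exp(-s/t) and
Fourier inversion bound it by a constant times an integral, over one energy ξ, of the product of the
Fourier transforms of the factors (`enorm_iterConv_le`). A free factor becomes a resolvent, at most
1/max(|E + 2πξ|, 1/t), which is `cut`. A recollision factor costs only its integral over time. That
integral is finite uniformly in the momentum, because ∫ exp(-i s e(k+q)) Q(k)² dk decays like
s^(-5/4) (`exists_lintegral_oscInt_le`): its square is an integral of correlations whose phase, a
difference of two translates of the convex function e, has no stationary point. Each recollision
also adds a surplus resolvent, bounded by t. The two lines together have N - n recollisions, which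
gives a factor t^(N-n).

Two lines. The momenta x_0, …, x_{n-1} of the upper line are taken as integration variables, and x_n
= p is fixed. A resolvent of the upper line costs a logarithm when its momentum is integrated. A
resolvent of the lower line with index 0 < j < n is bounded by t, unless j = π(a) for a selected
peak a. In that case its momentum is x_a - x_{a+1} + r, and the peak condition says exactly that r
depends neither on x_a nor on x_{a+1}. Transversality bounds the x_{a+1}-integral of two resolvents
by log² · (1 + 1/|x_a + r|), and for d ≥ 3 the point singularity is harmless in the x_a-integral
(`exists_resolvent_bounds`, `lmarginal_block_le`). The block of a thus costs log³ where the trivial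
bound is t log²: a power of t is exchanged for a logarithm.

Order of integration. Blocks are integrated by increasing π(a), so that the special lower momentum
of a later block does not contain the variables of an earlier one. Integrability at infinity comes
from four powers of a weight per phonon, rerouted so that every variable is tied to one that is
integrated later or kept fixed (`prod_ewt_le`). A block is tied to its right neighbour if the peaks
increase and to its left neighbour if they decrease; monotonicity of the peaks is needed exactly
here (`PeakSet.par_notMem`). At j = 0 and j = n both lines carry the same momentum and phase. There
one energy integral gives log · (1 + resolvent), the other gives t, and x_0 gives the last
logarithm. In total the momenta cost t^(n-κ) log^(n+κ+1).

Finite volume. Lattice sums are integrals of step functions. All factors are Lipschitz, so rounding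
the momenta costs an error of order (1 + |p|)/L, which the momentum moment of the electron state
controls and which vanishes as L → ∞. -/

namespace ElectronPhonon

/-! ### Brackets and weights -/

lemma bracket_sq {d : ℕ} (x : Momentum d) : bracket x ^ 2 = ‖x‖ ^ 2 + 1 :=
  Real.sq_sqrt (by positivity)

lemma one_le_bracket {d : ℕ} (x : Momentum d) : 1 ≤ bracket x :=
  Real.one_le_sqrt.2 (by nlinarith [sq_nonneg ‖x‖])

lemma bracket_pos {d : ℕ} (x : Momentum d) : 0 < bracket x :=
  zero_lt_one.trans_le (one_le_bracket x)

lemma norm_le_bracket {d : ℕ} (x : Momentum d) : ‖x‖ ≤ bracket x :=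
  Real.le_sqrt_of_sq_le (by linarith)

lemma bracket_le_one_add_norm {d : ℕ} (x : Momentum d) : bracket x ≤ 1 + ‖x‖ :=
  Real.sqrt_le_iff.2 ⟨by positivity, by nlinarith [norm_nonneg x]⟩

lemma bracket_neg {d : ℕ} (x : Momentum d) : bracket (-x) = bracket x := by
  simp [bracket]

lemma bracket_sub_comm {d : ℕ} (x y : Momentum d) : bracket (x - y) = bracket (y - x) := by
  rw [← bracket_neg, neg_sub]

lemma continuous_bracket {d : ℕ} : Continuous (bracket (d := d)) := by
  unfold bracket; fun_prop

/-- Peetre's inequality. -/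
lemma bracket_add_le {d : ℕ} (x y : Momentum d) : bracket (x + y) ≤ 2 * bracket x * bracket y := by
  have hx := one_le_bracket x
  have hy := one_le_bracket y
  have h1 : ‖x + y‖ ≤ ‖x‖ + ‖y‖ := norm_add_le x y
  refine Real.sqrt_le_iff.2 ⟨by positivity, ?_⟩
  have : (2 * bracket x * bracket y) ^ 2 = 4 * (‖x‖ ^ 2 + 1) * (‖y‖ ^ 2 + 1) := by
    rw [← bracket_sq, ← bracket_sq]; ring
  rw [this]
  nlinarith [norm_nonneg x, norm_nonneg y, norm_nonneg (x + y), sq_nonneg (‖x‖ - ‖y‖),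
    sq_nonneg (‖x‖ * ‖y‖)]

lemma bracket_sub_le {d : ℕ} (x y : Momentum d) : bracket (x - y) ≤ 2 * bracket x * bracket y := by
  rw [sub_eq_add_neg, ← bracket_neg y]; exact bracket_add_le x (-y)

/-- The weight `⟨x⟩^{-(d + 1)}`. -/
noncomputable def wt {d : ℕ} (x : Momentum d) : ℝ := (bracket x ^ (d + 1))⁻¹

lemma wt_pos {d : ℕ} (x : Momentum d) : 0 < wt x := by
  have := bracket_pos x; unfold wt; positivity

lemma wt_le_one {d : ℕ} (x : Momentum d) : wt x ≤ 1 :=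
  inv_le_one_of_one_le₀ (one_le_pow₀ (one_le_bracket x))

lemma continuous_wt {d : ℕ} : Continuous (wt (d := d)) :=
  (continuous_bracket.pow _).inv₀ fun x => (pow_pos (bracket_pos x) _).ne'

lemma measurable_wt {d : ℕ} : Measurable (wt (d := d)) := continuous_wt.measurable

lemma wt_sub_comm {d : ℕ} (x y : Momentum d) : wt (x - y) = wt (y - x) := by
  rw [wt, wt, bracket_sub_comm]

/-- The weight changes by a bounded factor under bounded relative displacements. -/
lemma wt_le_mul {d : ℕ} {x y : Momentum d} {a : ℝ} (ha : 0 < a) (h : bracket y ≤ a * bracket x) :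
    wt x ≤ a ^ (d + 1) * wt y := by
  have hx := bracket_pos x
  have hy := bracket_pos y
  unfold wt
  rw [inv_le_iff_one_le_mul₀ (by positivity), mul_assoc, mul_comm, mul_assoc, ← mul_pow,
    ← div_eq_inv_mul, le_div_iff₀ (by positivity), one_mul]
  exact pow_le_pow_left₀ hy.le (by linarith) _

lemma wt_mul_wt_le {d : ℕ} (x y : Momentum d) : wt x * wt y ≤ 2 ^ (d + 1) * wt (x + y) := by
  have hx := bracket_pos x
  have hy := bracket_pos y
  have hxy := bracket_pos (x + y)
  unfold wt
  rw [← mul_inv, ← mul_pow, inv_le_iff_one_le_mul₀ (by positivity), mul_assoc, mul_comm, mul_assoc,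
    ← mul_pow, ← div_eq_inv_mul, le_div_iff₀ (by positivity), one_mul]
  exact pow_le_pow_left₀ hxy.le (by linarith [bracket_add_le x y]) _

lemma prod_one_add_sq_le {d : ℕ} (x : Momentum d) :
    ∏ i, (1 + x i ^ 2) ≤ bracket x ^ (2 * d) := by
  rw [pow_mul, bracket_sq]
  calc ∏ i, (1 + x i ^ 2) ≤ ∏ _i : Fin d, (‖x‖ ^ 2 + 1) := by
        refine Finset.prod_le_prod (fun i _ => by positivity) fun i _ => ?_
        have : x i ^ 2 ≤ ‖x‖ ^ 2 := by
          rw [EuclideanSpace.norm_sq_eq]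
          have := Finset.single_le_sum (f := fun i => ‖x i‖ ^ 2) (fun i _ => by positivity)
            (Finset.mem_univ i)
          simpa [Real.norm_eq_abs, sq_abs] using this
        linarith
    _ = _ := by simp

/-- Bounding every coordinate by the norm turns the radial weight into a product, ready for Tonelli.
The exponent `(d + 1) / (2 * d)` exceeds `1 / 2`, so each one-dimensional factor remains integrable.
-/
lemma wt_le_prod {d : ℕ} (hd : 0 < d) (x : Momentum d) :
    wt x ≤ ∏ i, (1 + x i ^ 2) ^ (-((d + 1 : ℝ) / (2 * d))) := by
  have hb := bracket_pos x
  have hd' : (0 : ℝ) < d := by exact_mod_cast hd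
  have h0 : 0 < ∏ i, (1 + x i ^ 2) := Finset.prod_pos fun i _ => by positivity
  rw [Real.finsetProd_rpow _ _ (fun i _ => by positivity), Real.rpow_neg h0.le, wt]
  refine inv_anti₀ (Real.rpow_pos_of_pos h0 _) ?_
  calc _ ≤ (bracket x ^ (2 * d)) ^ ((d + 1 : ℝ) / (2 * d)) :=
        Real.rpow_le_rpow h0.le (prod_one_add_sq_le x) (by positivity)
    _ = bracket x ^ (d + 1) := by
        rw [← Real.rpow_natCast, ← Real.rpow_mul hb.le, ← Real.rpow_natCast]
        congr 1
        push_cast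
        field_simp

/-! ### Product integrals -/

lemma lmarginal_prod {ι : Type*} [DecidableEq ι] (f : ι → ℝ → ℝ≥0∞)
    (hf : ∀ i, Measurable (f i)) (s : Finset ι) (x : ι → ℝ) :
    (∫⋯∫⁻_s, (fun x => ∏ i ∈ s, f i (x i)) ∂(fun _ => volume)) x = ∏ i ∈ s, ∫⁻ y, f i y := by
  induction s using Finset.induction generalizing x with
  | empty => simp
  | insert j s hj ih =>
    rw [lmarginal_insert' (fun x : ι → ℝ => ∏ i ∈ insert j s, f i (x i))
      (Finset.measurable_prod _ fun i _ => (hf i).comp (measurable_pi_apply i)) hj,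
      Finset.prod_insert hj, ← ih x]
    have : (fun x : ι → ℝ => ∫⁻ y, ∏ i ∈ insert j s, f i (Function.update x j y i)) =
        fun x => (∫⁻ y, f j y) * ∏ i ∈ s, f i (x i) := by
      ext x
      rw [← lintegral_mul_const _ (hf j)]
      refine lintegral_congr fun y => ?_
      rw [Finset.prod_insert hj, Function.update_self]
      congr 1
      refine Finset.prod_congr rfl fun i hi => ?_
      rw [Function.update_of_ne (by rintro rfl; exact hj hi)]
    rw [this]
    unfold lmarginal
    rw [lintegral_const_mul]
    refine (Finset.measurable_prod _ fun i _ =>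
      (hf i).comp (measurable_pi_apply i)).comp measurable_updateFinset

lemma lintegral_prod_apply {d : ℕ} (f : Fin d → ℝ → ℝ≥0∞) (hf : ∀ i, Measurable (f i)) :
    ∫⁻ x : Momentum d, ∏ i, f i (x i) = ∏ i, ∫⁻ y, f i y := by
  have h := (PiLp.volume_preserving_ofLp (Fin d)).lintegral_comp
    (f := fun x : Fin d → ℝ => ∏ i, f i (x i))
    (Finset.measurable_prod _ fun i _ => (hf i).comp (measurable_pi_apply i))
  rw [h, volume_pi, lintegral_eq_lmarginal_univ (fun _ => 0), lmarginal_prod f hf]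

/-- Tonelli in an arbitrary orthonormal frame; the freedom is used later to turn the first axis
towards a singular point. -/
lemma lintegral_prod_repr {d : ℕ} (b : OrthonormalBasis (Fin d) ℝ (Momentum d))
    (f : Fin d → ℝ → ℝ≥0∞) (hf : ∀ i, Measurable (f i)) :
    ∫⁻ x : Momentum d, ∏ i, f i (b.repr x i) = ∏ i, ∫⁻ y, f i y := by
  rw [← lintegral_prod_apply f hf]
  exact b.measurePreserving_repr.lintegral_comp (f := fun x : Momentum d => ∏ i, f i (x i))
    (Finset.measurable_prod _ fun i _ => (hf i).comp (by fun_prop))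

lemma norm_repr {d : ℕ} (b : OrthonormalBasis (Fin d) ℝ (Momentum d)) (x : Momentum d) :
    ‖b.repr x‖ = ‖x‖ := b.repr.norm_map x

lemma wt_repr {d : ℕ} (b : OrthonormalBasis (Fin d) ℝ (Momentum d)) (x : Momentum d) :
    wt (b.repr x) = wt x := by
  simp [wt, bracket]

/-- The singularity `|y|^{-γ}` of one variable. -/
noncomputable def sing (γ y : ℝ) : ℝ≥0∞ := ‖y‖ₑ ^ (-γ)

lemma measurable_sing (γ : ℝ) : Measurable (sing γ) := by
  unfold sing; fun_prop

lemma setLIntegral_sing_le {γ R : ℝ} (h1 : γ < 1) (hR : 0 < R) :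
    ∫⁻ y in Set.Icc (-R) R, sing γ y ≤ ENNReal.ofReal (2 * R ^ (1 - γ) / (1 - γ)) := by
  have h2 : ∫⁻ y in Set.Ioc 0 R, sing γ y = ENNReal.ofReal (R ^ (1 - γ) / (1 - γ)) := by
    have e1 : ∫⁻ y in Set.Ioc 0 R, sing γ y = ∫⁻ y in Set.Ioc 0 R, ENNReal.ofReal (y ^ (-γ)) := by
      refine setLIntegral_congr_fun measurableSet_Ioc fun y hy => ?_
      rw [sing, Real.enorm_eq_ofReal hy.1.le, ENNReal.ofReal_rpow_of_pos hy.1]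
    rw [e1, ← ofReal_integral_eq_lintegral_ofReal]
    · rw [← intervalIntegral.integral_of_le hR.le, integral_rpow (Or.inl (by linarith)),
        Real.zero_rpow (by linarith)]
      rw [sub_zero, neg_add_eq_sub]
    · exact (intervalIntegrable_iff_integrableOn_Ioc_of_le hR.le).1
        (intervalIntegral.intervalIntegrable_rpow' (by linarith))
    · exact (ae_restrict_iff' measurableSet_Ioc).2 (ae_of_all _ fun y hy =>
        Real.rpow_nonneg hy.1.le _)
  have h3 : ∫⁻ y in Set.Ico (-R) 0, sing γ y = ∫⁻ y in Set.Ioc 0 R, sing γ y := by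
    have := (Measure.measurePreserving_neg (volume : Measure ℝ)).setLIntegral_comp_preimage
      (s := Set.Ioc 0 R) measurableSet_Ioc (measurable_sing γ)
    rw [← this]
    congr 1
    · congr 1; ext y; simp
    · ext y; simp [sing]
  -- The origin is split off because `sing γ` is infinite there for `γ > 0`; a single point is a
  -- null set.
  have h4 : Set.Icc (-R) R ⊆ Set.Ico (-R) 0 ∪ ({0} ∪ Set.Ioc 0 R) := by
    intro y hy
    rcases lt_trichotomy y 0 with h | h | h
    · exact Or.inl ⟨hy.1, h⟩
    · exact Or.inr (Or.inl h)
    · exact Or.inr (Or.inr ⟨h, hy.2⟩)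
  calc _ ≤ ∫⁻ y in Set.Ico (-R) 0 ∪ ({0} ∪ Set.Ioc 0 R), sing γ y := lintegral_mono_set h4
    _ ≤ (∫⁻ y in Set.Ico (-R) 0, sing γ y) + ((∫⁻ y in {0}, sing γ y)
        + ∫⁻ y in Set.Ioc 0 R, sing γ y) :=
        (lintegral_union_le _ _ _).trans (by gcongr; exact lintegral_union_le _ _ _)
    _ = ENNReal.ofReal (2 * R ^ (1 - γ) / (1 - γ)) := by
        rw [h3, h2, setLIntegral_measure_zero _ _ (by simp), zero_add, ← ENNReal.ofReal_add]
        · congr 1; ring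
        all_goals exact div_nonneg (Real.rpow_nonneg hR.le _) (by linarith)

/-- For `|y| ≤ 1` the decaying factor is at most one and the singularity is integrable; for `|y| >
1` the singularity is at most one and the decay is integrable. Uniformity in `γ` holds because `2 /
(1 - γ) ≤ 12` for `γ ≤ 5 / 6`. The value `5 / 6` is `5 / (2 * d)` at `d = 3`, the exponent in the
dispersive estimate. -/
lemma exists_lintegral_decay_sing_le {r : ℝ} (hr : 1 / 2 < r) :
    ∃ K : ℝ, 1 ≤ K ∧ ∀ γ c : ℝ, 0 ≤ γ → γ ≤ 5 / 6 →
      ∫⁻ y, ENNReal.ofReal ((1 + (y - c) ^ 2) ^ (-r)) * sing γ y ≤ ENNReal.ofReal K := by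
  have hint : Integrable (fun y : ℝ => (1 + ‖y‖ ^ 2) ^ (-(2 * r) / 2)) :=
    integrable_rpow_neg_one_add_norm_sq (by simp; linarith)
  have hint' : Integrable (fun y : ℝ => (1 + y ^ 2) ^ (-r)) := by
    convert! hint using 3 with y
    · simp
    · ring
  set I := ∫ y : ℝ, (1 + y ^ 2) ^ (-r)
  have hI : 0 ≤ I := integral_nonneg fun y => Real.rpow_nonneg (by positivity) _
  refine ⟨12 + I, by linarith, fun γ c h0 h1 => ?_⟩
  have hpt : ∀ y, ENNReal.ofReal ((1 + (y - c) ^ 2) ^ (-r)) * sing γ y ≤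
      (Set.Icc (-1 : ℝ) 1).indicator (sing γ) y + ENNReal.ofReal ((1 + (y - c) ^ 2) ^ (-r)) := by
    intro y
    by_cases hy : y ∈ Set.Icc (-1 : ℝ) 1
    · rw [Set.indicator_of_mem hy]
      refine le_trans ?_ le_self_add
      refine mul_le_of_le_one_left' ?_
      rw [← ENNReal.ofReal_one]
      refine ENNReal.ofReal_le_ofReal (Real.rpow_le_one_of_one_le_of_nonpos ?_ (by linarith))
      nlinarith [sq_nonneg (y - c)]
    · rw [Set.indicator_of_notMem hy, zero_add]
      refine mul_le_of_le_one_right' ?_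
      have : (1 : ℝ≥0∞) ≤ ‖y‖ₑ := by
        rw [← ofReal_norm, ← ENNReal.ofReal_one]
        refine ENNReal.ofReal_le_ofReal ?_
        rw [Real.norm_eq_abs]
        by_contra h
        push Not at h
        exact hy ⟨(abs_le.1 h.le).1, (abs_le.1 h.le).2⟩
      rw [sing, ENNReal.rpow_neg]
      rcases h0.eq_or_lt with h | h
      · simp [← h]
      · exact ENNReal.inv_le_one.2 (ENNReal.one_le_rpow this h)
  calc _ ≤ ∫⁻ y, ((Set.Icc (-1 : ℝ) 1).indicator (sing γ) y
          + ENNReal.ofReal ((1 + (y - c) ^ 2) ^ (-r))) := lintegral_mono hpt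
    _ = (∫⁻ y in Set.Icc (-1 : ℝ) 1, sing γ y)
          + ∫⁻ y : ℝ, ENNReal.ofReal ((1 + (y - c) ^ 2) ^ (-r)) := by
        rw [lintegral_add_left ((measurable_sing γ).indicator measurableSet_Icc),
          lintegral_indicator measurableSet_Icc]
    _ ≤ ENNReal.ofReal 12 + ENNReal.ofReal I := by
        gcongr
        · refine (setLIntegral_sing_le (by linarith) one_pos).trans
            (ENNReal.ofReal_le_ofReal ?_)
          rw [Real.one_rpow, div_le_iff₀ (by linarith)]
          linarith
        · rw [lintegral_sub_right_eq_self (fun y : ℝ => ENNReal.ofReal ((1 + y ^ 2) ^ (-r))) c,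
            ← ofReal_integral_eq_lintegral_ofReal hint'
              (ae_of_all _ fun y => Real.rpow_nonneg (by positivity) _)]
    _ = _ := (ENNReal.ofReal_add (by norm_num) hI).symm

/-- Weighted integrals of product singularities in an orthonormal frame. -/
lemma exists_lintegral_wt_sing_le (d : ℕ) (hd : 0 < d) :
    ∃ K : ℝ, 1 ≤ K ∧ ∀ (b : OrthonormalBasis (Fin d) ℝ (Momentum d)) (γ : Fin d → ℝ)
      (v : Momentum d), (∀ i, 0 ≤ γ i ∧ γ i ≤ 5 / 6) →
      ∫⁻ x, ENNReal.ofReal (wt (x - v)) * ∏ i, sing (γ i) (b.repr x i) ≤ ENNReal.ofReal K := by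
  have hd' : (0 : ℝ) < d := by exact_mod_cast hd
  obtain ⟨K, hK1, hK⟩ := exists_lintegral_decay_sing_le (r := (d + 1 : ℝ) / (2 * d)) (by
    rw [lt_div_iff₀ (by positivity)]; linarith)
  refine ⟨K ^ d, one_le_pow₀ hK1, fun b γ v hγ => ?_⟩
  set r := (d + 1 : ℝ) / (2 * d)
  calc _ ≤ ∫⁻ x, ∏ i, (ENNReal.ofReal ((1 + (b.repr x i - b.repr v i) ^ 2) ^ (-r)) *
          sing (γ i) (b.repr x i)) := by
        refine lintegral_mono fun x => ?_
        rw [Finset.prod_mul_distrib]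
        gcongr
        rw [← ENNReal.ofReal_prod_of_nonneg (fun i _ => Real.rpow_nonneg (by positivity) _),
          ← wt_repr b, map_sub]
        exact ENNReal.ofReal_le_ofReal (wt_le_prod hd _)
    _ = ∏ i, ∫⁻ y, ENNReal.ofReal ((1 + (y - b.repr v i) ^ 2) ^ (-r)) * sing (γ i) y :=
        lintegral_prod_repr b (fun i y => ENNReal.ofReal ((1 + (y - b.repr v i) ^ 2) ^ (-r)) *
          sing (γ i) y) fun i => by
            refine Measurable.mul ?_ (measurable_sing _)
            fun_prop
    _ ≤ ∏ _i : Fin d, ENNReal.ofReal K :=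
        Finset.prod_le_prod' fun i _ => hK _ _ (hγ i).1 (hγ i).2
    _ = ENNReal.ofReal (K ^ d) := by
        rw [Finset.prod_const, Finset.card_univ, Fintype.card_fin,
          ENNReal.ofReal_pow (by linarith)]

lemma lintegral_wt_le (d : ℕ) (hd : 0 < d) :
    ∃ K : ℝ, 1 ≤ K ∧ ∀ v : Momentum d,
      ∫⁻ x, ENNReal.ofReal (wt (x - v)) ≤ ENNReal.ofReal K := by
  obtain ⟨K, hK1, hK⟩ := exists_lintegral_wt_sing_le d hd
  refine ⟨K, hK1, fun v => ?_⟩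
  refine le_trans (le_of_eq ?_) (hK (EuclideanSpace.basisFun _ ℝ) (fun _ => 0) v (by norm_num))
  simp [sing]

lemma integrable_wt {d : ℕ} (hd : 0 < d) : Integrable (wt (d := d)) := by
  obtain ⟨K, -, hK⟩ := lintegral_wt_le d hd
  refine ⟨continuous_wt.aestronglyMeasurable, ?_⟩
  have h := hK 0
  simp only [sub_zero] at h
  refine lt_of_le_of_lt (le_of_eq ?_) (h.trans_lt ENNReal.ofReal_lt_top)
  exact lintegral_congr fun x => Real.enorm_eq_ofReal (wt_pos x).le

/-! ### Truncated inverses and the layer cake -/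

/-- The truncated inverse `1 / max(|y|, η)`. -/
noncomputable def cut (η y : ℝ) : ℝ := (max |y| η)⁻¹

lemma cut_pos {η : ℝ} (hη : 0 < η) (y : ℝ) : 0 < cut η y :=
  inv_pos.2 (hη.trans_le (le_max_right _ _))

lemma cut_le {η : ℝ} (hη : 0 < η) (y : ℝ) : cut η y ≤ η⁻¹ := inv_anti₀ hη (le_max_right _ _)

lemma measurable_cut (η : ℝ) : Measurable (cut η) := by unfold cut; fun_prop

lemma lintegral_inv_sq {a ρ : ℝ} (ha : 0 < a) (h : a ≤ ρ) :
    ∫⁻ δ in Set.Ioc a ρ, ENNReal.ofReal (δ ^ (-2 : ℤ)) = ENNReal.ofReal (a⁻¹ - ρ⁻¹) := by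
  have h0 : (0 : ℝ) ∉ Set.uIcc a ρ := by rw [Set.uIcc_of_le h]; simp [ha]
  rw [← ofReal_integral_eq_lintegral_ofReal, ← intervalIntegral.integral_of_le h,
    integral_zpow (Or.inr ⟨by norm_num, h0⟩)]
  · congr 1
    norm_num
    ring
  · exact (intervalIntegrable_iff_integrableOn_Ioc_of_le h).1
      (intervalIntegral.intervalIntegrable_zpow (Or.inr h0))
  · exact ae_of_all _ fun y => (even_two.neg).zpow_nonneg y

/-- Layer cake from the identity 1/a = 1/ρ + ∫_a^ρ δ⁻² dδ with `a = max |y| η`. -/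
lemma ofReal_cut_le {η ρ : ℝ} (hη : 0 < η) (hρ : 0 < ρ) (y : ℝ) :
    ENNReal.ofReal (cut η y) ≤ ENNReal.ofReal ρ⁻¹ +
      ∫⁻ δ in Set.Ioc η ρ, ENNReal.ofReal (δ ^ (-2 : ℤ)) * (if |y| ≤ δ then 1 else 0) := by
  have ha : 0 < max |y| η := hη.trans_le (le_max_right _ _)
  rcases le_or_gt ρ (max |y| η) with h | h
  · exact le_add_right (ENNReal.ofReal_le_ofReal (inv_anti₀ hρ h))
  · have h1 : ∫⁻ δ in Set.Ioc (max |y| η) ρ, ENNReal.ofReal (δ ^ (-2 : ℤ)) ≤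
        ∫⁻ δ in Set.Ioc η ρ, ENNReal.ofReal (δ ^ (-2 : ℤ)) * (if |y| ≤ δ then 1 else 0) := by
      refine le_trans (le_of_eq ?_)
        (lintegral_mono_set (Set.Ioc_subset_Ioc_left (le_max_right |y| η)))
      refine setLIntegral_congr_fun measurableSet_Ioc fun δ hδ => ?_
      rw [if_pos ((le_max_left _ _).trans hδ.1.le), mul_one]
    refine le_trans ?_ (add_le_add_right h1 _)
    rw [lintegral_inv_sq ha h.le, ← ENNReal.ofReal_add (by positivity)
      (sub_nonneg.2 (inv_anti₀ ha h.le))]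
    exact ENNReal.ofReal_le_ofReal (by rw [cut]; linarith)

/-- The logarithmic factor of the layer cake estimate. -/
noncomputable def cakeLog (η ρ : ℝ) : ℝ := ρ⁻¹ + max 0 (Real.log (ρ / η))

lemma cakeLog_nonneg {η ρ : ℝ} (hρ : 0 < ρ) : 0 ≤ cakeLog η ρ :=
  add_nonneg (by positivity) (le_max_left _ _)

lemma one_le_logStar (t : ℝ) : 1 ≤ logStar t := le_max_left _ _

lemma logStar_pos (t : ℝ) : 0 < logStar t := zero_lt_one.trans_le (one_le_logStar t)

lemma cakeLog_le {t ρ : ℝ} (ht : 0 < t) (hρ : 0 < ρ) :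
    cakeLog t⁻¹ ρ ≤ (ρ⁻¹ + |Real.log ρ| + 1) * logStar t := by
  have h1 := one_le_logStar t
  have h2 : Real.log t ≤ logStar t := le_max_right _ _
  have h3 := le_abs_self (Real.log ρ)
  have h4 : 0 < ρ⁻¹ := by positivity
  rw [cakeLog, div_inv_eq_mul, Real.log_mul hρ.ne' ht.ne']
  have h5 := abs_nonneg (Real.log ρ)
  have : max 0 (Real.log ρ + Real.log t) ≤ |Real.log ρ| + logStar t :=
    max_le (by linarith) (by linarith)
  nlinarith

/-- Layers of measure O(δ), integrated against δ⁻² over `(η, ρ]`, produce a logarithm. The measure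
is arbitrary so that it can absorb a weight, a restriction to another layer, or a further resolvent.
-/
lemma lintegral_cut_le {α : Type*} [MeasurableSpace α] (ν : Measure α) [SFinite ν] {g : α → ℝ}
    (hg : Measurable g) (K : ℝ≥0∞) {η ρ : ℝ} (hη : 0 < η) (hρ : 0 < ρ) (htot : ν Set.univ ≤ K)
    (hlay : ∀ δ, 0 < δ → δ ≤ ρ → ν {x | |g x| ≤ δ} ≤ K * ENNReal.ofReal δ) :
    ∫⁻ x, ENNReal.ofReal (cut η (g x)) ∂ν ≤ K * ENNReal.ofReal (cakeLog η ρ) := by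
  have hm : Measurable (fun p : α × ℝ =>
      ENNReal.ofReal (p.2 ^ (-2 : ℤ)) * (if |g p.1| ≤ p.2 then 1 else 0)) := by
    refine Measurable.mul (by fun_prop) (Measurable.ite ?_ measurable_const measurable_const)
    have h1 : Measurable fun p : α × ℝ => |g p.1| := by fun_prop
    exact measurableSet_le h1 measurable_snd
  have hI : ∫⁻ δ in Set.Ioc η ρ, ENNReal.ofReal (δ ^ (-1 : ℤ)) ≤
      ENNReal.ofReal (max 0 (Real.log (ρ / η))) := by
    rcases le_or_gt η ρ with h | h
    · have h0 : (0 : ℝ) ∉ Set.uIcc η ρ := by rw [Set.uIcc_of_le h]; simp [hη]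
      simp_rw [zpow_neg_one]
      rw [← ofReal_integral_eq_lintegral_ofReal, ← intervalIntegral.integral_of_le h,
        integral_inv h0]
      · exact ENNReal.ofReal_le_ofReal (le_max_right _ _)
      · exact (intervalIntegrable_iff_integrableOn_Ioc_of_le h).1
          (intervalIntegral.intervalIntegrable_inv (fun x hx => by
            rintro rfl; exact h0 hx) continuousOn_id)
      · refine (ae_restrict_iff' measurableSet_Ioc).2 (ae_of_all _ fun y hy => ?_)
        exact inv_nonneg.2 (hη.trans hy.1).le
    · simp [Set.Ioc_eq_empty (not_lt.2 h.le)]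
  calc ∫⁻ x, ENNReal.ofReal (cut η (g x)) ∂ν
      ≤ ∫⁻ x, (ENNReal.ofReal ρ⁻¹ + ∫⁻ δ in Set.Ioc η ρ,
          ENNReal.ofReal (δ ^ (-2 : ℤ)) * (if |g x| ≤ δ then 1 else 0)) ∂ν :=
        lintegral_mono fun x => ofReal_cut_le hη hρ _
    _ = ENNReal.ofReal ρ⁻¹ * ν Set.univ + ∫⁻ δ in Set.Ioc η ρ, ∫⁻ x,
          ENNReal.ofReal (δ ^ (-2 : ℤ)) * (if |g x| ≤ δ then 1 else 0) ∂ν := by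
        rw [lintegral_add_left measurable_const, lintegral_const,
          lintegral_lintegral_swap hm.aemeasurable]
    _ ≤ ENNReal.ofReal ρ⁻¹ * K + ∫⁻ δ in Set.Ioc η ρ, K * ENNReal.ofReal (δ ^ (-1 : ℤ)) := by
        refine add_le_add (by gcongr) (setLIntegral_mono' measurableSet_Ioc fun δ hδ => ?_)
        have hδ0 := hη.trans hδ.1
        have hs : MeasurableSet {x | |g x| ≤ δ} :=
          measurableSet_le (by fun_prop : Measurable fun x => |g x|) measurable_const
        have e1 : ∀ x, (if |g x| ≤ δ then (1 : ℝ≥0∞) else 0) =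
            {x | |g x| ≤ δ}.indicator 1 x := fun x => by simp [Set.indicator_apply]
        simp_rw [e1]
        rw [lintegral_const_mul _ (measurable_one.indicator hs), lintegral_indicator_one hs]
        calc _ ≤ ENNReal.ofReal (δ ^ (-2 : ℤ)) * (K * ENNReal.ofReal δ) := by
              gcongr; exact hlay δ hδ0 hδ.2
          _ = K * ENNReal.ofReal (δ ^ (-1 : ℤ)) := by
              rw [mul_left_comm, ← ENNReal.ofReal_mul (by positivity)]
              congr 2
              field_simp
    _ ≤ ENNReal.ofReal ρ⁻¹ * K + K * ENNReal.ofReal (max 0 (Real.log (ρ / η))) := by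
        rw [lintegral_const_mul _ (by fun_prop)]
        gcongr
    _ = K * ENNReal.ofReal (cakeLog η ρ) := by
        rw [cakeLog, ENNReal.ofReal_add (by positivity) (le_max_left _ _)]; ring

/-! ### Directional derivatives -/

/-- The `j`-th derivative of `f` in direction `v`. -/
noncomputable def dirDeriv {d : ℕ} (j : ℕ) (f : Momentum d → ℝ) (v x : Momentum d) : ℝ :=
  iteratedFDeriv ℝ j f x fun _ => v

lemma dirDeriv_zero {d : ℕ} (f : Momentum d → ℝ) (v x : Momentum d) : dirDeriv 0 f v x = f x := by
  simp [dirDeriv]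

lemma hasDerivAt_dirDeriv {d n j : ℕ} {f : Momentum d → ℝ}
    (hf : ContDiff ℝ ((n : ℕ) : WithTop ℕ∞) f) (hj : j < n) (v x : Momentum d) (s : ℝ) :
    HasDerivAt (fun s : ℝ => dirDeriv j f v (x + s • v)) (dirDeriv (j + 1) f v (x + s • v)) s := by
  have h1 : HasFDerivAt (iteratedFDeriv ℝ j f) (fderiv ℝ (iteratedFDeriv ℝ j f) (x + s • v))
      (x + s • v) :=
    (hf.differentiable_iteratedFDeriv (by exact_mod_cast hj) _).hasFDerivAt
  have h2 : HasDerivAt (fun s : ℝ => x + s • v) v s := by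
    simpa using ((hasDerivAt_id s).smul_const v).const_add x
  have h3 := h1.comp_hasDerivAt s h2
  have h4 := (ContinuousMultilinearMap.apply ℝ (fun _ : Fin j => Momentum d) ℝ
    (fun _ => v)).hasFDerivAt.comp_hasDerivAt s h3
  exact h4

lemma continuous_dirDeriv {d n j : ℕ} {f : Momentum d → ℝ}
    (hf : ContDiff ℝ ((n : ℕ) : WithTop ℕ∞) f) (hj : j ≤ n) (v : Momentum d) :
    Continuous (dirDeriv j f v) :=
  (ContinuousMultilinearMap.apply ℝ (fun _ : Fin j => Momentum d) ℝ (fun _ => v)).continuous.comp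
    (hf.continuous_iteratedFDeriv (by exact_mod_cast hj))

lemma abs_dirDeriv_le {d j : ℕ} (f : Momentum d → ℝ) (v x : Momentum d) :
    |dirDeriv j f v x| ≤ ‖iteratedFDeriv ℝ j f x‖ * ‖v‖ ^ j := by
  simpa [dirDeriv] using (iteratedFDeriv ℝ j f x).le_opNorm fun _ => v

/-! ### Even uniformly convex dispersion relations -/

/-- Even functions with second derivatives between two positive constants. -/
structure UniformlyConvex {d : ℕ} (a b : ℝ) (e : Momentum d → ℝ) : Prop where
  even : ∀ k, e (-k) = e k
  smooth : ContDiff ℝ ((2 : ℕ) : WithTop ℕ∞) e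
  hess_ge : ∀ x v, a * ‖v‖ ^ 2 ≤ dirDeriv 2 e v x
  hess_le : ∀ x v, dirDeriv 2 e v x ≤ b * ‖v‖ ^ 2

/-- Convexity makes `φ'` monotone; as it vanishes at zero, it is nonnegative on the half line. -/
lemma radial_aux {φ φ' φ'' : ℝ → ℝ} (h1 : ∀ s, HasDerivAt φ (φ' s) s)
    (h2 : ∀ s, HasDerivAt φ' (φ'' s) s) (h0 : φ' 0 = 0) (h : ∀ s, 0 ≤ φ'' s) {s s' : ℝ}
    (hs : 0 ≤ s') (hss : s' ≤ s) : φ s' ≤ φ s := by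
  have hmono : Monotone φ' := monotone_of_hasDerivAt_nonneg h2 h
  refine monotoneOn_of_deriv_nonneg (convex_Ici 0)
    (fun s _ => (h1 s).continuousAt.continuousWithinAt)
    (fun s _ => (h1 s).differentiableAt.differentiableWithinAt) (fun s hs => ?_) hs
    (hs.trans hss) hss
  rw [interior_Ici] at hs
  rw [(h1 s).deriv, ← h0]
  exact hmono hs.le

lemma hasDerivAt_sq_mul (c y s : ℝ) :
    HasDerivAt (fun s : ℝ => c / 2 * s ^ 2 * y) (c * s * y) s := by
  have h := ((hasDerivAt_pow 2 s).const_mul (c / 2)).mul_const y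
  have e : c / 2 * (((2 : ℕ) : ℝ) * s ^ (2 - 1)) * y = c * s * y := by simp only [Nat.cast_ofNat, Nat.add_one_sub_one, pow_one]; ring
  rwa [e] at h

lemma hasDerivAt_lin_mul (c y s : ℝ) : HasDerivAt (fun s : ℝ => c * s * y) (c * y) s := by
  simpa using ((hasDerivAt_id s).const_mul c).mul_const y

namespace UniformlyConvex

variable {d : ℕ} {a b : ℝ} {e : Momentum d → ℝ}

lemma continuous (h : UniformlyConvex a b e) : Continuous e := h.smooth.continuous

lemma hasDerivAt_radial (h : UniformlyConvex a b e) (x : Momentum d) :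
    (∀ s : ℝ, HasDerivAt (fun s : ℝ => e (s • x)) (dirDeriv 1 e x (s • x)) s) ∧
    (∀ s : ℝ, HasDerivAt (fun s : ℝ => dirDeriv 1 e x (s • x)) (dirDeriv 2 e x (s • x)) s) ∧
    dirDeriv 1 e x ((0 : ℝ) • x) = 0 := by
  have h1 : ∀ s : ℝ, HasDerivAt (fun s : ℝ => e (s • x)) (dirDeriv 1 e x (s • x)) s := fun s => by
    simpa [dirDeriv_zero] using hasDerivAt_dirDeriv (j := 0) h.smooth (by norm_num) x 0 s
  refine ⟨h1, fun s => ?_, ?_⟩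
  · simpa using hasDerivAt_dirDeriv (j := 1) h.smooth (by norm_num) x 0 s
  -- The radial profile is even, so its derivative at zero equals its own negative.
  · have h2 := (h1 (-0)).comp (0 : ℝ) (hasDerivAt_neg (0 : ℝ))
    have h3 : (fun s : ℝ => e (s • x)) ∘ Neg.neg = fun s : ℝ => e (s • x) := by
      ext s; simp [h.even]
    rw [h3, neg_zero] at h2
    have := h2.unique (h1 0)
    linarith

/-- After subtraction of `a / 2 * s ^ 2 * ‖x‖ ^ 2` the radial profile is still convex and critical
at the origin. This quantitative radial growth is what makes dilations about the origin transversal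
to the level sets of `e`. -/
lemma le_radial (h : UniformlyConvex a b e) (x : Momentum d) {s s' : ℝ} (hs : 0 ≤ s')
    (hss : s' ≤ s) : a / 2 * (s ^ 2 - s' ^ 2) * ‖x‖ ^ 2 ≤ e (s • x) - e (s' • x) := by
  obtain ⟨h1, h2, h3⟩ := h.hasDerivAt_radial x
  have := radial_aux (φ := fun s => e (s • x) - a / 2 * s ^ 2 * ‖x‖ ^ 2)
    (φ' := fun s => dirDeriv 1 e x (s • x) - a * s * ‖x‖ ^ 2)
    (φ'' := fun s => dirDeriv 2 e x (s • x) - a * ‖x‖ ^ 2)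
    (fun s => (h1 s).sub (hasDerivAt_sq_mul a _ s)) (fun s => (h2 s).sub (hasDerivAt_lin_mul a _ s))
    (by simpa using h3) (fun s => by linarith [h.hess_ge (s • x) x]) hs hss
  linarith

lemma radial_le (h : UniformlyConvex a b e) (x : Momentum d) {s s' : ℝ} (hs : 0 ≤ s')
    (hss : s' ≤ s) : e (s • x) - e (s' • x) ≤ b / 2 * (s ^ 2 - s' ^ 2) * ‖x‖ ^ 2 := by
  obtain ⟨h1, h2, h3⟩ := h.hasDerivAt_radial x
  have := radial_aux (φ := fun s => b / 2 * s ^ 2 * ‖x‖ ^ 2 - e (s • x))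
    (φ' := fun s => b * s * ‖x‖ ^ 2 - dirDeriv 1 e x (s • x))
    (φ'' := fun s => b * ‖x‖ ^ 2 - dirDeriv 2 e x (s • x))
    (fun s => (hasDerivAt_sq_mul b _ s).sub (h1 s)) (fun s => (hasDerivAt_lin_mul b _ s).sub (h2 s))
    (by simpa using h3) (fun s => by linarith [h.hess_le (s • x) x]) hs hss
  linarith

lemma quadratic_le (h : UniformlyConvex a b e) (x : Momentum d) : a / 2 * ‖x‖ ^ 2 ≤ e x - e 0 := by
  simpa using h.le_radial x le_rfl zero_le_one

lemma le_quadratic (h : UniformlyConvex a b e) (x : Momentum d) : e x - e 0 ≤ b / 2 * ‖x‖ ^ 2 := by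
  simpa using h.radial_le x le_rfl zero_le_one

end UniformlyConvex

/-! ### Layers around level sets -/

/-- A weight with product singularities on coordinate hyperplanes of an orthonormal frame. -/
noncomputable def frameWeight {d : ℕ} (b : OrthonormalBasis (Fin d) ℝ (Momentum d)) (γ : Fin d → ℝ)
    (v x : Momentum d) : ℝ≥0∞ :=
  ENNReal.ofReal (wt (x - v)) * ∏ i, sing (γ i) (b.repr x i)

/-- The exponents of the admissible singularities. -/
def Admissible {d : ℕ} (γ : Fin d → ℝ) : Prop :=
  (∀ i, 0 ≤ γ i ∧ γ i ≤ 1 / 2) ∧ ∑ i, γ i ≤ d - 2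

lemma measurable_frameWeight {d : ℕ} (b : OrthonormalBasis (Fin d) ℝ (Momentum d)) (γ : Fin d → ℝ)
    (v : Momentum d) : Measurable (frameWeight b γ v) := by
  refine Measurable.mul (measurable_wt.comp (by fun_prop)).ennreal_ofReal
    (Finset.measurable_prod _ fun i _ => (measurable_sing _).comp ?_)
  have : Continuous fun x => b.repr x := b.repr.continuous
  fun_prop

lemma abs_repr_le {d : ℕ} (b : OrthonormalBasis (Fin d) ℝ (Momentum d)) (x : Momentum d)
    (i : Fin d) : |b.repr x i| ≤ ‖x‖ := by
  rw [← norm_repr b x]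
  exact PiLp.norm_apply_le (b.repr x) i

/-- In a ball of radius `R < 1` the weight is dropped and the one-dimensional singularities
integrate to a multiple of `R ^ (d - ∑ i, γ i)`; admissibility says that this is at most `R ^ 2`. -/
lemma exists_lintegral_frameWeight_le (d : ℕ) (hd : 0 < d) :
    ∃ K : ℝ, 1 ≤ K ∧ ∀ (b : OrthonormalBasis (Fin d) ℝ (Momentum d)) (γ : Fin d → ℝ)
      (v : Momentum d), Admissible γ →
      ∫⁻ x, frameWeight b γ v x ≤ ENNReal.ofReal K ∧
      ∀ R, 0 < R → ∫⁻ x in Metric.closedBall 0 R, frameWeight b γ v x ≤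
        ENNReal.ofReal (K * min 1 (R ^ 2)) := by
  obtain ⟨K, hK1, hK⟩ := exists_lintegral_wt_sing_le d hd
  have h4 : (1 : ℝ) ≤ 4 ^ d := one_le_pow₀ (by norm_num)
  refine ⟨K * 4 ^ d, by nlinarith, fun b γ v hγ => ?_⟩
  have htot : ∫⁻ x, frameWeight b γ v x ≤ ENNReal.ofReal (K * 4 ^ d) :=
    (hK b γ v fun i => ⟨(hγ.1 i).1, (hγ.1 i).2.trans (by norm_num)⟩).trans
      (ENNReal.ofReal_le_ofReal (by nlinarith))
  refine ⟨htot, fun R hR => ?_⟩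
  rcases le_or_gt 1 R with h1 | h1
  · rw [min_eq_left (by nlinarith), mul_one]
    exact (setLIntegral_le_lintegral _ _).trans htot
  · have hpt : ∀ x, (Metric.closedBall 0 R).indicator (frameWeight b γ v) x ≤
        ∏ i, (Set.Icc (-R) R).indicator (sing (γ i)) (b.repr x i) := by
      intro x
      by_cases hx : x ∈ Metric.closedBall 0 R
      · rw [Set.indicator_of_mem hx, frameWeight]
        have : ∀ i, b.repr x i ∈ Set.Icc (-R) R := fun i =>
          abs_le.1 ((abs_repr_le b x i).trans (by simpa using hx))
        simp_rw [fun i => Set.indicator_of_mem (this i) (sing (γ i))]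
        exact mul_le_of_le_one_left' (ENNReal.ofReal_le_one.2 (wt_le_one _))
      · rw [Set.indicator_of_notMem hx]; exact zero_le
    calc _ = ∫⁻ x, (Metric.closedBall 0 R).indicator (frameWeight b γ v) x :=
          (lintegral_indicator Metric.isClosed_closedBall.measurableSet _).symm
      _ ≤ ∫⁻ x, ∏ i, (Set.Icc (-R) R).indicator (sing (γ i)) (b.repr x i) := lintegral_mono hpt
      _ = ∏ i, ∫⁻ y, (Set.Icc (-R) R).indicator (sing (γ i)) y :=
          lintegral_prod_repr b (fun i => (Set.Icc (-R) R).indicator (sing (γ i)))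
            fun i => (measurable_sing _).indicator measurableSet_Icc
      _ ≤ ∏ i, ENNReal.ofReal (4 * R ^ (1 - γ i)) := by
          refine Finset.prod_le_prod' fun i _ => ?_
          have hi := hγ.1 i
          rw [lintegral_indicator measurableSet_Icc]
          refine (setLIntegral_sing_le (by linarith) hR).trans (ENNReal.ofReal_le_ofReal ?_)
          rw [div_le_iff₀ (by linarith)]
          have := Real.rpow_pos_of_pos hR (1 - γ i)
          nlinarith
      _ = ENNReal.ofReal (4 ^ d * R ^ (d - ∑ i, γ i)) := by
          rw [← ENNReal.ofReal_prod_of_nonneg (fun i _ => by positivity), Finset.prod_mul_distrib,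
            ← Real.rpow_sum_of_pos hR]
          simp
      _ ≤ _ := by
          refine ENNReal.ofReal_le_ofReal ?_
          have h2 : R ^ (d - ∑ i, γ i) ≤ R ^ (2 : ℝ) :=
            Real.rpow_le_rpow_of_exponent_ge hR h1.le (by linarith [hγ.2])
          rw [Real.rpow_two] at h2
          rw [min_eq_right (by nlinarith)]
          have : 0 ≤ R ^ 2 := by positivity
          calc _ ≤ 4 ^ d * R ^ 2 := by gcongr
            _ ≤ K * 4 ^ d * R ^ 2 := by
              have : 0 ≤ 4 ^ d * R ^ 2 := by positivity
              nlinarith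

lemma lintegral_eq_dilation {d : ℕ} {l : ℝ} (hl : 0 < l) {f : Momentum d → ℝ≥0∞}
    (hf : Measurable f) : ∫⁻ x, f x = ENNReal.ofReal (l ^ d) * ∫⁻ x, f (l • x) := by
  have h := Measure.map_addHaar_smul (volume : Measure (Momentum d)) hl.ne'
  rw [← lintegral_map (g := fun x => l • x) hf (measurable_const_smul l), h,
    lintegral_smul_measure, smul_eq_mul, ← mul_assoc, finrank_euclideanSpace, Fintype.card_fin,
    abs_of_pos (by positivity), ← ENNReal.ofReal_mul (by positivity), mul_inv_cancel₀ (by positivity),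
    ENNReal.ofReal_one, one_mul]

lemma sing_smul_le {γ l y : ℝ} (hγ : 0 ≤ γ) (hl : 1 ≤ l) : sing γ (l * y) ≤ sing γ y := by
  unfold sing
  rw [ENNReal.rpow_neg, ENNReal.rpow_neg]
  refine ENNReal.inv_le_inv.2 (ENNReal.rpow_le_rpow ?_ hγ)
  rw [enorm_mul]
  refine le_mul_of_one_le_left' ?_
  rw [Real.enorm_eq_ofReal (by linarith), ← ENNReal.ofReal_one]
  exact ENNReal.ofReal_le_ofReal hl

/-- A dilation by `l ≥ 1` moves every coordinate away from the singular hyperplanes, and displaces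
`x` by at most `D`, which changes the weight only by a bounded factor. -/
lemma frameWeight_smul_le {d : ℕ} (b : OrthonormalBasis (Fin d) ℝ (Momentum d)) {γ : Fin d → ℝ}
    (hγ : ∀ i, 0 ≤ γ i) (v x : Momentum d) {l D : ℝ} (hl : 1 ≤ l) (h : (l - 1) * ‖x‖ ≤ D) :
    frameWeight b γ v (l • x) ≤
      ENNReal.ofReal ((2 * (1 + D)) ^ (d + 1)) * frameWeight b γ v x := by
  have hD : 0 ≤ D := le_trans (mul_nonneg (by linarith) (norm_nonneg x)) h
  unfold frameWeight
  rw [← mul_assoc, ← ENNReal.ofReal_mul (by positivity)]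
  refine mul_le_mul' (ENNReal.ofReal_le_ofReal (wt_le_mul (by positivity) ?_))
    (Finset.prod_le_prod' fun i _ => ?_)
  · have e1 : x - v = (l • x - v) - (l - 1) • x := by rw [sub_smul, one_smul]; abel
    have h1 := bracket_sub_le (l • x - v) ((l - 1) • x)
    have h2 : bracket ((l - 1) • x) ≤ 1 + D := by
      refine (bracket_le_one_add_norm _).trans ?_
      rw [norm_smul, Real.norm_of_nonneg (by linarith)]
      linarith
    rw [← e1] at h1
    have := bracket_pos (l • x - v)
    nlinarith
  · simpa using sing_smul_le (hγ i) hl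

/-- The three factors are the inverse length of the dilation interval, the length of the set of
dilations that hit the layer, and a weighted volume of a ball. For small `T` the ball compensates `1
/ T`; for large `T` the quotient `√T / T` is bounded. -/
lemma layer_arith {A B T δ : ℝ} (hA : 0 < A) (hB : 0 < B) (hT : 0 < T) (hδ : 0 ≤ δ) :
    2 * (1 + Real.sqrt T) * (5 * B * δ / (A * T)) * min 1 (3 / A * T) ≤
      10 * B / A * (2 + 6 / A) * δ := by
  have hsT := Real.sqrt_nonneg T
  have hTs := Real.sq_sqrt hT.le
  have h6 : 0 ≤ 6 / A := by positivity
  have h3 : (1 + Real.sqrt T) / T * min 1 (3 / A * T) ≤ 2 + 6 / A := by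
    rcases le_total T 1 with h4 | h4
    · have h5 : Real.sqrt T ≤ 1 := Real.sqrt_le_one.2 h4
      calc (1 + Real.sqrt T) / T * min 1 (3 / A * T) ≤ 2 / T * (3 / A * T) := by
            gcongr
            · linarith
            · exact min_le_right _ _
        _ = 6 / A := by field_simp; norm_num
        _ ≤ _ := by linarith
    · have h5 : 1 ≤ Real.sqrt T := Real.one_le_sqrt.2 h4
      calc (1 + Real.sqrt T) / T * min 1 (3 / A * T) ≤ 2 * 1 := by
            gcongr
            · rw [div_le_iff₀ hT]; nlinarith
            · exact min_le_left _ _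
        _ ≤ 2 + 6 / A := by linarith
  calc _ = 10 * B / A * ((1 + Real.sqrt T) / T * min 1 (3 / A * T)) * δ := by
        field_simp; norm_num; ring
    _ ≤ _ := by gcongr

set_option maxHeartbeats 800000 in
/-- Weighted volume of layers around level sets. -/
lemma exists_setLIntegral_layer_le (d : ℕ) (hd : 0 < d) {A B : ℝ} (hA : 0 < A) (hB : 0 < B) :
    ∃ K : ℝ, 1 ≤ K ∧ ∀ e : Momentum d → ℝ, UniformlyConvex A B e →
      ∀ (b : OrthonormalBasis (Fin d) ℝ (Momentum d)) (γ : Fin d → ℝ) (v : Momentum d),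
      Admissible γ → ∫⁻ x, frameWeight b γ v x ≤ ENNReal.ofReal K ∧
      ∀ θ δ, 0 < δ →
        ∫⁻ x in {x | |e x - θ| ≤ δ}, frameWeight b γ v x ≤ ENNReal.ofReal (K * δ) := by
  obtain ⟨K, hK1, hK⟩ := exists_lintegral_frameWeight_le d hd
  set D : ℝ := Real.sqrt (3 / A) with hDdef
  have hD : 0 ≤ D := Real.sqrt_nonneg _
  have hD2 : D ^ 2 = 3 / A := Real.sq_sqrt (by positivity)
  set M : ℝ := (2 * (1 + D)) ^ (d + 1) with hM
  set K₁ : ℝ := K * (6 / A) with hK1def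
  set K₂ : ℝ := 2 ^ d * M * K * (10 * B / A * (2 + 6 / A)) with hK2def
  have hK₁ : 0 < K₁ := by positivity
  have hK₂ : 0 < K₂ := by positivity
  refine ⟨K + K₁ + K₂, by linarith, fun e he b γ v hγ => ?_⟩
  refine ⟨(hK b γ v hγ).1.trans (ENNReal.ofReal_le_ofReal (by linarith)), fun θ δ hδ => ?_⟩
  have hec := he.continuous
  set T := θ - e 0 with hT
  set S := {x | |e x - θ| ≤ δ} with hS
  have hSm : MeasurableSet S :=
    measurableSet_le (by fun_prop : Measurable fun x => |e x - θ|) measurable_const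
  -- Near the minimum of `e` the layer lies in a ball of radius `√(6 * δ / A)`, whose weighted
  -- volume is already O(δ). Away from the minimum the layer is averaged over dilations.
  rcases le_or_gt T (2 * δ) with h | h
  · have hsub : S ⊆ Metric.closedBall 0 (Real.sqrt (6 * δ / A)) := by
      intro x hx
      have h1 := he.quadratic_le x
      have h2 := (abs_le.1 (show |e x - θ| ≤ δ from hx)).2
      rw [mem_closedBall_zero_iff]
      refine Real.le_sqrt_of_sq_le ?_
      rw [le_div_iff₀ hA]
      linarith
    refine (lintegral_mono_set hsub).trans
      (((hK b γ v hγ).2 _ (Real.sqrt_pos.2 (by positivity))).trans (ENNReal.ofReal_le_ofReal ?_))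
    rw [Real.sq_sqrt (by positivity)]
    calc K * min 1 (6 * δ / A) ≤ K * (6 * δ / A) := by gcongr; exact min_le_right _ _
      _ = K₁ * δ := by rw [hK1def]; ring
      _ ≤ _ := by gcongr; linarith
  · have hT0 : 0 < T := by linarith
    -- The dilation factor ranges over `[1, 1 + h₀]`. Points of the layer have norm at most `R = D *
    -- √T`, and this choice gives `h₀ * R ≤ D`, so the weights stay comparable.
    set h₀ : ℝ := (2 * (1 + Real.sqrt T))⁻¹ with hh
    have hsT := Real.sqrt_nonneg T
    have hh0 : 0 < h₀ := by positivity
    have hh1 : h₀ ≤ 1 / 2 := by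
      rw [hh, one_div]; exact inv_anti₀ (by norm_num) (by linarith)
    set R := D * Real.sqrt T with hR
    have hR0 : 0 < R := mul_pos (Real.sqrt_pos.2 (by positivity)) (Real.sqrt_pos.2 hT0)
    have hhR : h₀ * R ≤ D := by
      rw [hh, inv_mul_le_iff₀ (by positivity), hR]; nlinarith
    set W : ℝ := 5 * B * δ / (A * T) with hW
    have hW0 : 0 ≤ W := by positivity
    let Λ : Momentum d → Set ℝ := fun x => {l | l ∈ Set.Icc 1 (1 + h₀) ∧ l • x ∈ S}
    have key : ∀ l ∈ Set.Icc (1 : ℝ) (1 + h₀), ∫⁻ x in S, frameWeight b γ v x ≤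
        ENNReal.ofReal (2 ^ d * M) * ∫⁻ x, (Metric.closedBall 0 R).indicator
          (frameWeight b γ v) x * (S.indicator 1 (l • x)) := by
      intro l hl
      have hl0 : 0 < l := zero_lt_one.trans_le hl.1
      rw [← lintegral_indicator hSm, lintegral_eq_dilation hl0
        ((measurable_frameWeight b γ v).indicator hSm),
        ENNReal.ofReal_mul (by positivity), mul_assoc,
        ← lintegral_const_mul' (ENNReal.ofReal M)]
      · refine mul_le_mul' (ENNReal.ofReal_le_ofReal ?_) (lintegral_mono fun x => ?_)
        · exact pow_le_pow_left₀ hl0.le (by linarith [hl.2]) _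
        · by_cases hx : l • x ∈ S
          · have h1 := he.quadratic_le (l • x)
            have h2 := (abs_le.1 (show |e (l • x) - θ| ≤ δ from hx)).2
            have h3 : ‖l • x‖ ^ 2 ≤ R ^ 2 := by
              rw [hR, mul_pow, hD2, Real.sq_sqrt hT0.le, div_mul_eq_mul_div, le_div_iff₀ hA]
              linarith
            have h4 : ‖l • x‖ ≤ R := le_of_sq_le_sq h3 hR0.le
            have h5 : ‖x‖ ≤ ‖l • x‖ := by
              rw [norm_smul, Real.norm_of_nonneg hl0.le]
              exact le_mul_of_one_le_left (norm_nonneg x) hl.1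
            have h6 : x ∈ Metric.closedBall 0 R := by simpa using h5.trans h4
            rw [Set.indicator_of_mem hx, Set.indicator_of_mem hx, Set.indicator_of_mem h6,
              Pi.one_apply, mul_one]
            refine frameWeight_smul_le b (fun i => (hγ.1 i).1) v x hl.1 ?_
            calc (l - 1) * ‖x‖ ≤ h₀ * R := by
                  refine mul_le_mul (by linarith [hl.2]) (h5.trans h4) (norm_nonneg _) hh0.le
              _ ≤ D := hhR
          · rw [Set.indicator_of_notMem hx]; exact zero_le
      · exact ENNReal.ofReal_ne_top
    -- On the layer `e - e 0 ≥ T / 2`, which forces `‖x‖ ^ 2` to be at least of order `T / B`. Two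
    -- admissible factors `l' ≤ l` change `e` by at most `2 * δ` and, by radial growth, by at least
    -- `A * (l - l') * ‖x‖ ^ 2`.
    have hvol : ∀ x, volume (Λ x) ≤ ENNReal.ofReal W := by
      intro x
      refine (Real.volume_le_diam _).trans (Metric.ediam_le fun l hl l' hl' => ?_)
      rw [edist_dist, Real.dist_eq]
      refine ENNReal.ofReal_le_ofReal ?_
      wlog hll : l' ≤ l generalizing l l'
      · rw [abs_sub_comm]; exact this l' hl' l hl (le_of_not_ge hll)
      have h1 := he.le_radial x (zero_le_one.trans hl'.1.1) hll
      have h2 := abs_le.1 (show |e (l • x) - θ| ≤ δ from hl.2)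
      have h3 := abs_le.1 (show |e (l' • x) - θ| ≤ δ from hl'.2)
      have h4 := he.le_quadratic (l • x)
      rw [norm_smul, Real.norm_of_nonneg (zero_le_one.trans hl.1.1)] at h4
      have h5 : l ^ 2 ≤ 9 / 4 := by nlinarith [hl.1.1, hl.1.2]
      have h6 : 0 ≤ ‖x‖ ^ 2 := by positivity
      have h7 : T / 2 ≤ B / 2 * (9 / 4 * ‖x‖ ^ 2) := by
        have : B / 2 * (l * ‖x‖) ^ 2 ≤ B / 2 * (9 / 4 * ‖x‖ ^ 2) := by
          rw [mul_pow]; gcongr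
        linarith
      have h8 : A * (l - l') * ‖x‖ ^ 2 ≤ 2 * δ := by
        have : A * (l - l') * ‖x‖ ^ 2 ≤ A / 2 * (l ^ 2 - l' ^ 2) * ‖x‖ ^ 2 := by
          refine mul_le_mul_of_nonneg_right ?_ h6
          nlinarith [mul_nonneg (mul_nonneg hA.le (sub_nonneg.2 hll))
            (by linarith [hl.1.1, hl'.1.1] : 0 ≤ l + l' - 2)]
        linarith
      have h9 : 0 ≤ l - l' := sub_nonneg.2 hll
      rw [abs_of_nonneg h9, hW, le_div_iff₀ (by positivity)]
      have h10 : (l - l') * A * T ≤ (l - l') * A * (9 / 4 * B * ‖x‖ ^ 2) := by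
        gcongr; linarith
      nlinarith [mul_le_mul_of_nonneg_left h8 (by positivity : 0 ≤ 9 / 4 * B)]
    have hm : Measurable fun p : ℝ × Momentum d => (Metric.closedBall 0 R).indicator
          (frameWeight b γ v) p.2 * (S.indicator (1 : Momentum d → ℝ≥0∞) (p.1 • p.2)) := by
      refine Measurable.mul ?_ ?_
      · exact ((measurable_frameWeight b γ v).indicator
          Metric.isClosed_closedBall.measurableSet).comp measurable_snd
      · exact (measurable_one.indicator hSm).comp (by fun_prop)
    -- Averaging over the dilations puts the length `h₀` of the interval on the left; it is written
    -- on the right too and cancelled at the end.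
    have h2 : ENNReal.ofReal h₀ * ∫⁻ x in S, frameWeight b γ v x ≤
        ENNReal.ofReal h₀ * ENNReal.ofReal (K₂ * δ) := by
      calc ENNReal.ofReal h₀ * ∫⁻ x in S, frameWeight b γ v x
          = ∫⁻ _l in Set.Icc (1 : ℝ) (1 + h₀), ∫⁻ x in S, frameWeight b γ v x := by
            rw [setLIntegral_const, Real.volume_Icc, mul_comm]; congr 2; ring
        _ ≤ ∫⁻ l in Set.Icc (1 : ℝ) (1 + h₀), ENNReal.ofReal (2 ^ d * M) * ∫⁻ x,
              (Metric.closedBall 0 R).indicator (frameWeight b γ v) x *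
              (S.indicator 1 (l • x)) := setLIntegral_mono' measurableSet_Icc key
        _ = ENNReal.ofReal (2 ^ d * M) * ∫⁻ x, ∫⁻ l in Set.Icc (1 : ℝ) (1 + h₀),
              (Metric.closedBall 0 R).indicator (frameWeight b γ v) x *
              (S.indicator 1 (l • x)) := by
            rw [lintegral_const_mul' _ _ ENNReal.ofReal_ne_top,
              lintegral_lintegral_swap hm.aemeasurable]
        _ ≤ ENNReal.ofReal (2 ^ d * M) * ∫⁻ x, ENNReal.ofReal W *
              (Metric.closedBall 0 R).indicator (frameWeight b γ v) x := by
            refine mul_le_mul_right (lintegral_mono fun x => ?_) _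
            have hΛ : MeasurableSet {l : ℝ | l • x ∈ S} :=
              hSm.preimage (by fun_prop : Measurable fun l : ℝ => l • x)
            have e1 : ∀ l : ℝ, S.indicator (1 : Momentum d → ℝ≥0∞) (l • x) =
                {l : ℝ | l • x ∈ S}.indicator 1 l := fun l => by
              simp [Set.indicator_apply]
            simp_rw [e1]
            rw [lintegral_const_mul _ (measurable_one.indicator hΛ), lintegral_indicator_one hΛ,
              Measure.restrict_apply hΛ, mul_comm]
            refine mul_le_mul_left (le_trans (measure_mono fun l hl => ?_) (hvol x)) _
            exact ⟨hl.2, hl.1⟩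
        _ ≤ ENNReal.ofReal (2 ^ d * M) * (ENNReal.ofReal W *
              ENNReal.ofReal (K * min 1 (R ^ 2))) := by
            rw [lintegral_const_mul' _ _ ENNReal.ofReal_ne_top,
              lintegral_indicator Metric.isClosed_closedBall.measurableSet]
            gcongr
            exact (hK b γ v hγ).2 R hR0
        _ ≤ ENNReal.ofReal h₀ * ENNReal.ofReal (K₂ * δ) := by
            rw [← ENNReal.ofReal_mul hW0, ← ENNReal.ofReal_mul (by positivity),
              ← ENNReal.ofReal_mul hh0.le]
            refine ENNReal.ofReal_le_ofReal ?_
            rw [hh, le_inv_mul_iff₀ (by positivity), hR, mul_pow, hD2, Real.sq_sqrt hT0.le]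
            have h3 := layer_arith hA hB hT0 hδ.le
            have h4 : 0 ≤ 2 ^ d * M * K := by positivity
            calc _ = 2 ^ d * M * K * (2 * (1 + Real.sqrt T) * W * min 1 (3 / A * T)) := by ring
              _ ≤ 2 ^ d * M * K * (10 * B / A * (2 + 6 / A) * δ) :=
                mul_le_mul_of_nonneg_left h3 h4
              _ = K₂ * δ := by rw [hK2def]; ring
    rw [ENNReal.mul_le_mul_iff_right (ENNReal.ofReal_pos.2 hh0).ne' ENNReal.ofReal_ne_top] at h2
    exact h2.trans (ENNReal.ofReal_le_ofReal (by gcongr; linarith))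

/-! ### Resolvent integrals -/

lemma exists_frame {d : ℕ} (hd : 0 < d) (w : Momentum d) :
    ∃ b : OrthonormalBasis (Fin d) ℝ (Momentum d), ∀ i, i ≠ ⟨0, hd⟩ → b.repr w i = 0 := by
  rcases eq_or_ne w 0 with rfl | hw
  · exact ⟨EuclideanSpace.basisFun _ ℝ, fun i _ => by simp⟩
  have ho : Orthonormal ℝ (Set.domRestrict {(⟨0, hd⟩ : Fin d)} fun _ => ‖w‖⁻¹ • w) := by
    refine ⟨fun i => ?_, fun i j hij => absurd (Subsingleton.elim i j) hij⟩
    change ‖‖w‖⁻¹ • w‖ = 1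
    rw [norm_smul, norm_inv, norm_norm, inv_mul_cancel₀ (norm_ne_zero_iff.2 hw)]
  obtain ⟨b, hb⟩ := ho.exists_orthonormalBasis_extension_of_card_eq (by simp)
  refine ⟨b, fun i hi => ?_⟩
  have h0 : w = ‖w‖ • b ⟨0, hd⟩ := by
    rw [hb _ rfl, smul_smul, mul_inv_cancel₀ (norm_ne_zero_iff.2 hw), one_smul]
  rw [b.repr_apply_apply, h0, inner_smul_right, b.orthonormal.2 hi, mul_zero]

/-- The exponents used to dominate `|x - w|⁻¹`. -/
noncomputable def pairExponent (d : ℕ) (i : Fin d) : ℝ :=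
  if (i : ℕ) = 1 ∨ (i : ℕ) = 2 then 1 / 2 else 0

lemma admissible_zero {d : ℕ} (hd : 3 ≤ d) : Admissible (fun _ : Fin d => (0 : ℝ)) := by
  have : (3 : ℝ) ≤ d := by exact_mod_cast hd
  exact ⟨fun _ => by norm_num, by simp; linarith⟩

lemma admissible_pairExponent {d : ℕ} (hd : 3 ≤ d) : Admissible (pairExponent d) := by
  have h3 : (3 : ℝ) ≤ d := by exact_mod_cast hd
  refine ⟨fun i => by unfold pairExponent; split_ifs <;> norm_num, ?_⟩
  have : ∑ i : Fin d, pairExponent d i = 1 := by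
    rw [Finset.sum_eq_add (⟨1, by omega⟩ : Fin d) ⟨2, by omega⟩ (by simp)]
    · norm_num [pairExponent]
    · rintro ⟨i, hi⟩ - ⟨h1, h2⟩
      simp only [ne_eq, Fin.mk.injEq] at h1 h2
      simp [pairExponent, h1, h2]
    · simp
    · simp
  rw [this]; linarith

/-- In a frame whose first axis contains `w`, the other coordinates of `x` and `x - w` agree and are
at most `‖x - w‖`; two of them share the power one. A point singularity at `w`, which dilations
about the origin would not respect, is traded for singularities on hyperplanes through the origin.
The two additional axes exist because `3 ≤ d`. -/
lemma inv_norm_le_prod_sing {d : ℕ} (hd : 3 ≤ d) {w : Momentum d}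
    {b : OrthonormalBasis (Fin d) ℝ (Momentum d)}
    (hb : ∀ i, i ≠ ⟨0, by omega⟩ → b.repr w i = 0) (x : Momentum d) :
    ‖x - w‖ₑ⁻¹ ≤ ∏ i, sing (pairExponent d i) (b.repr x i) := by
  rw [Finset.prod_eq_mul (⟨1, by omega⟩ : Fin d) ⟨2, by omega⟩ (by simp)]
  · have key : ∀ i : Fin d, i ≠ ⟨0, by omega⟩ → (‖x - w‖ₑ ^ (1 / 2 : ℝ))⁻¹ ≤
        sing (1 / 2) (b.repr x i) := by
      intro i hi
      rw [sing, ENNReal.rpow_neg]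
      refine ENNReal.inv_le_inv.2 (ENNReal.rpow_le_rpow ?_ (by norm_num))
      have : b.repr x i = b.repr (x - w) i := by simp [hb i hi]
      rw [this, ← ofReal_norm, ← ofReal_norm]
      exact ENNReal.ofReal_le_ofReal (abs_repr_le b _ i)
    have e1 : ‖x - w‖ₑ = ‖x - w‖ₑ ^ (1 / 2 : ℝ) * ‖x - w‖ₑ ^ (1 / 2 : ℝ) := by
      rw [← ENNReal.rpow_add_of_nonneg _ _ (by norm_num) (by norm_num)]; norm_num
    have p1 : pairExponent d ⟨1, by omega⟩ = 1 / 2 := by simp [pairExponent]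
    have p2 : pairExponent d ⟨2, by omega⟩ = 1 / 2 := by simp [pairExponent]
    rw [p1, p2, e1]
    by_cases h0 : ‖x - w‖ₑ ^ (1 / 2 : ℝ) = 0
    · have h1 := key ⟨1, by omega⟩ (by simp)
      have h2 := key ⟨2, by omega⟩ (by simp)
      rw [h0, ENNReal.inv_zero, top_le_iff] at h1 h2
      rw [h1, h2]; simp
    · rw [ENNReal.mul_inv (Or.inl h0) (Or.inr h0)]
      exact mul_le_mul' (key _ (by simp)) (key _ (by simp))
  · rintro ⟨i, hi⟩ - ⟨h1, h2⟩
    simp only [ne_eq, Fin.mk.injEq] at h1 h2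
    simp [pairExponent, h1, h2, sing]
  · simp
  · simp

/-- The layer cake for the measure with density `frameWeight`, whose layers around level sets of `e`
have mass O(δ). -/
lemma exists_lintegral_frameWeight_cut_le (d : ℕ) (hd : 0 < d) {A B ρ : ℝ} (hA : 0 < A)
    (hB : 0 < B) (hρ : 0 < ρ) :
    ∃ K : ℝ, 1 ≤ K ∧ ∀ e : Momentum d → ℝ, UniformlyConvex A B e →
      ∀ (b : OrthonormalBasis (Fin d) ℝ (Momentum d)) (γ : Fin d → ℝ) (v : Momentum d),
      Admissible γ → ∀ θ η : ℝ, 0 < η →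
        ∫⁻ x, frameWeight b γ v x * ENNReal.ofReal (cut η (e x - θ)) ≤
          ENNReal.ofReal (K * cakeLog η ρ) := by
  obtain ⟨K, hK1, hK⟩ := exists_setLIntegral_layer_le d hd hA hB
  refine ⟨K, hK1, fun e he b γ v hγ θ η hη => ?_⟩
  have hec := he.continuous
  have hm := measurable_frameWeight b γ v
  have h1 := lintegral_cut_le (volume.withDensity (frameWeight b γ v)) (g := fun x => e x - θ)
    (by fun_prop) (ENNReal.ofReal K) hη hρ
    (by rw [withDensity_apply _ .univ, Measure.restrict_univ]; exact (hK e he b γ v hγ).1)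
    (fun δ hδ _ => by
      rw [withDensity_apply _
          (measurableSet_le (by fun_prop : Measurable fun x => |e x - θ|) measurable_const),
        ← ENNReal.ofReal_mul (by linarith)]
      exact (hK e he b γ v hγ).2 θ δ hδ)
  have hc : Measurable fun x => ENNReal.ofReal (cut η (e x - θ)) :=
    ((measurable_cut η).comp (by fun_prop)).ennreal_ofReal
  rw [lintegral_withDensity_eq_lintegral_mul _ hm hc, ← ENNReal.ofReal_mul (by linarith)] at h1
  exact h1

/-- Transversality of two layers. -/
def Transversal {d : ℕ} (κ ρ : ℝ) (e : Momentum d → ℝ) : Prop :=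
  ∀ (w q : Momentum d) (θ θ' δ δ' : ℝ), w ≠ 0 → 0 < δ → δ ≤ ρ → 0 < δ' → δ' ≤ ρ →
    volume ({x | |e x - θ| ≤ δ} ∩ {x | |e (x - w) - θ'| ≤ δ'} ∩ Metric.ball q ρ) ≤
      ENNReal.ofReal (κ * δ * δ' / ‖w‖)

/-- Local volume bounds imply weighted bounds. -/
lemma exists_setLIntegral_wt_le (d : ℕ) (hd : 0 < d) {ρ : ℝ} (hρ : 0 < ρ) :
    ∃ K : ℝ, 1 ≤ K ∧ ∀ (S : Set (Momentum d)) (c : ℝ≥0∞), MeasurableSet S →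
      (∀ q, volume (S ∩ Metric.ball q ρ) ≤ c) →
      ∀ v, ∫⁻ x in S, ENNReal.ofReal (wt (x - v)) ≤ ENNReal.ofReal K * c := by
  obtain ⟨K, hK1, hK⟩ := lintegral_wt_le d hd
  set M : ℝ := (2 * (1 + ρ)) ^ (d + 1) with hM
  set V := volume (Metric.ball (0 : Momentum d) ρ) with hV
  have hV0 : V ≠ 0 := (Metric.measure_ball_pos _ _ hρ).ne'
  have hVt : V ≠ ∞ := measure_ball_lt_top.ne
  have hVr : 0 < V.toReal := ENNReal.toReal_pos hV0 hVt
  refine ⟨1 + M * K / V.toReal, by have : 0 ≤ M * K / V.toReal := by positivity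
                                   linarith, fun S c hS hc v => ?_⟩
  -- The weight at `x` is compared with its values on the ball around `x`, where it varies by at
  -- most the factor `M`. After exchanging the integrals only the local volumes of `S` remain,
  -- summed against an integrable weight.
  have hpt : ∀ x, V * S.indicator (fun x => ENNReal.ofReal (wt (x - v))) x ≤
      ∫⁻ y, ENNReal.ofReal (M * wt (y - v)) * (S ∩ Metric.ball y ρ).indicator 1 x := by
    intro x
    by_cases hx : x ∈ S
    · rw [Set.indicator_of_mem hx]
      calc _ = ∫⁻ y in Metric.ball x ρ, ENNReal.ofReal (wt (x - v)) := by
            rw [setLIntegral_const, mul_comm, Measure.addHaar_ball_center]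
        _ ≤ ∫⁻ y in Metric.ball x ρ, ENNReal.ofReal (M * wt (y - v)) := by
            refine setLIntegral_mono' Metric.isOpen_ball.measurableSet fun y hy => ?_
            refine ENNReal.ofReal_le_ofReal (wt_le_mul (by positivity) ?_)
            have h1 := bracket_sub_le (x - v) (x - y)
            rw [sub_sub_sub_cancel_left] at h1
            have h2 := bracket_le_one_add_norm (x - y)
            rw [Metric.mem_ball, dist_comm, dist_eq_norm] at hy
            have := bracket_pos (x - v)
            nlinarith
        _ = _ := by
            rw [← lintegral_indicator Metric.isOpen_ball.measurableSet]
            refine lintegral_congr fun y => ?_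
            by_cases hy : y ∈ Metric.ball x ρ
            · have hy' : x ∈ S ∩ Metric.ball y ρ := ⟨hx, Metric.mem_ball_comm.1 hy⟩
              simp [Set.indicator_of_mem hy, Set.indicator_of_mem hy']
            · have hy' : x ∉ S ∩ Metric.ball y ρ := fun h => hy (Metric.mem_ball_comm.1 h.2)
              simp [Set.indicator_of_notMem hy, Set.indicator_of_notMem hy']
    · rw [Set.indicator_of_notMem hx]; simp
  have hmeas : Measurable fun p : Momentum d × Momentum d =>
      ENNReal.ofReal (M * wt (p.2 - v)) *
        (S ∩ Metric.ball p.2 ρ).indicator (1 : Momentum d → ℝ≥0∞) p.1 := by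
    refine Measurable.mul ?_ ?_
    · exact ((measurable_wt.comp (by fun_prop)).const_mul _).ennreal_ofReal
    · have hs : MeasurableSet {p : Momentum d × Momentum d | p.1 ∈ S ∧ dist p.1 p.2 < ρ} :=
        (hS.preimage measurable_fst).inter (measurableSet_lt measurable_dist measurable_const)
      exact (measurable_one.indicator hs : Measurable ({p : Momentum d × Momentum d |
        p.1 ∈ S ∧ dist p.1 p.2 < ρ}.indicator (1 : Momentum d × Momentum d → ℝ≥0∞)))
  have h1 : V * ∫⁻ x in S, ENNReal.ofReal (wt (x - v)) ≤ ENNReal.ofReal (M * K) * c := by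
    calc _ = ∫⁻ x, V * S.indicator (fun x => ENNReal.ofReal (wt (x - v))) x := by
          rw [lintegral_const_mul' _ _ hVt, lintegral_indicator hS]
      _ ≤ ∫⁻ x, ∫⁻ y, ENNReal.ofReal (M * wt (y - v)) *
            (S ∩ Metric.ball y ρ).indicator 1 x := lintegral_mono hpt
      _ = ∫⁻ y, ∫⁻ x, ENNReal.ofReal (M * wt (y - v)) *
            (S ∩ Metric.ball y ρ).indicator 1 x := lintegral_lintegral_swap hmeas.aemeasurable
      _ ≤ ∫⁻ y, ENNReal.ofReal (M * wt (y - v)) * c := by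
          refine lintegral_mono fun y => ?_
          have hs := hS.inter (Metric.isOpen_ball (x := y) (ε := ρ)).measurableSet
          rw [lintegral_const_mul _ (measurable_one.indicator hs), lintegral_indicator_one hs]
          gcongr
          exact hc y
      _ = ENNReal.ofReal M * (∫⁻ y, ENNReal.ofReal (wt (y - v))) * c := by
          simp_rw [ENNReal.ofReal_mul (by positivity : 0 ≤ M)]
          rw [lintegral_mul_const, lintegral_const_mul' _ _ ENNReal.ofReal_ne_top]
          exact (measurable_wt.comp (by fun_prop)).ennreal_ofReal.const_mul _
      _ ≤ _ := by
          rw [ENNReal.ofReal_mul (by positivity)]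
          gcongr
          exact hK v
  have h2 : ENNReal.ofReal (M * K) * c ≤ V * (ENNReal.ofReal (1 + M * K / V.toReal) * c) := by
    rw [← mul_assoc]
    gcongr
    rw [← ENNReal.ofReal_toReal hVt, ← ENNReal.ofReal_mul hVr.le]
    refine ENNReal.ofReal_le_ofReal ?_
    rw [ENNReal.toReal_ofReal hVr.le, mul_add, mul_div_cancel₀ _ hVr.ne']
    linarith
  exact (ENNReal.mul_le_mul_iff_right hV0 hVt).1 (h1.trans h2)

/-- The three resolvent bounds, with logarithmic growth in `t`. -/
lemma exists_resolvent_bounds (d : ℕ) (hd : 3 ≤ d) {A B κ ρ : ℝ} (hA : 0 < A) (hB : 0 < B)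
    (hρ : 0 < ρ) :
    ∃ K : ℝ, 1 ≤ K ∧ ∀ e : Momentum d → ℝ, UniformlyConvex A B e → Transversal κ ρ e →
      ∀ (v : Momentum d) (θ t : ℝ), 0 < t →
      (∫⁻ x, ENNReal.ofReal (wt (x - v)) * ENNReal.ofReal (cut t⁻¹ (e x - θ)) ≤
        ENNReal.ofReal (K * logStar t)) ∧
      (∀ w, ∫⁻ x, ENNReal.ofReal (wt (x - v)) * ENNReal.ofReal (cut t⁻¹ (e x - θ)) *
        (1 + ‖x - w‖ₑ⁻¹) ≤ ENNReal.ofReal (K * logStar t)) ∧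
      (∀ w θ', ∫⁻ x, ENNReal.ofReal (wt (x - v)) * ENNReal.ofReal (cut t⁻¹ (e x - θ)) *
        ENNReal.ofReal (cut t⁻¹ (e (x - w) - θ')) ≤
          ENNReal.ofReal (K * logStar t ^ 2) * (1 + ‖w‖ₑ⁻¹)) := by
  have hd0 : 0 < d := by omega
  obtain ⟨K₁, hK₁, hcut⟩ := exists_lintegral_frameWeight_cut_le d hd0 hA hB hρ
  obtain ⟨K₂, hK₂, hlay⟩ := exists_setLIntegral_layer_le d hd0 hA hB
  obtain ⟨K₃, hK₃, hloc⟩ := exists_setLIntegral_wt_le d hd0 hρ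
  set P : ℝ := ρ⁻¹ + |Real.log ρ| + 1 with hP
  have hP1 : 1 ≤ P := by
    have := abs_nonneg (Real.log ρ)
    have : 0 < ρ⁻¹ := by positivity
    linarith
  set K₄ : ℝ := K₂ + K₃ * |κ| with hK₄
  have hK₄0 : 0 ≤ K₄ := by positivity
  have hfw : ∀ (b : OrthonormalBasis (Fin d) ℝ (Momentum d)) v x,
      frameWeight b (fun _ => 0) v x = ENNReal.ofReal (wt (x - v)) := fun b v x => by
    simp [frameWeight, sing]
  refine ⟨2 * K₁ * P + K₄ * P ^ 2, ?_, fun e he htr v θ t ht => ?_⟩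
  · nlinarith [mul_nonneg hK₄0 (sq_nonneg P), mul_le_mul hK₁ hP1 zero_le_one (by linarith)]
  have hec := he.continuous
  have hL := logStar_pos t
  have hη : 0 < t⁻¹ := by positivity
  have hcl : cakeLog t⁻¹ ρ ≤ P * logStar t := cakeLog_le ht hρ
  have hcl0 := cakeLog_nonneg (η := t⁻¹) hρ
  have hL1 : ∀ v θ, ∫⁻ x, ENNReal.ofReal (wt (x - v)) * ENNReal.ofReal (cut t⁻¹ (e x - θ)) ≤
      ENNReal.ofReal (K₁ * P * logStar t) := fun v θ => by
    have := hcut e he (EuclideanSpace.basisFun _ ℝ) _ v (admissible_zero hd) θ _ hη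
    simp_rw [hfw] at this
    refine this.trans (ENNReal.ofReal_le_ofReal ?_)
    rw [mul_assoc]; gcongr
  have hwm : Measurable fun x : Momentum d => ENNReal.ofReal (wt (x - v)) :=
    (measurable_wt.comp (by fun_prop)).ennreal_ofReal
  have hcm : Measurable fun x : Momentum d => ENNReal.ofReal (cut t⁻¹ (e x - θ)) :=
    ((measurable_cut _).comp (by fun_prop)).ennreal_ofReal
  refine ⟨(hL1 v θ).trans (ENNReal.ofReal_le_ofReal ?_), fun w => ?_, fun w θ' => ?_⟩
  · gcongr
    nlinarith [mul_nonneg hK₄0 (sq_nonneg P), mul_le_mul hK₁ hP1 zero_le_one (by linarith)]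
  -- The frame is adapted to the singular point, so `‖x - w‖ₑ⁻¹` is dominated by an admissible
  -- product of singularities.
  · obtain ⟨b, hb⟩ := exists_frame hd0 w
    have h2 := hcut e he b _ v (admissible_pairExponent hd) θ _ hη
    calc _ ≤ ∫⁻ x, (ENNReal.ofReal (wt (x - v)) * ENNReal.ofReal (cut t⁻¹ (e x - θ)) +
            frameWeight b (pairExponent d) v x * ENNReal.ofReal (cut t⁻¹ (e x - θ))) := by
          refine lintegral_mono fun x => ?_
          rw [mul_add, mul_one, frameWeight, mul_right_comm _ (∏ i, _)]
          gcongr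
          exact inv_norm_le_prod_sing hd hb x
      _ = _ := lintegral_add_left (hwm.mul hcm) _
      _ ≤ ENNReal.ofReal (K₁ * P * logStar t) + ENNReal.ofReal (K₁ * (P * logStar t)) := by
          gcongr
          · exact hL1 v θ
          · exact h2.trans (ENNReal.ofReal_le_ofReal (by gcongr))
      _ ≤ _ := by
          rw [← ENNReal.ofReal_add (by positivity) (by positivity)]
          refine ENNReal.ofReal_le_ofReal ?_
          have : 0 ≤ K₄ * P ^ 2 * logStar t := by positivity
          nlinarith
  -- For `w = 0` there is no transversality, but the right-hand side is infinite.
  · rcases eq_or_ne w 0 with rfl | hw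
    · have : 0 < (2 * K₁ * P + K₄ * P ^ 2) * logStar t ^ 2 := by positivity
      simp [ENNReal.mul_top, (ENNReal.ofReal_pos.2 this).ne']
    set ν : Measure (Momentum d) := volume.withDensity fun x => ENNReal.ofReal (wt (x - v)) with hν
    set c : ℝ≥0∞ := ENNReal.ofReal K₄ * (1 + ‖w‖ₑ⁻¹) with hc
    have hK₂c : ENNReal.ofReal K₂ ≤ c := by
      calc ENNReal.ofReal K₂ ≤ ENNReal.ofReal K₄ * 1 := by
            rw [mul_one]
            exact ENNReal.ofReal_le_ofReal (by have : 0 ≤ K₃ * |κ| := by positivity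
                                               linarith)
        _ ≤ c := mul_le_mul_right le_self_add _
    have hS1 : ∀ δ, MeasurableSet {x | |e x - θ| ≤ δ} := fun δ =>
      measurableSet_le (by fun_prop : Measurable fun x => |e x - θ|) measurable_const
    have hS2 : ∀ δ, MeasurableSet {x | |e (x - w) - θ'| ≤ δ} := fun δ =>
      measurableSet_le (by fun_prop : Measurable fun x => |e (x - w) - θ'|) measurable_const
    -- Translation by `w` turns this into a layer of `e` itself, with the weight recentred; the
    -- layer bound is uniform in that centre.
    have hν2 : ∀ δ, 0 < δ → ν {x | |e (x - w) - θ'| ≤ δ} ≤ c * ENNReal.ofReal δ := by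
      intro δ hδ
      have h1 := (hlay e he (EuclideanSpace.basisFun _ ℝ) _ (v - w) (admissible_zero hd)).2 θ' δ hδ
      simp_rw [hfw] at h1
      calc _ = ∫⁻ x in {x | |e x - θ'| ≤ δ}, ENNReal.ofReal (wt (x - (v - w))) := by
            rw [hν, withDensity_apply _ (hS2 δ), ← lintegral_indicator (hS2 δ),
              ← lintegral_indicator (measurableSet_le
                (by fun_prop : Measurable fun x => |e x - θ'|) measurable_const),
              ← lintegral_sub_right_eq_self ({x | |e x - θ'| ≤ δ}.indicator _) w]
            refine lintegral_congr fun x => ?_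
            simp only [Set.indicator_apply, Set.mem_ofPred_eq, sub_sub_sub_cancel_right]
        _ ≤ _ := h1
        _ ≤ _ := by
            rw [ENNReal.ofReal_mul (by linarith)]; gcongr
    have hν1 : ν Set.univ ≤ c := by
      have h1 := (hlay e he (EuclideanSpace.basisFun _ ℝ) _ v (admissible_zero hd)).1
      simp_rw [hfw] at h1
      rw [hν, withDensity_apply _ .univ, Measure.restrict_univ]
      exact h1.trans hK₂c
    have hν1l : ∀ δ, 0 < δ → ν {x | |e x - θ| ≤ δ} ≤ c * ENNReal.ofReal δ := by
      intro δ hδ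
      have h1 := (hlay e he (EuclideanSpace.basisFun _ ℝ) _ v (admissible_zero hd)).2 θ δ hδ
      simp_rw [hfw] at h1
      rw [hν, withDensity_apply _ (hS1 δ)]
      refine h1.trans ?_
      rw [ENNReal.ofReal_mul (by linarith)]; gcongr
    have hν12 : ∀ δ δ', 0 < δ → δ ≤ ρ → 0 < δ' → δ' ≤ ρ →
        ν ({x | |e x - θ| ≤ δ} ∩ {x | |e (x - w) - θ'| ≤ δ'}) ≤
          c * ENNReal.ofReal δ' * ENNReal.ofReal δ := by
      intro δ δ' h0 h1 h0' h1'
      rw [hν, withDensity_apply _ ((hS1 δ).inter (hS2 δ'))]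
      refine (hloc _ _ ((hS1 δ).inter (hS2 δ'))
        (fun q => htr w q θ θ' δ δ' hw h0 h1 h0' h1') v).trans ?_
      have hwn : 0 < ‖w‖ := norm_pos_iff.2 hw
      calc _ ≤ ENNReal.ofReal K₃ * ENNReal.ofReal (|κ| * δ * δ' / ‖w‖) := by
            gcongr; exact le_abs_self κ
        _ = ENNReal.ofReal (K₃ * |κ|) * ‖w‖ₑ⁻¹ * ENNReal.ofReal δ' * ENNReal.ofReal δ := by
            rw [← ofReal_norm, ← ENNReal.ofReal_inv_of_pos hwn, ← ENNReal.ofReal_mul (by positivity),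
              ← ENNReal.ofReal_mul (by positivity), ← ENNReal.ofReal_mul (by positivity),
              ← ENNReal.ofReal_mul (by positivity)]
            congr 1
            field_simp
        _ ≤ _ := by
            rw [hc]
            gcongr
            · linarith
            · exact le_add_self
    have hcm' : Measurable fun x : Momentum d => ENNReal.ofReal (cut t⁻¹ (e (x - w) - θ')) :=
      ((measurable_cut _).comp (by fun_prop)).ennreal_ofReal
    -- Two layer cakes in succession. The inner one integrates the first resolvent over a layer of
    -- the second, where transversality gives mass at most `c * δ * δ'`. The outer one integrates
    -- the second resolvent against the measure `ν'`, which already contains the first.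
    set ν' := ν.withDensity fun x => ENNReal.ofReal (cut t⁻¹ (e x - θ)) with hν'
    have hl' := lintegral_cut_le ν' (g := fun x => e (x - w) - θ') (by fun_prop)
      (c * ENNReal.ofReal (cakeLog t⁻¹ ρ)) hη hρ ?_ ?_
    · rw [hν', lintegral_withDensity_eq_lintegral_mul _ hcm
        hcm', hν, lintegral_withDensity_eq_lintegral_mul _ hwm (hcm.mul hcm')] at hl'
      simp only [Pi.mul_apply, ← mul_assoc] at hl'
      refine hl'.trans ?_
      rw [hc, mul_assoc (_ * _), mul_right_comm, ← ENNReal.ofReal_mul hcl0,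
        ← ENNReal.ofReal_mul hK₄0]
      refine mul_le_mul_left (ENNReal.ofReal_le_ofReal ?_) _
      calc K₄ * (cakeLog t⁻¹ ρ * cakeLog t⁻¹ ρ) ≤ K₄ * ((P * logStar t) * (P * logStar t)) := by
            gcongr
        _ = K₄ * P ^ 2 * logStar t ^ 2 := by ring
        _ ≤ (2 * K₁ * P + K₄ * P ^ 2) * logStar t ^ 2 := by
            have : 0 ≤ 2 * K₁ * P := by positivity
            gcongr
            linarith
    · rw [hν', withDensity_apply _ .univ, Measure.restrict_univ]
      exact lintegral_cut_le ν (by fun_prop) c hη hρ hν1 fun δ hδ _ => hν1l δ hδ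
    · intro δ' h0' h1'
      rw [hν', withDensity_apply _ (hS2 δ'), mul_right_comm]
      refine lintegral_cut_le (ν.restrict _) (by fun_prop) _ hη hρ ?_ fun δ h0 h1 => ?_
      · rw [Measure.restrict_apply_univ]; exact hν2 δ' h0'
      · rw [Measure.restrict_apply (hS1 δ)]; exact hν12 δ δ' h0 h1 h0' h1'

/-! ### Functions with bounded derivatives in one direction -/

/-- Functions which have `j` continuous derivatives in direction `v`, bounded by `C w`. -/
def DirBound {d : ℕ} (v : Momentum d) : ℕ → ℝ → (Momentum d → ℝ) → (Momentum d → ℝ) → Prop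
  | 0, C, w, f => Continuous f ∧ ∀ x, |f x| ≤ C * w x
  | j + 1, C, w, f => (Continuous f ∧ ∀ x, |f x| ≤ C * w x) ∧
      ∃ f', (∀ x, HasLineDerivAt ℝ f (f' x) x v) ∧ DirBound v j C w f'

namespace DirBound

variable {d : ℕ} {v : Momentum d}

lemma base {j : ℕ} {C : ℝ} {w f : Momentum d → ℝ} (h : DirBound v j C w f) :
    Continuous f ∧ ∀ x, |f x| ≤ C * w x := by
  cases j with
  | zero => exact h
  | succ j => exact h.1

lemma pred {j : ℕ} {C : ℝ} {w f : Momentum d → ℝ} (h : DirBound v (j + 1) C w f) :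
    DirBound v j C w f := by
  induction j generalizing f with
  | zero => exact h.1
  | succ j ih =>
    obtain ⟨h1, f', h2, h3⟩ := h
    exact ⟨h1, f', h2, ih h3⟩

lemma mono {j : ℕ} {C C' : ℝ} {w w' f : Momentum d → ℝ} (h : DirBound v j C w f)
    (hC : ∀ x, C * w x ≤ C' * w' x) : DirBound v j C' w' f := by
  induction j generalizing f with
  | zero => exact ⟨h.1, fun x => (h.2 x).trans (hC x)⟩
  | succ j ih =>
    obtain ⟨h1, f', h2, h3⟩ := h
    exact ⟨⟨h1.1, fun x => (h1.2 x).trans (hC x)⟩, f', h2, ih h3⟩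

lemma add {j : ℕ} {C C' : ℝ} {w f g : Momentum d → ℝ} (hf : DirBound v j C w f)
    (hg : DirBound v j C' w g) : DirBound v j (C + C') w (fun x => f x + g x) := by
  have key : Continuous (fun x => f x + g x) ∧ ∀ x, |f x + g x| ≤ (C + C') * w x :=
    ⟨hf.base.1.add hg.base.1, fun x => by
      rw [add_mul]; exact (abs_add_le _ _).trans (add_le_add (hf.base.2 x) (hg.base.2 x))⟩
  induction j generalizing f g with
  | zero => exact key
  | succ j ih =>
    obtain ⟨h1, f', h2, h3⟩ := hf
    obtain ⟨h1', g', h2', h3'⟩ := hg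
    refine ⟨key, _, fun x => HasDerivAt.add (h2 x) (h2' x), ih h3 h3' ⟨h3.base.1.add h3'.base.1,
      fun x => ?_⟩⟩
    rw [add_mul]; exact (abs_add_le _ _).trans (add_le_add (h3.base.2 x) (h3'.base.2 x))

lemma neg {j : ℕ} {C : ℝ} {w f : Momentum d → ℝ} (hf : DirBound v j C w f) :
    DirBound v j C w (fun x => -f x) := by
  induction j generalizing f with
  | zero => exact ⟨hf.1.neg, fun x => by rw [abs_neg]; exact hf.2 x⟩
  | succ j ih =>
    obtain ⟨h1, f', h2, h3⟩ := hf
    exact ⟨⟨h1.1.neg, fun x => by rw [abs_neg]; exact h1.2 x⟩, _,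
      fun x => HasDerivAt.neg (h2 x), ih h3⟩

lemma mul {j : ℕ} {C C' : ℝ} {w w' f g : Momentum d → ℝ}
    (hf : DirBound v j C w f) (hg : DirBound v j C' w' g) :
    DirBound v j (2 ^ j * (C * C')) (fun x => w x * w' x) (fun x => f x * g x) := by
  have key : ∀ {C C' : ℝ} {f g : Momentum d → ℝ}, (Continuous f ∧ ∀ x, |f x| ≤ C * w x) →
      (Continuous g ∧ ∀ x, |g x| ≤ C' * w' x) →
      Continuous (fun x => f x * g x) ∧ ∀ x, |f x * g x| ≤ C * C' * (w x * w' x) :=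
    fun {C C' f g} h h' => ⟨h.1.mul h'.1, fun x => by
      rw [abs_mul, mul_mul_mul_comm]
      exact mul_le_mul (h.2 x) (h'.2 x) (abs_nonneg _) ((abs_nonneg _).trans (h.2 x))⟩
  induction j generalizing f g with
  | zero => rw [pow_zero, one_mul]; exact key hf hg
  | succ j ih =>
    have h0 := key hf.base hg.base
    have hf' := hf
    have hg' := hg
    obtain ⟨h1, f', h2, h3⟩ := hf
    obtain ⟨h1', g', h2', h3'⟩ := hg
    refine ⟨⟨h0.1, fun x => (h0.2 x).trans ?_⟩, fun x => f' x * g x + f x * g' x, fun x => ?_, ?_⟩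
    · have : 0 ≤ C * C' * (w x * w' x) := (abs_nonneg _).trans (h0.2 x)
      calc _ ≤ 2 ^ (j + 1) * (C * C' * (w x * w' x)) :=
            le_mul_of_one_le_left this (one_le_pow₀ (by norm_num))
        _ = _ := by ring
    · have := HasDerivAt.mul (h2 x) (h2' x)
      simp only [zero_smul, add_zero] at this
      exact this
    · have := (ih h3 hg'.pred).add (ih hf'.pred h3')
      refine this.mono fun x => le_of_eq ?_
      rw [pow_succ]; ring

/-- The derivative of `1 / f` is `-f' / f ^ 2`, so one derivative of the inverse uses the inverse
with one derivative fewer. The constant has to depend on `j`, `c` and `C` only, hence the order of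
the quantifiers. -/
lemma exists_inv (j : ℕ) {c C : ℝ} (hc : 0 < c) :
    ∃ C' : ℝ, ∀ (d : ℕ) (v : Momentum d) (f : Momentum d → ℝ), (∀ x, c ≤ f x) →
      DirBound v j C (fun _ => 1) f → DirBound v j C' (fun _ => 1) (fun x => (f x)⁻¹) := by
  have key : ∀ {d : ℕ} {f : Momentum d → ℝ}, (∀ x, c ≤ f x) → Continuous f →
      Continuous (fun x => (f x)⁻¹) ∧ ∀ x, |(f x)⁻¹| ≤ c⁻¹ * 1 := fun {d f} h h' =>
    ⟨h'.inv₀ fun x => (hc.trans_le (h x)).ne', fun x => by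
      rw [abs_of_pos (inv_pos.2 (hc.trans_le (h x))), mul_one]; exact inv_anti₀ hc (h x)⟩
  induction j with
  | zero => exact ⟨c⁻¹, fun d v f h hf => key h hf.1⟩
  | succ j ih =>
    obtain ⟨C₁, h₁⟩ := ih
    refine ⟨max c⁻¹ (2 ^ j * (2 ^ j * (C * C₁) * C₁)), fun d v f h hf => ?_⟩
    have h3 := h₁ d v f h hf.pred
    obtain ⟨h1, f', h2, h2'⟩ := hf
    refine ⟨⟨(key h h1.1).1, fun x => ((key h h1.1).2 x).trans ?_⟩,
      fun x => -(f' x * (f x)⁻¹ * (f x)⁻¹), fun x => ?_, ?_⟩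
    · gcongr; exact le_max_left _ _
    · have h0 : f (x + (0 : ℝ) • v) ≠ 0 := (hc.trans_le (h _)).ne'
      have := HasDerivAt.inv (h2 x) h0
      refine HasDerivAt.congr_deriv this ?_
      have h0' : f x ≠ 0 := (hc.trans_le (h _)).ne'
      rw [zero_smul, add_zero]
      field_simp
    · refine ((h2'.mul h3).mul h3).neg.mono fun x => ?_
      simp only [mul_one]
      exact le_max_right _ _

lemma translate {j : ℕ} {C : ℝ} {w f : Momentum d → ℝ} (hf : DirBound v j C w f) (u : Momentum d) :
    DirBound v j C (fun x => w (x + u)) (fun x => f (x + u)) := by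
  induction j generalizing f with
  | zero => exact ⟨hf.1.comp (by fun_prop), fun x => hf.2 _⟩
  | succ j ih =>
    obtain ⟨h1, f', h2, h3⟩ := hf
    refine ⟨⟨h1.1.comp (by fun_prop), fun x => h1.2 _⟩, _, fun x => ?_, ih h3⟩
    have := h2 (x + u)
    unfold HasLineDerivAt at this ⊢
    simpa only [add_right_comm] using this

end DirBound

lemma hasLineDerivAt_dirDeriv {d n j : ℕ} {f : Momentum d → ℝ}
    (hf : ContDiff ℝ ((n : ℕ) : WithTop ℕ∞) f) (hj : j < n) (v x : Momentum d) :
    HasLineDerivAt ℝ (dirDeriv j f v) (dirDeriv (j + 1) f v x) x v := by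
  simpa [HasLineDerivAt] using hasDerivAt_dirDeriv hf hj v x 0

lemma dirBound_dirDeriv {d n : ℕ} {f : Momentum d → ℝ} (hf : ContDiff ℝ ((n : ℕ) : WithTop ℕ∞) f)
    (v : Momentum d) {C : ℝ} {w : Momentum d → ℝ} (j i : ℕ) (hij : i + j ≤ n)
    (h : ∀ l, i ≤ l → l ≤ i + j → ∀ x, |dirDeriv l f v x| ≤ C * w x) :
    DirBound v j C w (dirDeriv i f v) := by
  induction j generalizing i with
  | zero => exact ⟨continuous_dirDeriv hf hij v, h i le_rfl le_rfl⟩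
  | succ j ih =>
    exact ⟨⟨continuous_dirDeriv hf (by omega) v, h i le_rfl (by omega)⟩, dirDeriv (i + 1) f v,
      fun x => hasLineDerivAt_dirDeriv hf (by omega) v x,
      ih (i + 1) (by omega) fun l h1 h2 => h l (by omega) (by omega)⟩

/-! ### Oscillatory integrals -/

/-- Repeated integration by parts. -/
lemma exists_norm_integral_osc_le (j : ℕ) {c C : ℝ} (hc : 0 < c) :
    ∃ K : ℝ, 0 ≤ K ∧ ∀ (d : ℕ) (v : Momentum d) (φ ψ : Momentum d → ℝ) (r s : ℝ), 0 < r → 0 < s →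
      Continuous ψ → (∀ x, HasLineDerivAt ℝ ψ (r * φ x) x v) → (∀ x, c ≤ φ x) →
      DirBound v j C (fun _ => 1) φ → ∀ (w : Momentum d → ℝ), Integrable w → (∀ x, 0 ≤ w x) →
      ∀ (b : Momentum d → ℝ) (D : ℝ), 0 ≤ D → DirBound v j D w b →
      ‖∫ x, Complex.exp (-Complex.I * ((s * ψ x : ℝ) : ℂ)) * (b x : ℂ)‖ ≤
        K * D * ((s * r) ^ j)⁻¹ * ∫ x, w x := by
  have hexp : ∀ y : ℝ, ‖Complex.exp (-Complex.I * (y : ℂ))‖ = 1 := fun y => by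
    rw [show -Complex.I * (y : ℂ) = ((-y : ℝ) : ℂ) * Complex.I by push_cast; ring]
    exact Complex.norm_exp_ofReal_mul_I _
  induction j with
  | zero =>
    refine ⟨1, zero_le_one, fun d v φ ψ r s hr hs hψ h1 h2 h3 w hw hw0 b D hD hb => ?_⟩
    have : ∀ x, ‖Complex.exp (-Complex.I * ((s * ψ x : ℝ) : ℂ)) * (b x : ℂ)‖ ≤ D * w x := fun x => by
      rw [norm_mul, hexp, one_mul, Complex.norm_real]
      exact hb.2 x
    calc _ ≤ ∫ x, D * w x := norm_integral_le_of_norm_le (hw.const_mul D) (ae_of_all _ this)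
      _ = _ := by rw [integral_const_mul]; simp
  | succ j ih =>
    obtain ⟨K, hK0, hK⟩ := ih
    obtain ⟨C', hC'⟩ := DirBound.exists_inv (j + 1) (C := C) hc
    refine ⟨K * (2 ^ (j + 1) * |C'|), by positivity,
      fun d v φ ψ r s hr hs hψ h1 h2 h3 w hw hw0 b D hD hb => ?_⟩
    -- One integration by parts. With `E` the exponential, ∂_v E = -i s r φ E, so `E * b` equals i
    -- (s r)⁻¹ ∂_v E · (b / φ). The derivative `g'` of `b / φ` is an amplitude of the same kind with
    -- one derivative fewer, to which the induction hypothesis applies.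
    have h4 : DirBound v (j + 1) (2 ^ (j + 1) * (D * |C'|)) w (fun x => b x * (φ x)⁻¹) := by
      refine (hb.mul (hC' d v φ h2 h3)).mono fun x => ?_
      rw [mul_one]
      gcongr
      · exact hw0 x
      · exact le_abs_self C'
    have h5 := h4
    obtain ⟨⟨h60, h61⟩, g', h7, h8⟩ := h4
    have h9 := hK d v φ ψ r s hr hs hψ h1 h2 h3.pred w hw hw0 g' _ (by positivity) h8
    have hsr : 0 < s * r := mul_pos hs hr
    have hφ : ∀ x, φ x ≠ 0 := fun x => (hc.trans_le (h2 x)).ne'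
    set E : Momentum d → ℂ := fun x => Complex.exp (-Complex.I * ((s * ψ x : ℝ) : ℂ)) with hE
    have hEc : Continuous E := by rw [hE]; fun_prop
    have hEd : ∀ x, HasLineDerivAt ℝ E (-Complex.I * ((s * (r * φ x) : ℝ) : ℂ) * E x) x v := by
      intro x
      have hd1 : HasDerivAt (fun t : ℝ => ((s * ψ (x + t • v) : ℝ) : ℂ))
          ((s * (r * φ x) : ℝ) : ℂ) 0 := (HasDerivAt.const_mul s (h1 x)).ofReal_comp
      have hd2 := (hd1.const_mul (-Complex.I)).cexp
      refine HasDerivAt.congr_deriv hd2 ?_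
      simp only [hE, zero_smul, add_zero]
      ring
    have hgd : ∀ x, HasLineDerivAt ℝ (fun x => ((b x * (φ x)⁻¹ : ℝ) : ℂ)) ((g' x : ℝ) : ℂ) x v :=
      fun x => HasDerivAt.ofReal_comp (h7 x)
    have hint : ∀ {f : Momentum d → ℂ} {D : ℝ}, Continuous f → (∀ x, ‖f x‖ ≤ D * w x) →
        Integrable f := fun {f D} hf h =>
      Integrable.mono' (hw.const_mul D) hf.aestronglyMeasurable (ae_of_all _ h)
    have hnE : ∀ x, ‖E x‖ = 1 := fun x => hexp _
    have e1 : ∀ x, -Complex.I * ((s * (r * φ x) : ℝ) : ℂ) * E x * ((b x * (φ x)⁻¹ : ℝ) : ℂ) =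
        -Complex.I * ((s * r : ℝ) : ℂ) * (E x * (b x : ℂ)) := fun x => by
      have : (φ x : ℂ) ≠ 0 := by exact_mod_cast hφ x
      push_cast
      field_simp
    have hibp := integral_bilinear_hasLineDerivAt_right_eq_neg_left_of_integrable
      (μ := (volume : Measure (Momentum d))) (B := ContinuousLinearMap.mul ℝ ℂ)
      (f := fun x => ((b x * (φ x)⁻¹ : ℝ) : ℂ)) (f' := fun x => ((g' x : ℝ) : ℂ))
      (g := E) (g' := fun x => -Complex.I * ((s * (r * φ x) : ℝ) : ℂ) * E x) (v := v)
      (hint (D := 2 ^ (j + 1) * (D * |C'|)) (by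
          have := h8.base.1
          simp only [ContinuousLinearMap.mul_apply']
          fun_prop) fun x => by
        simp only [ContinuousLinearMap.mul_apply', norm_mul, hnE, mul_one, Complex.norm_real]
        exact h8.base.2 x)
      (hint (D := s * r * D) (by
          have := h3.base.1
          simp only [ContinuousLinearMap.mul_apply']
          fun_prop) fun x => by
        simp only [ContinuousLinearMap.mul_apply']
        rw [mul_comm, e1]
        simp only [norm_mul, hnE, norm_neg, Complex.norm_I, one_mul, Complex.norm_real, norm_mul,
          Real.norm_of_nonneg hs.le, Real.norm_of_nonneg hr.le]
        rw [mul_assoc (s * r)]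
        gcongr
        exact hb.base.2 x)
      (hint (D := 2 ^ (j + 1) * (D * |C'|)) (by
          simp only [ContinuousLinearMap.mul_apply']
          fun_prop) fun x => by
        rw [ContinuousLinearMap.mul_apply', norm_mul, hnE, mul_one, Complex.norm_real]
        exact h61 x)
      (fun x _ => hgd x) (fun x _ => hEd x)
    simp only [ContinuousLinearMap.mul_apply'] at hibp
    have e2 : ∀ x, ((b x * (φ x)⁻¹ : ℝ) : ℂ) * (-Complex.I * ((s * (r * φ x) : ℝ) : ℂ) * E x) =
        -Complex.I * ((s * r : ℝ) : ℂ) * (E x * (b x : ℂ)) := fun x => by rw [mul_comm, e1]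
    simp_rw [e2] at hibp
    rw [integral_const_mul] at hibp
    have hn := congrArg norm hibp
    rw [norm_mul, norm_mul, norm_neg, norm_neg, Complex.norm_I, one_mul, Complex.norm_real,
      Real.norm_of_nonneg hsr.le] at hn
    have e3 : ∫ x, ((g' x : ℝ) : ℂ) * E x = ∫ x, E x * ((g' x : ℝ) : ℂ) := by
      simp_rw [mul_comm]
    rw [e3] at hn
    have h10 : ‖∫ x, E x * (b x : ℂ)‖ = (s * r)⁻¹ * ‖∫ x, E x * ((g' x : ℝ) : ℂ)‖ := by
      rw [← hn]; field_simp
    rw [h10]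
    calc _ ≤ (s * r)⁻¹ * (K * (2 ^ (j + 1) * (D * |C'|)) * ((s * r) ^ j)⁻¹ * ∫ x, w x) := by gcongr
      _ = _ := by rw [pow_succ (s * r), mul_inv]; ring

/-! ### The dispersive estimate -/

/-- Bounded derivatives of orders two to five. -/
structure BoundedDerivs {d : ℕ} (B : ℝ) (e : Momentum d → ℝ) : Prop where
  smooth : ContDiff ℝ ((5 : ℕ) : WithTop ℕ∞) e
  bound : ∀ l, 2 ≤ l → l ≤ 5 → ∀ x, ‖iteratedFDeriv ℝ l e x‖ ≤ B

lemma exp_neg_I_norm (y : ℝ) : ‖Complex.exp (-Complex.I * (y : ℂ))‖ = 1 := by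
  rw [show -Complex.I * (y : ℂ) = ((-y : ℝ) : ℂ) * Complex.I by push_cast; ring]
  exact Complex.norm_exp_ofReal_mul_I _

section Phase

variable {d : ℕ} {A B B' : ℝ} {e : Momentum d → ℝ}

/-- Derivatives of the normalized phase difference. -/
noncomputable def phaseDeriv (e : Momentum d → ℝ) (q u : Momentum d) (l : ℕ) (k : Momentum d) : ℝ :=
  ‖u‖⁻¹ * (dirDeriv (1 + l) e (‖u‖⁻¹ • u) (k + q) - dirDeriv (1 + l) e (‖u‖⁻¹ • u) (k + q - u))

lemma norm_unit {u : Momentum d} (hu : u ≠ 0) : ‖‖u‖⁻¹ • u‖ = 1 := by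
  rw [norm_smul, norm_inv, norm_norm, inv_mul_cancel₀ (norm_ne_zero_iff.2 hu)]

/-- The mean value theorem along the segment of length `‖u‖`. After division by `‖u‖` a difference
of derivatives of order `1 + l` is a derivative of order `2 + l`, so only the bounded derivatives of
`e`, those of order at least two, ever enter. -/
lemma exists_phaseDeriv_eq (he : BoundedDerivs B' e) (q : Momentum d) {u : Momentum d} (hu : u ≠ 0)
    {l : ℕ} (hl : l ≤ 3) (k : Momentum d) :
    ∃ y, phaseDeriv e q u l k = dirDeriv (2 + l) e (‖u‖⁻¹ • u) y := by
  have hr : 0 < ‖u‖ := norm_pos_iff.2 hu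
  set v := ‖u‖⁻¹ • u
  have hd := hasDerivAt_dirDeriv (j := 1 + l) he.smooth (by omega) v (k + q - u)
  obtain ⟨s, -, hs⟩ := exists_hasDerivAt_eq_slope _ _ hr
    (fun s _ => (hd s).continuousAt.continuousWithinAt) (fun s _ => hd s)
  refine ⟨k + q - u + s • v, ?_⟩
  rw [show 2 + l = 1 + l + 1 by ring, hs, sub_zero, zero_smul, add_zero, phaseDeriv, div_eq_inv_mul]
  have : ‖u‖ • v = u := by rw [smul_smul, mul_inv_cancel₀ hr.ne', one_smul]
  rw [this, sub_add_cancel]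

lemma hasLineDerivAt_phaseDeriv (he : BoundedDerivs B' e) (q u : Momentum d) {l : ℕ} (hl : l ≤ 3)
    (k : Momentum d) :
    HasLineDerivAt ℝ (phaseDeriv e q u l) (phaseDeriv e q u (l + 1) k) k (‖u‖⁻¹ • u) := by
  have h1 := hasDerivAt_dirDeriv (j := 1 + l) he.smooth (by omega) (‖u‖⁻¹ • u) (k + q) 0
  have h2 := hasDerivAt_dirDeriv (j := 1 + l) he.smooth (by omega) (‖u‖⁻¹ • u) (k + q - u) 0
  have h3 := (h1.sub h2).const_mul ‖u‖⁻¹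
  have hz : ∀ x : Momentum d, x + (0 : ℝ) • (‖u‖⁻¹ • u) = x := fun x => by simp
  rw [hz, hz] at h3
  have e1 : ∀ s : ℝ, k + s • (‖u‖⁻¹ • u) + q = k + q + s • (‖u‖⁻¹ • u) :=
    fun s => by rw [add_right_comm]
  have e2 : ∀ s : ℝ, k + s • (‖u‖⁻¹ • u) + q - u = k + q - u + s • (‖u‖⁻¹ • u) :=
    fun s => by rw [e1, add_sub_right_comm]
  refine (h3.congr_of_eventuallyEq (Eventually.of_forall fun s => ?_)).congr_deriv rfl
  simp only [phaseDeriv, Pi.sub_apply]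
  rw [e2, e1]

lemma dirBound_phaseDeriv (he : BoundedDerivs B' e) (q : Momentum d) {u : Momentum d} (hu : u ≠ 0)
    (j i : ℕ) (hij : i + j ≤ 3) :
    DirBound (‖u‖⁻¹ • u) j B' (fun _ => 1) (phaseDeriv e q u i) := by
  have key : ∀ i ≤ 3, Continuous (phaseDeriv e q u i) ∧ ∀ x, |phaseDeriv e q u i x| ≤ B' * 1 := by
    intro i hi
    constructor
    · have := continuous_dirDeriv (j := 1 + i) he.smooth (by omega) (‖u‖⁻¹ • u)
      unfold phaseDeriv
      fun_prop
    · intro x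
      obtain ⟨y, hy⟩ := exists_phaseDeriv_eq he q hu hi x
      rw [hy, mul_one]
      refine (abs_dirDeriv_le e _ y).trans ?_
      rw [norm_unit hu, one_pow, mul_one]
      exact he.bound _ (by omega) (by omega) y
  induction j generalizing i with
  | zero => exact key i hij
  | succ j ih =>
    exact ⟨key i (by omega), _, fun x => hasLineDerivAt_phaseDeriv he q u (by omega) x,
      ih (i + 1) (by omega)⟩

/-- Uniform convexity: along `u`, the difference of two translates of `e` has no stationary point.
-/
lemma le_phaseDeriv (he : BoundedDerivs B' e) (h : UniformlyConvex A B e) (q : Momentum d)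
    {u : Momentum d} (hu : u ≠ 0) (k : Momentum d) : A ≤ phaseDeriv e q u 0 k := by
  obtain ⟨y, hy⟩ := exists_phaseDeriv_eq he q hu (Nat.zero_le 3) k
  rw [hy]
  simpa [norm_unit hu] using h.hess_ge y (‖u‖⁻¹ • u)

lemma hasLineDerivAt_phase (he : BoundedDerivs B' e) (q : Momentum d) {u : Momentum d} (hu : u ≠ 0)
    (k : Momentum d) :
    HasLineDerivAt ℝ (fun k => e (k + q) - e (k + q - u)) (‖u‖ * phaseDeriv e q u 0 k) k
      (‖u‖⁻¹ • u) := by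
  have h1 := hasDerivAt_dirDeriv (j := 0) he.smooth (by omega) (‖u‖⁻¹ • u) (k + q) 0
  have h2 := hasDerivAt_dirDeriv (j := 0) he.smooth (by omega) (‖u‖⁻¹ • u) (k + q - u) 0
  have h3 := h1.sub h2
  have hz : ∀ x : Momentum d, x + (0 : ℝ) • (‖u‖⁻¹ • u) = x := fun x => by simp
  rw [hz, hz] at h3
  simp only [dirDeriv_zero] at h3
  have e1 : ∀ s : ℝ, k + s • (‖u‖⁻¹ • u) + q = k + q + s • (‖u‖⁻¹ • u) :=
    fun s => by rw [add_right_comm]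
  have e2 : ∀ s : ℝ, k + s • (‖u‖⁻¹ • u) + q - u = k + q - u + s • (‖u‖⁻¹ • u) :=
    fun s => by rw [e1, add_sub_right_comm]
  refine (h3.congr_of_eventuallyEq (Eventually.of_forall fun s => ?_)).congr_deriv ?_
  · simp only [Pi.sub_apply]
    rw [e2, e1]
  · rw [phaseDeriv, ← mul_assoc, mul_inv_cancel₀ (norm_ne_zero_iff.2 hu), one_mul]

end Phase

/-- The oscillatory integral `∫ exp(-i s e(k + q)) a(k) dk`. -/
noncomputable def oscInt {d : ℕ} (e a : Momentum d → ℝ) (q : Momentum d) (s : ℝ) : ℂ :=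
  ∫ k, Complex.exp (-Complex.I * ((s * e (k + q) : ℝ) : ℂ)) * (a k : ℂ)

/-- The correlations which appear in the square of `oscInt`. -/
noncomputable def oscCorr {d : ℕ} (e a : Momentum d → ℝ) (q : Momentum d) (s : ℝ) (u : Momentum d) :
    ℂ :=
  ∫ k, Complex.exp (-Complex.I * ((s * (e (k + q) - e (k + q - u)) : ℝ) : ℂ)) *
    ((a k * a (k - u) : ℝ) : ℂ)

/-- The squared modulus is the total integral of the convolution of the integrand with its reflected
conjugate. Squaring replaces the phase `e` by a difference of two translates, so the stationary
points of `e` need no separate analysis. -/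
lemma oscInt_mul_conj {d : ℕ} {e a : Momentum d → ℝ} (he : Continuous e) (hac : Continuous a)
    (ha : Integrable a) (q : Momentum d) (s : ℝ) :
    oscInt e a q s * (starRingEnd ℂ) (oscInt e a q s) = ∫ u, oscCorr e a q s u := by
  set g : Momentum d → ℂ := fun k => Complex.exp (-Complex.I * ((s * e (k + q) : ℝ) : ℂ)) * (a k : ℂ)
    with hg
  have hgc : Continuous g := by rw [hg]; fun_prop
  have hgi : Integrable g := by
    refine ha.norm.mono' hgc.aestronglyMeasurable (ae_of_all _ fun k => ?_)
    rw [hg, norm_mul, exp_neg_I_norm, one_mul, Complex.norm_real]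
  have hhi : Integrable fun k => (starRingEnd ℂ) (g (-k)) := by
    refine hgi.norm.comp_neg.mono' (by fun_prop) (ae_of_all _ fun k => ?_)
    rw [RCLike.norm_conj]
  have h1 := integral_convolution (μ := (volume : Measure (Momentum d))) (ν := volume)
    (ContinuousLinearMap.mul ℝ ℂ) hgi hhi
  have h2 : ∫ k, (starRingEnd ℂ) (g (-k)) = (starRingEnd ℂ) (oscInt e a q s) := by
    rw [integral_neg_eq_self (fun k => (starRingEnd ℂ) (g k)), integral_conj]
    rfl
  rw [h2, ContinuousLinearMap.mul_apply'] at h1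
  refine h1.symm.trans ?_
  refine integral_congr_ae (ae_of_all _ fun u => ?_)
  rw [convolution_def, oscCorr]
  refine integral_congr_ae (ae_of_all _ fun k => ?_)
  simp only [hg, ContinuousLinearMap.mul_apply', neg_sub, map_mul, ← Complex.exp_conj,
    Complex.conj_ofReal, map_neg, Complex.conj_I]
  rw [mul_mul_mul_comm, ← Complex.exp_add]
  congr 2
  · rw [show k - u + q = k + q - u by abel]
    push_cast
    ring
  · push_cast; rfl

/-- Interpolated decay of the correlations. -/
lemma rpow_interp {x K : ℝ} {y : ℝ} (hy : 0 < y) (hK : 0 ≤ K) (h0 : x ≤ K) (h3 : x ≤ K * (y ^ 3)⁻¹) :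
    x ≤ K * y ^ (-(5 / 2) : ℝ) := by
  rcases le_total y 1 with h | h
  · exact h0.trans (le_mul_of_one_le_right hK (Real.one_le_rpow_of_pos_of_le_one_of_nonpos hy h
      (by norm_num)))
  · refine h3.trans (mul_le_mul_of_nonneg_left ?_ hK)
    rw [← Real.rpow_natCast, ← Real.rpow_neg hy.le]
    exact Real.rpow_le_rpow_of_exponent_le h (by norm_num)

/-- The power `5 / 2` is shared equally among the `d` coordinates, each of which is at most `‖u‖` in
modulus. -/
lemma ofReal_rpow_norm_le_prod_sing {d : ℕ} (hd : 0 < d) {u : Momentum d} (hu : u ≠ 0)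
    (b : OrthonormalBasis (Fin d) ℝ (Momentum d)) :
    ENNReal.ofReal (‖u‖ ^ (-(5 / 2) : ℝ)) ≤ ∏ i, sing (5 / (2 * d)) (b.repr u i) := by
  have hd' : (0 : ℝ) < d := by exact_mod_cast hd
  calc ENNReal.ofReal (‖u‖ ^ (-(5 / 2) : ℝ)) = ∏ _i : Fin d, ‖u‖ₑ ^ (-(5 / (2 * d)) : ℝ) := by
        rw [Finset.prod_const, Finset.card_univ, Fintype.card_fin, ← ENNReal.rpow_natCast,
          ← ENNReal.rpow_mul, ← ofReal_norm, ENNReal.ofReal_rpow_of_pos (norm_pos_iff.2 hu)]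
        congr 2
        field_simp
    _ ≤ _ := by
        refine Finset.prod_le_prod' fun i _ => ?_
        rw [sing, ENNReal.rpow_neg, ENNReal.rpow_neg]
        refine ENNReal.inv_le_inv.2 (ENNReal.rpow_le_rpow ?_ (by positivity))
        rw [← ofReal_norm, ← ofReal_norm]
        exact ENNReal.ofReal_le_ofReal (abs_repr_le b u i)

/-- No integration by parts gives a constant and three give the power `-3` of `s * ‖u‖`; the power
`-5 / 2` lies in between. It is integrable at `u = 0` in dimension at least three, and its square
root is integrable in `s` at infinity. Peetre's inequality turns one pair of weights at `x` and `x -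
u` into decay in `u`, and a further weight makes the integral over `x` converge. -/
lemma exists_norm_oscCorr_le (d : ℕ) (hd : 0 < d) {A B B' D : ℝ} (hA : 0 < A) (hD : 0 ≤ D) :
    ∃ P : ℝ, 0 ≤ P ∧ ∀ e : Momentum d → ℝ, UniformlyConvex A B e → BoundedDerivs B' e →
      ∀ a : Momentum d → ℝ, (∀ v, ‖v‖ = 1 → DirBound v 3 D (fun x => wt x * wt x) a) →
      ∀ (q : Momentum d) (s : ℝ), 0 < s → ∀ u, u ≠ 0 → ‖oscCorr e a q s u‖ ≤
        P * wt u * (s ^ (-(5 / 2) : ℝ) * ‖u‖ ^ (-(5 / 2) : ℝ)) := by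
  obtain ⟨K₀, hK₀, hosc₀⟩ := exists_norm_integral_osc_le 0 (C := B') hA
  obtain ⟨K₃, hK₃, hosc₃⟩ := exists_norm_integral_osc_le 3 (C := B') hA
  have hwi := integrable_wt hd
  have hI0 : 0 ≤ ∫ x : Momentum d, wt x := integral_nonneg fun x => (wt_pos x).le
  have hM0 : (0 : ℝ) ≤ 2 ^ 3 * (D * D) * 2 ^ (d + 1) := by positivity
  obtain ⟨M, hM⟩ : ∃ M : ℝ, M = 2 ^ 3 * (D * D) * 2 ^ (d + 1) := ⟨_, rfl⟩
  rw [← hM] at hM0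
  refine ⟨(K₀ + K₃) * M * ∫ x : Momentum d, wt x, by positivity,
    fun e he heb a ha q s hs u hu => ?_⟩
  have hac : Continuous a := by
    obtain ⟨v, hv⟩ : ∃ v : Momentum d, ‖v‖ = 1 := by
      refine ⟨EuclideanSpace.basisFun _ ℝ ⟨0, hd⟩, by simp⟩
    exact (ha v hv).base.1
  have hec := he.continuous
  have hr : 0 < ‖u‖ := norm_pos_iff.2 hu
  have hwu := wt_pos u
  have hMu : 0 ≤ M * wt u := mul_nonneg hM0 hwu.le
  have hb : DirBound (‖u‖⁻¹ • u) 3 (M * wt u) wt (fun k => a k * a (k - u)) := by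
    have h1 := ha _ (norm_unit hu)
    have h2 := h1.translate (-u)
    simp only [← sub_eq_add_neg] at h2
    refine (h1.mul h2).mono fun x => ?_
    have h3 := wt_mul_wt_le x (u - x)
    rw [wt_sub_comm, add_sub_cancel] at h3
    have h4 := wt_pos x
    have h5 := wt_pos (x - u)
    have h6 := wt_le_one (x - u)
    rw [hM]
    calc 2 ^ 3 * (D * D) * (wt x * wt x * (wt (x - u) * wt (x - u)))
        = 2 ^ 3 * (D * D) * ((wt x * wt (x - u)) * wt x * wt (x - u)) := by ring
      _ ≤ 2 ^ 3 * (D * D) * ((2 ^ (d + 1) * wt u) * wt x * 1) := by gcongr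
      _ = _ := by ring
  have hψ : Continuous fun k => e (k + q) - e (k + q - u) := by fun_prop
  have hφ := dirBound_phaseDeriv heb q hu 3 0 le_rfl
  have j0 : ‖oscCorr e a q s u‖ ≤ _ :=
    hosc₀ d _ _ _ ‖u‖ s hr hs hψ (fun k => hasLineDerivAt_phase heb q hu k)
      (fun k => le_phaseDeriv heb he q hu k) hφ.pred.pred.pred wt hwi (fun x => (wt_pos x).le)
      _ _ hMu hb.pred.pred.pred
  have j3 : ‖oscCorr e a q s u‖ ≤ _ :=
    hosc₃ d _ _ _ ‖u‖ s hr hs hψ (fun k => hasLineDerivAt_phase heb q hu k)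
      (fun k => le_phaseDeriv heb he q hu k) hφ wt hwi (fun x => (wt_pos x).le)
      _ _ hMu hb
  have hsr : 0 < s * ‖u‖ := mul_pos hs hr
  generalize (∫ x : Momentum d, wt x) = I at hI0 j0 j3 ⊢
  have := rpow_interp (x := ‖oscCorr e a q s u‖) (K := (K₀ + K₃) * M * I * wt u) hsr
    (by positivity) ?_ ?_
  · rwa [Real.mul_rpow hs.le hr.le] at this
  · refine j0.trans ?_
    rw [pow_zero, inv_one, mul_one]
    calc _ = K₀ * ((M * wt u) * I) := by ring
      _ ≤ (K₀ + K₃) * ((M * wt u) * I) :=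
          mul_le_mul_of_nonneg_right (le_add_of_nonneg_right hK₃) (mul_nonneg hMu hI0)
      _ = _ := by ring
  · refine j3.trans ?_
    have hy : 0 ≤ ((s * ‖u‖) ^ 3)⁻¹ := by positivity
    calc _ = K₃ * ((M * wt u) * I * ((s * ‖u‖) ^ 3)⁻¹) := by ring
      _ ≤ (K₀ + K₃) * ((M * wt u) * I * ((s * ‖u‖) ^ 3)⁻¹) :=
          mul_le_mul_of_nonneg_right (le_add_of_nonneg_left hK₀)
            (mul_nonneg (mul_nonneg hMu hI0) hy)
      _ = _ := by ring

/-- The correlation bound is integrated over `u` with product singularities of exponent `5 / (2 * d)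
≤ 5 / 6`; taking the square root halves the power of `s`. -/
lemma exists_norm_oscInt_le (d : ℕ) (hd : 3 ≤ d) {A B B' D : ℝ} (hA : 0 < A) (hD : 0 ≤ D) :
    ∃ K : ℝ, 0 ≤ K ∧ ∀ e : Momentum d → ℝ, UniformlyConvex A B e → BoundedDerivs B' e →
      ∀ a : Momentum d → ℝ, (∀ v, ‖v‖ = 1 → DirBound v 3 D (fun x => wt x * wt x) a) →
      ∀ (q : Momentum d) (s : ℝ), 0 < s →
        ‖oscInt e a q s‖ ≤ K ∧ ‖oscInt e a q s‖ ≤ K * s ^ (-(5 / 4) : ℝ) := by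
  have hd0 : 0 < d := by omega
  obtain ⟨P, hP0, hcorr₀⟩ := exists_norm_oscCorr_le d hd0 (B := B) (B' := B') hA hD
  obtain ⟨K₁, hK₁, hsing⟩ := exists_lintegral_wt_sing_le d hd0
  set I := ∫ x : Momentum d, wt x with hI
  have hI0 : 0 ≤ I := integral_nonneg fun x => (wt_pos x).le
  have hwi := integrable_wt hd0
  refine ⟨D * I + Real.sqrt (P * K₁), by positivity, fun e he heb a ha q s hs => ?_⟩
  have hac : Continuous a := by
    obtain ⟨v, hv⟩ : ∃ v : Momentum d, ‖v‖ = 1 := by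
      refine ⟨EuclideanSpace.basisFun _ ℝ ⟨0, hd0⟩, by simp⟩
    exact (ha v hv).base.1
  have hab : ∀ x, |a x| ≤ D * wt x := by
    obtain ⟨v, hv⟩ : ∃ v : Momentum d, ‖v‖ = 1 := by
      refine ⟨EuclideanSpace.basisFun _ ℝ ⟨0, hd0⟩, by simp⟩
    intro x
    refine ((ha v hv).base.2 x).trans (mul_le_mul_of_nonneg_left ?_ hD)
    exact mul_le_of_le_one_left (wt_pos x).le (wt_le_one x)
  have hai : Integrable a := (hwi.const_mul D).mono' hac.aestronglyMeasurable
    (ae_of_all _ hab)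
  have hec := he.continuous
  have h0 : ‖oscInt e a q s‖ ≤ D * I := by
    rw [hI, ← integral_const_mul]
    refine norm_integral_le_of_norm_le (hwi.const_mul D) (ae_of_all _ fun x => ?_)
    rw [norm_mul, exp_neg_I_norm, one_mul, Complex.norm_real]
    exact hab x
  refine ⟨h0.trans (le_add_of_nonneg_right (Real.sqrt_nonneg _)), ?_⟩
  have hcorr := hcorr₀ e he heb a ha q s hs
  have hsq : ‖oscInt e a q s‖ ^ 2 ≤ P * K₁ * s ^ (-(5 / 2) : ℝ) := by
    have hs0 : 0 ≤ s ^ (-(5 / 2) : ℝ) := Real.rpow_nonneg hs.le _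
    have e1 : ‖oscInt e a q s‖ ^ 2 = ‖∫ u, oscCorr e a q s u‖ := by
      rw [← oscInt_mul_conj hec hac hai, norm_mul, RCLike.norm_conj, sq]
    have e2 : ‖∫ u, oscCorr e a q s u‖ₑ ≤ ENNReal.ofReal (P * K₁ * s ^ (-(5 / 2) : ℝ)) := by
      have hne : ∀ᵐ u : Momentum d, u ≠ 0 := by
        have : Nonempty (Fin d) := ⟨⟨0, hd0⟩⟩
        have : Nontrivial (Momentum d) := inferInstance
        exact Measure.ae_ne volume 0
      calc _ ≤ ∫⁻ u, ‖oscCorr e a q s u‖ₑ := enorm_integral_le_lintegral_enorm _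
        _ ≤ ∫⁻ u, ENNReal.ofReal (P * s ^ (-(5 / 2) : ℝ)) * (ENNReal.ofReal (wt (u - 0)) *
              ∏ i, sing (5 / (2 * d)) ((EuclideanSpace.basisFun _ ℝ).repr u i)) := by
            refine lintegral_mono_ae (hne.mono fun u hu => ?_)
            rw [← ofReal_norm]
            refine (ENNReal.ofReal_le_ofReal (hcorr u hu)).trans ?_
            rw [sub_zero, show P * wt u * (s ^ (-(5 / 2) : ℝ) * ‖u‖ ^ (-(5 / 2) : ℝ)) =
                P * s ^ (-(5 / 2) : ℝ) * (wt u * ‖u‖ ^ (-(5 / 2) : ℝ)) by ring,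
              ENNReal.ofReal_mul (by positivity), ENNReal.ofReal_mul (wt_pos u).le]
            exact mul_le_mul_right
              (mul_le_mul_right (ofReal_rpow_norm_le_prod_sing hd0 hu _) _) _
        _ ≤ ENNReal.ofReal (P * s ^ (-(5 / 2) : ℝ)) * ENNReal.ofReal K₁ := by
            rw [lintegral_const_mul' _ _ ENNReal.ofReal_ne_top]
            refine mul_le_mul_right (hsing _ (fun _ => 5 / (2 * d)) 0 fun i => ⟨by positivity, ?_⟩) _
            have : (3 : ℝ) ≤ d := by exact_mod_cast hd
            rw [div_le_div_iff₀ (by positivity) (by norm_num)]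
            linarith
        _ = _ := by
            rw [← ENNReal.ofReal_mul (by positivity)]
            congr 1; ring
    rw [e1]
    rw [← ofReal_norm] at e2
    exact (ENNReal.ofReal_le_ofReal_iff (by positivity)).1 e2
  have h4 : ‖oscInt e a q s‖ ≤ Real.sqrt (P * K₁) * s ^ (-(5 / 4) : ℝ) := by
    refine abs_le_of_sq_le_sq' ?_ (by positivity) |>.2
    rw [mul_pow, Real.sq_sqrt (by positivity), ← Real.rpow_natCast (s ^ _), ← Real.rpow_mul hs.le]
    rw [show (-(5 / 4) : ℝ) * ((2 : ℕ) : ℝ) = -(5 / 2) by norm_num]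
    exact hsq
  refine h4.trans ?_
  gcongr
  exact le_add_of_nonneg_left (by positivity)

/-- Integrability in time of the oscillatory integrals, uniformly in `q`. -/
lemma exists_lintegral_oscInt_le (d : ℕ) (hd : 3 ≤ d) {A B B' D : ℝ} (hA : 0 < A) (hD : 0 ≤ D) :
    ∃ K : ℝ, 1 ≤ K ∧ ∀ e : Momentum d → ℝ, UniformlyConvex A B e → BoundedDerivs B' e →
      ∀ a : Momentum d → ℝ, (∀ v, ‖v‖ = 1 → DirBound v 3 D (fun x => wt x * wt x) a) →
      ∀ q : Momentum d, ∫⁻ s in Set.Ioi 0, ‖oscInt e a q s‖ₑ ≤ ENNReal.ofReal K := by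
  obtain ⟨K, hK0, hK⟩ := exists_norm_oscInt_le d hd (B := B) (B' := B') hA hD
  -- The unit interval contributes `K`, and ∫_1^∞ s^(-5/4) ds = 4 contributes `4 * K`.
  refine ⟨1 + 5 * K, by linarith, fun e he heb a ha q => ?_⟩
  have h1 : ∫⁻ s in Set.Ioc 0 1, ‖oscInt e a q s‖ₑ ≤ ENNReal.ofReal K := by
    calc _ ≤ ∫⁻ _s in Set.Ioc (0 : ℝ) 1, ENNReal.ofReal K := by
          refine setLIntegral_mono' measurableSet_Ioc fun s hs => ?_
          rw [← ofReal_norm]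
          exact ENNReal.ofReal_le_ofReal (hK e he heb a ha q s hs.1).1
      _ = ENNReal.ofReal K := by simp
  have h2 : ∫⁻ s in Set.Ioi 1, ‖oscInt e a q s‖ₑ ≤ ENNReal.ofReal (4 * K) := by
    calc _ ≤ ∫⁻ s in Set.Ioi (1 : ℝ), ENNReal.ofReal (K * s ^ (-(5 / 4) : ℝ)) := by
          refine setLIntegral_mono' measurableSet_Ioi fun s hs => ?_
          rw [← ofReal_norm]
          exact ENNReal.ofReal_le_ofReal (hK e he heb a ha q s (zero_lt_one.trans hs)).2
      _ = ENNReal.ofReal (∫ s in Set.Ioi (1 : ℝ), K * s ^ (-(5 / 4) : ℝ)) := by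
          rw [ofReal_integral_eq_lintegral_ofReal]
          · exact (integrableOn_Ioi_rpow_of_lt (by norm_num) one_pos).const_mul K
          · exact (ae_restrict_iff' measurableSet_Ioi).2 (ae_of_all _ fun s hs =>
              mul_nonneg hK0 (Real.rpow_nonneg (zero_lt_one.trans hs).le _))
      _ = ENNReal.ofReal (4 * K) := by
          rw [integral_const_mul, integral_Ioi_rpow_of_lt (by norm_num) one_pos]
          congr 1; norm_num; ring
  rw [← Set.Ioc_union_Ioi_eq_Ioi (zero_le_one' ℝ)]
  refine (lintegral_union_le _ _ _).trans ((add_le_add h1 h2).trans ?_)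
  rw [← ENNReal.ofReal_add hK0 (by positivity)]
  exact ENNReal.ofReal_le_ofReal (by linarith)

/-! ### Time-ordered integrals as iterated convolutions -/

section IterConv

open scoped FourierTransform

/-- The iterated causal convolution of `f 0, …, f N`. -/
noncomputable def iterConv (f : ℕ → ℝ → ℂ) : ℕ → ℝ → ℂ
  | 0 => f 0
  | N + 1 => fun t => ∫ s in (0 : ℝ)..t, f (N + 1) s * iterConv f N (t - s)

lemma continuous_iterConv {f : ℕ → ℝ → ℂ} (hf : ∀ b, Continuous (f b)) :
    ∀ N, Continuous (iterConv f N)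
  | 0 => hf 0
  | N + 1 => by
    have h1 := hf (N + 1)
    have h2 := continuous_iterConv hf N
    refine intervalIntegral.continuous_parametric_intervalIntegral_of_continuous ?_ continuous_id
    fun_prop

/-- The simplex over which `timeInt` integrates. -/
def timeSimplex (t : ℝ) (N : ℕ) : Set (Fin N → ℝ) := {s | (∀ i, 0 ≤ s i) ∧ ∑ i, s i ≤ t}

lemma measurableSet_timeSimplex (t : ℝ) (N : ℕ) : MeasurableSet (timeSimplex t N) := by
  refine MeasurableSet.inter ?_ (measurableSet_le
    (by fun_prop : Measurable fun s : Fin N → ℝ => ∑ i, s i) measurable_const)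
  exact measurableSet_setOfPred.2 (Measurable.forall fun i =>
    measurableSet_setOfPred.1 (measurableSet_le measurable_const (measurable_pi_apply i)))

lemma timeSimplex_subset (t : ℝ) (N : ℕ) :
    timeSimplex t N ⊆ Set.Icc (0 : Fin N → ℝ) (fun _ => t) := fun s hs =>
  ⟨fun i => hs.1 i, fun i =>
    (Finset.single_le_sum (f := s) (fun j _ => hs.1 j) (Finset.mem_univ i)).trans hs.2⟩

lemma timeSimplex_of_neg {t : ℝ} (ht : t < 0) (N : ℕ) : timeSimplex t N = ∅ := by
  refine Set.eq_empty_of_forall_notMem fun s hs => ?_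
  have := Finset.sum_nonneg fun i (_ : i ∈ Finset.univ) => hs.1 i
  linarith [hs.2]

lemma continuous_timeSeq (t : ℝ) {N : ℕ} (b : ℕ) : Continuous fun s : Fin N → ℝ => timeSeq t s b := by
  cases b with
  | zero => simp only [timeSeq]; fun_prop
  | succ b =>
    simp only [timeSeq]
    by_cases h : b < N
    · simp only [h, dite_true]; fun_prop
    · simp only [h, dite_false]; fun_prop

lemma timeSeq_snoc (t x : ℝ) {N : ℕ} (s : Fin N → ℝ) {b : ℕ} (hb : b ≤ N) :
    timeSeq t (Fin.snoc (α := fun _ => ℝ) s x) b = timeSeq (t - x) s b := by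
  cases b with
  | zero =>
    simp only [timeSeq, Fin.sum_univ_castSucc, Fin.snoc_castSucc, Fin.snoc_last]
    ring
  | succ b =>
    have h1 : b < N := hb
    have h2 : b < N + 1 := by omega
    simp only [timeSeq, h1, h2, dite_true]
    exact Fin.snoc_castSucc (α := fun _ => ℝ) x s ⟨b, h1⟩

lemma timeSeq_snoc_last (t x : ℝ) {N : ℕ} (s : Fin N → ℝ) :
    timeSeq t (Fin.snoc (α := fun _ => ℝ) s x) (N + 1) = x := by
  simp only [timeSeq, Nat.lt_succ_self, dite_true]
  exact Fin.snoc_last (α := fun _ => ℝ) x s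

lemma snoc_mem_timeSimplex {t x : ℝ} {N : ℕ} {s : Fin N → ℝ} :
    Fin.snoc (α := fun _ => ℝ) s x ∈ timeSimplex t (N + 1) ↔
      0 ≤ x ∧ s ∈ timeSimplex (t - x) N := by
  simp only [timeSimplex, Set.mem_ofPred_eq, Fin.forall_fin_succ', Fin.snoc_castSucc, Fin.snoc_last,
    Fin.sum_univ_castSucc]
  rw [le_sub_iff_add_le]
  tauto

/-- Fubini for the last time `x`. The other times lie in the simplex of total time `t - x`; the time
`s_0`, being the remainder, is unchanged when the two totals decrease together. -/
lemma timeInt_prod_succ {f : ℕ → ℝ → ℂ} (hf : ∀ b, Continuous (f b)) (N : ℕ) {t : ℝ} (ht : 0 ≤ t) :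
    timeInt t (N + 1) (fun s => ∏ b ∈ Finset.range (N + 2), f b (s b)) =
      ∫ x in (0 : ℝ)..t, f (N + 1) x *
        timeInt (t - x) N (fun s => ∏ b ∈ Finset.range (N + 1), f b (s b)) := by
  set G : (Fin (N + 1) → ℝ) → ℂ := (timeSimplex t (N + 1)).indicator
    fun s => ∏ b ∈ Finset.range (N + 2), f b (timeSeq t s b) with hG
  have hGi : Integrable G := by
    rw [hG, integrable_indicator_iff (measurableSet_timeSimplex _ _)]
    refine IntegrableOn.mono_set ?_ (timeSimplex_subset t (N + 1))
    refine Continuous.integrableOn_Icc (continuous_finsetProd _ fun b _ => ?_)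
    exact (hf b).comp (continuous_timeSeq t b)
  have hmp := (volume_preserving_piFinSuccAbove (fun _ : Fin (N + 1) => ℝ) (Fin.last N)).symm
  have hsnoc : ∀ z : ℝ × (Fin N → ℝ),
      (MeasurableEquiv.piFinSuccAbove (fun _ : Fin (N + 1) => ℝ) (Fin.last N)).symm z =
        Fin.snoc (α := fun _ => ℝ) z.2 z.1 := fun z => by
    rw [MeasurableEquiv.piFinSuccAbove_symm_apply]
    exact Fin.insertNth_last' z.1 z.2
  have h1 : timeInt t (N + 1) (fun s => ∏ b ∈ Finset.range (N + 2), f b (s b)) = ∫ s, G s := by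
    rw [hG, integral_indicator (measurableSet_timeSimplex _ _)]; rfl
  have hGz : ∀ z : ℝ × (Fin N → ℝ), G (Fin.snoc (α := fun _ => ℝ) z.2 z.1) =
      (Set.Ici (0 : ℝ)).indicator (fun x => f (N + 1) x * (timeSimplex (t - x) N).indicator
        (fun s => ∏ b ∈ Finset.range (N + 1), f b (timeSeq (t - x) s b)) z.2) z.1 := by
    intro z
    by_cases h0 : 0 ≤ z.1
    · by_cases h2 : z.2 ∈ timeSimplex (t - z.1) N
      · rw [hG, Set.indicator_of_mem (snoc_mem_timeSimplex.2 ⟨h0, h2⟩),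
          Set.indicator_of_mem (Set.mem_Ici.2 h0), Set.indicator_of_mem h2,
          Finset.prod_range_succ, timeSeq_snoc_last, mul_comm]
        congr 1
        refine Finset.prod_congr rfl fun b hb => ?_
        rw [timeSeq_snoc _ _ _ (by simpa [Nat.lt_succ_iff] using hb)]
      · rw [hG, Set.indicator_of_notMem (fun h => h2 (snoc_mem_timeSimplex.1 h).2),
          Set.indicator_of_mem (Set.mem_Ici.2 h0), Set.indicator_of_notMem h2, mul_zero]
    · rw [hG, Set.indicator_of_notMem (fun h => h0 (snoc_mem_timeSimplex.1 h).1),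
        Set.indicator_of_notMem (by simpa using h0)]
  rw [h1, ← hmp.integral_comp' G]
  have hGi' : Integrable (fun z => G ((MeasurableEquiv.piFinSuccAbove
      (fun _ : Fin (N + 1) => ℝ) (Fin.last N)).symm z)) (Measure.prod volume volume) :=
    (hmp.integrable_comp_emb (MeasurableEquiv.measurableEmbedding _)).2 hGi
  rw [Measure.volume_eq_prod, integral_prod _ hGi']
  simp only [hsnoc]
  rw [intervalIntegral.integral_of_le ht, ← integral_Icc_eq_integral_Ioc,
    ← integral_indicator measurableSet_Icc]
  refine integral_congr_ae (ae_of_all _ fun x => ?_)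
  simp only
  by_cases h0 : 0 ≤ x
  · have e1 : ∀ y : Fin N → ℝ, G (Fin.snoc (α := fun _ => ℝ) y x) = _ := fun y => hGz (x, y)
    simp only [Set.indicator_of_mem (Set.mem_Ici.2 h0)] at e1
    simp only [e1]
    rw [integral_const_mul, integral_indicator (measurableSet_timeSimplex _ _)]
    by_cases hx : x ≤ t
    · rw [Set.indicator_of_mem (Set.mem_Icc.2 ⟨h0, hx⟩)]
      rfl
    · rw [Set.indicator_of_notMem fun h => hx h.2, timeSimplex_of_neg (by linarith)]
      simp
  · have e1 : ∀ y : Fin N → ℝ, G (Fin.snoc (α := fun _ => ℝ) y x) = 0 := fun y => by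
      rw [hGz (x, y), Set.indicator_of_notMem (by simpa using h0)]
    simp only [e1, integral_zero]
    rw [Set.indicator_of_notMem fun h => h0 h.1]

lemma timeInt_prod {f : ℕ → ℝ → ℂ} (hf : ∀ b, Continuous (f b)) (N : ℕ) {t : ℝ} (ht : 0 ≤ t) :
    timeInt t N (fun s => ∏ b ∈ Finset.range (N + 1), f b (s b)) = iterConv f N t := by
  induction N generalizing t with
  | zero =>
    have : timeSimplex t 0 = Set.univ := by
      ext s; simp [timeSimplex, ht]
    rw [timeInt]
    change ∫ s in timeSimplex t 0, _ = _
    rw [this, setIntegral_univ, integral_unique]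
    rw [measureReal_def, volume_pi, Measure.pi_of_empty, Measure.dirac_apply_of_mem (Set.mem_univ _)]
    simp [timeSeq, iterConv]
  | succ N ih =>
    rw [timeInt_prod_succ hf N ht, iterConv]
    refine intervalIntegral.integral_congr fun x hx => ?_
    rw [Set.uIcc_of_le ht] at hx
    rw [ih (sub_nonneg.2 hx.2)]

/-- The causal, exponentially damped version of a function of time. -/
noncomputable def damp (η : ℝ) (f : ℝ → ℂ) : ℝ → ℂ :=
  (Set.Ici (0 : ℝ)).indicator fun s => (Real.exp (-(η * s)) : ℂ) * f s

/-- The exponential factors of `s` and `t - s` multiply to that of `t`, and the two causal cut-offs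
confine `s` to `[0, t]`. Damping therefore commutes with causal convolution. -/
lemma damp_iterConv_succ (η : ℝ) (f : ℕ → ℝ → ℂ) (N : ℕ) :
    convolution (damp η (f (N + 1))) (damp η (iterConv f N)) (ContinuousLinearMap.mul ℂ ℂ) volume =
      damp η (iterConv f (N + 1)) := by
  funext t
  rw [convolution_def]
  simp only [ContinuousLinearMap.mul_apply']
  rcases lt_or_ge t 0 with ht | ht
  · rw [damp, damp, damp, Set.indicator_of_notMem (by simpa using ht)]
    refine integral_eq_zero_of_ae (ae_of_all _ fun s => ?_)
    beta_reduce
    rcases lt_or_ge s 0 with hs | hs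
    · rw [Set.indicator_of_notMem (by simpa using hs), zero_mul]; rfl
    · rw [Set.indicator_of_notMem (s := Set.Ici (0 : ℝ)) (a := t - s)
        (by simp only [Set.mem_Ici, not_le]; linarith), mul_zero]; rfl
  · rw [damp, damp, damp, Set.indicator_of_mem (Set.mem_Ici.2 ht), iterConv]
    beta_reduce
    rw [intervalIntegral.integral_of_le ht, ← integral_Icc_eq_integral_Ioc,
      ← integral_const_mul, ← integral_indicator measurableSet_Icc]
    refine integral_congr_ae (ae_of_all _ fun s => ?_)
    simp only
    by_cases h0 : 0 ≤ s
    · rw [Set.indicator_of_mem (Set.mem_Ici.2 h0)]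
      by_cases h1 : s ≤ t
      · rw [Set.indicator_of_mem (Set.mem_Ici.2 (sub_nonneg.2 h1)),
          Set.indicator_of_mem (Set.mem_Icc.2 ⟨h0, h1⟩), mul_mul_mul_comm, ← Complex.ofReal_mul,
          ← Real.exp_add]
        congr 3; ring_nf
      · rw [Set.indicator_of_notMem (s := Set.Ici (0 : ℝ)) (a := t - s) (by simpa using h1),
          Set.indicator_of_notMem (fun h => h1 h.2), mul_zero]
    · rw [Set.indicator_of_notMem (by simpa using h0),
        Set.indicator_of_notMem (s := Set.Icc 0 t) (fun h => h0 h.1), zero_mul]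

lemma integrable_damp_iterConv {η : ℝ} {f : ℕ → ℝ → ℂ} (hf : ∀ b, Integrable (damp η (f b))) :
    ∀ N, Integrable (damp η (iterConv f N))
  | 0 => hf 0
  | N + 1 => by
    rw [← damp_iterConv_succ]
    exact (hf (N + 1)).integrable_convolution _ (integrable_damp_iterConv hf N)

lemma fourier_damp_iterConv {η : ℝ} {f : ℕ → ℝ → ℂ} (hf : ∀ b, Integrable (damp η (f b)))
    (N : ℕ) (ξ : ℝ) :
    𝓕 (damp η (iterConv f N)) ξ = ∏ b ∈ Finset.range (N + 1), 𝓕 (damp η (f b)) ξ := by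
  induction N with
  | zero => simp [iterConv]
  | succ N ih =>
    rw [← damp_iterConv_succ, Real.fourier_mul_convolution_eq (hf _)
      (integrable_damp_iterConv hf N), ih, Finset.prod_range_succ _ (N + 1), mul_comm]

/-- Fourier inversion at a time `t > 0`, where the damped function is continuous in spite of its
possible jump at zero; the transform of the convolution is the product of the transforms. For `η =
t⁻¹` undoing the damping costs `exp 1`. -/
lemma enorm_iterConv_le {η : ℝ} {f : ℕ → ℝ → ℂ} (hc : ∀ b, Continuous (f b))
    (hf : ∀ b, Integrable (damp η (f b))) (N : ℕ) {t : ℝ} (ht : 0 < t) :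
    ‖iterConv f N t‖ₑ ≤ ENNReal.ofReal (Real.exp (η * t)) *
      ∫⁻ ξ, ∏ b ∈ Finset.range (N + 1), ‖𝓕 (damp η (f b)) ξ‖ₑ := by
  -- If the right-hand side is finite, the transform is integrable and inversion is legitimate;
  -- otherwise there is nothing to prove.
  by_cases htop : ∫⁻ ξ, ∏ b ∈ Finset.range (N + 1), ‖𝓕 (damp η (f b)) ξ‖ₑ = ⊤
  · rw [htop, ENNReal.mul_top (by simpa using Real.exp_pos _)]
    exact le_top
  set F := damp η (iterConv f N) with hF
  have hFi : Integrable F := integrable_damp_iterConv hf N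
  have hFe : ∀ ξ, ‖𝓕 F ξ‖ₑ = ∏ b ∈ Finset.range (N + 1), ‖𝓕 (damp η (f b)) ξ‖ₑ := fun ξ => by
    rw [hF, fourier_damp_iterConv hf, ← ofReal_norm, norm_prod,
      ENNReal.ofReal_prod_of_nonneg fun _ _ => norm_nonneg _]
    simp only [ofReal_norm]
  have hFF : Integrable (𝓕 F) := by
    refine ⟨(VectorFourier.fourierIntegral_continuous Real.continuous_fourierChar
      (L := innerₗ ℝ) (by exact continuous_inner) hFi).aestronglyMeasurable, ?_⟩
    rw [hasFiniteIntegral_iff_enorm]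
    simp only [hFe]
    exact lt_top_iff_ne_top.2 htop
  have hFt : F =ᶠ[𝓝 t] fun s => (Real.exp (-(η * s)) : ℂ) * iterConv f N s := by
    filter_upwards [lt_mem_nhds ht] with s hs
    rw [hF, damp, Set.indicator_of_mem (Set.mem_Ici.2 hs.le)]
  have hcont : ContinuousAt F t := by
    have h1 := continuous_iterConv hc N
    refine ContinuousAt.congr (Continuous.continuousAt ?_) hFt.symm
    fun_prop
  have hinv := hFi.fourierInv_fourier_eq hFF hcont
  have h2 : ‖F t‖ₑ ≤ ∫⁻ ξ, ‖𝓕 F ξ‖ₑ := by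
    rw [← hinv, Real.fourierInv_eq']
    refine (enorm_integral_le_lintegral_enorm _).trans (lintegral_mono fun ξ => ?_)
    rw [enorm_smul, ← ofReal_norm (Complex.exp _), Complex.norm_exp_ofReal_mul_I,
      ENNReal.ofReal_one, one_mul]
  have h3 : iterConv f N t = (Real.exp (η * t) : ℂ) * F t := by
    rw [hFt.eq_of_nhds, ← mul_assoc, ← Complex.ofReal_mul, ← Real.exp_add, add_neg_cancel,
      Real.exp_zero, Complex.ofReal_one, one_mul]
  rw [h3, enorm_mul]
  simp only [hFe] at h2
  refine mul_le_mul' ?_ h2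
  rw [← ofReal_norm, Complex.norm_real, Real.norm_of_nonneg (Real.exp_pos _).le]

/-! ### Fourier transforms of recollision factors and of free propagators. -/

lemma integrable_damp {η : ℝ} (hη : 0 ≤ η) {g : ℝ → ℂ} (hg : IntegrableOn g (Set.Ici 0))
    (hc : Continuous g) : Integrable (damp η g) := by
  rw [damp, integrable_indicator_iff measurableSet_Ici]
  refine Integrable.mono' hg.norm (by fun_prop) ?_
  refine (ae_restrict_iff' measurableSet_Ici).2 (ae_of_all _ fun s hs => ?_)
  rw [norm_mul, Complex.norm_real, Real.norm_of_nonneg (Real.exp_pos _).le]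
  refine mul_le_of_le_one_left (norm_nonneg _) (Real.exp_le_one_iff.2 ?_)
  have := mul_nonneg hη (Set.mem_Ici.1 hs)
  linarith

lemma enorm_fourier_damp_le {η : ℝ} (hη : 0 ≤ η) (g : ℝ → ℂ) (ξ : ℝ) :
    ‖𝓕 (damp η g) ξ‖ₑ ≤ ∫⁻ s in Set.Ioi 0, ‖g s‖ₑ := by
  rw [Real.fourier_real_eq_integral_exp_smul]
  refine (enorm_integral_le_lintegral_enorm _).trans ?_
  rw [← lintegral_indicator measurableSet_Ioi]
  refine lintegral_mono_ae ((Measure.ae_ne volume (0 : ℝ)).mono fun s hs => ?_)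
  rw [enorm_smul, ← ofReal_norm (Complex.exp _), Complex.norm_exp_ofReal_mul_I,
      ENNReal.ofReal_one, one_mul, damp]
  rcases lt_or_ge 0 s with h | h
  · rw [Set.indicator_of_mem (Set.mem_Ici.2 h.le), Set.indicator_of_mem (Set.mem_Ioi.2 h),
      enorm_mul]
    refine mul_le_of_le_one_left' ?_
    rw [← ofReal_norm, Complex.norm_real, Real.norm_of_nonneg (Real.exp_pos _).le]
    refine ENNReal.ofReal_le_one.2 (Real.exp_le_one_iff.2 ?_)
    have := mul_nonneg hη h.le
    linarith
  · rw [Set.indicator_of_notMem]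
    · simp
    · simpa using lt_of_le_of_ne h hs

lemma damp_exp (η E : ℝ) : damp η (fun s => Complex.exp (-Complex.I * ((s * E : ℝ) : ℂ))) =
    (Set.Ici (0 : ℝ)).indicator fun s => Complex.exp (-(η + Complex.I * E) * (s : ℂ)) := by
  rw [damp]
  congr 1
  funext s
  rw [Complex.ofReal_exp, ← Complex.exp_add]
  congr 1
  push_cast
  ring

lemma integrable_damp_exp {η : ℝ} (hη : 0 < η) (E : ℝ) :
    Integrable (damp η (fun s => Complex.exp (-Complex.I * ((s * E : ℝ) : ℂ)))) := by
  rw [damp_exp, integrable_indicator_iff measurableSet_Ici, integrableOn_Ici_iff_integrableOn_Ioi]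
  exact integrableOn_exp_mul_complex_Ioi (by simpa using hη) 0

/-- The transform is exactly 1/(η + iy) with `y = E + 2 * π * ξ`, and the modulus of the denominator
dominates both `|y|` and `η`. -/
lemma enorm_fourier_damp_exp_le {η : ℝ} (hη : 0 < η) (E ξ : ℝ) :
    ‖𝓕 (damp η (fun s => Complex.exp (-Complex.I * ((s * E : ℝ) : ℂ)))) ξ‖ₑ ≤
      ENNReal.ofReal (cut η (E + 2 * Real.pi * ξ)) := by
  set y := E + 2 * Real.pi * ξ with hy
  have hre : (-(η + Complex.I * y) : ℂ).re < 0 := by simpa using hη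
  have h1 : 𝓕 (damp η (fun s => Complex.exp (-Complex.I * ((s * E : ℝ) : ℂ)))) ξ =
      (η + Complex.I * y : ℂ)⁻¹ := by
    rw [Real.fourier_real_eq_integral_exp_smul, damp_exp]
    have : ∀ s : ℝ, Complex.exp (((-2 * Real.pi * s * ξ : ℝ) : ℂ) * Complex.I) •
        (Set.Ici (0 : ℝ)).indicator (fun s => Complex.exp (-(η + Complex.I * E) * (s : ℂ))) s =
        (Set.Ici (0 : ℝ)).indicator (fun s => Complex.exp (-(η + Complex.I * y) * (s : ℂ))) s := by
      intro s
      by_cases h : 0 ≤ s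
      · rw [Set.indicator_of_mem (Set.mem_Ici.2 h), Set.indicator_of_mem (Set.mem_Ici.2 h),
          smul_eq_mul, ← Complex.exp_add, hy]
        congr 1
        push_cast
        ring
      · rw [Set.indicator_of_notMem (by simpa using h), Set.indicator_of_notMem (by simpa using h),
          smul_zero]
    simp only [this]
    rw [integral_indicator measurableSet_Ici, integral_Ici_eq_integral_Ioi,
      integral_exp_mul_complex_Ioi hre]
    simp only [Complex.ofReal_zero, mul_zero, Complex.exp_zero]
    rw [neg_div_neg_eq, one_div]
  rw [h1, ← ofReal_norm, norm_inv]
  refine ENNReal.ofReal_le_ofReal (inv_anti₀ (lt_max_of_lt_right hη) (max_le ?_ ?_))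
  · simpa using Complex.abs_im_le_norm (η + Complex.I * y : ℂ)
  · simpa [abs_of_pos hη] using Complex.abs_re_le_norm (η + Complex.I * y : ℂ)

end IterConv

/-! ### The slots of an electron line -/

section Slots

variable {n N : ℕ} {m : Fin (n + 1) → ℕ}

lemma externalIndex_add_le (m : Fin (n + 1) → ℕ) {i j : Fin (n + 1)} (hij : i < j) :
    externalIndex m i + 2 * m i + 1 ≤ externalIndex m j := by
  have h1 : ∑ l ∈ Finset.univ.filter (fun l : Fin (n + 1) => l < i), m l + m i ≤
      ∑ l ∈ Finset.univ.filter (fun l : Fin (n + 1) => l < j), m l := by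
    rw [add_comm, ← Finset.sum_insert (a := i) (by simp)]
    refine Finset.sum_le_sum_of_subset fun l hl => ?_
    simp only [Finset.mem_insert, Finset.mem_filter, Finset.mem_univ, true_and] at hl ⊢
    rcases hl with rfl | hl
    · exact hij
    · exact hl.trans hij
  have h2 : (i : ℕ) < j := hij
  unfold externalIndex
  omega

lemma externalIndex_last_add (hm : m ∈ patterns n N) (j : Fin (n + 1)) :
    externalIndex m j + 2 * m j ≤ N := by
  have h1 : ∑ l ∈ Finset.univ.filter (fun l : Fin (n + 1) => l < j), m l + m j ≤ ∑ l, m l := by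
    rw [add_comm, ← Finset.sum_insert (a := j) (by simp)]
    exact Finset.sum_le_sum_of_subset (Finset.subset_univ _)
  have h2 : n + 2 * ∑ l, m l = N := hm
  have := j.2
  unfold externalIndex
  omega

lemma freeSlots_disjoint_recollisionSlots (m : Fin (n + 1) → ℕ) (j : Fin (n + 1)) :
    Disjoint (freeSlots m j) (recollisionSlots m j) := by
  rw [Finset.disjoint_left]
  intro b hb hb'
  simp only [freeSlots, recollisionSlots, Finset.mem_image, Finset.mem_range] at hb hb'
  obtain ⟨i, -, rfl⟩ := hb
  obtain ⟨i', -, h⟩ := hb'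
  omega

lemma card_freeSlots (m : Fin (n + 1) → ℕ) (j : Fin (n + 1)) : (freeSlots m j).card = m j + 1 := by
  rw [freeSlots, Finset.card_image_of_injective _ (fun a b h => by simpa using h),
    Finset.card_range]

lemma card_recollisionSlots (m : Fin (n + 1) → ℕ) (j : Fin (n + 1)) :
    (recollisionSlots m j).card = m j := by
  rw [recollisionSlots, Finset.card_image_of_injective _ (fun a b h => by simpa using h),
    Finset.card_range]

lemma slots_bounds (m : Fin (n + 1) → ℕ) (j : Fin (n + 1)) {b : ℕ}
    (hb : b ∈ freeSlots m j ∪ recollisionSlots m j) :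
    externalIndex m j ≤ b ∧ b ≤ externalIndex m j + 2 * m j := by
  simp only [freeSlots, recollisionSlots, Finset.mem_union, Finset.mem_image,
    Finset.mem_range] at hb
  rcases hb with ⟨i, hi, rfl⟩ | ⟨i, hi, rfl⟩ <;> omega

lemma slots_pairwiseDisjoint (m : Fin (n + 1) → ℕ) :
    ((Finset.univ : Finset (Fin (n + 1))) : Set (Fin (n + 1))).PairwiseDisjoint
      (fun j => freeSlots m j ∪ recollisionSlots m j) := by
  intro i _ j _ hij
  rw [Function.onFun, Finset.disjoint_left]
  intro b hb hb'
  have h1 := slots_bounds m i hb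
  have h2 := slots_bounds m j hb'
  rcases lt_or_gt_of_ne hij with h | h
  · have := externalIndex_add_le m h
    omega
  · have := externalIndex_add_le m h
    omega

/-- The group of `j` has `2 * m j + 1` slots, which sum to `n + 1 + 2 * ∑ m = N + 1`; disjointness
and inclusion then force equality. -/
lemma biUnion_slots (hm : m ∈ patterns n N) :
    Finset.univ.biUnion (fun j => freeSlots m j ∪ recollisionSlots m j) = Finset.range (N + 1) := by
  refine Finset.eq_of_subset_of_card_le ?_ ?_
  · intro b hb
    obtain ⟨j, -, hj⟩ := Finset.mem_biUnion.1 hb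
    have h1 := slots_bounds m j hj
    have h2 := externalIndex_last_add hm j
    simp only [Finset.mem_range]
    omega
  · rw [Finset.card_biUnion fun i hi j hj hij => slots_pairwiseDisjoint m hi hj hij]
    simp only [Finset.card_union_of_disjoint (freeSlots_disjoint_recollisionSlots m _),
      card_freeSlots, card_recollisionSlots]
    have h2 : n + 2 * ∑ l, m l = N := hm
    rw [Finset.card_range, Finset.sum_add_distrib, Finset.sum_add_distrib]
    simp only [Finset.sum_const, Finset.card_univ, Fintype.card_fin, smul_eq_mul, mul_one]
    omega

lemma prod_slots {M : Type*} [CommMonoid M] (hm : m ∈ patterns n N) (h : ℕ → M) :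
    ∏ b ∈ Finset.range (N + 1), h b =
      ∏ j, ((∏ b ∈ freeSlots m j, h b) * ∏ b ∈ recollisionSlots m j, h b) := by
  rw [← biUnion_slots hm, Finset.prod_biUnion (slots_pairwiseDisjoint m)]
  exact Finset.prod_congr rfl fun j _ =>
    Finset.prod_union (freeSlots_disjoint_recollisionSlots m j)

/-- The function attached to the slot `b`. -/
noncomputable def slotFun (m : Fin (n + 1) → ℕ) (φ ψ : Fin (n + 1) → ℝ → ℂ) (b : ℕ) : ℝ → ℂ := by
  classical
  -- Indices beyond `N` receive `φ 0`. They never occur in a product over slots, but continuity and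
  -- integrability then hold for all indices.
  exact if h : ∃ j, b ∈ freeSlots m j then φ h.choose
    else if h : ∃ j, b ∈ recollisionSlots m j then ψ h.choose else φ 0

lemma slots_unique {i j : Fin (n + 1)} {b : ℕ} (hi : b ∈ freeSlots m i ∪ recollisionSlots m i)
    (hj : b ∈ freeSlots m j ∪ recollisionSlots m j) : i = j := by
  by_contra h
  exact (Finset.disjoint_left.1 (slots_pairwiseDisjoint m (Finset.mem_coe.2 (Finset.mem_univ i))
    (Finset.mem_coe.2 (Finset.mem_univ j)) h)) hi hj

lemma slotFun_free (φ ψ : Fin (n + 1) → ℝ → ℂ) {j : Fin (n + 1)} {b : ℕ}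
    (hb : b ∈ freeSlots m j) : slotFun m φ ψ b = φ j := by
  have h : ∃ j, b ∈ freeSlots m j := ⟨j, hb⟩
  rw [slotFun, dif_pos h, slots_unique (Finset.mem_union_left _ h.choose_spec)
    (Finset.mem_union_left _ hb)]

lemma slotFun_recollision (φ ψ : Fin (n + 1) → ℝ → ℂ) {j : Fin (n + 1)} {b : ℕ}
    (hb : b ∈ recollisionSlots m j) : slotFun m φ ψ b = ψ j := by
  have h : ∃ j, b ∈ recollisionSlots m j := ⟨j, hb⟩
  have h' : ¬ ∃ j, b ∈ freeSlots m j := by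
    rintro ⟨i, hi⟩
    have := slots_unique (Finset.mem_union_left _ hi) (Finset.mem_union_right _ hb)
    subst this
    exact Finset.disjoint_left.1 (freeSlots_disjoint_recollisionSlots m i) hi hb
  rw [slotFun, dif_neg h', dif_pos h, slots_unique (Finset.mem_union_right _ h.choose_spec)
    (Finset.mem_union_right _ hb)]

lemma slotFun_induction {φ ψ : Fin (n + 1) → ℝ → ℂ} {p : (ℝ → ℂ) → Prop} (hφ : ∀ j, p (φ j))
    (hψ : ∀ j, p (ψ j)) (b : ℕ) : p (slotFun m φ ψ b) := by
  unfold slotFun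
  split_ifs
  exacts [hφ _, hψ _, hφ _]

/-- The integrand of a line amplitude as a product over all slots. -/
lemma line_integrand_eq (hm : m ∈ patterns n N) (φ ψ : Fin (n + 1) → ℝ → ℂ) (s : ℕ → ℝ) :
    ∏ j, ((∏ b ∈ freeSlots m j, φ j (s b)) * ∏ b ∈ recollisionSlots m j, ψ j (s b)) =
      ∏ b ∈ Finset.range (N + 1), slotFun m φ ψ b (s b) := by
  rw [prod_slots hm]
  refine Finset.prod_congr rfl fun j _ => ?_
  congr 1
  · exact Finset.prod_congr rfl fun b hb => by rw [slotFun_free φ ψ hb]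
  · exact Finset.prod_congr rfl fun b hb => by rw [slotFun_recollision φ ψ hb]

/-- The time integral of an electron line, bounded by an integral over an energy variable. -/
lemma enorm_timeInt_line_le (hm : m ∈ patterns n N) (E : Fin (n + 1) → ℝ)
    {ψ : Fin (n + 1) → ℝ → ℂ} (hψ : ∀ j, Continuous (ψ j)) {K : ℝ}
    (hK : ∀ j, ∫⁻ s in Set.Ioi 0, ‖ψ j s‖ₑ ≤ ENNReal.ofReal K) {t : ℝ} (ht : 0 < t) :
    ‖timeInt t N fun s => ∏ j, ((∏ b ∈ freeSlots m j,
        Complex.exp (-Complex.I * ((s b * E j : ℝ) : ℂ))) * ∏ b ∈ recollisionSlots m j, ψ j (s b))‖ₑ ≤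
      ENNReal.ofReal (Real.exp 1) * (ENNReal.ofReal K ^ (∑ j, m j) *
        ∫⁻ ξ : ℝ, ∏ j, ENNReal.ofReal (cut t⁻¹ (E j + 2 * Real.pi * ξ)) ^ (m j + 1)) := by
  set φ : Fin (n + 1) → ℝ → ℂ := fun j s => Complex.exp (-Complex.I * ((s * E j : ℝ) : ℂ)) with hφ
  -- The damping rate `t⁻¹` keeps the cost of undamping at `exp 1` and truncates the resolvents at
  -- height `t`.
  have hη : 0 < t⁻¹ := inv_pos.2 ht
  have hφc : ∀ j, Continuous (φ j) := fun j => by rw [hφ]; fun_prop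
  have hint : ∀ j, IntegrableOn (ψ j) (Set.Ici 0) := fun j => by
    rw [integrableOn_Ici_iff_integrableOn_Ioi]
    refine ⟨(hψ j).aestronglyMeasurable, ?_⟩
    rw [hasFiniteIntegral_iff_enorm]
    exact (hK j).trans_lt ENNReal.ofReal_lt_top
  have e1 : timeInt t N (fun s => ∏ j, ((∏ b ∈ freeSlots m j,
        Complex.exp (-Complex.I * ((s b * E j : ℝ) : ℂ))) * ∏ b ∈ recollisionSlots m j, ψ j (s b))) =
      iterConv (slotFun m φ ψ) N t := by
    rw [← timeInt_prod (slotFun_induction hφc hψ) N ht.le]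
    congr 1
    funext s
    exact line_integrand_eq hm φ ψ s
  rw [e1]
  refine (enorm_iterConv_le (slotFun_induction hφc hψ) (slotFun_induction (p := fun g =>
    Integrable (damp t⁻¹ g)) (fun j => integrable_damp_exp hη (E j))
    (fun j => integrable_damp hη.le (hint j) (hψ j))) N ht).trans ?_
  rw [inv_mul_cancel₀ ht.ne', ← lintegral_const_mul' _ _ (ENNReal.pow_ne_top ENNReal.ofReal_ne_top)]
  refine mul_le_mul_right (lintegral_mono fun ξ => ?_) _
  rw [prod_slots hm, ← Finset.prod_pow_eq_pow_sum, ← Finset.prod_mul_distrib]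
  refine Finset.prod_le_prod' fun j _ => ?_
  rw [mul_comm]
  refine mul_le_mul' ?_ ?_
  · rw [← card_recollisionSlots m j, ← Finset.prod_const]
    refine Finset.prod_le_prod' fun b hb => ?_
    rw [slotFun_recollision φ ψ hb]
    exact (enorm_fourier_damp_le hη.le _ _).trans (hK j)
  · rw [← card_freeSlots m j, ← Finset.prod_const]
    refine Finset.prod_le_prod' fun b hb => ?_
    rw [slotFun_free φ ψ hb]
    exact enorm_fourier_damp_exp_le hη (E j) ξ

end Slots

/-! ### Integrals over the energy variable -/

lemma lintegral_comp_affine {f : ℝ → ℝ≥0∞} (hf : Measurable f) (a : ℝ) {b : ℝ} (hb : b ≠ 0) :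
    ∫⁻ x, f (a + b * x) = ENNReal.ofReal |b⁻¹| * ∫⁻ x, f x := by
  have h1 : ∫⁻ x, f (a + b * x) = ∫⁻ y, f (a + y) ∂(Measure.map (fun x => b * x) volume) := by
    rw [lintegral_map (by fun_prop) (by fun_prop)]
  rw [h1, Real.map_volume_mul_left hb, lintegral_smul_measure, lintegral_add_left_eq_self,
    smul_eq_mul]

lemma lintegral_comp_two_pi_le {f : ℝ → ℝ≥0∞} (hf : Measurable f) (a : ℝ) :
    ∫⁻ x, f (a + 2 * Real.pi * x) ≤ ∫⁻ x, f x := by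
  have h2 := Real.pi_gt_three
  rw [lintegral_comp_affine hf a (by positivity)]
  refine mul_le_of_le_one_left' (ENNReal.ofReal_le_one.2 ?_)
  rw [abs_inv, abs_of_pos (by positivity)]
  exact inv_le_one_of_one_le₀ (by linarith)

lemma lintegral_inv_one_add_sq_le : ∫⁻ y : ℝ, ENNReal.ofReal ((1 + y ^ 2)⁻¹) ≤ ENNReal.ofReal 4 := by
  rw [← ofReal_integral_eq_lintegral_ofReal integrable_inv_one_add_sq
    (ae_of_all _ fun x => by positivity), integral_univ_inv_one_add_sq]
  exact ENNReal.ofReal_le_ofReal Real.pi_le_four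

lemma cut_sq_le {η : ℝ} (hη : 0 < η) (y : ℝ) :
    cut η y ^ 2 ≤ 2 * (η ^ 2)⁻¹ * (1 + (η⁻¹ * y) ^ 2)⁻¹ := by
  have h1 : 2 * (η ^ 2)⁻¹ * (1 + (η⁻¹ * y) ^ 2)⁻¹ = 2 * (η ^ 2 + y ^ 2)⁻¹ := by
    field_simp
  rw [h1, cut, inv_pow, ← div_eq_mul_inv, inv_le_comm₀ (by positivity) (by positivity), inv_div]
  rcases le_total |y| η with h | h
  · rw [max_eq_right h]
    have : y ^ 2 ≤ η ^ 2 := by rw [← sq_abs]; gcongr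
    linarith
  · rw [max_eq_left h, sq_abs]
    have : η ^ 2 ≤ y ^ 2 := by rw [← sq_abs y]; gcongr
    linarith

lemma lintegral_cut_sq_le {t : ℝ} (ht : 0 < t) :
    ∫⁻ y, ENNReal.ofReal (cut t⁻¹ y ^ 2) ≤ ENNReal.ofReal (8 * t) := by
  have hm : Measurable fun y : ℝ => ENNReal.ofReal ((1 + y ^ 2)⁻¹) := by fun_prop
  calc ∫⁻ y, ENNReal.ofReal (cut t⁻¹ y ^ 2)
      ≤ ∫⁻ y, ENNReal.ofReal (2 * t ^ 2) * ENNReal.ofReal ((1 + (0 + t * y) ^ 2)⁻¹) := by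
        refine lintegral_mono fun y => ?_
        rw [← ENNReal.ofReal_mul (by positivity)]
        refine ENNReal.ofReal_le_ofReal ((cut_sq_le (inv_pos.2 ht) y).trans_eq ?_)
        rw [inv_pow, inv_inv, inv_inv, zero_add]
    _ = ENNReal.ofReal (2 * t ^ 2) * (ENNReal.ofReal |t⁻¹| *
          ∫⁻ y : ℝ, ENNReal.ofReal ((1 + y ^ 2)⁻¹)) := by
        rw [lintegral_const_mul' _ _ ENNReal.ofReal_ne_top, lintegral_comp_affine hm 0 ht.ne']
    _ ≤ ENNReal.ofReal (2 * t ^ 2) * (ENNReal.ofReal |t⁻¹| * ENNReal.ofReal 4) :=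
        mul_le_mul_right (mul_le_mul_right lintegral_inv_one_add_sq_le _) _
    _ = _ := by
        rw [← ENNReal.ofReal_mul (abs_nonneg _), ← ENNReal.ofReal_mul (by positivity),
          abs_of_pos (inv_pos.2 ht)]
        congr 1
        field_simp
        norm_num

/-- A product is at most the sum of the squares. Nothing is gained from the distance of `a` and `b`;
this is the bound for the energy of one of the two lines, while the other receives a logarithmic
one. -/
lemma lintegral_cut_mul_cut_le {t : ℝ} (ht : 0 < t) (a b : ℝ) :
    ∫⁻ x : ℝ, ENNReal.ofReal (cut t⁻¹ (a + 2 * Real.pi * x)) *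
      ENNReal.ofReal (cut t⁻¹ (b + 2 * Real.pi * x)) ≤ ENNReal.ofReal (16 * t) := by
  have hη := inv_pos.2 ht
  have hm : Measurable fun y : ℝ => ENNReal.ofReal (cut t⁻¹ y ^ 2) :=
    ((measurable_cut _).pow_const 2).ennreal_ofReal
  have hm' : ∀ a : ℝ, Measurable fun x : ℝ => ENNReal.ofReal (cut t⁻¹ (a + 2 * Real.pi * x) ^ 2) :=
    fun a => hm.comp (by fun_prop)
  calc _ ≤ ∫⁻ x : ℝ, (ENNReal.ofReal (cut t⁻¹ (a + 2 * Real.pi * x) ^ 2) +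
        ENNReal.ofReal (cut t⁻¹ (b + 2 * Real.pi * x) ^ 2)) := by
        refine lintegral_mono fun x => ?_
        rw [← ENNReal.ofReal_mul (cut_pos hη _).le, ← ENNReal.ofReal_add (sq_nonneg _) (sq_nonneg _)]
        refine ENNReal.ofReal_le_ofReal ?_
        nlinarith [sq_nonneg (cut t⁻¹ (a + 2 * Real.pi * x) - cut t⁻¹ (b + 2 * Real.pi * x)),
          sq_nonneg (cut t⁻¹ (a + 2 * Real.pi * x)), sq_nonneg (cut t⁻¹ (b + 2 * Real.pi * x))]
    _ ≤ ENNReal.ofReal (8 * t) + ENNReal.ofReal (8 * t) := by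
        rw [lintegral_add_left (hm' a)]
        exact add_le_add ((lintegral_comp_two_pi_le hm a).trans (lintegral_cut_sq_le ht))
          ((lintegral_comp_two_pi_le hm b).trans (lintegral_cut_sq_le ht))
    _ = _ := by
        rw [← ENNReal.ofReal_add (by positivity) (by positivity)]
        congr 1; ring

/-- A majorant of the cut-off resolvent, in which the local and the global part are separated. -/
noncomputable def cutMajorant (η y : ℝ) : ℝ≥0∞ :=
  (Set.Icc (-1) 1).indicator (fun y => ENNReal.ofReal (cut η y)) y +
    ENNReal.ofReal (2 * (1 + y ^ 2)⁻¹)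

lemma measurable_cutMajorant (η : ℝ) : Measurable (cutMajorant η) :=
  ((measurable_cut η).ennreal_ofReal.indicator measurableSet_Icc).add (by fun_prop)

lemma exists_lintegral_cutMajorant_le : ∃ K : ℝ, 1 ≤ K ∧ ∀ t : ℝ, 0 < t →
    ∫⁻ y, cutMajorant t⁻¹ y ≤ ENNReal.ofReal (K * logStar t) := by
  refine ⟨2 * (1 + |Real.log 1| + 1) + 8, by
    have := abs_nonneg (Real.log 1); linarith, fun t ht => ?_⟩
  have h1 := lintegral_cut_le (volume.restrict (Set.Icc (-1 : ℝ) 1)) (g := fun y => y) measurable_id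
    (ENNReal.ofReal 2) (inv_pos.2 ht) one_pos (by
      rw [Measure.restrict_apply_univ, Real.volume_Icc]; norm_num) (by
      intro δ hδ _
      have : {x : ℝ | |x| ≤ δ} = Set.Icc (-δ) δ := by ext x; simp [abs_le]
      rw [this]
      refine (Measure.restrict_apply_le _ _).trans ?_
      rw [Real.volume_Icc, ← ENNReal.ofReal_mul (by norm_num)]
      exact ENNReal.ofReal_le_ofReal (by linarith))
  have h2 := cakeLog_le ht one_pos
  have hl := one_le_logStar t
  unfold cutMajorant
  rw [lintegral_add_right _ (by fun_prop), lintegral_indicator measurableSet_Icc]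
  have h3 : ∫⁻ y : ℝ, ENNReal.ofReal (2 * (1 + y ^ 2)⁻¹) ≤ ENNReal.ofReal 8 := by
    calc _ = ∫⁻ y : ℝ, ENNReal.ofReal 2 * ENNReal.ofReal ((1 + y ^ 2)⁻¹) := by
          refine lintegral_congr fun y => ENNReal.ofReal_mul (by norm_num)
      _ ≤ ENNReal.ofReal 2 * ENNReal.ofReal 4 := by
          rw [lintegral_const_mul' _ _ ENNReal.ofReal_ne_top]
          exact mul_le_mul_right lintegral_inv_one_add_sq_le _
      _ = _ := by rw [← ENNReal.ofReal_mul (by norm_num)]; norm_num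
  refine (add_le_add h1 h3).trans ?_
  rw [← ENNReal.ofReal_mul (by norm_num), ← ENNReal.ofReal_add (by
    exact mul_nonneg zero_le_two (cakeLog_nonneg one_pos)) (by norm_num)]
  refine ENNReal.ofReal_le_ofReal ?_
  rw [inv_one] at h2
  nlinarith

/-- Partial fractions for truncated inverses: the truncation of `y - z` is at most the sum of those
of `y` and `z`. -/
lemma cut_mul_cut_le_add {η : ℝ} (hη : 0 < η) (y z : ℝ) :
    cut η y * cut η z ≤ cut η (y - z) * (cut η y + cut η z) := by
  have h1 : 0 < max |y| η := lt_max_of_lt_right hη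
  have h2 : 0 < max |z| η := lt_max_of_lt_right hη
  have h3 : 0 < max |y - z| η := lt_max_of_lt_right hη
  have h4 : max |y - z| η ≤ max |y| η + max |z| η := by
    refine max_le ((abs_sub y z).trans (add_le_add (le_max_left _ _) (le_max_left _ _))) ?_
    exact (le_max_right _ _).trans (le_add_of_nonneg_right h2.le)
  unfold cut
  have h5 : (max |y| η)⁻¹ + (max |z| η)⁻¹ =
      (max |y| η + max |z| η) * ((max |y| η)⁻¹ * (max |z| η)⁻¹) := by
    field_simp
    ring
  rw [h5, ← mul_assoc]
  refine le_mul_of_one_le_left (by positivity) ?_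
  rw [inv_mul_eq_div, one_le_div h3]
  exact h4

lemma ofReal_cut_le_cutMajorant {η : ℝ} (y : ℝ) (hy : |y| ≤ 1) :
    ENNReal.ofReal (cut η y) ≤ cutMajorant η y := by
  rw [cutMajorant, Set.indicator_of_mem (Set.mem_Icc.2 (abs_le.1 hy))]
  exact le_self_add

/-- Partial fractions alone would leave tails 1/|y|, which are not integrable. They are used only if
`|y| ≤ 1` or `|z| ≤ 1`; if the other variable exceeds one, its truncated inverse is at most one and
is dominated by the tail part of the majorant of the first. If both exceed one, the product is
dominated directly by the two integrable tails. -/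
lemma cut_mul_cut_le_cutMajorant {η : ℝ} (hη : 0 < η) (y z : ℝ) :
    ENNReal.ofReal (cut η y) * ENNReal.ofReal (cut η z) ≤
      (1 + ENNReal.ofReal (cut η (y - z))) * (cutMajorant η y + cutMajorant η z) := by
  have hy := cut_pos hη y
  have hz := cut_pos hη z
  have hyz := cut_pos hη (y - z)
  have key : ∀ y z : ℝ, |y| ≤ 1 →
      ENNReal.ofReal (cut η y) + ENNReal.ofReal (cut η z) ≤ cutMajorant η y + cutMajorant η z := by
    intro y z hy
    rcases le_or_gt |z| 1 with h | h
    · exact add_le_add (ofReal_cut_le_cutMajorant y hy) (ofReal_cut_le_cutMajorant z h)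
    · rw [cutMajorant, Set.indicator_of_mem (Set.mem_Icc.2 (abs_le.1 hy)), add_assoc]
      refine add_le_add le_rfl (le_trans ?_ le_self_add)
      refine ENNReal.ofReal_le_ofReal ?_
      have h1 : cut η z ≤ 1 := by
        rw [cut]; exact inv_le_one_of_one_le₀ (h.le.trans (le_max_left _ _))
      refine h1.trans ?_
      rw [← div_eq_mul_inv, one_le_div (by positivity)]
      have : y ^ 2 ≤ 1 := by rw [← sq_abs]; exact pow_le_one₀ (abs_nonneg _) hy
      linarith
  have hA : ENNReal.ofReal (cut η y) * ENNReal.ofReal (cut η z) ≤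
      ENNReal.ofReal (cut η (y - z)) * (ENNReal.ofReal (cut η y) + ENNReal.ofReal (cut η z)) := by
    rw [← ENNReal.ofReal_mul hy.le, ← ENNReal.ofReal_add hy.le hz.le, ← ENNReal.ofReal_mul hyz.le]
    exact ENNReal.ofReal_le_ofReal (cut_mul_cut_le_add hη y z)
  rcases le_or_gt |y| 1 with h1 | h1
  · exact hA.trans (mul_le_mul' le_add_self (key y z h1))
  rcases le_or_gt |z| 1 with h2 | h2
  · refine hA.trans (mul_le_mul' le_add_self ?_)
    rw [add_comm, add_comm (cutMajorant η y)]
    exact key z y h2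
  have hc : ∀ y : ℝ, 1 < |y| → cut η y ^ 2 ≤ 2 * (1 + y ^ 2)⁻¹ := by
    intro y h
    have h3 : 1 < y ^ 2 := by rw [← sq_abs]; exact one_lt_pow₀ h two_ne_zero
    have h4 : cut η y ≤ |y|⁻¹ := inv_anti₀ (by linarith) (le_max_left _ _)
    calc cut η y ^ 2 ≤ (|y|⁻¹) ^ 2 := pow_le_pow_left₀ (cut_pos hη y).le h4 2
      _ = (y ^ 2)⁻¹ := by rw [inv_pow, sq_abs]
      _ ≤ _ := by
        rw [← div_eq_mul_inv, inv_eq_one_div, div_le_div_iff₀ (by positivity) (by positivity)]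
        linarith
  calc ENNReal.ofReal (cut η y) * ENNReal.ofReal (cut η z)
      ≤ ENNReal.ofReal (2 * (1 + y ^ 2)⁻¹) + ENNReal.ofReal (2 * (1 + z ^ 2)⁻¹) := by
        rw [← ENNReal.ofReal_mul hy.le, ← ENNReal.ofReal_add (by positivity) (by positivity)]
        refine ENNReal.ofReal_le_ofReal ?_
        nlinarith [sq_nonneg (cut η y - cut η z), hc y h1, hc z h2, sq_nonneg (cut η y)]
    _ ≤ cutMajorant η y + cutMajorant η z := add_le_add le_add_self le_add_self
    _ ≤ _ := le_mul_of_one_le_left' le_self_add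

lemma exists_lintegral_cut_mul_cut_le : ∃ K : ℝ, 1 ≤ K ∧ ∀ t : ℝ, 0 < t → ∀ a b : ℝ,
    ∫⁻ x : ℝ, ENNReal.ofReal (cut t⁻¹ (a + 2 * Real.pi * x)) *
      ENNReal.ofReal (cut t⁻¹ (b + 2 * Real.pi * x)) ≤
        ENNReal.ofReal (K * logStar t) * (1 + ENNReal.ofReal (cut t⁻¹ (a - b))) := by
  obtain ⟨K, hK1, hK⟩ := exists_lintegral_cutMajorant_le
  refine ⟨2 * K, by linarith, fun t ht a b => ?_⟩
  have hm := measurable_cutMajorant t⁻¹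
  have hm' : ∀ a : ℝ, Measurable fun x : ℝ => cutMajorant t⁻¹ (a + 2 * Real.pi * x) :=
    fun a => hm.comp (by fun_prop)
  have hl := logStar_pos t
  calc _ ≤ ∫⁻ x : ℝ, (1 + ENNReal.ofReal (cut t⁻¹ (a - b))) *
        (cutMajorant t⁻¹ (a + 2 * Real.pi * x) + cutMajorant t⁻¹ (b + 2 * Real.pi * x)) := by
        refine lintegral_mono fun x => ?_
        have := cut_mul_cut_le_cutMajorant (inv_pos.2 ht) (a + 2 * Real.pi * x)
          (b + 2 * Real.pi * x)
        rwa [add_sub_add_right_eq_sub] at this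
    _ ≤ (1 + ENNReal.ofReal (cut t⁻¹ (a - b))) *
          (ENNReal.ofReal (K * logStar t) + ENNReal.ofReal (K * logStar t)) := by
        rw [lintegral_const_mul' _ _ (by simp), lintegral_add_left (hm' a)]
        exact mul_le_mul_right (add_le_add ((lintegral_comp_two_pi_le hm a).trans (hK t ht))
          ((lintegral_comp_two_pi_le hm b).trans (hK t ht))) _
    _ = _ := by
        rw [← ENNReal.ofReal_add (by positivity) (by positivity), mul_comm]
        congr 2; ring

/-! ### Elimination of variables -/

section Elimination

variable {ι : Type*} [DecidableEq ι] {X : ι → Type*} [∀ i, MeasurableSpace (X i)]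
  (μ : ∀ i, Measure (X i)) [∀ i, SigmaFinite (μ i)]

/-- `f` does not depend on the variables with index in `V`. -/
def IndepOf {β : Type*} (f : (∀ i, X i) → β) (V : Finset ι) : Prop :=
  ∀ x y, (∀ j, j ∉ V → x j = y j) → f x = f y

lemma IndepOf.updateFinset {β : Type*} {f : (∀ i, X i) → β} {V : Finset ι} (hf : IndepOf f V)
    (x : ∀ i, X i) (y : ∀ i : V, X i) : f (Function.updateFinset x V y) = f x :=
  hf _ _ fun j hj => by rw [Function.updateFinset, dif_neg hj]

lemma lmarginal_mul_indep {f G : (∀ i, X i) → ℝ≥0∞} (hf : Measurable f) {V : Finset ι}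
    (hG : IndepOf G V) (x : ∀ i, X i) :
    lmarginal μ V (fun x => f x * G x) x = lmarginal μ V f x * G x := by
  simp only [lmarginal, hG.updateFinset]
  exact lintegral_mul_const _ (hf.comp measurable_updateFinset)

lemma IndepOf.prod {α : Type*} {I : Finset α} {f : α → (∀ i, X i) → ℝ≥0∞} {V : Finset ι}
    (hf : ∀ a ∈ I, IndepOf (f a) V) : IndepOf (fun x => ∏ a ∈ I, f a x) V :=
  fun x y h => Finset.prod_congr rfl fun a ha => hf a ha x y h

lemma IndepOf.mul {f g : (∀ i, X i) → ℝ≥0∞} {V : Finset ι}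
    (hf : IndepOf f V) (hg : IndepOf g V) : IndepOf (fun x => f x * g x) V :=
  fun x y h => congrArg₂ (· * ·) (hf x y h) (hg x y h)

/-- Successive elimination of the disjoint groups `V a` of variables in the order given by `key`. -/
lemma lmarginal_prod_le {α : Type*} [DecidableEq α] (key : α → ℕ) (I : Finset α)
    {V : α → Finset ι} {f : α → (∀ i, X i) → ℝ≥0∞} {B : α → ℝ≥0∞} {G : (∀ i, X i) → ℝ≥0∞}
    (hf : ∀ a, Measurable (f a)) (hGm : Measurable G)
    (hV : ∀ a ∈ I, ∀ b ∈ I, a ≠ b → key a ≤ key b → Disjoint (V a) (V b) ∧ IndepOf (f b) (V a))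
    (hG : ∀ a ∈ I, IndepOf G (V a)) (hB : ∀ a ∈ I, ∀ x, lmarginal μ (V a) (f a) x ≤ B a)
    (x : ∀ i, X i) :
    lmarginal μ (I.biUnion V) (fun x => (∏ a ∈ I, f a x) * G x) x ≤ (∏ a ∈ I, B a) * G x := by
  -- The group with the smallest key is integrated first. By `hV` no other factor contains its
  -- variables, so its integral is replaced by `B a` and leaves the marginal.
  induction I using Finset.induction_on_min_value key generalizing x with
  | empty => simp
  | insert a s ha hmin ih =>
    have hVa : ∀ b ∈ s, Disjoint (V a) (V b) ∧ IndepOf (f b) (V a) := fun b hb =>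
      hV a (Finset.mem_insert_self _ _) b (Finset.mem_insert_of_mem hb)
        (fun h => ha (h ▸ hb)) (hmin b hb)
    have hm : Measurable fun x => (∏ a ∈ s, f a x) * G x :=
      (Finset.measurable_fun_prod _ fun b _ => hf b).mul hGm
    have hdis : Disjoint (V a) (s.biUnion V) :=
      (Finset.disjoint_biUnion_right _ _ _).2 fun b hb => (hVa b hb).1
    have e1 : (fun x => (∏ b ∈ insert a s, f b x) * G x) =
        fun x => f a x * ((∏ b ∈ s, f b x) * G x) := by
      funext x; rw [Finset.prod_insert ha, mul_assoc]
    have hm' : Measurable fun x => f a x * ((∏ b ∈ s, f b x) * G x) := (hf a).mul hm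
    rw [Finset.biUnion_insert, e1, lmarginal_union' μ _ hm' hdis]
    have hind : IndepOf (fun x => (∏ b ∈ s, f b x) * G x) (V a) :=
      (IndepOf.prod fun b hb => (hVa b hb).2).mul (hG a (Finset.mem_insert_self _ _))
    have h1 : lmarginal μ (V a) (fun x => f a x * ((∏ b ∈ s, f b x) * G x)) ≤
        fun x => B a * ((∏ b ∈ s, f b x) * G x) := fun x => by
      rw [lmarginal_mul_indep μ (hf a) hind]
      exact mul_le_mul_left (hB a (Finset.mem_insert_self _ _) x) _
    refine (lmarginal_mono h1 x).trans ?_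
    have h2 : lmarginal μ (s.biUnion V) (fun x => B a * ((∏ b ∈ s, f b x) * G x)) x =
        B a * lmarginal μ (s.biUnion V) (fun x => (∏ b ∈ s, f b x) * G x) x := by
      simp only [lmarginal]
      exact lintegral_const_mul _ (hm.comp measurable_updateFinset)
    rw [h2, Finset.prod_insert ha, mul_assoc]
    refine mul_le_mul_right (ih ?_ ?_ ?_ x) _
    · exact fun b hb c hc => hV b (Finset.mem_insert_of_mem hb) c (Finset.mem_insert_of_mem hc)
    · exact fun b hb => hG b (Finset.mem_insert_of_mem hb)
    · exact fun b hb => hB b (Finset.mem_insert_of_mem hb)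

end Elimination

/-! ### From phonon momenta to electron momenta -/

section ChangeOfVariables

variable {E : Type*} [AddCommGroup E]

/-- The electron momenta `p_0, …, p_{n-1}`. -/
def chain {n : ℕ} (p : E) (k : Fin n → E) (j : Fin n) : E :=
  p + ∑ l ∈ Finset.univ.filter (fun l : Fin n => j ≤ l), k l

/-- The sequence `x_0, …, x_{n-1}, p, p, …`. -/
def ext {n : ℕ} (p : E) (x : Fin n → E) (j : ℕ) : E := if h : j < n then x ⟨j, h⟩ else p

lemma chain_cons_succ {n : ℕ} (p a : E) (k : Fin n → E) (j : Fin n) :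
    chain p (Fin.cons a k : Fin (n + 1) → E) j.succ = chain p k j := by
  simp only [chain, Finset.sum_filter, Fin.sum_univ_succ, Fin.cons_zero, Fin.cons_succ,
    Fin.succ_le_succ_iff]
  simp

lemma chain_cons_zero {n : ℕ} (p a : E) (k : Fin n → E) :
    chain p (Fin.cons a k : Fin (n + 1) → E) 0 = a + (p + ∑ l, k l) := by
  simp only [chain, Finset.sum_filter, Fin.sum_univ_succ, Fin.cons_zero, Fin.cons_succ]
  simp only [Fin.zero_le, if_true]
  abel

lemma chain_cons {n : ℕ} (p a : E) (k : Fin n → E) :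
    chain p (Fin.cons a k : Fin (n + 1) → E) = Fin.cons (a + (p + ∑ l, k l)) (chain p k) := by
  funext j
  refine Fin.cases ?_ (fun j => ?_) j
  · rw [chain_cons_zero, Fin.cons_zero]
  · rw [chain_cons_succ, Fin.cons_succ]

lemma lintegral_pi_succ [MeasureSpace E] [SigmaFinite (volume : Measure E)] {n : ℕ}
    {F : (Fin (n + 1) → E) → ℝ≥0∞} (hF : Measurable F) :
    ∫⁻ k, F k = ∫⁻ k : Fin n → E, ∫⁻ a : E, F (Fin.cons a k) := by
  have hmp := (volume_preserving_piFinSuccAbove (fun _ : Fin (n + 1) => E) 0).symm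
  have hc : ∀ z : E × (Fin n → E), (MeasurableEquiv.piFinSuccAbove (fun _ : Fin (n + 1) => E) 0).symm z
      = Fin.cons z.1 z.2 := fun z => by
    rw [MeasurableEquiv.piFinSuccAbove_symm_apply]
    exact Fin.insertNth_zero' z.1 z.2
  have hm : Measurable fun z : E × (Fin n → E) =>
      F ((MeasurableEquiv.piFinSuccAbove (fun _ : Fin (n + 1) => E) 0).symm z) :=
    hF.comp (MeasurableEquiv.measurable _)
  rw [← hmp.lintegral_comp hF, Measure.volume_eq_prod, lintegral_prod_symm' _ hm]
  simp only [hc]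

/-- The map is triangular with unit Jacobian: the first phonon momentum occurs only in the first
electron momentum, where it is removed by a translation. -/
lemma lintegral_chain [MeasureSpace E] [SigmaFinite (volume : Measure E)] [MeasurableAdd₂ E]
    [(volume : Measure E).IsAddRightInvariant] {n : ℕ} (p : E)
    {F : (Fin n → E) → ℝ≥0∞} (hF : Measurable F) :
    ∫⁻ k, F (chain p k) = ∫⁻ x, F x := by
  have hcm : ∀ n, Measurable fun k : Fin n → E => chain p k := fun n => by
    refine measurable_pi_lambda _ fun j => ?_
    unfold chain
    exact (Finset.measurable_fun_sum _ fun l _ => measurable_pi_apply l).const_add p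
  have hcons : ∀ n, Measurable fun z : E × (Fin n → E) => (Fin.cons z.1 z.2 : Fin (n + 1) → E) := by
    intro n
    refine measurable_pi_lambda _ fun j => ?_
    refine Fin.cases ?_ (fun j => ?_) j
    · simpa using measurable_fst
    · simp only [Fin.cons_succ]
      exact (measurable_pi_apply j).comp measurable_snd
  induction n with
  | zero =>
    refine lintegral_congr fun k => ?_
    congr 1
    exact Subsingleton.elim _ _
  | succ n ih =>
    have hm : Measurable fun k : Fin (n + 1) → E => F (chain p k) := hF.comp (hcm _)
    rw [lintegral_pi_succ hm, lintegral_pi_succ hF]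
    simp only [chain_cons]
    have : ∀ k : Fin n → E, ∫⁻ a, F (Fin.cons (a + (p + ∑ l, k l)) (chain p k)) =
        ∫⁻ a, F (Fin.cons a (chain p k)) := fun k =>
      lintegral_add_right_eq_self (fun a => F (Fin.cons a (chain p k))) _
    simp only [this]
    refine ih (F := fun x => ∫⁻ a, F (Fin.cons a x)) ?_
    exact Measurable.lintegral_prod_left' (f := fun z : E × (Fin n → E) => F (Fin.cons z.1 z.2))
      (hF.comp (hcons n))

end ChangeOfVariables

/-- The weight `wt`, as an extended nonnegative real. -/
noncomputable abbrev ewt {d : ℕ} (x : Momentum d) : ℝ≥0∞ := ENNReal.ofReal (wt x)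

/-- The cut-off resolvent at time `t`, as an extended nonnegative real. -/
noncomputable abbrev ecut (t y : ℝ) : ℝ≥0∞ := ENNReal.ofReal (cut t⁻¹ y)

lemma ecut_le {t : ℝ} (ht : 0 < t) (y : ℝ) : ecut t y ≤ ENNReal.ofReal t :=
  ENNReal.ofReal_le_ofReal ((cut_le (inv_pos.2 ht) y).trans_eq (inv_inv t))

/-! ### Distribution of the weights -/

section Weights

variable {d : ℕ}

lemma wt_zero : wt (0 : Momentum d) = 1 := by simp [wt, bracket]

/-- Peetre's inequality along a chain of differences, which telescope. -/
lemma prod_ewt_path_le (X : ℕ → Momentum d) {i j : ℕ} (hij : i ≤ j) :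
    ∏ l ∈ Finset.Ico i j, ewt (X l - X (l + 1)) ≤
      (∏ _l ∈ Finset.Ico i j, (2 : ℝ≥0∞) ^ (d + 1)) * ewt (X i - X j) := by
  induction j, hij using Nat.le_induction with
  | base => simp [wt_zero, ewt]
  | succ j hij ih =>
    rw [Finset.prod_Ico_succ_top hij, Finset.prod_Ico_succ_top hij]
    refine (mul_le_mul_left ih _).trans ?_
    rw [mul_assoc, mul_assoc]
    refine mul_le_mul_right ?_ _
    rw [ewt, ewt, ewt, ← ENNReal.ofReal_mul (wt_pos _).le]
    refine (ENNReal.ofReal_le_ofReal (wt_mul_wt_le _ _)).trans ?_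
    rw [sub_add_sub_cancel, ENNReal.ofReal_mul (by positivity), ENNReal.ofReal_pow (by norm_num)]
    simp

/-- The links between `j` and `ρ j`. -/
def path (ρ : ℕ → ℕ) (j : ℕ) : Finset ℕ := Finset.Ico (min j (ρ j)) (max j (ρ j))

/-- Of the four weights on each link, one pays for the path from `0` to `n` and three pay for the
paths from `j` to `ρ j`, at most three of which cross a given link. -/
lemma prod_ewt_le {n : ℕ} (ρ : ℕ → ℕ) (hρ : ∀ j, j < n → ρ j ≤ n)
    (hmult : ∀ l < n, ((Finset.Ico 1 n).filter fun j => l ∈ path ρ j).card ≤ 3)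
    (X : ℕ → Momentum d) :
    ∏ l ∈ Finset.range n, ewt (X l - X (l + 1)) ^ 4 ≤ ((2 : ℝ≥0∞) ^ (d + 1)) ^ (4 * n) *
      (ewt (X 0 - X n) * ∏ j ∈ Finset.Ico 1 n, ewt (X j - X (ρ j))) := by
  set c : ℝ≥0∞ := (2 : ℝ≥0∞) ^ (d + 1) with hc
  have hc1 : 1 ≤ c := one_le_pow₀ (by norm_num)
  set w : ℕ → ℝ≥0∞ := fun l => ewt (X l - X (l + 1)) with hw
  have hw1 : ∀ l, w l ≤ 1 := fun l => ENNReal.ofReal_le_one.2 (wt_le_one _)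
  have hcomm : ∀ h : ℕ → ℝ≥0∞, ∏ j ∈ Finset.Ico 1 n, ∏ l ∈ path ρ j, h l =
      ∏ l ∈ Finset.range n, h l ^ ((Finset.Ico 1 n).filter fun j => l ∈ path ρ j).card := by
    intro h
    rw [Finset.prod_comm' (t' := Finset.range n)
      (s' := fun l => (Finset.Ico 1 n).filter fun j => l ∈ path ρ j)]
    · exact Finset.prod_congr rfl fun l _ => Finset.prod_const _
    · intro j l
      simp only [Finset.mem_filter, Finset.mem_range]
      constructor
      · rintro ⟨h1, h2⟩
        refine ⟨⟨h1, h2⟩, ?_⟩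
        have h3 := (Finset.mem_Ico.1 h1).2
        have h4 := (Finset.mem_Ico.1 h2).2
        have h5 := hρ j h3
        omega
      · rintro ⟨⟨h1, h2⟩, -⟩
        exact ⟨h1, h2⟩
  have h1 : ∏ l ∈ Finset.range n, w l ≤ c ^ n * ewt (X 0 - X n) := by
    have := prod_ewt_path_le X (Nat.zero_le n)
    rwa [← Finset.range_eq_Ico, Finset.prod_const, Finset.card_range] at this
  have h2 : ∏ l ∈ Finset.range n, w l ^ 3 ≤
      c ^ (3 * n) * ∏ j ∈ Finset.Ico 1 n, ewt (X j - X (ρ j)) := by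
    calc ∏ l ∈ Finset.range n, w l ^ 3
        ≤ ∏ l ∈ Finset.range n, w l ^ ((Finset.Ico 1 n).filter fun j => l ∈ path ρ j).card :=
          Finset.prod_le_prod' fun l hl =>
            pow_le_pow_right_of_le_one' (hw1 l) (hmult l (Finset.mem_range.1 hl))
      _ = ∏ j ∈ Finset.Ico 1 n, ∏ l ∈ path ρ j, w l := (hcomm w).symm
      _ ≤ ∏ j ∈ Finset.Ico 1 n, ((∏ _l ∈ path ρ j, c) * ewt (X j - X (ρ j))) := by
          refine Finset.prod_le_prod' fun j _ => ?_
          rcases le_total j (ρ j) with h | h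
          · have := prod_ewt_path_le X h
            rwa [path, min_eq_left h, max_eq_right h]
          · have := prod_ewt_path_le X h
            rw [ewt, wt_sub_comm] at this
            rwa [path, min_eq_right h, max_eq_left h]
      _ = (∏ l ∈ Finset.range n, c ^ ((Finset.Ico 1 n).filter fun j => l ∈ path ρ j).card) *
            ∏ j ∈ Finset.Ico 1 n, ewt (X j - X (ρ j)) := by
          rw [Finset.prod_mul_distrib, hcomm]
      _ ≤ (∏ l ∈ Finset.range n, c ^ 3) * ∏ j ∈ Finset.Ico 1 n, ewt (X j - X (ρ j)) :=
          mul_le_mul_left (Finset.prod_le_prod' fun l hl =>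
            pow_le_pow_right₀ hc1 (hmult l (Finset.mem_range.1 hl))) _
      _ = _ := by rw [Finset.prod_const, Finset.card_range, ← pow_mul]
  calc ∏ l ∈ Finset.range n, w l ^ 4
      = (∏ l ∈ Finset.range n, w l) * ∏ l ∈ Finset.range n, w l ^ 3 := by
        rw [← Finset.prod_mul_distrib]
        exact Finset.prod_congr rfl fun l _ => by ring
    _ ≤ (c ^ n * ewt (X 0 - X n)) *
          (c ^ (3 * n) * ∏ j ∈ Finset.Ico 1 n, ewt (X j - X (ρ j))) := mul_le_mul' h1 h2
    _ = _ := by rw [show 4 * n = n + 3 * n by ring, pow_add]; ring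

end Weights

/-! ### Peaks, blocks and survivors -/

/-- The values of `π` as natural numbers. -/
def permVal {n : ℕ} (π : Equiv.Perm (Fin n)) (j : ℕ) : ℕ := if h : j < n then π ⟨j, h⟩ else 0

/-- A set of peaks of `π`, on which `π` is monotone or antitone; every peak `a` spans the block
`{a, a + 1}`, and `par a` is a neighbour of the block. -/
structure PeakSet {n : ℕ} (π : Equiv.Perm (Fin n)) (P : Finset ℕ) (par : ℕ → ℕ) : Prop where
  one_le : ∀ a ∈ P, 1 ≤ a
  lt : ∀ a ∈ P, a + 1 < n
  left : ∀ a ∈ P, permVal π (a - 1) < permVal π a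
  right : ∀ a ∈ P, permVal π (a + 1) < permVal π a
  par_spec : ((∀ a, par a = a + 2) ∧ ∀ a ∈ P, ∀ b ∈ P, permVal π a < permVal π b → a < b) ∨
    ((∀ a, par a = a - 1) ∧ ∀ a ∈ P, ∀ b ∈ P, permVal π a < permVal π b → b < a)

lemma permVal_inj {n : ℕ} (π : Equiv.Perm (Fin n)) {i j : ℕ} (hi : i < n) (hj : j < n)
    (h : permVal π i = permVal π j) : i = j := by
  rw [permVal, permVal, dif_pos hi, dif_pos hj] at h
  simpa using π.injective (Fin.ext h)

/-- The neighbour `par` is chosen on the side of the blocks with larger values of `π`, which are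
integrated later: to the right for increasing peaks, to the left for decreasing ones. -/
lemma HasMonotonePeaks.exists_peakSet {n κ : ℕ} {π : Equiv.Perm (Fin n)}
    (h : HasMonotonePeaks π κ) : ∃ P par, PeakSet π P par ∧ P.card = κ := by
  obtain ⟨a, ha, hpk, hmono⟩ := h
  have hinj : Function.Injective fun i => ((a i : Fin n) : ℕ) :=
    fun i j hij => ha.injective (Fin.ext hij)
  have hval : ∀ i, permVal π (a i) = π (a i) := fun i => by rw [permVal, dif_pos (a i).2]
  have hlt : ∀ i j, permVal π (a i) < permVal π (a j) ↔ π (a i) < π (a j) := fun i j => by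
    rw [hval, hval, Fin.lt_def]
  have hbase : ∀ i, 1 ≤ (a i : ℕ) ∧ (a i : ℕ) + 1 < n ∧
      permVal π ((a i : ℕ) - 1) < permVal π (a i) ∧
      permVal π ((a i : ℕ) + 1) < permVal π (a i) := by
    intro i
    obtain ⟨b, c, hb, hc, h1, h2⟩ := hpk i
    have hb' : (a i : ℕ) - 1 = b := by omega
    refine ⟨by omega, hc ▸ c.2, ?_, ?_⟩
    · rw [hb', hval, permVal, dif_pos b.2]; exact h1
    · rw [hc, hval, permVal, dif_pos c.2]; exact h2
  have hmem : ∀ {p : ℕ → Prop}, (∀ i, p (a i)) →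
      ∀ b ∈ Finset.univ.image (fun i => ((a i : Fin n) : ℕ)), p b := by
    intro p hp b hb
    obtain ⟨i, -, rfl⟩ := Finset.mem_image.1 hb
    exact hp i
  have hcard : (Finset.univ.image fun i => ((a i : Fin n) : ℕ)).card = κ := by
    rw [Finset.card_image_of_injective _ hinj, Finset.card_univ, Fintype.card_fin]
  rcases hmono with hm | hm
  · refine ⟨Finset.univ.image fun i => ((a i : Fin n) : ℕ), fun a => a + 2,
      ⟨hmem fun i => (hbase i).1, hmem fun i => (hbase i).2.1, hmem fun i => (hbase i).2.2.1,
        hmem fun i => (hbase i).2.2.2, Or.inl ⟨fun _ => rfl, ?_⟩⟩, hcard⟩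
    refine hmem (p := fun x => ∀ b ∈ _, permVal π x < permVal π b → x < b) fun i => ?_
    refine hmem (p := fun b => permVal π (a i) < permVal π b → (a i : ℕ) < b) fun j hij => ?_
    exact ha (hm.lt_iff_lt.1 ((hlt i j).1 hij))
  · refine ⟨Finset.univ.image fun i => ((a i : Fin n) : ℕ), fun a => a - 1,
      ⟨hmem fun i => (hbase i).1, hmem fun i => (hbase i).2.1, hmem fun i => (hbase i).2.2.1,
        hmem fun i => (hbase i).2.2.2, Or.inr ⟨fun _ => rfl, ?_⟩⟩, hcard⟩
    refine hmem (p := fun x => ∀ b ∈ _, permVal π x < permVal π b → b < x) fun i => ?_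
    refine hmem (p := fun b => permVal π (a i) < permVal π b → b < (a i : ℕ)) fun j hij => ?_
    exact ha (hm.lt_iff_gt.1 ((hlt i j).1 hij))

namespace PeakSet

variable {n : ℕ} {π : Equiv.Perm (Fin n)} {P : Finset ℕ} {par : ℕ → ℕ}

/-- Two adjacent peaks would each have to exceed the other. This makes the blocks disjoint. -/
lemma succ_notMem (h : PeakSet π P par) {a : ℕ} (ha : a ∈ P) : a + 1 ∉ P := fun hb => by
  have h1 := h.right a ha
  have h2 := h.left _ hb
  rw [Nat.add_sub_cancel] at h2
  omega

/-- The indices which belong to a block. -/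
def blocks (P : Finset ℕ) : Finset ℕ := P.biUnion fun a => {a, a + 1}

lemma mem_blocks {j : ℕ} : j ∈ blocks P ↔ j ∈ P ∨ ∃ a ∈ P, j = a + 1 := by
  simp only [blocks, Finset.mem_biUnion, Finset.mem_insert, Finset.mem_singleton]
  constructor
  · rintro ⟨a, ha, rfl | rfl⟩
    · exact Or.inl ha
    · exact Or.inr ⟨a, ha, rfl⟩
  · rintro (h | ⟨a, ha, rfl⟩)
    · exact ⟨j, h, Or.inl rfl⟩
    · exact ⟨a, ha, Or.inr rfl⟩

lemma blocks_subset (h : PeakSet π P par) : blocks P ⊆ Finset.Ico 1 n := by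
  intro j hj
  rw [Finset.mem_Ico]
  rcases mem_blocks.1 hj with hj | ⟨a, ha, rfl⟩
  · have := h.one_le j hj
    have := h.lt j hj
    omega
  · have := h.lt a ha
    omega

/-- The indices `1 ≤ j < n` which do not belong to a block. -/
def survivors (n : ℕ) (P : Finset ℕ) : Finset ℕ := Finset.Ico 1 n \ blocks P

lemma exists_next (h : PeakSet π P par) {j : ℕ} (hj : j < n) : ∃ i, j < i ∧ i ∉ blocks P :=
  ⟨n, hj, fun hn => by simpa using h.blocks_subset hn⟩

open Classical in
/-- The next index which does not belong to a block. -/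
noncomputable def next (P : Finset ℕ) (j : ℕ) : ℕ :=
  -- For `j < n` the default is never reached, because `n` belongs to no block.
  if h : ∃ i, j < i ∧ i ∉ blocks P then Nat.find h else 0

lemma lt_next (h : PeakSet π P par) {j : ℕ} (hj : j < n) : j < next P j := by
  classical
  rw [next, dif_pos (h.exists_next hj)]
  exact (Nat.find_spec (h.exists_next hj)).1

lemma next_notMem (h : PeakSet π P par) {j : ℕ} (hj : j < n) : next P j ∉ blocks P := by
  classical
  rw [next, dif_pos (h.exists_next hj)]
  exact (Nat.find_spec (h.exists_next hj)).2

lemma next_le (h : PeakSet π P par) {i j : ℕ} (hj : j < n) (hij : j < i) (hi : i ∉ blocks P) :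
    next P j ≤ i := by
  classical
  rw [next, dif_pos (h.exists_next hj)]
  exact Nat.find_min' _ ⟨hij, hi⟩

/-- The index to which the weight of `j` is attached. -/
noncomputable def parent (P : Finset ℕ) (par : ℕ → ℕ) (j : ℕ) : ℕ :=
  if j ∈ P then par j else if j - 1 ∈ P then par (j - 1) else next P j

lemma parent_of_mem {a : ℕ} (ha : a ∈ P) : parent P par a = par a := by
  rw [parent, if_pos ha]

lemma parent_succ (h : PeakSet π P par) {a : ℕ} (ha : a ∈ P) : parent P par (a + 1) = par a := by
  rw [parent, if_neg (h.succ_notMem ha), Nat.add_sub_cancel, if_pos ha]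

lemma parent_survivor {j : ℕ} (hj : j ∈ survivors n P) : parent P par j = next P j := by
  have h1 := Finset.mem_sdiff.1 hj
  have h2 := (Finset.mem_Ico.1 h1.1).1
  rw [parent, if_neg fun h => h1.2 (mem_blocks.2 (Or.inl h)),
    if_neg fun h => h1.2 (mem_blocks.2 (Or.inr ⟨_, h, by omega⟩))]

lemma par_le (h : PeakSet π P par) {a : ℕ} (ha : a ∈ P) : par a ≤ n := by
  have := h.lt a ha
  rcases h.par_spec with ⟨h1, -⟩ | ⟨h1, -⟩ <;> rw [h1] <;> omega

lemma parent_le (h : PeakSet π P par) (j : ℕ) (hj : j < n) : parent P par j ≤ n := by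
  unfold parent
  split_ifs with h1 h2
  · exact h.par_le h1
  · exact h.par_le h2
  · exact h.next_le hj hj fun hn => by simpa using h.blocks_subset hn

/-- The paths of the survivors run from one survivor to the next index outside the blocks and do not
overlap, so at most one crosses a link. A path from a block has length at most two and stays at the
block, which leaves at most two candidates for its starting point. -/
lemma card_path_le (h : PeakSet π P par) {l : ℕ} (_hl : l < n) :
    ((Finset.Ico 1 n).filter fun j => l ∈ path (parent P par) j).card ≤ 3 := by
  have hsurv : ((survivors n P).filter fun j => l ∈ path (parent P par) j).card ≤ 1 := by
    refine Finset.card_le_one.2 ?_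
    have key : ∀ i ∈ survivors n P, ∀ j ∈ survivors n P, l ∈ path (parent P par) i →
        l ∈ path (parent P par) j → i < j → False := by
      intro i hi j hj hli hlj hij
      have hin := (Finset.mem_Ico.1 (Finset.mem_sdiff.1 hi).1).2
      have hjn := (Finset.mem_Ico.1 (Finset.mem_sdiff.1 hj).1).2
      have h1 := h.next_le hin hij (Finset.mem_sdiff.1 hj).2
      have h2 := h.lt_next hin
      have h3 := h.lt_next hjn
      rw [path, parent_survivor hi, Finset.mem_Ico] at hli
      rw [path, parent_survivor hj, Finset.mem_Ico] at hlj
      omega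
    intro i hi j hj
    rw [Finset.mem_filter] at hi hj
    by_contra hne
    rcases lt_or_gt_of_ne hne with hlt | hlt
    · exact key i hi.1 j hj.1 hi.2 hj.2 hlt
    · exact key j hj.1 i hi.1 hj.2 hi.2 hlt
  have hblock : ((blocks P).filter fun j => l ∈ path (parent P par) j).card ≤ 2 := by
    rcases h.par_spec with ⟨h1, -⟩ | ⟨h1, -⟩
    · refine (Finset.card_le_card (t := {l - 1, l}) ?_).trans Finset.card_le_two
      intro j hj
      obtain ⟨hj1, hj2⟩ := Finset.mem_filter.1 hj
      rw [path, Finset.mem_Ico] at hj2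
      simp only [Finset.mem_insert, Finset.mem_singleton]
      rcases mem_blocks.1 hj1 with hj | ⟨a, ha, rfl⟩
      · rw [parent_of_mem hj, h1] at hj2
        omega
      · rw [h.parent_succ ha, h1] at hj2
        omega
    · refine (Finset.card_le_card (t := {l + 1, l + 2}) ?_).trans Finset.card_le_two
      intro j hj
      obtain ⟨hj1, hj2⟩ := Finset.mem_filter.1 hj
      rw [path, Finset.mem_Ico] at hj2
      simp only [Finset.mem_insert, Finset.mem_singleton]
      rcases mem_blocks.1 hj1 with hj | ⟨a, ha, rfl⟩
      · rw [parent_of_mem hj, h1] at hj2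
        omega
      · rw [h.parent_succ ha, h1] at hj2
        omega
  have hsplit : ((Finset.Ico 1 n).filter fun j => l ∈ path (parent P par) j) ⊆
      ((survivors n P).filter fun j => l ∈ path (parent P par) j) ∪
      ((blocks P).filter fun j => l ∈ path (parent P par) j) := by
    intro j hj
    obtain ⟨hj1, hj2⟩ := Finset.mem_filter.1 hj
    by_cases hb : j ∈ blocks P
    · exact Finset.mem_union_right _ (Finset.mem_filter.2 ⟨hb, hj2⟩)
    · exact Finset.mem_union_left _
        (Finset.mem_filter.2 ⟨Finset.mem_sdiff.2 ⟨hj1, hb⟩, hj2⟩)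
  have := (Finset.card_le_card hsplit).trans (Finset.card_union_le _ _)
  omega

lemma pair_disjoint (h : PeakSet π P par) {a b : ℕ} (ha : a ∈ P) (hb : b ∈ P) (hab : a ≠ b) :
    Disjoint ({a, a + 1} : Finset ℕ) {b, b + 1} := by
  have h1 : b ≠ a + 1 := fun e => h.succ_notMem ha (e ▸ hb)
  have h2 : a ≠ b + 1 := fun e => h.succ_notMem hb (e ▸ ha)
  rw [Finset.disjoint_left]
  intro j hj hj'
  simp only [Finset.mem_insert, Finset.mem_singleton] at hj hj'
  omega

lemma prod_Ico_eq (h : PeakSet π P par) {M : Type*} [CommMonoid M] (g : ℕ → M) :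
    ∏ j ∈ Finset.Ico 1 n, g j =
      (∏ a ∈ P, g a * g (a + 1)) * ∏ j ∈ survivors n P, g j := by
  rw [← Finset.prod_sdiff h.blocks_subset, mul_comm]
  congr 1
  rw [blocks, Finset.prod_biUnion fun a ha b hb hab => h.pair_disjoint ha hb hab]
  exact Finset.prod_congr rfl fun a _ => Finset.prod_pair (Nat.succ_ne_self a).symm

lemma card_survivors (h : PeakSet π P par) : 2 * P.card + (survivors n P).card = n - 1 := by
  have h1 : (blocks P).card = 2 * P.card := by
    rw [blocks, Finset.card_biUnion fun a ha b hb hab => h.pair_disjoint ha hb hab]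
    rw [Finset.sum_congr rfl fun a _ => Finset.card_pair (Nat.succ_ne_self a).symm]
    simp [mul_comm]
  rw [survivors, Finset.card_sdiff_of_subset h.blocks_subset, h1, Nat.card_Ico]
  have := Finset.card_le_card h.blocks_subset
  rw [h1, Nat.card_Ico] at this
  omega

lemma permVal_mem (h : PeakSet π P par) {a : ℕ} (ha : a ∈ P) :
    permVal π a ∈ Finset.Ico 1 n := by
  have h1 := h.right a ha
  have h2 := h.lt a ha
  rw [Finset.mem_Ico]
  refine ⟨by omega, ?_⟩
  rw [permVal, dif_pos (by omega)]
  exact Fin.is_lt _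

lemma permVal_injOn (h : PeakSet π P par) : Set.InjOn (permVal π) P := fun a ha b hb hab =>
  permVal_inj π (by have := h.lt a ha; omega) (by have := h.lt b hb; omega) hab

/-- The place where monotonicity of the peaks is used: a block integrated later lies on one fixed
side of the present one, and its neighbour `par b` is on that same side. -/
lemma par_notMem (h : PeakSet π P par) {a b : ℕ} (ha : a ∈ P) (hb : b ∈ P)
    (hab : permVal π a ≤ permVal π b) : par b ∉ ({a, a + 1} : Finset ℕ) := by
  have h1 := h.one_le b hb
  simp only [Finset.mem_insert, Finset.mem_singleton]
  rcases hab.eq_or_lt with e | hlt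
  · have := h.permVal_injOn ha hb e
    subst this
    rcases h.par_spec with ⟨h2, -⟩ | ⟨h2, -⟩ <;> rw [h2] <;> omega
  · rcases h.par_spec with ⟨h2, h3⟩ | ⟨h2, h3⟩
    · have := h3 a ha b hb hlt
      rw [h2]; omega
    · have := h3 a ha b hb hlt
      rw [h2]; omega

end PeakSet

/-! ### The momenta of the lower line -/

section Lower

variable {n : ℕ} {E : Type*} [AddCommGroup E]

/-- The momenta of the lower line in terms of those of the upper line. -/
def lowerMomentum (π : Equiv.Perm (Fin n)) (j : ℕ) (X : ℕ → E) : E :=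
  X n + ∑ i ∈ Finset.univ.filter (fun i : Fin n => j ≤ π i), (X i - X (i + 1))

lemma lowerMomentum_zero (π : Equiv.Perm (Fin n)) (X : ℕ → E) : lowerMomentum π 0 X = X 0 := by
  simp only [lowerMomentum, Nat.zero_le, Finset.filter_true]
  rw [Fin.sum_univ_eq_sum_range (fun i => X i - X (i + 1)), Finset.sum_range_sub', add_sub_cancel]

lemma lowerMomentum_last (π : Equiv.Perm (Fin n)) (X : ℕ → E) : lowerMomentum π n X = X n := by
  rw [lowerMomentum, Finset.filter_false_of_mem fun i _ => not_le.2 (π i).2, Finset.sum_empty,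
    add_zero]

/-- Together with `indepOf_lowerMomentum` at `permVal π a + 1`, this isolates the whole dependence
on the block of a peak in the difference `X a - X (a + 1)`. -/
lemma lowerMomentum_permVal (π : Equiv.Perm (Fin n)) {a : ℕ} (ha : a < n) (X : ℕ → E) :
    lowerMomentum π (permVal π a) X =
      X a - X (a + 1) + lowerMomentum π (permVal π a + 1) X := by
  have h1 : Finset.univ.filter (fun i : Fin n => permVal π a ≤ π i) =
      insert ⟨a, ha⟩ (Finset.univ.filter fun i : Fin n => permVal π a + 1 ≤ π i) := by
    ext i
    simp only [Finset.mem_filter, Finset.mem_univ, true_and, Finset.mem_insert, permVal,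
      dif_pos ha]
    rw [Nat.succ_le_iff, le_iff_eq_or_lt]
    refine or_congr ⟨fun h => ?_, fun h => by rw [h]⟩ Iff.rfl
    exact (π.injective (Fin.ext h)).symm
  rw [lowerMomentum, lowerMomentum, h1, Finset.sum_insert]
  · simp only
    abel
  · simp [permVal, ha]

/-- The variables of the block occur only in the differences with index `a - 1`, `a` and `a + 1`;
the three hypotheses place these below the threshold `j`. For `j = permVal π a + 1` they are the
peak conditions. -/
lemma indepOf_lowerMomentum (π : Equiv.Perm (Fin n)) {a j : ℕ} (ha : a + 1 < n)
    (h0 : permVal π (a - 1) < j) (h1 : permVal π a < j) (h2 : permVal π (a + 1) < j) :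
    IndepOf (X := fun _ : ℕ => E) (lowerMomentum π j) {a, a + 1} := by
  intro X Y hXY
  simp only [Finset.mem_insert, Finset.mem_singleton] at hXY
  have hval : ∀ i : Fin n, permVal π i = π i := fun i => by rw [permVal, dif_pos i.2]
  rw [lowerMomentum, lowerMomentum, hXY n (by omega)]
  congr 1
  refine Finset.sum_congr rfl fun i hi => ?_
  have hi' := (Finset.mem_filter.1 hi).2
  rw [← hval i] at hi'
  have e0 : (i : ℕ) ≠ a - 1 := fun e => by rw [e] at hi'; omega
  have e1 : (i : ℕ) ≠ a := fun e => by rw [e] at hi'; omega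
  have e2 : (i : ℕ) ≠ a + 1 := fun e => by rw [e] at hi'; omega
  rw [hXY i (by omega), hXY (i + 1) (by omega)]

end Lower

/-! ### The momentum integrals of a pairing graph -/

lemma measurable_ecut (t : ℝ) {α : Type*} [MeasurableSpace α] {f : α → ℝ} (hf : Measurable f) :
    Measurable fun x => ecut t (f x) := ((measurable_cut _).comp hf).ennreal_ofReal

lemma measurable_ewt {d : ℕ} {α : Type*} [MeasurableSpace α] {f : α → Momentum d}
    (hf : Measurable f) : Measurable fun x => ewt (f x) := (measurable_wt.comp hf).ennreal_ofReal

/-- Families indexed by `ℕ` give all blocks, survivors and end points a common index set for partial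
integration; coordinates from `n` on stay frozen at `p`. -/
lemma lintegral_ext_eq_lmarginal {E : Type*} [AddCommGroup E] [MeasureSpace E]
    [SigmaFinite (volume : Measure E)] {n : ℕ} (p : E) {F : (ℕ → E) → ℝ≥0∞} (hF : Measurable F) :
    ∫⁻ x : Fin n → E, F (ext p x) =
      lmarginal (fun _ : ℕ => (volume : Measure E)) (Finset.range n) F (fun _ => p) := by
  let f : Fin n ≃ Finset.range n :=
    { toFun := fun i => ⟨i, Finset.mem_range.2 i.2⟩
      invFun := fun i => ⟨i, Finset.mem_range.1 i.2⟩
      left_inv := fun i => rfl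
      right_inv := fun i => rfl }
  have hmp := measurePreserving_piCongrLeft (fun _ : Finset.range n => (volume : Measure E)) f
  have hm : Measurable fun y : (∀ _ : Finset.range n, E) =>
      F (Function.updateFinset (fun _ => p) (Finset.range n) y) := hF.comp measurable_updateFinset
  rw [lmarginal, ← hmp.lintegral_comp hm]
  refine lintegral_congr fun x => ?_
  congr 1
  funext j
  by_cases hj : j < n
  · rw [ext, dif_pos hj, Function.updateFinset, dif_pos (Finset.mem_range.2 hj)]
    exact (Equiv.piCongrLeft_apply_apply (fun _ : Finset.range n => E) f x ⟨j, hj⟩).symm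
  · rw [ext, dif_neg hj, Function.updateFinset, dif_neg (by simpa using hj)]

lemma ext_chain_sub {E : Type*} [AddCommGroup E] {n : ℕ} (p : E) (k : Fin n → E) (l : Fin n) :
    ext p (chain p k) l - ext p (chain p k) (l + 1) = k l := by
  have h1 : Finset.univ.filter (fun i : Fin n => l ≤ i) =
      insert l (Finset.univ.filter fun i : Fin n => (l : ℕ) + 1 ≤ i) := by
    ext i
    simp only [Finset.mem_filter, Finset.mem_univ, true_and, Finset.mem_insert]
    rw [Nat.succ_le_iff, Fin.le_def, le_iff_eq_or_lt]
    exact or_congr ⟨fun h => (Fin.ext h).symm, fun h => by rw [h]⟩ Iff.rfl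
  have h2 : ext p (chain p k) (l + 1) =
      p + ∑ i ∈ Finset.univ.filter (fun i : Fin n => (l : ℕ) + 1 ≤ i), k i := by
    rw [ext]
    split_ifs with h
    · rfl
    · rw [Finset.filter_false_of_mem, Finset.sum_empty, add_zero]
      intro i _
      omega
  rw [h2, ext, dif_pos l.2]
  change chain p k l - _ = _
  rw [chain, h1, Finset.sum_insert (by simp)]
  abel

section Marginals

variable {d : ℕ} {e : Momentum d → ℝ} {t K : ℝ}

lemma lmarginal_single_le (hec : Continuous e)
    (h1 : ∀ v θ, ∫⁻ x, ewt (x - v) * ecut t (e x - θ) ≤ ENNReal.ofReal (K * logStar t))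
    {j b : ℕ} (hb : b ≠ j) (θ : ℝ) (X : ℕ → Momentum d) :
    lmarginal (fun _ : ℕ => (volume : Measure (Momentum d))) {j} (fun X : ℕ → Momentum d => ewt (X j - X b) * ecut t (e (X j) + θ)) X ≤
      ENNReal.ofReal (K * logStar t) := by
  rw [lmarginal_singleton]
  simp only [Function.update_self, Function.update_of_ne hb]
  have := h1 (X b) (-θ)
  simpa only [sub_neg_eq_add] using this

/-- The second variable of the block is integrated first: it meets two resolvents, and
transversality leaves `1 + ‖u + r‖ₑ⁻¹` for the first variable `u`. That singularity is then
integrated against the remaining resolvent. The cost is two logarithms and then one. -/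
lemma lmarginal_block_le (hec : Continuous e) (heven : ∀ x, e (-x) = e x) (hK : 0 ≤ K)
    (h2 : ∀ v θ w, ∫⁻ x, ewt (x - v) * ecut t (e x - θ) * (1 + ‖x - w‖ₑ⁻¹) ≤
      ENNReal.ofReal (K * logStar t))
    (h3 : ∀ v θ w θ', ∫⁻ x, ewt (x - v) * ecut t (e x - θ) * ecut t (e (x - w) - θ') ≤
      ENNReal.ofReal (K * logStar t ^ 2) * (1 + ‖w‖ₑ⁻¹))
    {a b : ℕ} (hb : b ∉ ({a, a + 1} : Finset ℕ)) {r : (ℕ → Momentum d) → Momentum d}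
    (hrm : Measurable r) (hr : IndepOf r {a, a + 1}) (θ θ' θ'' : ℝ) (X : ℕ → Momentum d) :
    lmarginal (fun _ : ℕ => (volume : Measure (Momentum d))) {a, a + 1}
      (fun X : ℕ → Momentum d => (ewt (X a - X b) * ecut t (e (X a) + θ)) *
      (ewt (X (a + 1) - X b) * ecut t (e (X (a + 1)) + θ')) *
        ecut t (e (X a - X (a + 1) + r X) + θ'')) X ≤
      ENNReal.ofReal (K ^ 2 * logStar t ^ 3) := by
  have hl := logStar_pos t
  simp only [Finset.mem_insert, Finset.mem_singleton, not_or] at hb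
  have hem := hec.measurable
  have hX : ∀ j, Measurable fun X : ℕ → Momentum d => X j := fun j => measurable_pi_apply j
  rw [lmarginal_insert _ ?_ (by simp)]
  swap
  · exact (((measurable_ewt ((hX _).sub (hX _))).mul
      (measurable_ecut t ((hem.comp (hX _)).add_const _))).mul
      ((measurable_ewt ((hX _).sub (hX _))).mul
      (measurable_ecut t ((hem.comp (hX _)).add_const _)))).mul
      (measurable_ecut t ((hem.comp (((hX _).sub (hX _)).add hrm)).add_const _))
  have hru : ∀ u v, r (Function.update (Function.update X a u) (a + 1) v) = r X := fun u v => by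
    refine hr _ _ fun j hj => ?_
    simp only [Finset.mem_insert, Finset.mem_singleton, not_or] at hj
    rw [Function.update_of_ne hj.2, Function.update_of_ne hj.1]
  simp only [lmarginal_singleton, Function.update_self, Function.update_of_ne hb.1,
    Function.update_of_ne hb.2, Function.update_of_ne (Nat.succ_ne_self a).symm, hru]
  calc _ ≤ ∫⁻ u, ewt (u - X b) * ecut t (e u - -θ) *
        (ENNReal.ofReal (K * logStar t ^ 2) * (1 + ‖u - -r X‖ₑ⁻¹)) := by
        refine lintegral_mono fun u => ?_
        have := h3 (X b) (-θ') (u + r X) (-θ'')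
        rw [sub_neg_eq_add, sub_neg_eq_add]
        refine le_trans (le_of_eq ?_) (mul_le_mul_right this _)
        rw [← lintegral_const_mul' _ _ (ENNReal.mul_ne_top ENNReal.ofReal_ne_top
          ENNReal.ofReal_ne_top)]
        refine lintegral_congr fun y => ?_
        rw [sub_neg_eq_add, sub_neg_eq_add, mul_assoc]
        congr 4
        -- By evenness the momentum `u - y + r` may be replaced by `y - (u + r)`, the form required
        -- by the two-resolvent bound.
        rw [← heven]
        congr 1
        abel
    _ = ENNReal.ofReal (K * logStar t ^ 2) *
          ∫⁻ u, ewt (u - X b) * ecut t (e u - -θ) * (1 + ‖u - -r X‖ₑ⁻¹) := by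
        rw [← lintegral_const_mul' _ _ ENNReal.ofReal_ne_top]
        exact lintegral_congr fun u => by ring
    _ ≤ ENNReal.ofReal (K * logStar t ^ 2) * ENNReal.ofReal (K * logStar t) :=
        mul_le_mul_right (h2 _ _ _) _
    _ = _ := by
        rw [← ENNReal.ofReal_mul (by positivity)]
        congr 1; ring

lemma measurable_lowerMomentum {n : ℕ} (π : Equiv.Perm (Fin n)) (j : ℕ) :
    Measurable (lowerMomentum (E := Momentum d) π j) := by
  unfold lowerMomentum
  exact (measurable_pi_apply n).add (Finset.measurable_fun_sum _ fun i _ =>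
    (measurable_pi_apply _).sub (measurable_pi_apply _))

lemma prod_range_succ_split {M : Type*} [CommMonoid M] {n : ℕ} (hn : 0 < n) (g : ℕ → M) :
    ∏ j ∈ Finset.range (n + 1), g j = g 0 * g n * ∏ j ∈ Finset.Ico 1 n, g j := by
  rw [Finset.prod_range_succ, Finset.prod_range_eq_mul_Ico g hn, mul_right_comm]

/-- The momentum integrals at fixed energies, up to the integral over `x_0`. -/
lemma lmarginal_graph_le (hec : Continuous e) (heven : ∀ x, e (-x) = e x) (ht : 0 < t) (hK : 0 ≤ K)
    (h1 : ∀ v θ, ∫⁻ x, ewt (x - v) * ecut t (e x - θ) ≤ ENNReal.ofReal (K * logStar t))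
    (h2 : ∀ v θ w, ∫⁻ x, ewt (x - v) * ecut t (e x - θ) * (1 + ‖x - w‖ₑ⁻¹) ≤
      ENNReal.ofReal (K * logStar t))
    (h3 : ∀ v θ w θ', ∫⁻ x, ewt (x - v) * ecut t (e x - θ) * ecut t (e (x - w) - θ') ≤
      ENNReal.ofReal (K * logStar t ^ 2) * (1 + ‖w‖ₑ⁻¹))
    {n : ℕ} (hn : 0 < n) {π : Equiv.Perm (Fin n)} {P : Finset ℕ} {par : ℕ → ℕ}
    (hP : PeakSet π P par) (θ θ' : ℕ → ℝ) (X : ℕ → Momentum d) :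
    lmarginal (fun _ : ℕ => (volume : Measure (Momentum d))) (Finset.range n) (fun X : ℕ → Momentum d =>
      (∏ l ∈ Finset.range n, ewt (X l - X (l + 1)) ^ 4) *
        ((∏ j ∈ Finset.range (n + 1), ecut t (e (X j) + θ j)) *
          ∏ j ∈ Finset.range (n + 1), ecut t (e (lowerMomentum π j X) + θ' j))) X ≤
      ((2 : ℝ≥0∞) ^ (d + 1)) ^ (4 * n) * ENNReal.ofReal t ^ (n - 1 - P.card) *
        (ENNReal.ofReal (K ^ 2 * logStar t ^ 3) ^ P.card *
          ENNReal.ofReal (K * logStar t) ^ (n - 1 - 2 * P.card)) *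
        ∫⁻ u, ewt (u - X n) * ((ecut t (e u + θ 0) * ecut t (e (X n) + θ n)) *
          (ecut t (e u + θ' 0) * ecut t (e (X n) + θ' n))) := by
  have hem := hec.measurable
  have hX : ∀ j, Measurable fun X : ℕ → Momentum d => X j := fun j => measurable_pi_apply j
  have hwm : ∀ i j, Measurable fun X : ℕ → Momentum d => ewt (X i - X j) := fun i j =>
    measurable_ewt ((hX i).sub (hX j))
  have hum : ∀ j θ, Measurable fun X : ℕ → Momentum d => ecut t (e (X j) + θ) := fun j θ =>
    measurable_ecut t ((hem.comp (hX j)).add_const _)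
  have hvm : ∀ j θ, Measurable fun X : ℕ → Momentum d => ecut t (e (lowerMomentum π j X) + θ) :=
    fun j θ => measurable_ecut t ((hem.comp (measurable_lowerMomentum π j)).add_const _)
  set fB : ℕ → (ℕ → Momentum d) → ℝ≥0∞ := fun a X =>
    (ewt (X a - X (par a)) * ecut t (e (X a) + θ a)) *
      (ewt (X (a + 1) - X (par a)) * ecut t (e (X (a + 1)) + θ (a + 1))) *
        ecut t (e (lowerMomentum π (permVal π a) X) + θ' (permVal π a)) with hfB
  set fS : ℕ → (ℕ → Momentum d) → ℝ≥0∞ := fun j X =>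
    ewt (X j - X (PeakSet.next P j)) * ecut t (e (X j) + θ j) with hfS
  set G : (ℕ → Momentum d) → ℝ≥0∞ := fun X => ewt (X 0 - X n) *
    ((ecut t (e (X 0) + θ 0) * ecut t (e (X n) + θ n)) *
      (ecut t (e (X 0) + θ' 0) * ecut t (e (X n) + θ' n))) with hG
  have hfBm : ∀ a, Measurable (fB a) := fun a =>
    (((hwm _ _).mul (hum _ _)).mul ((hwm _ _).mul (hum _ _))).mul (hvm _ _)
  have hfSm : ∀ j, Measurable (fS j) := fun j => (hwm _ _).mul (hum _ _)
  have hGm : Measurable G :=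
    (hwm _ _).mul (((hum _ _).mul (hum _ _)).mul ((hum _ _).mul (hum _ _)))
  set c : ℝ≥0∞ := (2 : ℝ≥0∞) ^ (d + 1) with hc
  set C₀ : ℝ≥0∞ := c ^ (4 * n) * ENNReal.ofReal t ^ (n - 1 - P.card) with hC₀
  have hC₀top : C₀ ≠ ⊤ := ENNReal.mul_ne_top (ENNReal.pow_ne_top (ENNReal.pow_ne_top (by simp)))
    (ENNReal.pow_ne_top ENNReal.ofReal_ne_top)
  -- Weights are rerouted to the parents, lower resolvents that do not belong to a peak are replaced
  -- by `t`, and the rest is grouped into block factors, survivor factors and a factor `G` of `X 0`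
  -- and `X n` alone.
  have hpt : ∀ X : ℕ → Momentum d, (∏ l ∈ Finset.range n, ewt (X l - X (l + 1)) ^ 4) *
        ((∏ j ∈ Finset.range (n + 1), ecut t (e (X j) + θ j)) *
          ∏ j ∈ Finset.range (n + 1), ecut t (e (lowerMomentum π j X) + θ' j)) ≤
      C₀ * ((∏ a ∈ P, fB a X) * ((∏ j ∈ PeakSet.survivors n P, fS j X) * G X)) := by
    intro X
    set u : ℕ → ℝ≥0∞ := fun j => ecut t (e (X j) + θ j) with hu
    set v : ℕ → ℝ≥0∞ := fun j => ecut t (e (lowerMomentum π j X) + θ' j) with hv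
    have hw := prod_ewt_le (PeakSet.parent P par) hP.parent_le (fun l hl => hP.card_path_le hl) X
    have hQ : P.image (permVal π) ⊆ Finset.Ico 1 n := fun j hj => by
      obtain ⟨a, ha, rfl⟩ := Finset.mem_image.1 hj
      exact hP.permVal_mem ha
    have hlow : ∏ j ∈ Finset.Ico 1 n, v j ≤
        ENNReal.ofReal t ^ (n - 1 - P.card) * ∏ a ∈ P, v (permVal π a) := by
      rw [← Finset.prod_sdiff hQ, Finset.prod_image hP.permVal_injOn]
      refine mul_le_mul_left ?_ _
      have : (Finset.Ico 1 n \ P.image (permVal π)).card = n - 1 - P.card := by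
        rw [Finset.card_sdiff_of_subset hQ, Finset.card_image_of_injOn hP.permVal_injOn,
          Nat.card_Ico]
      rw [← this, ← Finset.prod_const]
      exact Finset.prod_le_prod' fun j _ => ecut_le ht _
    have hup : (∏ j ∈ Finset.Ico 1 n, ewt (X j - X (PeakSet.parent P par j))) *
        ∏ j ∈ Finset.Ico 1 n, u j =
        (∏ a ∈ P, (ewt (X a - X (par a)) * u a) * (ewt (X (a + 1) - X (par a)) * u (a + 1))) *
          ∏ j ∈ PeakSet.survivors n P, fS j X := by
      rw [← Finset.prod_mul_distrib, hP.prod_Ico_eq]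
      congr 1
      · exact Finset.prod_congr rfl fun a ha => by
          rw [PeakSet.parent_of_mem ha, hP.parent_succ ha]
      · exact Finset.prod_congr rfl fun j hj => by rw [PeakSet.parent_survivor hj]
    have hB' : ∏ a ∈ P, fB a X =
        (∏ a ∈ P, (ewt (X a - X (par a)) * u a) * (ewt (X (a + 1) - X (par a)) * u (a + 1))) *
          ∏ a ∈ P, v (permVal π a) := by
      rw [← Finset.prod_mul_distrib]
    rw [prod_range_succ_split hn u, prod_range_succ_split hn v]
    calc _ ≤ (c ^ (4 * n) * (ewt (X 0 - X n) *
          ∏ j ∈ Finset.Ico 1 n, ewt (X j - X (PeakSet.parent P par j)))) *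
          ((u 0 * u n * ∏ j ∈ Finset.Ico 1 n, u j) * (v 0 * v n *
            (ENNReal.ofReal t ^ (n - 1 - P.card) * ∏ a ∈ P, v (permVal π a)))) :=
          mul_le_mul' hw (mul_le_mul_right (mul_le_mul_right hlow _) _)
      _ = C₀ * ((((∏ j ∈ Finset.Ico 1 n, ewt (X j - X (PeakSet.parent P par j))) *
            ∏ j ∈ Finset.Ico 1 n, u j) * ∏ a ∈ P, v (permVal π a)) *
            (ewt (X 0 - X n) * ((u 0 * u n) * (v 0 * v n)))) := by rw [hC₀]; ring
      _ = _ := by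
          have e0 : v 0 = ecut t (e (X 0) + θ' 0) := by rw [hv]; simp only [lowerMomentum_zero]
          have en : v n = ecut t (e (X n) + θ' n) := by rw [hv]; simp only [lowerMomentum_last]
          rw [hup, hB', hG, e0, en]
          simp only [hu]
          ring
  refine (lmarginal_mono hpt X).trans ?_
  have hm2 : Measurable fun X => (∏ j ∈ PeakSet.survivors n P, fS j X) * G X :=
    (Finset.measurable_fun_prod _ fun j _ => hfSm j).mul hGm
  have hm1 : Measurable fun X => (∏ a ∈ P, fB a X) *
      ((∏ j ∈ PeakSet.survivors n P, fS j X) * G X) :=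
    (Finset.measurable_fun_prod _ fun j _ => hfBm j).mul hm2
  have hconst : ∀ (C : ℝ≥0∞) (s : Finset ℕ) {g : (ℕ → Momentum d) → ℝ≥0∞}, Measurable g → ∀ X,
      lmarginal (fun _ : ℕ => (volume : Measure (Momentum d))) s (fun X => C * g X) X =
        C * lmarginal (fun _ : ℕ => (volume : Measure (Momentum d))) s g X := fun C s g hg X => by
    simp only [lmarginal]
    exact lintegral_const_mul _ (hg.comp measurable_updateFinset)
  rw [hconst _ _ hm1]
  refine le_trans (mul_le_mul_right ?_ C₀) (mul_assoc _ _ _).symm.le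
  -- the order of integration
  have hsurv_n : ∀ j ∈ PeakSet.survivors n P, 1 ≤ j ∧ j < n ∧ j ∉ PeakSet.blocks P := fun j hj => by
    obtain ⟨h4, h5⟩ := Finset.mem_sdiff.1 hj
    exact ⟨(Finset.mem_Ico.1 h4).1, (Finset.mem_Ico.1 h4).2, h5⟩
  have hrange : Finset.range n = ({0} ∪ PeakSet.survivors n P) ∪ PeakSet.blocks P := by
    ext j
    have h4 : j ∈ PeakSet.blocks P → j ∈ Finset.Ico 1 n := fun h => hP.blocks_subset h
    simp only [Finset.mem_range, Finset.mem_union, Finset.mem_singleton, PeakSet.survivors,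
      Finset.mem_sdiff]
    rw [Finset.mem_Ico] at h4 ⊢
    by_cases hb : j ∈ PeakSet.blocks P
    · simp only [hb, or_true, iff_true]; exact (h4 hb).2
    · simp only [hb, or_false, not_false_eq_true, and_true]
      omega
  have hd1 : Disjoint ({0} ∪ PeakSet.survivors n P) (PeakSet.blocks P) := by
    rw [Finset.disjoint_union_left]
    refine ⟨?_, Finset.sdiff_disjoint⟩
    rw [Finset.disjoint_singleton_left]
    intro h
    simpa using hP.blocks_subset h
  have hd2 : Disjoint ({0} : Finset ℕ) (PeakSet.survivors n P) := by
    rw [Finset.disjoint_singleton_left]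
    intro h
    have := (hsurv_n 0 h).1
    omega
  rw [hrange, lmarginal_union _ _ hm1 hd1]
  -- blocks
  have hGindep : ∀ V : Finset ℕ, 0 ∉ V → n ∉ V → IndepOf G V := by
    intro V h0 hn' Y Z h
    simp only [hG]
    rw [h 0 h0, h n hn']
  have hblock : ∀ Y, lmarginal (fun _ : ℕ => (volume : Measure (Momentum d))) (PeakSet.blocks P) (fun X => (∏ a ∈ P, fB a X) *
      ((∏ j ∈ PeakSet.survivors n P, fS j X) * G X)) Y ≤
      (∏ _a ∈ P, ENNReal.ofReal (K ^ 2 * logStar t ^ 3)) *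
        ((∏ j ∈ PeakSet.survivors n P, fS j Y) * G Y) := by
    intro Y
    refine lmarginal_prod_le (fun _ : ℕ => (volume : Measure (Momentum d))) (permVal π) P hfBm hm2
      ?_ ?_ ?_ Y
    -- The key is the value of `π`: for a later block neither the lower momentum at its peak nor its
    -- parent involves the variables of an earlier one.
    · intro a ha b hb hab hkey
      refine ⟨hP.pair_disjoint ha hb hab, ?_⟩
      have hlt : permVal π a < permVal π b :=
        lt_of_le_of_ne hkey fun h => hab (hP.permVal_injOn ha hb h)
      have hq := indepOf_lowerMomentum (E := Momentum d) π (hP.lt a ha)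
        ((hP.left a ha).trans hlt) hlt ((hP.right a ha).trans hlt)
      have hdis := hP.pair_disjoint hb ha (Ne.symm hab)
      rw [Finset.disjoint_left] at hdis
      intro Y Z h
      simp only [hfB]
      rw [hq Y Z h, h b (hdis (by simp)), h (b + 1) (hdis (by simp)),
        h (par b) (hP.par_notMem ha hb hkey)]
    · intro a ha
      have hab : a ∈ PeakSet.blocks P := PeakSet.mem_blocks.2 (Or.inl ha)
      have hab' : a + 1 ∈ PeakSet.blocks P := PeakSet.mem_blocks.2 (Or.inr ⟨a, ha, rfl⟩)
      have hnot : ∀ j ∉ PeakSet.blocks P, j ∉ ({a, a + 1} : Finset ℕ) := fun j hj hj' => by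
        simp only [Finset.mem_insert, Finset.mem_singleton] at hj'
        rcases hj' with rfl | rfl
        · exact hj hab
        · exact hj hab'
      refine IndepOf.mul (IndepOf.prod fun j hj => ?_) (hGindep _ ?_ ?_)
      · obtain ⟨-, h5, h6⟩ := hsurv_n j hj
        intro Y Z h
        simp only [hfS]
        rw [h j (hnot j h6), h _ (hnot _ (hP.next_notMem h5))]
      · exact hnot 0 fun h => by simpa using hP.blocks_subset h
      · exact hnot n fun h => by simpa using hP.blocks_subset h
    · intro a ha Y
      have hq := indepOf_lowerMomentum (E := Momentum d) π (hP.lt a ha)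
        ((hP.left a ha).trans (Nat.lt_succ_self _)) (Nat.lt_succ_self _)
        ((hP.right a ha).trans (Nat.lt_succ_self _))
      have := lmarginal_block_le hec heven hK h2 h3 (hP.par_notMem ha ha le_rfl)
        (measurable_lowerMomentum π _) hq (θ a) (θ (a + 1)) (θ' (permVal π a)) Y
      simp only [← lowerMomentum_permVal π ((Nat.lt_succ_self a).trans (hP.lt a ha))] at this
      exact this
  refine (lmarginal_mono hblock X).trans ?_
  rw [hconst _ _ hm2, Finset.prod_const]
  refine le_trans (mul_le_mul_right ?_ _) (mul_assoc _ _ _).symm.le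
  rw [lmarginal_union _ _ hm2 hd2]
  -- survivors
  have hsur : ∀ Y, lmarginal (fun _ : ℕ => (volume : Measure (Momentum d))) (PeakSet.survivors n P)
      (fun X => (∏ j ∈ PeakSet.survivors n P, fS j X) * G X) Y ≤
      (∏ _j ∈ PeakSet.survivors n P, ENNReal.ofReal (K * logStar t)) * G Y := by
    intro Y
    have hbi : (PeakSet.survivors n P).biUnion (fun j => ({j} : Finset ℕ)) =
        PeakSet.survivors n P := Finset.biUnion_singleton_eq_self
    have := lmarginal_prod_le (fun _ : ℕ => (volume : Measure (Momentum d))) (fun j => j)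
      (PeakSet.survivors n P) (V := fun j => {j}) (B := fun _ => ENNReal.ofReal (K * logStar t))
      hfSm hGm ?_ ?_ ?_ Y
    · rwa [hbi] at this
    -- Survivors are integrated in increasing order, since each is attached to a larger index.
    · intro i hi j hj hij hle
      have hlt : i < j := lt_of_le_of_ne hle hij
      refine ⟨by simpa using hij, fun Y Z h => ?_⟩
      have h6 := hP.lt_next (hsurv_n j hj).2.1
      simp only [hfS]
      rw [h j (by simpa using hij.symm), h (PeakSet.next P j) (by
        rw [Finset.mem_singleton]; omega)]
    · intro j hj
      obtain ⟨h5, h6, -⟩ := hsurv_n j hj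
      refine hGindep _ ?_ ?_ <;> rw [Finset.mem_singleton] <;> omega
    · intro j hj Y
      have h6 := hP.lt_next (hsurv_n j hj).2.1
      exact lmarginal_single_le hec h1 (by omega) (θ j) Y
  refine (lmarginal_mono hsur X).trans ?_
  have hcard : (PeakSet.survivors n P).card = n - 1 - 2 * P.card := by
    have := hP.card_survivors
    omega
  rw [hconst _ _ hGm, Finset.prod_const, hcard]
  refine mul_le_mul_right (le_of_eq ?_) _
  rw [lmarginal_singleton]
  simp only [hG, Function.update_self, Function.update_of_ne hn.ne']

end Marginals

/-- Needed in both directions: first to eliminate momenta at fixed energies, then to integrate the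
energies at fixed `x_0`. -/
lemma lintegral_mul_lintegral_swap {α : Type*} [MeasurableSpace α] {μ : Measure α} [SFinite μ]
    {W : α → ℝ≥0∞} (hW : Measurable W) {U V : α → ℝ → ℝ≥0∞}
    (hU : Measurable fun z : α × ℝ => U z.1 z.2) (hV : Measurable fun z : α × ℝ => V z.1 z.2) :
    ∫⁻ x, W x * ((∫⁻ ξ, U x ξ) * ∫⁻ ξ, V x ξ) ∂μ =
      ∫⁻ z : ℝ × ℝ, ∫⁻ x, W x * (U x z.1 * V x z.2) ∂μ := by
  have hUx : ∀ x, Measurable fun ξ => U x ξ := fun x => hU.comp measurable_prodMk_left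
  have hVx : ∀ x, Measurable fun ξ => V x ξ := fun x => hV.comp measurable_prodMk_left
  have e2 : ∀ x, W x * ((∫⁻ ξ, U x ξ) * ∫⁻ ξ, V x ξ) =
      ∫⁻ z : ℝ × ℝ, W x * (U x z.1 * V x z.2) := fun x => by
    have hm : Measurable fun z : ℝ × ℝ => U x z.1 * V x z.2 :=
      ((hUx x).comp measurable_fst).mul ((hVx x).comp measurable_snd)
    rw [lintegral_const_mul _ hm, Measure.volume_eq_prod, lintegral_prod_mul (hUx x).aemeasurable (hVx x).aemeasurable]
  simp only [e2]
  refine lintegral_lintegral_swap (Measurable.aemeasurable ?_)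
  have h1 : Measurable fun z : α × (ℝ × ℝ) => (z.1, z.2.1) := by fun_prop
  have h2 : Measurable fun z : α × (ℝ × ℝ) => (z.1, z.2.2) := by fun_prop
  exact (hW.comp measurable_fst).mul ((hU.comp h1).mul (hV.comp h2))

/-- The powers of `t` add up to `(n - 1 - q) + 1 = n - q`, and those of the logarithm to `3 * q + (n
- 1 - 2 * q) + 2 = n + q + 1`. -/
lemma graph_constant_le {c₀ K₁ K₂ K₃ t l : ℝ} (hc : 1 ≤ c₀) (h1 : 1 ≤ K₁) (h2 : 1 ≤ K₂)
    (h3 : 1 ≤ K₃) (ht : 0 < t) (hl : 1 ≤ l) {n q : ℕ} (hn : 2 * q ≤ n - 1) (hn0 : 0 < n) :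
    c₀ ^ (4 * n) * t ^ (n - 1 - q) * ((K₁ ^ 2 * l ^ 3) ^ q * (K₁ * l) ^ (n - 1 - 2 * q)) *
        (K₂ * l * (16 * t) * (K₃ + K₁ * l)) ≤
      (c₀ ^ 4 * K₁ * (K₂ * 16 * (K₃ + K₁))) ^ n * (t ^ n * (t ^ q)⁻¹) * l ^ (n + q + 1) := by
  obtain ⟨M, hM⟩ : ∃ M, M = K₂ * 16 * (K₃ + K₁) := ⟨_, rfl⟩
  have hM1 : 1 ≤ M := by nlinarith
  obtain ⟨s, rfl⟩ : ∃ s, n = 1 + 2 * q + s := ⟨n - 1 - 2 * q, by omega⟩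
  have hs1 : 1 + 2 * q + s - 1 - q = q + s := by omega
  have hs2 : 1 + 2 * q + s - 1 - 2 * q = s := by omega
  rw [hs1, hs2, ← hM]
  have hbr : K₃ + K₁ * l ≤ (K₃ + K₁) * l := by nlinarith
  have htq : t ^ (1 + 2 * q + s) * (t ^ q)⁻¹ = t ^ (q + s) * t := by
    field_simp
    ring
  have hl0 : 0 < l := by linarith
  rw [htq]
  have hf1 : K₁ ^ (2 * q + s) ≤ K₁ ^ (1 + 2 * q + s) := pow_le_pow_right₀ h1 (by omega)
  have hf2 : M ≤ M ^ (1 + 2 * q + s) := le_self_pow₀ hM1 (by omega)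
  calc c₀ ^ (4 * (1 + 2 * q + s)) * t ^ (q + s) * ((K₁ ^ 2 * l ^ 3) ^ q * (K₁ * l) ^ s) *
        (K₂ * l * (16 * t) * (K₃ + K₁ * l))
      ≤ c₀ ^ (4 * (1 + 2 * q + s)) * t ^ (q + s) * ((K₁ ^ 2 * l ^ 3) ^ q * (K₁ * l) ^ s) *
        (K₂ * l * (16 * t) * ((K₃ + K₁) * l)) :=
        mul_le_mul_of_nonneg_left (mul_le_mul_of_nonneg_left hbr (by positivity)) (by positivity)
    _ = ((c₀ ^ 4) ^ (1 + 2 * q + s) * (t ^ (q + s) * t) * l ^ (1 + 2 * q + s + q + 1)) *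
          (K₁ ^ (2 * q + s) * M) := by
        rw [hM, ← pow_mul]; ring
    _ ≤ ((c₀ ^ 4) ^ (1 + 2 * q + s) * (t ^ (q + s) * t) * l ^ (1 + 2 * q + s + q + 1)) *
          (K₁ ^ (1 + 2 * q + s) * M ^ (1 + 2 * q + s)) :=
        mul_le_mul_of_nonneg_left (mul_le_mul hf1 hf2 (by positivity) (by positivity))
          (by positivity)
    _ = _ := by rw [mul_pow, mul_pow]; ring

/-- The integral over the momenta and the two energy variables of a pairing graph. -/
theorem exists_lintegral_graph_le (d : ℕ) (hd : 3 ≤ d) {A B κ₀ ρ : ℝ} (hA : 0 < A) (hB : 0 < B)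
    (hρ : 0 < ρ) :
    ∃ K : ℝ, 1 ≤ K ∧ ∀ e : Momentum d → ℝ, UniformlyConvex A B e → Transversal κ₀ ρ e →
      ∀ (n κ : ℕ) (π : Equiv.Perm (Fin n)), 0 < n → HasMonotonePeaks π κ →
      ∀ c c' : ℕ → ℝ, c 0 = c' 0 → c n = c' n → ∀ (p : Momentum d) (t : ℝ), 0 < t →
      ∫⁻ k : Fin n → Momentum d, (∏ l, ewt (k l) ^ 4) *
        ((∫⁻ ξ : ℝ, ∏ j ∈ Finset.range (n + 1),
            ecut t (e (ext p (chain p k) j) + (c j + 2 * Real.pi * ξ))) *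
          ∫⁻ ξ : ℝ, ∏ j ∈ Finset.range (n + 1),
            ecut t (e (lowerMomentum π j (ext p (chain p k))) + (c' j + 2 * Real.pi * ξ))) ≤
        ENNReal.ofReal (K ^ n * (t ^ n * (t ^ κ)⁻¹) * logStar t ^ (n + κ + 1)) := by
  obtain ⟨K₁, hK₁, hres⟩ := exists_resolvent_bounds d hd (κ := κ₀) hA hB hρ
  obtain ⟨K₂, hK₂, hen⟩ := exists_lintegral_cut_mul_cut_le
  obtain ⟨K₃, hK₃, hwt⟩ := lintegral_wt_le d (by omega)
  obtain ⟨c₀, hc₀⟩ : ∃ c₀ : ℝ, c₀ = (2 : ℝ) ^ (d + 1) := ⟨_, rfl⟩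
  have hc₀1 : 1 ≤ c₀ := hc₀ ▸ one_le_pow₀ (by norm_num)
  have hM1 : 1 ≤ K₂ * 16 * (K₃ + K₁) := by nlinarith
  refine ⟨c₀ ^ 4 * K₁ * (K₂ * 16 * (K₃ + K₁)), by
    have : 1 ≤ c₀ ^ 4 := one_le_pow₀ hc₀1
    have : 1 ≤ c₀ ^ 4 * K₁ := one_le_mul_of_one_le_of_one_le this hK₁
    exact one_le_mul_of_one_le_of_one_le this hM1, ?_⟩
  intro e he htr n κ π hn hpk c c' h0 hcn p t ht
  obtain ⟨P, par, hP, rfl⟩ := hpk.exists_peakSet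
  have hl := one_le_logStar t
  have hl0 := logStar_pos t
  have hec := he.continuous
  have hem := hec.measurable
  have hX : ∀ j, Measurable fun X : ℕ → Momentum d => X j := fun j => measurable_pi_apply j
  have hwm : ∀ i j, Measurable fun X : ℕ → Momentum d => ewt (X i - X j) := fun i j =>
    measurable_ewt ((hX i).sub (hX j))
  obtain ⟨W, hW⟩ : ∃ W : (ℕ → Momentum d) → ℝ≥0∞, W = fun X =>
    ∏ l ∈ Finset.range n, ewt (X l - X (l + 1)) ^ 4 := ⟨_, rfl⟩
  obtain ⟨U, hU⟩ : ∃ U : (ℕ → Momentum d) → ℝ → ℝ≥0∞, U = fun X ξ =>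
    ∏ j ∈ Finset.range (n + 1), ecut t (e (X j) + (c j + 2 * Real.pi * ξ)) := ⟨_, rfl⟩
  obtain ⟨V, hV⟩ : ∃ V : (ℕ → Momentum d) → ℝ → ℝ≥0∞, V = fun X ξ =>
    ∏ j ∈ Finset.range (n + 1), ecut t (e (lowerMomentum π j X) + (c' j + 2 * Real.pi * ξ)) :=
    ⟨_, rfl⟩
  have hWm : Measurable W := by
    rw [hW]
    exact Finset.measurable_fun_prod _ fun l _ => (hwm _ _).pow_const 4
  have hUm : Measurable fun z : (ℕ → Momentum d) × ℝ => U z.1 z.2 := by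
    rw [hU]
    exact Finset.measurable_fun_prod _ fun j _ => measurable_ecut t
      ((hem.comp ((hX j).comp measurable_fst)).add
        ((measurable_snd.const_mul (2 * Real.pi)).const_add (c j)))
  have hVm : Measurable fun z : (ℕ → Momentum d) × ℝ => V z.1 z.2 := by
    rw [hV]
    exact Finset.measurable_fun_prod _ fun j _ => measurable_ecut t
      ((hem.comp ((measurable_lowerMomentum π j).comp measurable_fst)).add
        ((measurable_snd.const_mul (2 * Real.pi)).const_add (c' j)))
  have hextm : Measurable fun x : Fin n → Momentum d => ext p x := by
    refine measurable_pi_lambda _ fun j => ?_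
    unfold ext
    by_cases hj : j < n
    · simp only [hj, dite_true]; exact measurable_pi_apply _
    · simp only [hj, dite_false]; exact measurable_const
  have hFm : Measurable fun X : ℕ → Momentum d => W X * ((∫⁻ ξ, U X ξ) * ∫⁻ ξ, V X ξ) :=
    hWm.mul (hUm.lintegral_prod_right'.mul hVm.lintegral_prod_right')
  have e1 : ∀ k : Fin n → Momentum d, ∏ l, ewt (k l) ^ 4 = W (ext p (chain p k)) := fun k => by
    simp only [hW]
    rw [← Fin.prod_univ_eq_prod_range
      (fun l => ewt (ext p (chain p k) l - ext p (chain p k) (l + 1)) ^ 4)]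
    exact Finset.prod_congr rfl fun l _ => by rw [ext_chain_sub]
  have e2 : ∀ k : Fin n → Momentum d, _ = U (ext p (chain p k)) := fun k => (congrFun hU _).symm
  have e3 : ∀ k : Fin n → Momentum d, _ = V (ext p (chain p k)) := fun k => (congrFun hV _).symm
  simp only [e1]
  simp only [funext_iff] at e2 e3
  simp only [e2, e3]
  rw [lintegral_chain p (F := fun x => W (ext p x) *
    ((∫⁻ ξ, U (ext p x) ξ) * ∫⁻ ξ, V (ext p x) ξ)) (hFm.comp hextm)]
  set C₀ : ℝ≥0∞ := ((2 : ℝ≥0∞) ^ (d + 1)) ^ (4 * n) * ENNReal.ofReal t ^ (n - 1 - P.card) *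
        (ENNReal.ofReal (K₁ ^ 2 * logStar t ^ 3) ^ P.card *
          ENNReal.ofReal (K₁ * logStar t) ^ (n - 1 - 2 * P.card)) with hC₀
  have hC₀' : C₀ = ENNReal.ofReal (c₀ ^ (4 * n) * t ^ (n - 1 - P.card) *
      ((K₁ ^ 2 * logStar t ^ 3) ^ P.card * (K₁ * logStar t) ^ (n - 1 - 2 * P.card))) := by
    rw [ENNReal.ofReal_mul (by positivity), ENNReal.ofReal_mul (by positivity),
      ENNReal.ofReal_mul (by positivity), ENNReal.ofReal_pow (by positivity),
      ENNReal.ofReal_pow ht.le, ENNReal.ofReal_pow (by positivity),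
      ENNReal.ofReal_pow (by positivity)]
    have : ENNReal.ofReal c₀ = 2 ^ (d + 1) := by
      rw [hc₀, ENNReal.ofReal_pow (by norm_num)]; simp
    rw [this, hC₀]
  have hC₀top : C₀ ≠ ⊤ := hC₀' ▸ ENNReal.ofReal_ne_top
  obtain ⟨g, hg⟩ : ∃ g : Momentum d → ℝ → ℝ≥0∞, g = fun u ξ =>
    ecut t ((e u + c 0) + 2 * Real.pi * ξ) * ecut t ((e p + c n) + 2 * Real.pi * ξ) := ⟨_, rfl⟩
  have hgm : Measurable fun z : Momentum d × ℝ => g z.1 z.2 := by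
    rw [hg]
    exact (measurable_ecut t (((hem.comp measurable_fst).add_const _).add
      (measurable_snd.const_mul _))).mul
      (measurable_ecut t ((measurable_snd.const_mul (2 * Real.pi)).const_add (e p + c n)))
  have hstep : ∀ z : ℝ × ℝ, ∫⁻ x : Fin n → Momentum d,
      W (ext p x) * (U (ext p x) z.1 * V (ext p x) z.2) ≤
      C₀ * ∫⁻ u, ewt (u - p) * (g u z.1 * g u z.2) := by
    intro z
    have hUz : Measurable fun X => U X z.1 := hUm.comp measurable_prodMk_right
    have hVz : Measurable fun X => V X z.2 := hVm.comp measurable_prodMk_right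
    have hF : Measurable fun X => W X * (U X z.1 * V X z.2) := hWm.mul (hUz.mul hVz)
    rw [lintegral_ext_eq_lmarginal p hF, hW, hU, hV]
    have := lmarginal_graph_le hec he.even ht (zero_le_one.trans hK₁)
      (fun v θ => (hres e he htr v θ t ht).1) (fun v θ => (hres e he htr v θ t ht).2.1)
      (fun v θ => (hres e he htr v θ t ht).2.2) hn hP
      (fun j => c j + 2 * Real.pi * z.1) (fun j => c' j + 2 * Real.pi * z.2) (fun _ => p)
    refine this.trans (le_of_eq ?_)
    -- The end phases of the two lines agree, so both pairs of end factors are the same function of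
    -- their energy.
    simp only [← h0, ← hcn, hg, ← add_assoc]
    rw [hC₀]
  have hUm' : Measurable fun z : (Fin n → Momentum d) × ℝ => U (ext p z.1) z.2 :=
    hUm.comp ((hextm.comp measurable_fst).prodMk measurable_snd)
  have hVm' : Measurable fun z : (Fin n → Momentum d) × ℝ => V (ext p z.1) z.2 :=
    hVm.comp ((hextm.comp measurable_fst).prodMk measurable_snd)
  have hWm' : Measurable fun x : Fin n → Momentum d => W (ext p x) := hWm.comp hextm
  refine (lintegral_mul_lintegral_swap hWm' hUm' hVm').le.trans ?_
  have hwp : Measurable fun u : Momentum d => ewt (u - p) :=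
    measurable_ewt (measurable_id.sub_const p)
  refine (lintegral_mono hstep).trans ?_
  rw [lintegral_const_mul' _ _ hC₀top, ← lintegral_mul_lintegral_swap
    hwp hgm hgm]
  -- One energy integral takes the logarithmic bound, the other the bound `16 * t`. Using the
  -- logarithmic bound twice would leave the square of a resolvent of `e u`.
  have hlast : ∀ u, ewt (u - p) * ((∫⁻ ξ, g u ξ) * ∫⁻ ξ, g u ξ) ≤
      ENNReal.ofReal (K₂ * logStar t * (16 * t)) *
        (ewt (u - p) + ewt (u - p) * ecut t (e u - (e p + c n - c 0))) := by
    intro u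
    rw [hg]
    have h1 := hen t ht (e u + c 0) (e p + c n)
    have h2 := lintegral_cut_mul_cut_le ht (e u + c 0) (e p + c n)
    refine (mul_le_mul_right (mul_le_mul' h1 h2) _).trans (le_of_eq ?_)
    rw [ENNReal.ofReal_mul (by positivity) (p := K₂ * logStar t),
      show e u + c 0 - (e p + c n) = e u - (e p + c n - c 0) by ring]
    ring
  refine (mul_le_mul_right (lintegral_mono hlast) _).trans ?_
  rw [lintegral_const_mul' _ _ ENNReal.ofReal_ne_top,
    lintegral_add_left hwp]
  refine (mul_le_mul_right (mul_le_mul_right (add_le_add (hwt p)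
    (hres e he htr p (e p + c n - c 0) t ht).1) _) _).trans ?_
  rw [hC₀', ← ENNReal.ofReal_add (by positivity) (by positivity),
    ← ENNReal.ofReal_mul (by positivity), ← ENNReal.ofReal_mul (by positivity)]
  have hcd := hP.card_survivors
  exact ENNReal.ofReal_le_ofReal
    (graph_constant_le hc₀1 hK₁ hK₂ hK₃ ht hl (by omega) hn)

/-! ### Lattice sums as integrals -/

section Lattice

variable {d : ℕ}

/-- The label of the cell of the dual lattice which contains `k`. -/
noncomputable def cellIndex (L : ℝ) (k : Momentum d) : LatticeIndex d :=
  fun i => ⌊k i / (Real.sqrt (2 * Real.pi) / L)⌋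

/-- The lattice point of the cell which contains `k`. -/
noncomputable def roundMap (L : ℝ) (k : Momentum d) : Momentum d := latticePoint L (cellIndex L k)

lemma one_le_sqrt_two_pi : 1 ≤ Real.sqrt (2 * Real.pi) := by
  rw [Real.one_le_sqrt]
  have := Real.pi_gt_three
  linarith

lemma measurable_cellIndex (L : ℝ) : Measurable (cellIndex (d := d) L) := by
  refine measurable_pi_lambda _ fun i => Int.measurable_floor.comp ?_
  fun_prop

lemma measurable_roundMap (L : ℝ) : Measurable (roundMap (d := d) L) :=
  (measurable_of_countable (latticePoint L)).comp (measurable_cellIndex L)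

lemma norm_roundMap_sub_le {L : ℝ} (hL : 0 < L) (k : Momentum d) :
    ‖roundMap L k - k‖ ≤ Real.sqrt (2 * Real.pi) * d / L := by
  set h := Real.sqrt (2 * Real.pi) / L with hh
  have hh0 : 0 < h := div_pos (zero_lt_one.trans_le one_le_sqrt_two_pi) hL
  have hi : ∀ i, ‖(roundMap L k - k) i‖ ≤ h := fun i => by
    have e1 : (roundMap L k - k) i = h * (⌊k i / h⌋ : ℝ) - k i := rfl
    have h1 := Int.floor_le (k i / h)
    have h2 := Int.lt_floor_add_one (k i / h)
    rw [le_div_iff₀ hh0] at h1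
    rw [div_lt_iff₀ hh0] at h2
    rw [e1, Real.norm_eq_abs, abs_le]
    constructor <;> nlinarith
  rw [EuclideanSpace.norm_eq]
  have e2 : Real.sqrt (2 * Real.pi) * d / L = d * h := by rw [hh]; ring
  rw [e2]
  refine Real.sqrt_le_iff.2 ⟨by positivity, ?_⟩
  calc ∑ i, ‖(roundMap L k - k) i‖ ^ 2 ≤ ∑ _i : Fin d, h ^ 2 :=
        Finset.sum_le_sum fun i _ => pow_le_pow_left₀ (norm_nonneg _) (hi i) 2
    _ = d * h ^ 2 := by simp
    _ ≤ d ^ 2 * h ^ 2 := by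
        refine mul_le_mul_of_nonneg_right ?_ (sq_nonneg _)
        exact_mod_cast Nat.le_self_pow two_ne_zero d
    _ = _ := by ring

lemma volume_cell {L : ℝ} (hL : 0 < L) (x : LatticeIndex d) :
    volume (cellIndex L ⁻¹' {x}) = ENNReal.ofReal (Real.sqrt (2 * Real.pi) / L) ^ d := by
  set h := Real.sqrt (2 * Real.pi) / L with hh
  have hh0 : 0 < h := div_pos (zero_lt_one.trans_le one_le_sqrt_two_pi) hL
  have e1 : cellIndex L ⁻¹' {x} = (MeasurableEquiv.toLp 2 (Fin d → ℝ)).symm ⁻¹'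
      Set.univ.pi fun i => Set.Ico (h * x i) (h * x i + h) := by
    ext k
    simp only [Set.mem_preimage, Set.mem_singleton_iff, Set.mem_pi, Set.mem_univ, true_implies,
      Set.mem_Ico, funext_iff, cellIndex]
    refine forall_congr' fun i => ?_
    rw [Int.floor_eq_iff, le_div_iff₀ hh0, div_lt_iff₀ hh0]
    change _ ↔ _ ≤ k i ∧ k i < _
    rw [add_mul, one_mul, mul_comm (x i : ℝ)]
  rw [e1, (EuclideanSpace.volume_preserving_symm_measurableEquiv_toLp (Fin d)).measure_preimage
    (MeasurableSet.univ_pi fun i => measurableSet_Ico).nullMeasurableSet, volume_pi_pi]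
  simp [Real.volume_Ico]

/-- Cells have volume (√(2π)/L)^d, whereas the lattice sum is normalized by L^(-d); hence the
prefactor. -/
lemma latticeInt_eq_integral {L : ℝ} (hL : 0 < L) {f : LatticeIndex d → ℂ}
    (hf : Integrable fun k : Momentum d => f (cellIndex L k)) :
    latticeInt L f = ((Real.sqrt (2 * Real.pi) : ℂ) ^ d)⁻¹ *
      ∫ k : Momentum d, f (cellIndex L k) := by
  have hs : 0 < Real.sqrt (2 * Real.pi) := zero_lt_one.trans_le one_le_sqrt_two_pi
  have hm := (measurable_cellIndex (d := d) L).aemeasurable (μ := volume)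
  have hfm : AEStronglyMeasurable f (Measure.map (cellIndex L) volume) :=
    (measurable_of_countable f).aestronglyMeasurable
  have hμ : ∀ x : LatticeIndex d, (Measure.map (cellIndex L) volume).real {x} =
      (Real.sqrt (2 * Real.pi) / L) ^ d := fun x => by
    rw [measureReal_def, Measure.map_apply (measurable_cellIndex L) (measurableSet_singleton x),
      volume_cell hL, ENNReal.toReal_pow, ENNReal.toReal_ofReal (by positivity)]
  rw [← integral_map hm hfm, integral_countable ((integrable_map_measure hfm hm).2 hf)]
  simp only [hμ, Complex.real_smul]
  rw [tsum_mul_left, latticeInt, ← mul_assoc]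
  congr 1
  push_cast
  rw [div_pow]
  have h1 : ((Real.sqrt (2 * Real.pi) : ℝ) : ℂ) ≠ 0 := by exact_mod_cast hs.ne'
  have h2 : (L : ℂ) ≠ 0 := by exact_mod_cast hL.ne'
  field_simp

/-- Only an upper bound is needed here, so the prefactor (√(2π))^(-dn) ≤ 1 is dropped. -/
lemma enorm_latticeIntMulti_le {L : ℝ} (hL : 0 < L) (n : ℕ) (f : (Fin n → LatticeIndex d) → ℂ) :
    ‖latticeIntMulti L n f‖ₑ ≤ ∫⁻ k : Fin n → Momentum d, ‖f fun j => cellIndex L (k j)‖ₑ := by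
  have hs := one_le_sqrt_two_pi
  have hm : Measurable fun k : Fin n → Momentum d => fun j => cellIndex L (k j) :=
    measurable_pi_lambda _ fun j => (measurable_cellIndex L).comp (measurable_pi_apply j)
  have hfm : Measurable fun y => ‖f y‖ₑ := measurable_of_countable _
  have hμ : ∀ y : Fin n → LatticeIndex d, Measure.map (fun k : Fin n → Momentum d =>
      fun j => cellIndex L (k j)) volume {y} =
        (ENNReal.ofReal (Real.sqrt (2 * Real.pi) / L) ^ d) ^ n := fun y => by
    rw [Measure.map_apply hm (measurableSet_singleton y)]
    have : (fun k : Fin n → Momentum d => fun j => cellIndex L (k j)) ⁻¹' {y} =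
        Set.univ.pi fun j => cellIndex L ⁻¹' {y j} := by
      ext k
      simp [funext_iff]
    rw [this, volume_pi_pi]
    simp only [volume_cell hL]
    simp
  rw [← lintegral_map hfm hm, lintegral_countable']
  simp only [hμ]
  rw [latticeIntMulti, enorm_mul, ENNReal.tsum_mul_right, mul_comm]
  refine mul_le_mul' enorm_tsum_le_tsum_enorm ?_
  rw [← ENNReal.ofReal_pow (by positivity), ← ENNReal.ofReal_pow (by positivity), ← ofReal_norm]
  refine ENNReal.ofReal_le_ofReal ?_
  rw [norm_inv, norm_pow, Complex.norm_real, Real.norm_of_nonneg hL.le, ← pow_mul, div_pow,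
    inv_eq_one_div]
  gcongr
  exact one_le_pow₀ hs

end Lattice

/-! ### Stability of iterated convolutions -/

lemma norm_iterConv_le {f : ℕ → ℝ → ℂ} {C t : ℝ} (hC : 0 ≤ C)
    (hb : ∀ b, ∀ s ∈ Set.Icc 0 t, ‖f b s‖ ≤ C) (N : ℕ) :
    ∀ s ∈ Set.Icc 0 t, ‖iterConv f N s‖ ≤ C ^ (N + 1) * t ^ N := by
  induction N with
  | zero => intro s hs; simpa [iterConv] using hb 0 s hs
  | succ N ih =>
    intro s hs
    have ht : 0 ≤ t := hs.1.trans hs.2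
    rw [iterConv]
    have h1 : ∀ u ∈ Set.uIoc 0 s, ‖f (N + 1) u * iterConv f N (s - u)‖ ≤
        C * (C ^ (N + 1) * t ^ N) := by
      intro u hu
      rw [Set.uIoc_of_le hs.1] at hu
      rw [norm_mul]
      exact mul_le_mul (hb _ u ⟨hu.1.le, hu.2.trans hs.2⟩)
        (ih _ ⟨by linarith [hu.2], by linarith [hu.1, hs.2]⟩) (norm_nonneg _) hC
    refine (intervalIntegral.norm_integral_le_of_norm_le_const h1).trans ?_
    rw [sub_zero, abs_of_nonneg hs.1]
    calc C * (C ^ (N + 1) * t ^ N) * s ≤ C * (C ^ (N + 1) * t ^ N) * t :=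
          mul_le_mul_of_nonneg_left hs.2 (by positivity)
      _ = _ := by ring

/-- The factors are exchanged one at a time; each exchange costs `ε` while the others are bounded by
`C`. -/
lemma norm_iterConv_sub_le {f g : ℕ → ℝ → ℂ} (hf : ∀ b, Continuous (f b))
    (hg : ∀ b, Continuous (g b)) {C t ε : ℝ} (hC : 0 ≤ C) (hε : 0 ≤ ε)
    (hbf : ∀ b, ∀ s ∈ Set.Icc 0 t, ‖f b s‖ ≤ C) (hbg : ∀ b, ∀ s ∈ Set.Icc 0 t, ‖g b s‖ ≤ C)
    (hfg : ∀ b, ∀ s ∈ Set.Icc 0 t, ‖f b s - g b s‖ ≤ ε) (N : ℕ) :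
    ∀ s ∈ Set.Icc 0 t, ‖iterConv f N s - iterConv g N s‖ ≤ (N + 1) * (C ^ N * t ^ N) * ε := by
  induction N with
  | zero => intro s hs; simpa [iterConv] using hfg 0 s hs
  | succ N ih =>
    intro s hs
    have ht : 0 ≤ t := hs.1.trans hs.2
    have hcf := continuous_iterConv hf N
    have hcg := continuous_iterConv hg N
    have hf' := hf (N + 1)
    have hg' := hg (N + 1)
    rw [iterConv, iterConv]
    beta_reduce
    rw [← intervalIntegral.integral_sub
      (Continuous.intervalIntegrable (by fun_prop) _ _)
      (Continuous.intervalIntegrable (by fun_prop) _ _)]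
    have h1 : ∀ u ∈ Set.uIoc 0 s, ‖f (N + 1) u * iterConv f N (s - u) -
        g (N + 1) u * iterConv g N (s - u)‖ ≤ (N + 2) * (C ^ (N + 1) * t ^ N) * ε := by
      intro u hu
      rw [Set.uIoc_of_le hs.1] at hu
      have hu' : u ∈ Set.Icc 0 t := ⟨hu.1.le, hu.2.trans hs.2⟩
      have hsu : s - u ∈ Set.Icc 0 t := ⟨by linarith [hu.2], by linarith [hu.1, hs.2]⟩
      have e1 : f (N + 1) u * iterConv f N (s - u) - g (N + 1) u * iterConv g N (s - u) =
          (f (N + 1) u - g (N + 1) u) * iterConv f N (s - u) +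
            g (N + 1) u * (iterConv f N (s - u) - iterConv g N (s - u)) := by ring
      rw [e1]
      refine (norm_add_le _ _).trans ?_
      rw [norm_mul, norm_mul]
      have h2 := mul_le_mul (hfg (N + 1) u hu') (norm_iterConv_le hC hbf N _ hsu)
        (norm_nonneg _) hε
      have h3 := mul_le_mul (hbg (N + 1) u hu') (ih _ hsu) (norm_nonneg _) hC
      refine (add_le_add h2 h3).trans (le_of_eq ?_)
      ring
    refine (intervalIntegral.norm_integral_le_of_norm_le_const h1).trans ?_
    rw [sub_zero, abs_of_nonneg hs.1]
    calc (N + 2) * (C ^ (N + 1) * t ^ N) * ε * s ≤ (N + 2) * (C ^ (N + 1) * t ^ N) * ε * t :=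
          mul_le_mul_of_nonneg_left hs.2 (by positivity)
      _ = _ := by push_cast; ring

/-! ### Constant phonon dispersion: the recollision function and the line amplitudes -/

lemma norm_exp_sub_exp_le (x y : ℝ) :
    ‖Complex.exp (-Complex.I * (x : ℂ)) - Complex.exp (-Complex.I * (y : ℂ))‖ ≤ |x - y| := by
  have e1 : Complex.exp (-Complex.I * (x : ℂ)) - Complex.exp (-Complex.I * (y : ℂ)) =
      Complex.exp (-Complex.I * (y : ℂ)) * (Complex.exp (Complex.I * ((y - x : ℝ) : ℂ)) - 1) := by
    rw [mul_sub, mul_one, ← Complex.exp_add]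
    congr 2
    push_cast
    ring
  rw [e1, norm_mul, exp_neg_I_norm, one_mul, abs_sub_comm]
  exact Real.norm_exp_I_mul_ofReal_sub_one_le

/-- Quantitative regularity of a model with constant phonon dispersion `ω₀`. -/
structure ConstantPhonon {d : ℕ} (S : Model d) (ω₀ D : ℝ) : Prop where
  one_le : 1 ≤ D
  ω_eq : ∀ k, S.ω k = ω₀
  e_cont : Continuous S.e
  Q_cont : Continuous S.Q
  e_lip : ∀ x y, |S.e x - S.e y| ≤ D * (1 + ‖x‖ + ‖y‖) * ‖x - y‖
  Q_le : ∀ x, |S.Q x| ≤ D * wt x ^ 2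
  Q_lip : ∀ x y, |S.Q x - S.Q y| ≤ D * ‖x - y‖
  phonon_nonneg : ∀ k, 0 ≤ S.phononNumber k
  phonon_le : ∀ k, S.phononNumber k ≤ D

lemma wt_le_of_norm_sub_le {d : ℕ} {x k : Momentum d} (h : ‖x - k‖ ≤ 1) :
    wt x ≤ 4 ^ (d + 1) * wt k := by
  refine wt_le_mul (by norm_num) ?_
  have h1 := bracket_add_le x (k - x)
  rw [add_sub_cancel] at h1
  have h2 := bracket_le_one_add_norm (k - x)
  rw [norm_sub_rev] at h2
  have h3 := bracket_pos x
  nlinarith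

lemma one_add_norm_mul_wt_le {d : ℕ} (k : Momentum d) : (1 + ‖k‖) * wt k ≤ 2 := by
  have h1 := one_le_bracket k
  have h2 := norm_le_bracket k
  have h3 : wt k ≤ (bracket k)⁻¹ := by
    rw [wt]
    exact inv_anti₀ (by linarith) (le_self_pow₀ h1 (by omega))
  calc (1 + ‖k‖) * wt k ≤ (2 * bracket k) * (bracket k)⁻¹ := by
        refine mul_le_mul (by linarith) h3 (wt_pos k).le (by linarith)
    _ = 2 := by field_simp

/-- The function `Θ`, with the momenta of the phonon replaced by their images under `R`, and the
lattice sum replaced by an integral. -/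
noncomputable def thetaInt {d : ℕ} (S : Model d) (R : Momentum d → Momentum d) (s : ℝ)
    (q : Momentum d) (Ω : ℝ) : ℂ :=
  ∑ σ : ℤˣ, ((Real.sqrt (2 * Real.pi) : ℂ) ^ d)⁻¹ * ∫ k,
    Complex.exp (-Complex.I * ((s * (S.Phi σ q (R k) + Ω) : ℝ) : ℂ)) * ((S.M (R k) σ : ℝ) : ℂ)

/-- The amplitude of an electron line, with `thetaInt` in place of `Theta`. -/
noncomputable def amp {d : ℕ} (S : Model d) (R : Momentum d → Momentum d) (t : ℝ) {n : ℕ} (N : ℕ)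
    (m : Fin (n + 1) → ℕ) (p : Momentum d) (k : Fin n → Momentum d) (σ : Fin n → ℤˣ) : ℂ :=
  timeInt t N fun s => ∏ j : Fin (n + 1),
    ((∏ b ∈ freeSlots m j, Complex.exp (-Complex.I *
        ((s b * (S.e (electronMomentum p k j) + phononEnergy S k σ j) : ℝ) : ℂ))) *
      ∏ b ∈ recollisionSlots m j,
        thetaInt S R (s b) (electronMomentum p k j) (phononEnergy S k σ j))

lemma norm_inv_sqrt_two_pi_pow_le (d : ℕ) :
    ‖((Real.sqrt (2 * Real.pi) : ℂ) ^ d)⁻¹‖ ≤ 1 := by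
  rw [norm_inv, norm_pow, Complex.norm_real, Real.norm_of_nonneg (Real.sqrt_nonneg _)]
  exact inv_le_one_of_one_le₀ (one_le_pow₀ one_le_sqrt_two_pi)

lemma sgn_add_one_div_two (σ : ℤˣ) :
    0 ≤ (Model.sgn σ + 1) / 2 ∧ (Model.sgn σ + 1) / 2 ≤ 1 := by
  rcases Int.units_eq_one_or σ with rfl | rfl <;> norm_num [Model.sgn]

namespace ConstantPhonon

variable {d : ℕ} {S : Model d} {ω₀ D : ℝ}

lemma phonon_const (h : ConstantPhonon S ω₀ D) (k : Momentum d) :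
    S.phononNumber k = S.phononNumber 0 := by
  unfold Model.phononNumber
  rw [h.ω_eq, h.ω_eq]

lemma factor_nonneg (h : ConstantPhonon S ω₀ D) (σ : ℤˣ) :
    0 ≤ S.phononNumber 0 + (Model.sgn σ + 1) / 2 :=
  add_nonneg (h.phonon_nonneg 0) (sgn_add_one_div_two σ).1

lemma factor_le (h : ConstantPhonon S ω₀ D) (σ : ℤˣ) :
    S.phononNumber 0 + (Model.sgn σ + 1) / 2 ≤ 2 * D := by
  have h1 := h.phonon_le 0
  have h2 := (sgn_add_one_div_two σ).2
  have h3 := h.one_le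
  linarith

lemma M_eq (h : ConstantPhonon S ω₀ D) (k : Momentum d) (σ : ℤˣ) :
    S.M k σ = S.Q k ^ 2 * (S.phononNumber 0 + (Model.sgn σ + 1) / 2) := by
  rw [Model.M, h.phonon_const, sq_abs]

lemma M_nonneg (h : ConstantPhonon S ω₀ D) (k : Momentum d) (σ : ℤˣ) : 0 ≤ S.M k σ := by
  rw [h.M_eq]
  exact mul_nonneg (sq_nonneg _) (h.factor_nonneg σ)

/-- `Q` is bounded by a multiple of `wt ^ 2`, so its square supplies four weights, the number spent
in `prod_ewt_le`. The displaced point `x` is the lattice point of the cell of `k`. -/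
lemma M_le (h : ConstantPhonon S ω₀ D) {x k : Momentum d} (hx : ‖x - k‖ ≤ 1) (σ : ℤˣ) :
    S.M x σ ≤ 2 * D ^ 3 * (4 ^ (d + 1)) ^ 4 * wt k ^ 4 := by
  have hD := h.one_le
  have hk := wt_pos k
  have hx0 := wt_pos x
  rw [h.M_eq]
  have h1 : S.Q x ^ 2 ≤ (D * (4 ^ (d + 1) * wt k) ^ 2) ^ 2 := by
    rw [← sq_abs]
    refine pow_le_pow_left₀ (abs_nonneg _) ((h.Q_le x).trans ?_) 2
    exact mul_le_mul_of_nonneg_left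
      (pow_le_pow_left₀ hx0.le (wt_le_of_norm_sub_le hx) 2) (by linarith)
  calc _ ≤ (D * (4 ^ (d + 1) * wt k) ^ 2) ^ 2 * (2 * D) :=
        mul_le_mul h1 (h.factor_le σ) (h.factor_nonneg σ) (by positivity)
    _ = _ := by ring

lemma Phi_eq (h : ConstantPhonon S ω₀ D) (σ : ℤˣ) (q k : Momentum d) :
    S.Phi σ q k = S.e (k + q) + Model.sgn σ * ω₀ := by rw [Model.Phi, h.ω_eq]

lemma phononEnergy_eq (h : ConstantPhonon S ω₀ D) {n : ℕ} (k k' : Fin n → Momentum d)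
    (σ : Fin n → ℤˣ) (j : Fin (n + 1)) : phononEnergy S k σ j = phononEnergy S k' σ j := by
  unfold phononEnergy
  simp only [h.ω_eq]

lemma measurable_integrand (h : ConstantPhonon S ω₀ D) {R : Momentum d → Momentum d}
    (hR : Measurable R) (s : ℝ) (q : Momentum d) (Ω : ℝ) (σ : ℤˣ) :
    Measurable fun k => Complex.exp (-Complex.I * ((s * (S.Phi σ q (R k) + Ω) : ℝ) : ℂ)) *
      ((S.M (R k) σ : ℝ) : ℂ) := by
  simp only [h.Phi_eq, h.M_eq]
  have h1 := h.e_cont.measurable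
  have h2 := h.Q_cont.measurable
  fun_prop

lemma norm_integrand_le (h : ConstantPhonon S ω₀ D) {R : Momentum d → Momentum d}
    (hR1 : ∀ k, ‖R k - k‖ ≤ 1) (s : ℝ) (q : Momentum d) (Ω : ℝ) (σ : ℤˣ) (k : Momentum d) :
    ‖Complex.exp (-Complex.I * ((s * (S.Phi σ q (R k) + Ω) : ℝ) : ℂ)) *
      ((S.M (R k) σ : ℝ) : ℂ)‖ ≤ 2 * D ^ 3 * (4 ^ (d + 1)) ^ 4 * wt k := by
  have hD := h.one_le
  rw [norm_mul, exp_neg_I_norm, one_mul, Complex.norm_real, Real.norm_of_nonneg (h.M_nonneg _ _)]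
  refine (h.M_le (hR1 k) σ).trans (mul_le_mul_of_nonneg_left ?_ (by positivity))
  exact pow_le_of_le_one (wt_pos k).le (wt_le_one k) (by norm_num)

lemma integrable_integrand (h : ConstantPhonon S ω₀ D) (hd : 0 < d) {R : Momentum d → Momentum d}
    (hR : Measurable R) (hR1 : ∀ k, ‖R k - k‖ ≤ 1) (s : ℝ) (q : Momentum d) (Ω : ℝ) (σ : ℤˣ) :
    Integrable fun k => Complex.exp (-Complex.I * ((s * (S.Phi σ q (R k) + Ω) : ℝ) : ℂ)) *
      ((S.M (R k) σ : ℝ) : ℂ) :=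
  ((integrable_wt hd).const_mul _).mono'
    (h.measurable_integrand hR s q Ω σ).aestronglyMeasurable
    (ae_of_all _ (h.norm_integrand_le hR1 s q Ω σ))

lemma norm_sum_units_le {f : ℤˣ → ℂ} {C : ℝ} (hf : ∀ σ, ‖f σ‖ ≤ C) : ‖∑ σ, f σ‖ ≤ 2 * C := by
  refine (norm_sum_le_of_le _ fun σ _ => hf σ).trans_eq ?_
  rw [Finset.sum_const, Finset.card_univ, Fintype.card_units_int, nsmul_eq_mul]
  norm_num

lemma norm_thetaInt_le (h : ConstantPhonon S ω₀ D) (hd : 0 < d) {R : Momentum d → Momentum d}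
    (hR1 : ∀ k, ‖R k - k‖ ≤ 1) (s : ℝ) (q : Momentum d) (Ω : ℝ) :
    ‖thetaInt S R s q Ω‖ ≤ 2 * (2 * D ^ 3 * (4 ^ (d + 1)) ^ 4 * ∫ x : Momentum d, wt x) := by
  refine norm_sum_units_le fun σ => ?_
  rw [norm_mul]
  refine (mul_le_of_le_one_left (norm_nonneg _) (norm_inv_sqrt_two_pi_pow_le d)).trans ?_
  rw [← integral_const_mul]
  exact norm_integral_le_of_norm_le ((integrable_wt hd).const_mul _)
    (ae_of_all _ (h.norm_integrand_le hR1 s q Ω σ))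

lemma continuous_thetaInt (h : ConstantPhonon S ω₀ D) (hd : 0 < d) {R : Momentum d → Momentum d}
    (hR : Measurable R) (hR1 : ∀ k, ‖R k - k‖ ≤ 1) (q : Momentum d) (Ω : ℝ) :
    Continuous fun s => thetaInt S R s q Ω := by
  unfold thetaInt
  refine continuous_finsetSum _ fun σ _ => Continuous.mul continuous_const ?_
  refine continuous_of_dominated
    (fun s => (h.measurable_integrand hR s q Ω σ).aestronglyMeasurable)
    (fun s => ae_of_all _ (h.norm_integrand_le hR1 s q Ω σ)) ((integrable_wt hd).const_mul _)
    (ae_of_all _ fun k => ?_)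
  fun_prop

/-- Phase and coupling are Lipschitz. The Lipschitz constant of `e` grows linearly with the
momentum, and the growth in `k` is absorbed by one of the weights. -/
lemma norm_integrand_sub_le (h : ConstantPhonon S ω₀ D) {R : Momentum d → Momentum d} {δ : ℝ}
    (hδ1 : δ ≤ 1) (hRδ : ∀ k, ‖R k - k‖ ≤ δ) {δ' : ℝ} (hδδ' : δ ≤ δ') (s : ℝ) {q q' : Momentum d}
    (hq : ‖q - q'‖ ≤ δ') (Ω : ℝ) (σ : ℤˣ) (k : Momentum d) :
    ‖Complex.exp (-Complex.I * ((s * (S.Phi σ q (R k) + Ω) : ℝ) : ℂ)) * ((S.M (R k) σ : ℝ) : ℂ) -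
      Complex.exp (-Complex.I * ((s * (S.Phi σ q' k + Ω) : ℝ) : ℂ)) * ((S.M k σ : ℝ) : ℂ)‖ ≤
      2 * D ^ 3 * (4 ^ (d + 1)) ^ 4 * (8 * D * (1 + |s|) * (1 + ‖q‖ + ‖q'‖) * δ') * wt k := by
  have hD := h.one_le
  have hδ0 : 0 ≤ δ := (norm_nonneg _).trans (hRδ k)
  have hδ'0 : 0 ≤ δ' := hδ0.trans hδδ'
  have hR1 : ‖R k - k‖ ≤ 1 := (hRδ k).trans hδ1
  have hw := wt_pos k
  have hw1 := wt_le_one k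
  obtain ⟨B, hB⟩ : ∃ B : ℝ, B = 2 * D ^ 3 * (4 ^ (d + 1)) ^ 4 := ⟨_, rfl⟩
  have hB0 : 0 ≤ B := hB ▸ by positivity
  have e1 : ∀ a b : ℂ, ∀ x y : ℝ, a * (x : ℂ) - b * (y : ℂ) =
      (a - b) * (x : ℂ) + b * ((x - y : ℝ) : ℂ) := fun a b x y => by push_cast; ring
  rw [e1]
  refine (norm_add_le _ _).trans ?_
  rw [norm_mul, norm_mul, exp_neg_I_norm, one_mul, Complex.norm_real, Complex.norm_real,
    Real.norm_of_nonneg (h.M_nonneg _ _), Real.norm_eq_abs]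
  have hM := h.M_le hR1 σ
  rw [← hB] at hM ⊢
  have h1 : ‖Complex.exp (-Complex.I * ((s * (S.Phi σ q (R k) + Ω) : ℝ) : ℂ)) -
      Complex.exp (-Complex.I * ((s * (S.Phi σ q' k + Ω) : ℝ) : ℂ))‖ ≤
      |s| * (4 * D * ((1 + ‖k‖) * (1 + ‖q‖ + ‖q'‖)) * δ') := by
    refine (norm_exp_sub_exp_le _ _).trans ?_
    rw [← mul_sub, abs_mul]
    refine mul_le_mul_of_nonneg_left ?_ (abs_nonneg _)
    rw [h.Phi_eq, h.Phi_eq, show S.e (R k + q) + Model.sgn σ * ω₀ + Ω -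
      (S.e (k + q') + Model.sgn σ * ω₀ + Ω) = S.e (R k + q) - S.e (k + q') by ring]
    refine (h.e_lip _ _).trans ?_
    have h2 : ‖R k + q - (k + q')‖ ≤ 2 * δ' := by
      rw [add_sub_add_comm]
      exact (norm_add_le _ _).trans (by linarith [hRδ k])
    have h3 : ‖R k + q‖ ≤ 1 + ‖k‖ + ‖q‖ := by
      have := norm_add_le (R k - k) (k + q)
      rw [show R k - k + (k + q) = R k + q by abel] at this
      linarith [norm_add_le k q]
    have h4 := norm_add_le k q'
    have hk0 := norm_nonneg k
    have hq0 := norm_nonneg q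
    have hq'0 := norm_nonneg q'
    calc D * (1 + ‖R k + q‖ + ‖k + q'‖) * ‖R k + q - (k + q')‖
        ≤ D * (2 * ((1 + ‖k‖) * (1 + ‖q‖ + ‖q'‖))) * (2 * δ') := by
          refine mul_le_mul (mul_le_mul_of_nonneg_left ?_ (by linarith)) h2 (norm_nonneg _)
            (by positivity)
          nlinarith [mul_nonneg hk0 hq0, mul_nonneg hk0 hq'0]
      _ = _ := by ring
  have hA : ‖Complex.exp (-Complex.I * ((s * (S.Phi σ q (R k) + Ω) : ℝ) : ℂ)) -
      Complex.exp (-Complex.I * ((s * (S.Phi σ q' k + Ω) : ℝ) : ℂ))‖ * S.M (R k) σ ≤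
      B * (8 * D * |s| * (1 + ‖q‖ + ‖q'‖) * δ') * wt k := by
    refine (mul_le_mul h1 hM (h.M_nonneg _ _) (by positivity)).trans ?_
    have h5 : (1 + ‖k‖) * wt k ^ 4 ≤ 2 * wt k := by
      have h6 := one_add_norm_mul_wt_le k
      calc (1 + ‖k‖) * wt k ^ 4 = ((1 + ‖k‖) * wt k) * (wt k ^ 2 * wt k) := by ring
        _ ≤ 2 * (1 * wt k) := by
          refine mul_le_mul h6 (mul_le_mul_of_nonneg_right (pow_le_one₀ hw.le hw1) hw.le)
            (by positivity) zero_le_two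
        _ = _ := by ring
    calc _ = (B * (4 * D * |s| * (1 + ‖q‖ + ‖q'‖) * δ')) * ((1 + ‖k‖) * wt k ^ 4) := by ring
      _ ≤ (B * (4 * D * |s| * (1 + ‖q‖ + ‖q'‖) * δ')) * (2 * wt k) :=
        mul_le_mul_of_nonneg_left h5 (by positivity)
      _ = _ := by ring
  have hC : |S.M (R k) σ - S.M k σ| ≤ B * (8 * D * 1 * (1 + ‖q‖ + ‖q'‖) * δ') * wt k := by
    rw [h.M_eq, h.M_eq, ← sub_mul, abs_mul, abs_of_nonneg (h.factor_nonneg σ), sq_sub_sq, abs_mul]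
    have h6 : |S.Q (R k) + S.Q k| ≤ 2 * D * (4 ^ (d + 1)) ^ 4 * wt k := by
      have h7 := h.Q_le (R k)
      have h8 := h.Q_le k
      have h9 := wt_le_of_norm_sub_le hR1
      have h10 := wt_pos (R k)
      have h11 : (1 : ℝ) ≤ 4 ^ (d + 1) := one_le_pow₀ (by norm_num)
      have h12 : wt (R k) ^ 2 ≤ (4 ^ (d + 1)) ^ 4 * wt k := by
        calc wt (R k) ^ 2 ≤ wt (R k) := pow_le_of_le_one h10.le (wt_le_one _) two_ne_zero
          _ ≤ 4 ^ (d + 1) * wt k := h9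
          _ ≤ _ := mul_le_mul_of_nonneg_right (le_self_pow₀ h11 (by norm_num)) hw.le
      have h13 : wt k ^ 2 ≤ (4 ^ (d + 1)) ^ 4 * wt k := by
        calc wt k ^ 2 ≤ wt k := pow_le_of_le_one hw.le hw1 two_ne_zero
          _ ≤ _ := le_mul_of_one_le_left hw.le (one_le_pow₀ h11)
      calc |S.Q (R k) + S.Q k| ≤ D * wt (R k) ^ 2 + D * wt k ^ 2 :=
            (abs_add_le _ _).trans (add_le_add h7 h8)
        _ ≤ D * ((4 ^ (d + 1)) ^ 4 * wt k) + D * ((4 ^ (d + 1)) ^ 4 * wt k) := by gcongr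
        _ = _ := by ring
    have h14 : |S.Q (R k) - S.Q k| ≤ D * δ' :=
      (h.Q_lip _ _).trans (mul_le_mul_of_nonneg_left ((hRδ k).trans hδδ') (by linarith))
    have h15 : 1 ≤ 1 + ‖q‖ + ‖q'‖ := by
      have := norm_nonneg q
      have := norm_nonneg q'
      linarith
    calc |S.Q (R k) + S.Q k| * |S.Q (R k) - S.Q k| * (S.phononNumber 0 + (Model.sgn σ + 1) / 2)
        ≤ (2 * D * (4 ^ (d + 1)) ^ 4 * wt k) * (D * δ') * (2 * D) := by
          refine mul_le_mul (mul_le_mul h6 h14 (abs_nonneg _) (by positivity)) (h.factor_le σ)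
            (h.factor_nonneg σ) (by positivity)
      _ = B * wt k * δ' * (2 * 1) := by rw [hB]; ring
      _ ≤ B * wt k * δ' * ((8 * D) * (1 + ‖q‖ + ‖q'‖)) := by
          refine mul_le_mul_of_nonneg_left ?_ (by positivity)
          exact mul_le_mul (by linarith) h15 zero_le_one (by positivity)
      _ = _ := by ring
  refine (add_le_add hA hC).trans (le_of_eq ?_)
  ring

lemma norm_thetaInt_sub_le (h : ConstantPhonon S ω₀ D) (hd : 0 < d) {R : Momentum d → Momentum d}
    (hR : Measurable R) {δ : ℝ} (hδ1 : δ ≤ 1) (hRδ : ∀ k, ‖R k - k‖ ≤ δ) {δ' : ℝ} (hδδ' : δ ≤ δ')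
    (s : ℝ) {q q' : Momentum d} (hq : ‖q - q'‖ ≤ δ') (Ω : ℝ) :
    ‖thetaInt S R s q Ω - thetaInt S id s q' Ω‖ ≤
      2 * (2 * D ^ 3 * (4 ^ (d + 1)) ^ 4 * (8 * D * (1 + |s|) * (1 + ‖q‖ + ‖q'‖) * δ') *
        ∫ x : Momentum d, wt x) := by
  have hR1 : ∀ k, ‖R k - k‖ ≤ 1 := fun k => (hRδ k).trans hδ1
  rw [thetaInt, thetaInt, ← Finset.sum_sub_distrib]
  refine norm_sum_units_le fun σ => ?_
  rw [← mul_sub, norm_mul, ← integral_sub (h.integrable_integrand hd hR hR1 s q Ω σ)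
    (h.integrable_integrand hd measurable_id (fun k => by simp) s q' Ω σ)]
  refine (mul_le_of_le_one_left (norm_nonneg _) (norm_inv_sqrt_two_pi_pow_le d)).trans ?_
  rw [← integral_const_mul]
  exact norm_integral_le_of_norm_le ((integrable_wt hd).const_mul _)
    (ae_of_all _ (h.norm_integrand_sub_le hδ1 hRδ hδδ' s hq Ω σ))

lemma Theta_eq_thetaInt (h : ConstantPhonon S ω₀ D) (hd : 0 < d) {L : ℝ} (hL : 0 < L)
    (hR1 : ∀ k : Momentum d, ‖roundMap L k - k‖ ≤ 1) (s : ℝ) (q : Momentum d) (Ω : ℝ) :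
    Theta S L s q Ω = thetaInt S (roundMap L) s q Ω := by
  rw [Theta, thetaInt]
  exact Finset.sum_congr rfl fun σ _ => latticeInt_eq_integral hL
    (h.integrable_integrand hd (measurable_roundMap L) hR1 s q Ω σ)

lemma lineAmplitude_eq_amp (h : ConstantPhonon S ω₀ D) (hd : 0 < d) {L : ℝ} (hL : 0 < L)
    (hR1 : ∀ k : Momentum d, ‖roundMap L k - k‖ ≤ 1) (t : ℝ) {n : ℕ} (N : ℕ)
    (m : Fin (n + 1) → ℕ) (p : Momentum d) (k : Fin n → Momentum d) (σ : Fin n → ℤˣ) :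
    lineAmplitude S L t N m p k σ = amp S (roundMap L) t N m p k σ := by
  unfold lineAmplitude amp
  simp only [h.Theta_eq_thetaInt hd hL hR1]

/-- For constant `ω` the phonon phase, the energy `Ω` and the occupation factor leave the integral,
and the modulus does not see the phases. -/
lemma norm_thetaInt_id_le (h : ConstantPhonon S ω₀ D) (s : ℝ) (q : Momentum d) (Ω : ℝ) :
    ‖thetaInt S id s q Ω‖ ≤ 4 * D * ‖oscInt S.e (fun k => S.Q k ^ 2) q s‖ := by
  have hD := h.one_le
  have : ∀ σ : ℤˣ, ‖((Real.sqrt (2 * Real.pi) : ℂ) ^ d)⁻¹ * ∫ k,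
      Complex.exp (-Complex.I * ((s * (S.Phi σ q (id k) + Ω) : ℝ) : ℂ)) *
        ((S.M (id k) σ : ℝ) : ℂ)‖ ≤ 2 * D * ‖oscInt S.e (fun k => S.Q k ^ 2) q s‖ := by
    intro σ
    rw [norm_mul]
    refine (mul_le_of_le_one_left (norm_nonneg _) (norm_inv_sqrt_two_pi_pow_le d)).trans ?_
    have e1 : ∀ k, Complex.exp (-Complex.I * ((s * (S.Phi σ q (id k) + Ω) : ℝ) : ℂ)) *
        ((S.M (id k) σ : ℝ) : ℂ) =
        (Complex.exp (-Complex.I * ((s * (Model.sgn σ * ω₀ + Ω) : ℝ) : ℂ)) *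
          ((S.phononNumber 0 + (Model.sgn σ + 1) / 2 : ℝ) : ℂ)) *
        (Complex.exp (-Complex.I * ((s * S.e (k + q) : ℝ) : ℂ)) * ((S.Q k ^ 2 : ℝ) : ℂ)) := by
      intro k
      rw [id, h.Phi_eq, h.M_eq, mul_mul_mul_comm, ← Complex.exp_add, ← Complex.ofReal_mul]
      congr 2
      · push_cast; ring
      · ring
    simp only [e1]
    rw [integral_const_mul, norm_mul, norm_mul, exp_neg_I_norm, one_mul, Complex.norm_real,
      Real.norm_of_nonneg (h.factor_nonneg σ)]
    exact mul_le_mul_of_nonneg_right (h.factor_le σ) (norm_nonneg _)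
  refine (norm_sum_units_le this).trans (le_of_eq ?_)
  ring

lemma lintegral_thetaInt_le (h : ConstantPhonon S ω₀ D) {K : ℝ} {q : Momentum d}
    (hK : ∫⁻ s in Set.Ioi 0, ‖oscInt S.e (fun k => S.Q k ^ 2) q s‖ₑ ≤ ENNReal.ofReal K) (Ω : ℝ) :
    ∫⁻ s in Set.Ioi 0, ‖thetaInt S id s q Ω‖ₑ ≤ ENNReal.ofReal (4 * D * K) := by
  have hD := h.one_le
  calc _ ≤ ∫⁻ s in Set.Ioi 0, ENNReal.ofReal (4 * D) *
        ‖oscInt S.e (fun k => S.Q k ^ 2) q s‖ₑ := by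
        refine lintegral_mono fun s => ?_
        rw [← ofReal_norm, ← ofReal_norm, ← ENNReal.ofReal_mul (by positivity)]
        exact ENNReal.ofReal_le_ofReal (h.norm_thetaInt_id_le s q Ω)
    _ ≤ ENNReal.ofReal (4 * D) * ENNReal.ofReal K := by
        rw [lintegral_const_mul' _ _ ENNReal.ofReal_ne_top]
        exact mul_le_mul_right hK _
    _ = _ := by rw [← ENNReal.ofReal_mul (by positivity)]

/-! ### Comparison of the line amplitudes -/

lemma amp_eq_iterConv (h : ConstantPhonon S ω₀ D) (hd : 0 < d) {R : Momentum d → Momentum d}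
    (hR : Measurable R) (hR1 : ∀ k, ‖R k - k‖ ≤ 1) {t : ℝ} (ht : 0 ≤ t) {n N : ℕ}
    {m : Fin (n + 1) → ℕ} (hm : m ∈ patterns n N) (p : Momentum d) (k : Fin n → Momentum d)
    (σ : Fin n → ℤˣ) :
    amp S R t N m p k σ = iterConv (slotFun m
      (fun j s => Complex.exp (-Complex.I *
        ((s * (S.e (electronMomentum p k j) + phononEnergy S k σ j) : ℝ) : ℂ)))
      (fun j s => thetaInt S R s (electronMomentum p k j) (phononEnergy S k σ j))) N t := by
  rw [← timeInt_prod (slotFun_induction (fun j => by fun_prop)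
    fun j => h.continuous_thetaInt hd hR hR1 _ _) N ht, amp]
  congr 1
  funext s
  exact line_integrand_eq hm
    (fun j s => Complex.exp (-Complex.I *
        ((s * (S.e (electronMomentum p k j) + phononEnergy S k σ j) : ℝ) : ℂ)))
      (fun j s => thetaInt S R s (electronMomentum p k j) (phononEnergy S k σ j)) s

/-- A bound on the factors of a line amplitude. -/
noncomputable def slotBound (d : ℕ) (D : ℝ) : ℝ :=
  1 + 32 * D ^ 4 * (4 ^ (d + 1)) ^ 4 * ∫ x : Momentum d, wt x

lemma one_le_slotBound (hD : 0 ≤ D) : 1 ≤ slotBound d D := by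
  have : 0 ≤ ∫ x : Momentum d, wt x := integral_nonneg fun x => (wt_pos x).le
  rw [slotBound]
  have : 0 ≤ 32 * D ^ 4 * (4 ^ (d + 1)) ^ 4 * ∫ x : Momentum d, wt x := by positivity
  linarith

lemma norm_slot_le (h : ConstantPhonon S ω₀ D) (hd : 0 < d) {R : Momentum d → Momentum d}
    (hR1 : ∀ k, ‖R k - k‖ ≤ 1) {n : ℕ} (m : Fin (n + 1) → ℕ) (E Ω : Fin (n + 1) → ℝ)
    (q : Fin (n + 1) → Momentum d) (b : ℕ) (s : ℝ) :
    ‖slotFun m (fun j s => Complex.exp (-Complex.I * ((s * E j : ℝ) : ℂ)))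
      (fun j s => thetaInt S R s (q j) (Ω j)) b s‖ ≤ slotBound d D := by
  have hD := h.one_le
  refine slotFun_induction (p := fun f : ℝ → ℂ => ‖f s‖ ≤ slotBound d D) ?_ ?_ b
  · intro j
    rw [exp_neg_I_norm]
    exact one_le_slotBound (by linarith)
  · intro j
    refine (h.norm_thetaInt_le hd hR1 s _ _).trans ?_
    have hI : 0 ≤ ∫ x : Momentum d, wt x := integral_nonneg fun x => (wt_pos x).le
    have h1 : D ^ 3 ≤ D ^ 4 := pow_le_pow_right₀ hD (by norm_num)
    rw [slotBound]
    have h2 : 0 ≤ (4 ^ (d + 1)) ^ 4 * ∫ x : Momentum d, wt x := by positivity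
    nlinarith [mul_le_mul_of_nonneg_right h1 h2, mul_nonneg (by positivity : 0 ≤ D ^ 3) h2]

lemma norm_amp_le (h : ConstantPhonon S ω₀ D) (hd : 0 < d) {R : Momentum d → Momentum d}
    (hR : Measurable R) (hR1 : ∀ k, ‖R k - k‖ ≤ 1) {t : ℝ} (ht : 0 ≤ t) {n N : ℕ}
    {m : Fin (n + 1) → ℕ} (hm : m ∈ patterns n N) (p : Momentum d) (k : Fin n → Momentum d)
    (σ : Fin n → ℤˣ) :
    ‖amp S R t N m p k σ‖ ≤ slotBound d D ^ (N + 1) * t ^ N := by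
  have hD := h.one_le
  rw [h.amp_eq_iterConv hd hR hR1 ht hm]
  exact norm_iterConv_le (zero_le_one.trans (one_le_slotBound (by linarith)))
    (fun b s _ => h.norm_slot_le hd hR1 m _ _ _ b s) N t ⟨ht, le_rfl⟩

lemma electronMomentum_norm_le {n : ℕ} (p : Momentum d) (k : Fin n → Momentum d)
    (j : Fin (n + 1)) : ‖electronMomentum p k j‖ ≤ ‖p‖ + ∑ l, ‖k l‖ := by
  refine (norm_add_le _ _).trans (add_le_add le_rfl ((norm_sum_le _ _).trans ?_))
  exact Finset.sum_le_sum_of_subset_of_nonneg (Finset.filter_subset _ _)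
    fun l _ _ => norm_nonneg _

lemma electronMomentum_sub_norm_le {n : ℕ} (p : Momentum d) {k k' : Fin n → Momentum d} {δ : ℝ}
    (hδ : 0 ≤ δ) (hk : ∀ l, ‖k l - k' l‖ ≤ δ) (j : Fin (n + 1)) :
    ‖electronMomentum p k j - electronMomentum p k' j‖ ≤ n * δ := by
  rw [electronMomentum, electronMomentum, add_sub_add_left_eq_sub, ← Finset.sum_sub_distrib]
  refine (norm_sum_le_of_le _ fun l _ => hk l).trans ?_
  rw [Finset.sum_const, nsmul_eq_mul]
  refine mul_le_mul_of_nonneg_right ?_ hδ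
  have := Finset.card_le_univ (Finset.univ.filter fun l : Fin n => (j : ℕ) ≤ (l : ℕ))
  rw [Fintype.card_fin] at this
  exact_mod_cast this

/-- Rounding does not affect the constant phonon energies. Only the electron energies and the
recollision functions vary, by a Lipschitz bound that is linear in the momenta. -/
lemma norm_amp_sub_le (h : ConstantPhonon S ω₀ D) (hd : 0 < d) {R : Momentum d → Momentum d}
    (hR : Measurable R) {δ : ℝ} (hδ0 : 0 ≤ δ) (hδ1 : δ ≤ 1) (hRδ : ∀ k, ‖R k - k‖ ≤ δ) {t : ℝ}
    (ht : 0 ≤ t) {n N : ℕ} {m : Fin (n + 1) → ℕ} (hm : m ∈ patterns n N) (p : Momentum d)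
    {k k' : Fin n → Momentum d} (hk : ∀ l, ‖k' l - k l‖ ≤ δ) (σ : Fin n → ℤˣ) :
    ‖amp S R t N m p k' σ - amp S id t N m p k σ‖ ≤
      (N + 1) * (slotBound d D ^ N * t ^ N) *
        ((slotBound d D + D) * (1 + t) * ((n + 2) * (1 + ‖p‖ + ∑ l, ‖k l‖)) * ((n + 1) * δ)) := by
  have hD := h.one_le
  have hR1 : ∀ k, ‖R k - k‖ ≤ 1 := fun k => (hRδ k).trans hδ1
  have hid : ∀ k : Momentum d, ‖id k - k‖ ≤ 1 := fun k => by simp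
  have hI : 0 ≤ ∫ x : Momentum d, wt x := integral_nonneg fun x => (wt_pos x).le
  have hsb := one_le_slotBound (d := d) (D := D) (by linarith)
  set Z : ℝ := 1 + ‖p‖ + ∑ l, ‖k l‖ with hZ
  have hZ1 : 1 ≤ Z := by
    have := norm_nonneg p
    have : 0 ≤ ∑ l, ‖k l‖ := Finset.sum_nonneg fun l _ => norm_nonneg _
    linarith
  rw [h.amp_eq_iterConv hd hR hR1 ht hm, h.amp_eq_iterConv hd measurable_id hid ht hm]
  have hΩ : ∀ j, phononEnergy S k' σ j = phononEnergy S k σ j := h.phononEnergy_eq k' k σ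
  simp only [hΩ]
  have hq : ∀ j, ‖electronMomentum p k' j - electronMomentum p k j‖ ≤ n * δ := fun j =>
    electronMomentum_sub_norm_le p hδ0 hk j
  have hsum : ∀ j, 1 + ‖electronMomentum p k' j‖ + ‖electronMomentum p k j‖ ≤ (n + 2) * Z := by
    intro j
    have h1 := electronMomentum_norm_le p k j
    have h2 := norm_sub_norm_le (electronMomentum p k' j) (electronMomentum p k j)
    have h3 : (n : ℝ) * δ ≤ n := mul_le_of_le_one_right (by positivity) hδ1
    have h4 : (n : ℝ) ≤ n * Z := le_mul_of_one_le_right (by positivity) hZ1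
    linarith [hq j]
  refine norm_iterConv_sub_le
    (slotFun_induction (fun j => by fun_prop) fun j => h.continuous_thetaInt hd hR hR1 _ _)
    (slotFun_induction (fun j => by fun_prop) fun j =>
      h.continuous_thetaInt hd measurable_id hid _ _)
    (zero_le_one.trans hsb) (by positivity)
    (fun b s _ => h.norm_slot_le hd hR1 m _ _ _ b s)
    (fun b s _ => h.norm_slot_le hd hid m _ _ _ b s) ?_ N t ⟨ht, le_rfl⟩
  intro b s hs
  have hs' : |s| ≤ t := by rw [abs_of_nonneg hs.1]; exact hs.2
  have hφ : ∀ j, ‖Complex.exp (-Complex.I *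
        ((s * (S.e (electronMomentum p k' j) + phononEnergy S k σ j) : ℝ) : ℂ)) -
      Complex.exp (-Complex.I *
        ((s * (S.e (electronMomentum p k j) + phononEnergy S k σ j) : ℝ) : ℂ))‖ ≤
      (slotBound d D + D) * (1 + t) * ((n + 2) * Z) * ((n + 1) * δ) := by
    intro j
    refine (norm_exp_sub_exp_le _ _).trans ?_
    rw [← mul_sub, add_sub_add_right_eq_sub, abs_mul]
    have h1 : |S.e (electronMomentum p k' j) - S.e (electronMomentum p k j)| ≤
        D * ((n + 2) * Z) * ((n + 1) * δ) := by
      refine (h.e_lip _ _).trans ?_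
      refine mul_le_mul (mul_le_mul_of_nonneg_left (hsum j) (by linarith)) ?_ (norm_nonneg _)
        (by positivity)
      exact (hq j).trans (by nlinarith)
    calc |s| * |S.e (electronMomentum p k' j) - S.e (electronMomentum p k j)|
        ≤ (1 + t) * (D * ((n + 2) * Z) * ((n + 1) * δ)) :=
          mul_le_mul (by linarith) h1 (abs_nonneg _) (by linarith)
      _ = D * ((1 + t) * ((n + 2) * Z) * ((n + 1) * δ)) := by ring
      _ ≤ (slotBound d D + D) * ((1 + t) * ((n + 2) * Z) * ((n + 1) * δ)) :=
          mul_le_mul_of_nonneg_right (by linarith) (by positivity)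
      _ = _ := by ring
  have hψ : ∀ j, ‖thetaInt S R s (electronMomentum p k' j) (phononEnergy S k σ j) -
      thetaInt S id s (electronMomentum p k j) (phononEnergy S k σ j)‖ ≤
      (slotBound d D + D) * (1 + t) * ((n + 2) * Z) * ((n + 1) * δ) := by
    intro j
    have h1 := h.norm_thetaInt_sub_le hd hR hδ1 hRδ (δ' := (n + 1) * δ) (by nlinarith) s
      ((hq j).trans (by nlinarith)) (phononEnergy S k σ j)
    refine h1.trans ?_
    have h2 : (1 + |s|) * (1 + ‖electronMomentum p k' j‖ + ‖electronMomentum p k j‖) ≤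
        (1 + t) * ((n + 2) * Z) :=
      mul_le_mul (by linarith) (hsum j) (by positivity) (by linarith)
    calc _ = (32 * D ^ 4 * (4 ^ (d + 1)) ^ 4 * ∫ x : Momentum d, wt x) *
          ((1 + |s|) * (1 + ‖electronMomentum p k' j‖ + ‖electronMomentum p k j‖)) *
            ((n + 1) * δ) := by ring
      _ ≤ (slotBound d D + D) * ((1 + t) * ((n + 2) * Z)) * ((n + 1) * δ) := by
          refine mul_le_mul_of_nonneg_right (mul_le_mul ?_ h2 (by positivity) (by linarith))
            (by positivity)
          rw [slotBound]
          linarith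
      _ = _ := by ring
  unfold slotFun
  split_ifs
  exacts [hφ _, hψ _, hφ _]

end ConstantPhonon

/-! ### The pairing graphs in infinite volume -/

section Momenta

variable {d n : ℕ}

lemma electronMomentum_eq_ext (p : Momentum d) (k : Fin n → Momentum d) (j : Fin (n + 1)) :
    electronMomentum p k j = ext p (chain p k) j := by
  rw [ext]
  split_ifs with h
  · rfl
  · rw [electronMomentum, Finset.filter_false_of_mem, Finset.sum_empty, add_zero]
    intro i _
    omega

lemma electronMomentum_comp_symm (p : Momentum d) (k : Fin n → Momentum d)
    (π : Equiv.Perm (Fin n)) (j : Fin (n + 1)) :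
    electronMomentum p (k ∘ π.symm) j = lowerMomentum π j (ext p (chain p k)) := by
  simp only [lowerMomentum, ext_chain_sub, electronMomentum]
  have h1 : ext p (chain p k) n = p := by rw [ext, dif_neg (lt_irrefl n)]
  rw [h1, Finset.sum_filter, Finset.sum_filter, ← Equiv.sum_comp π]
  simp

/-- The phonon energies along an electron line, for the constant dispersion relation `ω₀`. -/
noncomputable def phaseShift (ω₀ : ℝ) (σ : Fin n → ℤˣ) (j : ℕ) : ℝ :=
  ∑ l ∈ Finset.univ.filter (fun l : Fin n => j ≤ (l : ℕ)), Model.sgn (σ l) * ω₀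

/-- At index zero all phonons are counted, so the permutation is invisible. With `phaseShift_last`
this supplies the equal end phases required by the graph bound. -/
lemma phaseShift_zero_comp (ω₀ : ℝ) (σ : Fin n → ℤˣ) (π : Equiv.Perm (Fin n)) :
    phaseShift ω₀ (σ ∘ π.symm) 0 = phaseShift ω₀ σ 0 := by
  simp only [phaseShift, Nat.zero_le, Finset.filter_true]
  rw [← Equiv.sum_comp π]
  simp

lemma phaseShift_last (ω₀ : ℝ) (σ : Fin n → ℤˣ) : phaseShift ω₀ σ n = 0 := by
  rw [phaseShift, Finset.filter_false_of_mem fun i _ => not_le.2 i.2, Finset.sum_empty]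

/-- The `m j` recollisions add `m j` surplus copies of the resolvent of `j`, each at most `t`. -/
lemma prod_pow_succ_le {t : ℝ} (ht : 0 < t) (m : Fin (n + 1) → ℕ) (f : Fin (n + 1) → ℝ) :
    ∏ j, ecut t (f j) ^ (m j + 1) ≤ ENNReal.ofReal t ^ (∑ j, m j) * ∏ j, ecut t (f j) := by
  rw [← Finset.prod_pow_eq_pow_sum, ← Finset.prod_mul_distrib]
  refine Finset.prod_le_prod' fun j _ => ?_
  rw [pow_succ]
  exact mul_le_mul' (pow_le_pow_left' (ecut_le ht _) _) le_rfl

lemma mul_mul_le_ofReal_mul {x y U V : ℝ≥0∞} {a b c : ℝ} (ha : 0 ≤ a)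
    (hx : x ≤ ENNReal.ofReal a * U) (hy : y ≤ ENNReal.ofReal b * V) (W : ℝ≥0∞) (hc : a * b ≤ c) :
    W * (x * y) ≤ ENNReal.ofReal c * (W * (U * V)) := by
  calc W * (x * y) ≤ W * ((ENNReal.ofReal a * U) * (ENNReal.ofReal b * V)) :=
        mul_le_mul_right (mul_le_mul' hx hy) _
    _ = ENNReal.ofReal (a * b) * (W * (U * V)) := by
        rw [ENNReal.ofReal_mul ha]
        ring
    _ ≤ _ := mul_le_mul_left (ENNReal.ofReal_le_ofReal hc) _

end Momenta

namespace ConstantPhonon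

variable {d n N : ℕ} {S : Model d} {ω₀ D K : ℝ}

lemma phononEnergy_eq_phaseShift (h : ConstantPhonon S ω₀ D) (k : Fin n → Momentum d)
    (σ : Fin n → ℤˣ) (j : Fin (n + 1)) : phononEnergy S k σ j = phaseShift ω₀ σ j := by
  unfold phononEnergy phaseShift
  simp only [h.ω_eq]

lemma enorm_amp_id_le (h : ConstantPhonon S ω₀ D) (hd : 0 < d)
    (hK : ∀ q, ∫⁻ s in Set.Ioi 0, ‖oscInt S.e (fun k => S.Q k ^ 2) q s‖ₑ ≤ ENNReal.ofReal K)
    {t : ℝ} (ht : 0 < t) {m : Fin (n + 1) → ℕ} (hm : m ∈ patterns n N) (p : Momentum d)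
    (k : Fin n → Momentum d) (σ : Fin n → ℤˣ) :
    ‖amp S id t N m p k σ‖ₑ ≤ ENNReal.ofReal (Real.exp 1) *
      (ENNReal.ofReal (4 * D * K) ^ (∑ j, m j) * ∫⁻ ξ : ℝ, ∏ j : Fin (n + 1),
        ecut t (S.e (electronMomentum p k j) + (phaseShift ω₀ σ j + 2 * Real.pi * ξ)) ^
          (m j + 1)) := by
  have h1 := enorm_timeInt_line_le hm
    (fun j => S.e (electronMomentum p k j) + phononEnergy S k σ j)
    (ψ := fun j s => thetaInt S id s (electronMomentum p k j) (phononEnergy S k σ j))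
    (fun j => h.continuous_thetaInt hd measurable_id (fun k => by simp) _ _)
    (fun j => h.lintegral_thetaInt_le (hK _) _) ht
  simp only [h.phononEnergy_eq_phaseShift, add_assoc] at h1
  unfold amp
  simp only [h.phononEnergy_eq_phaseShift]
  exact h1

lemma enorm_amp_id_le_prod (h : ConstantPhonon S ω₀ D) (hd : 0 < d)
    (hK : ∀ q, ∫⁻ s in Set.Ioi 0, ‖oscInt S.e (fun k => S.Q k ^ 2) q s‖ₑ ≤ ENNReal.ofReal K)
    {t : ℝ} (ht : 0 < t) {m : Fin (n + 1) → ℕ} (hm : m ∈ patterns n N) (p : Momentum d)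
    (k : Fin n → Momentum d) (σ : Fin n → ℤˣ) :
    ‖amp S id t N m p k σ‖ₑ ≤ ENNReal.ofReal (Real.exp 1) *
      (ENNReal.ofReal (4 * D * K) * ENNReal.ofReal t) ^ (∑ j, m j) *
        ∫⁻ ξ : ℝ, ∏ j : Fin (n + 1),
          ecut t (S.e (electronMomentum p k j) + (phaseShift ω₀ σ j + 2 * Real.pi * ξ)) := by
  refine (h.enorm_amp_id_le hd hK ht hm p k σ).trans ?_
  rw [mul_pow, mul_assoc (ENNReal.ofReal (Real.exp 1)), mul_assoc (_ ^ _)]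
  refine mul_le_mul' le_rfl (mul_le_mul' le_rfl ?_)
  rw [← lintegral_const_mul' _ _ (ENNReal.pow_ne_top ENNReal.ofReal_ne_top)]
  exact lintegral_mono fun ξ => prod_pow_succ_le ht m _

lemma norm_amp_zero (h : ConstantPhonon S ω₀ D) (hd : 0 < d) {R : Momentum d → Momentum d}
    (hR : Measurable R) (hR1 : ∀ k, ‖R k - k‖ ≤ 1) {t : ℝ} (ht : 0 ≤ t)
    {m : Fin (n + 1) → ℕ} (hm : m ∈ patterns n 0) (p : Momentum d) (k : Fin n → Momentum d)
    (σ : Fin n → ℤˣ) : ‖amp S R t 0 m p k σ‖ = 1 := by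
  rw [h.amp_eq_iterConv hd hR hR1 ht hm, iterConv]
  have h0 : (0 : ℕ) ∈ freeSlots m 0 := by
    rw [freeSlots, Finset.mem_image]
    exact ⟨0, by simp, by simp [externalIndex]⟩
  rw [slotFun_free _ _ h0]
  exact exp_neg_I_norm _

/-- The contribution of the line amplitudes of a pairing graph with at least one phonon. -/
lemma lintegral_amp_mul_amp_le (h : ConstantPhonon S ω₀ D) (hd : 0 < d)
    (hK1 : 1 ≤ K)
    (hK : ∀ q, ∫⁻ s in Set.Ioi 0, ‖oscInt S.e (fun k => S.Q k ^ 2) q s‖ₑ ≤ ENNReal.ofReal K)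
    {t : ℝ} (ht : 0 < t) {m m' : Fin (n + 1) → ℕ} (hm : m ∈ patterns n N) (hm' : m' ∈ patterns n N)
    (π : Equiv.Perm (Fin n)) (p : Momentum d) (σ : Fin n → ℤˣ) {B : ℝ≥0∞}
    (hB : ∫⁻ k : Fin n → Momentum d, (∏ l, ewt (k l) ^ 4) *
        ((∫⁻ ξ : ℝ, ∏ j ∈ Finset.range (n + 1),
            ecut t (S.e (ext p (chain p k) j) + (phaseShift ω₀ σ j + 2 * Real.pi * ξ))) *
          ∫⁻ ξ : ℝ, ∏ j ∈ Finset.range (n + 1),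
            ecut t (S.e (lowerMomentum π j (ext p (chain p k))) +
              (phaseShift ω₀ (σ ∘ π.symm) j + 2 * Real.pi * ξ))) ≤ B) :
    ∫⁻ k : Fin n → Momentum d, (∏ l, ewt (k l) ^ 4) * (‖amp S id t N m p k σ‖ₑ *
        ‖amp S id t N m' p (k ∘ π.symm) (σ ∘ π.symm)‖ₑ) ≤
      ENNReal.ofReal (8 * (4 * D * K * t) ^ (N - n)) * B := by
  have hD := h.one_le
  -- Each line has `(N - n) / 2` recollisions, so the two lines together have `N - n`.
  have hN : N - n = ∑ j, m j + ∑ j, m' j := by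
    simp only [patterns, Set.mem_ofPred_eq] at hm hm'
    omega
  have he : Real.exp 1 * Real.exp 1 ≤ 8 := by
    have := Real.exp_one_lt_d9
    nlinarith [Real.exp_pos 1]
  calc _ ≤ ∫⁻ k : Fin n → Momentum d, ENNReal.ofReal (8 * (4 * D * K * t) ^ (N - n)) *
      ((∏ l, ewt (k l) ^ 4) *
        ((∫⁻ ξ : ℝ, ∏ j ∈ Finset.range (n + 1),
            ecut t (S.e (ext p (chain p k) j) + (phaseShift ω₀ σ j + 2 * Real.pi * ξ))) *
          ∫⁻ ξ : ℝ, ∏ j ∈ Finset.range (n + 1),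
            ecut t (S.e (lowerMomentum π j (ext p (chain p k))) +
              (phaseShift ω₀ (σ ∘ π.symm) j + 2 * Real.pi * ξ)))) := by
        refine lintegral_mono fun k => ?_
        have h1 := h.enorm_amp_id_le_prod hd hK ht hm p k σ
        have h2 := h.enorm_amp_id_le_prod hd hK ht hm' p (k ∘ π.symm) (σ ∘ π.symm)
        simp only [electronMomentum_comp_symm] at h2
        simp only [electronMomentum_eq_ext] at h1
        rw [← ENNReal.ofReal_mul (by positivity), ← ENNReal.ofReal_pow (by positivity),
          ← ENNReal.ofReal_mul (by positivity)] at h1 h2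
        simp only [Finset.prod_range]
        refine mul_mul_le_ofReal_mul (by positivity) h1 h2 _ ?_
        rw [hN, pow_add, mul_mul_mul_comm]
        exact mul_le_mul_of_nonneg_right he (by positivity)
    _ ≤ _ := by
        rw [lintegral_const_mul' _ _ ENNReal.ofReal_ne_top]
        exact mul_le_mul_right hB _

/-- The line amplitudes of a graph without phonons. -/
lemma enorm_amp_no_phonon_le (h : ConstantPhonon S ω₀ D) (hd : 0 < d) (hK1 : 1 ≤ K)
    (hK : ∀ q, ∫⁻ s in Set.Ioi 0, ‖oscInt S.e (fun k => S.Q k ^ 2) q s‖ₑ ≤ ENNReal.ofReal K)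
    {t : ℝ} (ht : 0 < t) {m : Fin (0 + 1) → ℕ} (hm : m ∈ patterns 0 N) (hN : N ≠ 0) (p : Momentum d)
    (k : Fin 0 → Momentum d) (σ : Fin 0 → ℤˣ) :
    ‖amp S id t N m p k σ‖ₑ ≤ ENNReal.ofReal (24 * (4 * D * K * t) ^ (m 0)) := by
  have hD := h.one_le
  have hm0 : m 0 ≠ 0 := by
    simp only [patterns, Set.mem_ofPred_eq, Nat.reduceAdd, Finset.univ_unique, Fin.default_eq_zero,
      Fin.isValue, Finset.sum_singleton] at hm
    omega
  obtain ⟨l, hl⟩ := Nat.exists_eq_succ_of_ne_zero hm0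
  refine (h.enorm_amp_id_le hd hK ht hm p k σ).trans ?_
  simp only [Nat.reduceAdd, Finset.univ_unique, Fin.default_eq_zero, Finset.sum_singleton,
    Finset.prod_singleton]
  -- Two of the `m 0 + 1 ≥ 2` resolvents are kept, to make the energy integral converge with value
  -- O(t). The other `m 0 - 1` are bounded by `t`, for a total of `t ^ m 0`.
  have h2 : ∀ y, ecut t y ^ (m 0 + 1) ≤ ENNReal.ofReal t ^ l * ENNReal.ofReal (cut t⁻¹ y ^ 2) := by
    intro y
    rw [hl, Nat.succ_eq_add_one, add_assoc, pow_add,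
      ENNReal.ofReal_pow (cut_pos (inv_pos.2 ht) y).le]
    exact mul_le_mul_left (pow_le_pow_left' (ecut_le ht _) _) _
  have h3 : ∫⁻ ξ : ℝ, ecut t (S.e (electronMomentum p k 0) +
      (phaseShift ω₀ σ (0 : Fin 1) + 2 * Real.pi * ξ)) ^ (m 0 + 1) ≤
      ENNReal.ofReal t ^ l * ENNReal.ofReal (8 * t) := by
    refine (lintegral_mono fun ξ => h2 _).trans ?_
    rw [lintegral_const_mul' _ _ (ENNReal.pow_ne_top ENNReal.ofReal_ne_top)]
    refine mul_le_mul_right ?_ _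
    simp only [← add_assoc]
    refine (lintegral_comp_two_pi_le (f := fun y => ENNReal.ofReal (cut t⁻¹ y ^ 2))
      ((measurable_cut _).pow_const 2).ennreal_ofReal _).trans (lintegral_cut_sq_le ht)
  refine (mul_le_mul_right (mul_le_mul_right h3 _) _).trans ?_
  rw [← ENNReal.ofReal_pow (by positivity), ← ENNReal.ofReal_pow (by positivity),
    ← ENNReal.ofReal_mul (by positivity), ← ENNReal.ofReal_mul (by positivity),
    ← ENNReal.ofReal_mul (by positivity)]
  refine ENNReal.ofReal_le_ofReal ?_
  have he : Real.exp 1 ≤ 3 := by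
    have := Real.exp_one_lt_d9
    linarith
  calc _ = Real.exp 1 * (8 * (4 * D * K * t) ^ m 0) := by
        rw [hl, Nat.succ_eq_add_one, mul_pow _ t, pow_succ t]
        ring
    _ ≤ 3 * (8 * (4 * D * K * t) ^ m 0) := mul_le_mul_of_nonneg_right he (by positivity)
    _ = _ := by ring

end ConstantPhonon

lemma HasMonotonePeaks.eq_zero {κ : ℕ} {π : Equiv.Perm (Fin 0)} (h : HasMonotonePeaks π κ) :
    κ = 0 := by
  obtain ⟨a, -⟩ := h
  by_contra hκ
  exact (a ⟨0, Nat.pos_of_ne_zero hκ⟩).elim0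

lemma graph_power_le {K₁ K₂ t l : ℝ} (h1 : 1 ≤ K₁) (h2 : 1 ≤ K₂) (ht : 0 < t) (hl : 1 ≤ l)
    {n N κ : ℕ} (hn : 0 < n) (hnN : n ≤ N) :
    8 * (K₁ * t) ^ (N - n) * (K₂ ^ n * (t ^ n * (t ^ κ)⁻¹) * l ^ (n + κ + 1)) ≤
      (t ^ κ)⁻¹ * (576 * K₁ * K₂ * t) ^ N * l ^ (n + κ + 2) := by
  have e1 : (K₁ * t) ^ (N - n) * t ^ n = K₁ ^ (N - n) * t ^ N := by
    rw [mul_pow, mul_assoc, ← pow_add, Nat.sub_add_cancel hnN]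
  calc _ = 8 * ((K₁ * t) ^ (N - n) * t ^ n) * K₂ ^ n * (t ^ κ)⁻¹ * l ^ (n + κ + 1) := by ring
    _ = 8 * K₁ ^ (N - n) * K₂ ^ n * ((t ^ κ)⁻¹ * t ^ N * l ^ (n + κ + 1)) := by rw [e1]; ring
    _ ≤ 576 ^ N * K₁ ^ N * K₂ ^ N * ((t ^ κ)⁻¹ * t ^ N * l ^ (n + κ + 2)) := by
        have h8 : (8 : ℝ) ≤ 576 ^ N :=
          (by norm_num : (8 : ℝ) ≤ 576).trans (le_self_pow₀ (by norm_num) (by omega))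
        have h3 : K₁ ^ (N - n) ≤ K₁ ^ N := pow_le_pow_right₀ h1 (by omega)
        have h4 : K₂ ^ n ≤ K₂ ^ N := pow_le_pow_right₀ h2 hnN
        have h5 : l ^ (n + κ + 1) ≤ l ^ (n + κ + 2) := pow_le_pow_right₀ hl (by omega)
        gcongr
    _ = _ := by rw [mul_pow, mul_pow, mul_pow]; ring

/-- The bound on the pairing graphs in infinite volume, uniformly in the outer momentum. -/
theorem exists_lintegral_amp_mul_amp_le (d : ℕ) (hd : 3 ≤ d) {A B κ₀ ρ D K : ℝ} (hA : 0 < A)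
    (hB : 0 < B) (hρ : 0 < ρ) (hD : 1 ≤ D) (hK1 : 1 ≤ K) :
    ∃ K' : ℝ, 1 ≤ K' ∧ ∀ (S : Model d) (ω₀ : ℝ), ConstantPhonon S ω₀ D → UniformlyConvex A B S.e →
      Transversal κ₀ ρ S.e →
      (∀ q, ∫⁻ s in Set.Ioi 0, ‖oscInt S.e (fun k => S.Q k ^ 2) q s‖ₑ ≤ ENNReal.ofReal K) →
      ∀ (n N κ : ℕ) (m m' : Fin (n + 1) → ℕ), m ∈ patterns n N → m' ∈ patterns n N →
      ∀ π : Equiv.Perm (Fin n), HasMonotonePeaks π κ → ∀ (p : Momentum d) (σ : Fin n → ℤˣ) (t : ℝ),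
      0 < t →
      ∫⁻ k : Fin n → Momentum d, (∏ l, ewt (k l) ^ 4) * (‖amp S id t N m p k σ‖ₑ *
          ‖amp S id t N m' p (k ∘ π.symm) (σ ∘ π.symm)‖ₑ) ≤
        ENNReal.ofReal ((t ^ κ)⁻¹ * (K' * t) ^ N * logStar t ^ (n + κ + 2)) := by
  obtain ⟨K₂, hK₂, hgraph⟩ := exists_lintegral_graph_le d hd (κ₀ := κ₀) hA hB hρ
  have hK₁ : 1 ≤ 4 * D * K := by nlinarith
  refine ⟨576 * (4 * D * K) * K₂, by nlinarith, ?_⟩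
  intro S ω₀ h he htr hK n N κ m m' hm hm' π hπ p σ t ht
  have hl := one_le_logStar t
  have hd0 : 0 < d := by omega
  rcases Nat.eq_zero_or_pos n with rfl | hn
  -- Without phonons there are no momenta to integrate and no peaks. The momentum space is a point
  -- of mass one and the amplitudes are bounded directly, which produces `24 ^ 2 = 576`.
  · obtain rfl := hπ.eq_zero
    rw [lintegral_unique]
    simp only [Finset.univ_eq_empty, Finset.prod_empty, one_mul]
    have hvol : (volume : Measure (Fin 0 → Momentum d)) Set.univ = 1 := by
      rw [← Set.pi_univ Set.univ, volume_pi_pi]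
      simp
    rw [hvol, mul_one]
    rcases Nat.eq_zero_or_pos N with rfl | hN
    · have hid : ∀ k : Momentum d, ‖id k - k‖ ≤ 1 := fun k => by simp
      have e1 := fun k => h.norm_amp_zero hd0 measurable_id hid ht.le hm p k σ
      have e2 := fun k => h.norm_amp_zero hd0 measurable_id hid ht.le hm' p k (σ ∘ π.symm)
      rw [← ofReal_norm, ← ofReal_norm, e1, e2, ENNReal.ofReal_one, one_mul,
        ← ENNReal.ofReal_one]
      refine ENNReal.ofReal_le_ofReal ?_
      simp only [pow_zero, inv_one, one_mul]
      exact one_le_pow₀ hl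
    · refine (mul_le_mul' (h.enorm_amp_no_phonon_le hd0 hK1 hK ht hm hN.ne' p default σ)
        (h.enorm_amp_no_phonon_le hd0 hK1 hK ht hm' hN.ne' p _ _)).trans ?_
      rw [← ENNReal.ofReal_mul (by positivity)]
      refine ENNReal.ofReal_le_ofReal ?_
      have hN' : N = m 0 + m' 0 := by
        simp only [patterns, Set.mem_ofPred_eq, Nat.reduceAdd, Finset.univ_unique,
          Fin.default_eq_zero, Fin.isValue, Finset.sum_singleton] at hm hm'
        omega
      calc _ = 576 * (4 * D * K * t) ^ N := by rw [hN', pow_add]; ring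
        _ ≤ 576 ^ N * (4 * D * K * t) ^ N * K₂ ^ N := by
            have h6 : (576 : ℝ) ≤ 576 ^ N := le_self_pow₀ (by norm_num) hN.ne'
            have h7 : 1 ≤ K₂ ^ N := one_le_pow₀ hK₂
            have h8 := mul_le_mul_of_nonneg_right h6
              (by positivity : 0 ≤ (4 * D * K * t) ^ N)
            exact h8.trans (le_mul_of_one_le_right (by positivity) h7)
        _ = (576 * (4 * D * K) * K₂ * t) ^ N := by rw [← mul_pow, ← mul_pow]; ring
        _ ≤ _ := by
            rw [pow_zero, inv_one, one_mul]
            exact le_mul_of_one_le_right (by positivity) (one_le_pow₀ hl)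
  · refine (h.lintegral_amp_mul_amp_le hd0 hK1 hK ht hm hm' π p σ
      (hgraph S.e he htr n κ π hn hπ (phaseShift ω₀ σ) (phaseShift ω₀ (σ ∘ π.symm))
        (phaseShift_zero_comp ω₀ σ π).symm
        (by rw [phaseShift_last, phaseShift_last]) p t ht)).trans ?_
    rw [← ENNReal.ofReal_mul (by positivity)]
    refine ENNReal.ofReal_le_ofReal (graph_power_le hK₁ hK₂ ht hl hn ?_)
    simp only [patterns, Set.mem_ofPred_eq] at hm
    omega

/-! ### The infinite-volume limit of the pairing graphs -/

lemma one_add_add_sum_le {ι : Type*} (s : Finset ι) {a : ℝ} (ha : 0 ≤ a) {x : ι → ℝ}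
    (hx : ∀ i, 0 ≤ x i) : 1 + a + ∑ i ∈ s, x i ≤ (1 + a) * ∏ i ∈ s, (1 + x i) := by
  classical
  induction s using Finset.induction_on with
  | empty => simp
  | insert i s hi ih =>
    rw [Finset.sum_insert hi, Finset.prod_insert hi]
    have h1 := hx i
    have h2 : 0 ≤ ∑ i ∈ s, x i := Finset.sum_nonneg fun i _ => hx i
    have h3 := mul_le_mul_of_nonneg_left ih (by linarith : 0 ≤ 1 + x i)
    nlinarith [mul_nonneg h1 h2, mul_nonneg h1 ha]

/-- The sum of the norms is dominated by the product of the factors `1 + ‖k l‖`, each absorbed by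
one of the four weights; an integrable weight is left for every variable. -/
lemma sum_mul_prod_wt_le {d n : ℕ} (p : Momentum d) (k : Fin n → Momentum d) :
    (1 + ‖p‖ + ∑ l, ‖k l‖) * ∏ l, wt (k l) ^ 4 ≤ (1 + ‖p‖) * (2 ^ n * ∏ l, wt (k l)) := by
  have h0 : 0 ≤ ∏ l, wt (k l) ^ 4 := Finset.prod_nonneg fun l _ => (pow_pos (wt_pos _) 4).le
  refine (mul_le_mul_of_nonneg_right (one_add_add_sum_le Finset.univ (norm_nonneg p)
    fun l => norm_nonneg (k l)) h0).trans ?_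
  rw [mul_assoc, ← Finset.prod_mul_distrib]
  refine mul_le_mul_of_nonneg_left ?_ (by positivity)
  calc ∏ l, (1 + ‖k l‖) * wt (k l) ^ 4 ≤ ∏ l, 2 * wt (k l) := by
        refine Finset.prod_le_prod (fun l _ => by have := wt_pos (k l); positivity) fun l _ => ?_
        have hw := wt_pos (k l)
        have hw1 := wt_le_one (k l)
        calc (1 + ‖k l‖) * wt (k l) ^ 4 = ((1 + ‖k l‖) * wt (k l)) * (wt (k l) ^ 2 * wt (k l)) := by
              ring
          _ ≤ 2 * (1 * wt (k l)) :=
            mul_le_mul (one_add_norm_mul_wt_le _)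
              (mul_le_mul_of_nonneg_right (pow_le_one₀ hw.le hw1) hw.le) (by positivity) zero_le_two
          _ = _ := by ring
    _ = _ := by rw [Finset.prod_mul_distrib]; simp

lemma mul_norm_le_of_sub_le {a b a' b' M ε : ℝ} (ha : 0 ≤ a) (hb : 0 ≤ b')
    (haM : a ≤ M) (hbM : b' ≤ M) (h1 : a' ≤ a + ε) (h2 : b' ≤ b + ε) (hε : 0 ≤ ε) :
    a' * b' ≤ a * b + 2 * M * ε := by
  nlinarith [mul_le_mul_of_nonneg_right h1 hb, mul_le_mul_of_nonneg_left h2 ha,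
    mul_le_mul_of_nonneg_right haM hε, mul_le_mul_of_nonneg_right hbM hε]

namespace ConstantPhonon

variable {d n N : ℕ} {S : Model d} {ω₀ D : ℝ}

/-- A bound on the function `M`, relative to the fourth power of the weight. -/
noncomputable def couplingBound (d : ℕ) (D : ℝ) : ℝ := 2 * D ^ 3 * (4 ^ (d + 1)) ^ 4

lemma one_le_couplingBound (hD : 1 ≤ D) : 1 ≤ couplingBound d D := by
  rw [couplingBound]
  have h1 : 1 ≤ D ^ 3 := one_le_pow₀ hD
  have h2 : (1 : ℝ) ≤ (4 ^ (d + 1)) ^ 4 := one_le_pow₀ (one_le_pow₀ (by norm_num))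
  nlinarith

/-- The comparison of the finite-volume sum over the phonon momenta with the integral. -/
lemma exists_enorm_latticeIntMulti_le (h : ConstantPhonon S ω₀ D) (hd : 0 < d) {t : ℝ} (ht : 0 ≤ t)
    {m m' : Fin (n + 1) → ℕ} (hm : m ∈ patterns n N) (hm' : m' ∈ patterns n N)
    (π : Equiv.Perm (Fin n)) :
    ∃ E : ℝ, 0 ≤ E ∧ ∀ L : ℝ, 0 < L → Real.sqrt (2 * Real.pi) * d / L ≤ 1 →
      ∀ (p : Momentum d) (σ : Fin n → ℤˣ),
      ‖latticeIntMulti L n fun y : Fin n → LatticeIndex d =>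
        (∏ j, ((S.M (latticePoint L (y j)) (σ j) : ℝ) : ℂ)) *
          Y S L t N m m' π p (fun j => latticePoint L (y j)) σ‖ₑ ≤
      ENNReal.ofReal (couplingBound d D ^ n) *
        ((∫⁻ k : Fin n → Momentum d, (∏ l, ewt (k l) ^ 4) * (‖amp S id t N m p k σ‖ₑ *
          ‖amp S id t N m' p (k ∘ π.symm) (σ ∘ π.symm)‖ₑ)) + ENNReal.ofReal (E / L * (1 + ‖p‖))) := by
  have hD := h.one_le
  have hsb := one_le_slotBound (d := d) (D := D) (by linarith)
  obtain ⟨M, hM⟩ : ∃ M : ℝ, M = slotBound d D ^ (N + 1) * t ^ N := ⟨_, rfl⟩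
  obtain ⟨G, hG⟩ : ∃ G : ℝ, G = (N + 1) * (slotBound d D ^ N * t ^ N) *
    ((slotBound d D + D) * (1 + t) * (n + 2) * (n + 1)) := ⟨_, rfl⟩
  have hM0 : 0 ≤ M := by rw [hM]; positivity
  have hG0 : 0 ≤ G := by rw [hG]; positivity
  obtain ⟨I, hI⟩ : ∃ I : ℝ, I = ∫ k : Fin n → Momentum d, ∏ l, wt (k l) := ⟨_, rfl⟩
  have hwt0 : ∀ k : Fin n → Momentum d, 0 ≤ ∏ l, wt (k l) := fun k =>
    Finset.prod_nonneg fun l _ => (wt_pos _).le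
  have hI0 : 0 ≤ I := hI ▸ integral_nonneg hwt0
  have hint : Integrable fun k : Fin n → Momentum d => ∏ l, wt (k l) :=
    Integrable.fintype_prod fun _ => integrable_wt hd
  -- `M` bounds the amplitudes, `G` their variation under rounding, and `I` is the integral of the
  -- weights that remain after the growth in the momenta has been absorbed.
  refine ⟨2 * M * G * (Real.sqrt (2 * Real.pi) * d) * 2 ^ n * I, by positivity, ?_⟩
  intro L hL hL1 p σ
  obtain ⟨δ, hδ⟩ : ∃ δ : ℝ, δ = Real.sqrt (2 * Real.pi) * d / L := ⟨_, rfl⟩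
  rw [← hδ] at hL1
  have hδ0 : 0 ≤ δ := by rw [hδ]; positivity
  have hRδ : ∀ k : Momentum d, ‖roundMap L k - k‖ ≤ δ := fun k =>
    hδ ▸ norm_roundMap_sub_le hL k
  have hR1 : ∀ k : Momentum d, ‖roundMap L k - k‖ ≤ 1 := fun k => (hRδ k).trans hL1
  have hid : ∀ k : Momentum d, ‖id k - k‖ ≤ 1 := fun k => by simp
  have hRm := measurable_roundMap (d := d) L
  refine (enorm_latticeIntMulti_le hL n _).trans ?_
  have key : ∀ k : Fin n → Momentum d,
      ‖(∏ j, ((S.M (roundMap L (k j)) (σ j) : ℝ) : ℂ)) *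
        Y S L t N m m' π p (fun j => roundMap L (k j)) σ‖ ≤
      couplingBound d D ^ n * ((∏ l, wt (k l) ^ 4) * (‖amp S id t N m p k σ‖ *
          ‖amp S id t N m' p (k ∘ π.symm) (σ ∘ π.symm)‖) +
        (2 * M * G * δ * 2 ^ n * (1 + ‖p‖)) * ∏ l, wt (k l)) := by
    intro k
    have hw4 : 0 ≤ ∏ l, wt (k l) ^ 4 := Finset.prod_nonneg fun l _ => (pow_pos (wt_pos _) 4).le
    have hcb := one_le_couplingBound (d := d) hD
    have h1 : ‖∏ j, ((S.M (roundMap L (k j)) (σ j) : ℝ) : ℂ)‖ ≤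
        couplingBound d D ^ n * ∏ l, wt (k l) ^ 4 := by
      rw [norm_prod]
      calc _ ≤ ∏ l, couplingBound d D * wt (k l) ^ 4 := by
            refine Finset.prod_le_prod (fun l _ => norm_nonneg _) fun l _ => ?_
            rw [Complex.norm_real, Real.norm_of_nonneg (h.M_nonneg _ _)]
            exact h.M_le (hR1 _) _
        _ = _ := by rw [Finset.prod_mul_distrib]; simp
    obtain ⟨Z, hZ⟩ : ∃ Z : ℝ, Z = 1 + ‖p‖ + ∑ l, ‖k l‖ := ⟨_, rfl⟩
    have hZ0 : 0 ≤ Z := by rw [hZ]; positivity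
    have h2 := h.norm_amp_sub_le hd hRm hδ0 hL1 hRδ ht hm p
      (k := k) (k' := fun j => roundMap L (k j)) (fun l => hRδ _) σ
    have h3 := h.norm_amp_sub_le hd hRm hδ0 hL1 hRδ ht hm' p
      (k := k ∘ π.symm) (k' := (fun j => roundMap L (k j)) ∘ π.symm) (fun l => hRδ _) (σ ∘ π.symm)
    have e3 : ∑ l, ‖(k ∘ π.symm) l‖ = ∑ l, ‖k l‖ := Equiv.sum_comp π.symm fun l => ‖k l‖
    rw [e3] at h3
    have e4 : (N + 1) * (slotBound d D ^ N * t ^ N) *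
        ((slotBound d D + D) * (1 + t) * ((n + 2) * (1 + ‖p‖ + ∑ l, ‖k l‖)) * ((n + 1) * δ)) =
        G * Z * δ := by rw [hG, hZ]; ring
    rw [e4] at h2 h3
    have h4 := h.norm_amp_le hd measurable_id hid ht hm p k σ
    have h5 := h.norm_amp_le hd hRm hR1 ht hm' p ((fun j => roundMap L (k j)) ∘ π.symm)
      (σ ∘ π.symm)
    rw [← hM] at h4 h5
    have h6 := mul_norm_le_of_sub_le (norm_nonneg _) (norm_nonneg _) h4 h5
      ((norm_le_norm_add_norm_sub' _ _).trans (add_le_add le_rfl h2))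
      ((norm_le_norm_add_norm_sub' _ _).trans (add_le_add le_rfl h3)) (by positivity)
    rw [norm_mul, Y, h.lineAmplitude_eq_amp hd hL hR1, h.lineAmplitude_eq_amp hd hL hR1, norm_mul,
      RCLike.norm_conj]
    refine (mul_le_mul h1 h6 (by positivity) (by positivity)).trans ?_
    rw [mul_assoc]
    refine mul_le_mul_of_nonneg_left ?_ (by positivity)
    rw [mul_add]
    refine add_le_add le_rfl ?_
    have h7 := sum_mul_prod_wt_le p k
    rw [← hZ] at h7
    calc _ = (2 * M * G * δ) * (Z * ∏ l, wt (k l) ^ 4) := by ring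
      _ ≤ (2 * M * G * δ) * ((1 + ‖p‖) * (2 ^ n * ∏ l, wt (k l))) :=
        mul_le_mul_of_nonneg_left h7 (by positivity)
      _ = _ := by ring
  have hcb := one_le_couplingBound (d := d) hD
  have hp0 : 0 ≤ 2 * M * G * δ * 2 ^ n * (1 + ‖p‖) := by positivity
  calc _ ≤ ∫⁻ k : Fin n → Momentum d, ENNReal.ofReal (couplingBound d D ^ n) *
        ((∏ l, ewt (k l) ^ 4) * (‖amp S id t N m p k σ‖ₑ *
          ‖amp S id t N m' p (k ∘ π.symm) (σ ∘ π.symm)‖ₑ) +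
        ENNReal.ofReal (2 * M * G * δ * 2 ^ n * (1 + ‖p‖)) *
          ENNReal.ofReal (∏ l, wt (k l))) := by
        refine lintegral_mono fun k => ?_
        have hw4 : 0 ≤ ∏ l, wt (k l) ^ 4 := Finset.prod_nonneg fun l _ => (pow_pos (wt_pos _) 4).le
        have e5 : ∏ l, ewt (k l) ^ 4 = ENNReal.ofReal (∏ l, wt (k l) ^ 4) := by
          rw [ENNReal.ofReal_prod_of_nonneg fun l _ => (pow_pos (wt_pos _) 4).le]
          exact Finset.prod_congr rfl fun l _ => (ENNReal.ofReal_pow (wt_pos _).le 4).symm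
        rw [e5, ← ofReal_norm, ← ofReal_norm, ← ofReal_norm, ← ENNReal.ofReal_mul (norm_nonneg _),
          ← ENNReal.ofReal_mul hw4, ← ENNReal.ofReal_mul hp0,
          ← ENNReal.ofReal_add (by positivity) (mul_nonneg hp0 (hwt0 k)),
          ← ENNReal.ofReal_mul (by positivity)]
        exact ENNReal.ofReal_le_ofReal (key k)
    _ = _ := by
        have hm1 : Measurable fun k : Fin n → Momentum d =>
            ENNReal.ofReal (2 * M * G * δ * 2 ^ n * (1 + ‖p‖)) * ENNReal.ofReal (∏ l, wt (k l)) := by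
          refine Measurable.const_mul (Measurable.ennreal_ofReal ?_) _
          exact Finset.measurable_fun_prod _ fun l _ => measurable_wt.comp (measurable_pi_apply l)
        rw [lintegral_const_mul' _ _ ENNReal.ofReal_ne_top, lintegral_add_right _ hm1,
          lintegral_const_mul' _ _ ENNReal.ofReal_ne_top,
          ← ofReal_integral_eq_lintegral_ofReal hint (ae_of_all _ hwt0), ← hI,
          ← ENNReal.ofReal_mul hp0]
        congr 3
        rw [hδ]
        ring

end ConstantPhonon

/-! ### The sum over the electron momentum -/

section Electron

variable {d : ℕ} {γ : ElectronSpace d →L[ℂ] ElectronSpace d}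

/-- The probability of a momentum in the electron state `γ`. -/
noncomputable def occupation (γ : ElectronSpace d →L[ℂ] ElectronSpace d) (x : LatticeIndex d) : ℝ :=
  (inner ℂ (planeWave x) (γ (planeWave x))).re

namespace IsDensityMatrix

lemma inner_eq_occupation (hγ : IsDensityMatrix γ) (x : LatticeIndex d) :
    0 ≤ occupation γ x ∧ inner ℂ (planeWave x) (γ (planeWave x)) = (occupation γ x : ℂ) := by
  have h := Complex.nonneg_iff.1 (hγ.positive.inner_nonneg_right (planeWave x))
  exact ⟨h.1, Complex.ext (by simp [occupation]) (by simp [← h.2])⟩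

lemma tsum_occupation (hγ : IsDensityMatrix γ) : ∑' x, ENNReal.ofReal (occupation γ x) = 1 := by
  have h1 : HasSum (occupation γ) 1 := by
    have h2 : HasSum (fun x => (inner ℂ (planeWave x) (γ (planeWave x))).re) 1 := by
      simpa using Complex.reCLM.hasSum hγ.trace_one
    exact h2
  rw [← ENNReal.ofReal_tsum_of_nonneg (fun x => (hγ.inner_eq_occupation x).1) h1.summable,
    h1.tsum_eq, ENNReal.ofReal_one]

lemma kernel_eq (hγ : IsDensityMatrix γ) (L : ℝ) (x : LatticeIndex d) :
    kernel L γ x x = ((L ^ d * occupation γ x : ℝ) : ℂ) := by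
  rw [kernel, (hγ.inner_eq_occupation x).2]
  push_cast
  rfl

lemma enorm_latticeInt_kernel_le (hγ : IsDensityMatrix γ) {L : ℝ} (hL : 0 < L)
    (F : LatticeIndex d → ℂ) :
    ‖latticeInt L fun x => kernel L γ x x * F x‖ₑ ≤
      ∑' x, ENNReal.ofReal (occupation γ x) * ‖F x‖ₑ := by
  rw [latticeInt, ← tsum_mul_left]
  refine enorm_tsum_le_tsum_enorm.trans (le_of_eq (tsum_congr fun x => ?_))
  have hL' : (L : ℂ) ^ d ≠ 0 := pow_ne_zero _ (by exact_mod_cast hL.ne')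
  have e1 : ((L : ℂ) ^ d)⁻¹ * (kernel L γ x x * F x) = (occupation γ x : ℂ) * F x := by
    rw [hγ.kernel_eq]
    push_cast
    field_simp
  rw [e1, enorm_mul, ← ofReal_norm, Complex.norm_real,
    Real.norm_of_nonneg (hγ.inner_eq_occupation x).1]

/-- The rounding error grows linearly in the electron momentum, so the first moment suffices; it is
dominated by the moment of order `3 * d + 12`. -/
lemma tsum_occupation_mul_le (hγ : IsDensityMatrix γ) {L : ℝ} (hL : 0 < L) :
    ∑' x, ENNReal.ofReal (occupation γ x) * ENNReal.ofReal (1 + ‖latticePoint L x‖) ≤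
      ENNReal.ofReal 2 * momentumMoment L γ := by
  rw [momentumMoment, ← ENNReal.tsum_mul_left, ← ENNReal.tsum_mul_left]
  refine ENNReal.tsum_le_tsum fun x => ?_
  have h0 := (hγ.inner_eq_occupation x).1
  have h1 := one_le_bracket (latticePoint L x)
  have h2 := norm_le_bracket (latticePoint L x)
  have h3 : bracket (latticePoint L x) ≤ bracket (latticePoint L x) ^ (3 * d + 12) :=
    le_self_pow₀ h1 (by omega)
  rw [hγ.kernel_eq, Complex.ofReal_re, ← ENNReal.ofReal_mul h0, ← ENNReal.ofReal_mul (by positivity),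
    ← ENNReal.ofReal_mul zero_le_two]
  refine ENNReal.ofReal_le_ofReal ?_
  have hL' : L ^ d ≠ 0 := pow_ne_zero _ hL.ne'
  calc occupation γ x * (1 + ‖latticePoint L x‖)
      ≤ occupation γ x * (2 * bracket (latticePoint L x) ^ (3 * d + 12)) :=
        mul_le_mul_of_nonneg_left (by linarith) h0
    _ = _ := by field_simp

end IsDensityMatrix

end Electron

/-- The limit of a pairing graph is bounded by the integral in infinite volume. -/
theorem ConstantPhonon.limsup_graphValue_le {d n N : ℕ} {S : Model d} {ω₀ D : ℝ}
    (h : ConstantPhonon S ω₀ D) (hd : 0 < d)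
    {γ : ℝ → (ElectronSpace d →L[ℂ] ElectronSpace d)} (hγ : ∀ L, 0 < L → IsDensityMatrix (γ L))
    {C₈ : ℝ} (hmom : limsup (fun L : ℝ => momentumMoment L (γ L)) atTop ≤ ENNReal.ofReal C₈)
    {m m' : Fin (n + 1) → ℕ} (hm : m ∈ patterns n N) (hm' : m' ∈ patterns n N)
    (π : Equiv.Perm (Fin n)) (lam : ℝ) {t : ℝ} (ht : 0 ≤ t) {X : ℝ} (hX0 : 0 ≤ X)
    (hX : ∀ (p : Momentum d) (σ : Fin n → ℤˣ),
      ∫⁻ k : Fin n → Momentum d, (∏ l, ewt (k l) ^ 4) * (‖amp S id t N m p k σ‖ₑ *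
          ‖amp S id t N m' p (k ∘ π.symm) (σ ∘ π.symm)‖ₑ) ≤ ENNReal.ofReal X) :
    limsup (fun L : ℝ => ‖graphValue S L (γ L) lam t N m m' π‖ₑ) atTop ≤
      ENNReal.ofReal ((lam ^ 2) ^ N * (2 ^ n * (couplingBound d D ^ n * X))) := by
  have hcb : 0 ≤ couplingBound d D := zero_le_one.trans (one_le_couplingBound h.one_le)
  obtain ⟨E, hE0, hE⟩ := h.exists_enorm_latticeIntMulti_le hd ht hm hm' π
  -- A bound on the limsup controls the moment only eventually, and only up to a slightly larger
  -- constant.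
  have hC : limsup (fun L : ℝ => momentumMoment L (γ L)) atTop < ENNReal.ofReal (|C₈| + 1) :=
    hmom.trans_lt ((ENNReal.ofReal_lt_ofReal_iff (by positivity)).2
      (lt_of_le_of_lt (le_abs_self _) (lt_add_one _)))
  have hev : ∀ᶠ L : ℝ in atTop, ‖graphValue S L (γ L) lam t N m m' π‖ₑ ≤
      ENNReal.ofReal ((lam ^ 2) ^ N * (2 ^ n * (couplingBound d D ^ n *
        (X + E / L * (2 * (|C₈| + 1)))))) := by
    filter_upwards [eventually_lt_of_limsup_lt hC, eventually_gt_atTop 0,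
      eventually_ge_atTop (Real.sqrt (2 * Real.pi) * d)] with L hL1 hL hL2
    have hL3 : Real.sqrt (2 * Real.pi) * d / L ≤ 1 := (div_le_one hL).2 hL2
    have hEL : 0 ≤ E / L := div_nonneg hE0 hL.le
    have hσ : ∀ σ : Fin n → ℤˣ, ‖latticeInt L fun x : LatticeIndex d => kernel L (γ L) x x *
        latticeIntMulti L n fun y : Fin n → LatticeIndex d =>
          (∏ j, ((S.M (latticePoint L (y j)) (σ j) : ℝ) : ℂ)) *
            Y S L t N m m' π (latticePoint L x) (fun j => latticePoint L (y j)) σ‖ₑ ≤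
        ENNReal.ofReal (couplingBound d D ^ n * (X + E / L * (2 * (|C₈| + 1)))) := by
      intro σ
      refine ((hγ L hL).enorm_latticeInt_kernel_le hL _).trans ?_
      have h1 : ∀ x : LatticeIndex d, ENNReal.ofReal (occupation (γ L) x) *
          ‖latticeIntMulti L n fun y : Fin n → LatticeIndex d =>
          (∏ j, ((S.M (latticePoint L (y j)) (σ j) : ℝ) : ℂ)) *
            Y S L t N m m' π (latticePoint L x) (fun j => latticePoint L (y j)) σ‖ₑ ≤
          ENNReal.ofReal (couplingBound d D ^ n) *
            (ENNReal.ofReal X * ENNReal.ofReal (occupation (γ L) x) + ENNReal.ofReal (E / L) *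
              (ENNReal.ofReal (occupation (γ L) x) *
                ENNReal.ofReal (1 + ‖latticePoint L x‖))) := by
        intro x
        refine (mul_le_mul_right ((hE L hL hL3 (latticePoint L x) σ).trans
          (mul_le_mul_right (add_le_add (hX _ σ) le_rfl) _)) _).trans (le_of_eq ?_)
        rw [ENNReal.ofReal_mul hEL]
        ring
      refine (ENNReal.tsum_le_tsum h1).trans ?_
      rw [ENNReal.tsum_mul_left, ENNReal.tsum_add, ENNReal.tsum_mul_left, ENNReal.tsum_mul_left,
        (hγ L hL).tsum_occupation, mul_one, ENNReal.ofReal_mul (by positivity),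
        ENNReal.ofReal_add hX0 (by positivity), ENNReal.ofReal_mul hEL,
        ENNReal.ofReal_mul zero_le_two]
      exact mul_le_mul_right (add_le_add le_rfl (mul_le_mul_right
        (((hγ L hL).tsum_occupation_mul_le hL).trans (mul_le_mul_right hL1.le _)) _)) _
    rw [graphValue, enorm_mul, ENNReal.ofReal_mul (by positivity)]
    refine mul_le_mul' (le_of_eq ?_) ?_
    · rw [← ofReal_norm, norm_pow, Complex.norm_real, pow_mul, ← norm_pow,
        Real.norm_of_nonneg (sq_nonneg lam)]
    · refine (enorm_sum_le _ _).trans ((Finset.sum_le_sum fun σ _ => hσ σ).trans (le_of_eq ?_))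
      rw [Finset.sum_const, Finset.card_univ, Fintype.card_fun, Fintype.card_units_int,
        Fintype.card_fin, nsmul_eq_mul, ENNReal.ofReal_mul (p := 2 ^ n) (by positivity)]
      congr 1
      rw [ENNReal.ofReal_pow zero_le_two]
      simp
  refine (limsup_le_limsup hev).trans (le_of_eq (Tendsto.limsup_eq ?_))
  refine ENNReal.tendsto_ofReal ?_
  have h1 : Tendsto (fun L : ℝ => E / L) atTop (𝓝 0) := tendsto_const_nhds.div_atTop tendsto_id
  have h2 := (((h1.mul_const (2 * (|C₈| + 1))).const_add X).const_mul
    (couplingBound d D ^ n)).const_mul ((2 : ℝ) ^ n) |>.const_mul ((lam ^ 2) ^ N)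
  simpa using h2

/-! ### The standing assumptions for a constant phonon dispersion -/

lemma bracket_zpow_le_one {d : ℕ} (x : Momentum d) {i : ℤ} (hi : i ≤ 0) : bracket x ^ i ≤ 1 :=
  zpow_le_one_of_nonpos₀ (one_le_bracket x) hi

lemma bracket_zpow_le_wt_sq {d : ℕ} (x : Momentum d) :
    bracket x ^ (-(2 * (d : ℤ)) - 12) ≤ wt x ^ 2 := by
  have h1 : wt x ^ 2 = bracket x ^ (-(2 * (d : ℤ)) - 2) := by
    rw [wt, inv_pow, ← pow_mul, ← zpow_natCast, ← zpow_neg]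
    congr 1
    push_cast
    ring
  rw [h1]
  exact zpow_le_zpow_right₀ (one_le_bracket x) (by omega)

lemma bracket_zpow_le_wt {d : ℕ} (x : Momentum d) : bracket x ^ (-(2 * (d : ℤ)) - 12) ≤ wt x :=
  (bracket_zpow_le_wt_sq x).trans (pow_le_of_le_one (wt_pos x).le (wt_le_one x) two_ne_zero)

namespace StandingAssumptions

variable {d : ℕ} {c : Bounds} {S : Model d} {ω₀ : ℝ}

lemma C₁_nonneg (h : StandingAssumptions c S) : 0 ≤ c.C₁ := by
  have h1 := (norm_nonneg _).trans (h.e_bound 0 (Nat.zero_le _) 0)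
  have h2 : 0 < 1 + bracket (0 : Momentum d) ^ (2 - ((0 : ℕ) : ℤ)) :=
    add_pos one_pos (zpow_pos (bracket_pos _) _)
  exact nonneg_of_mul_nonneg_left h1 h2

lemma C₇_nonneg (h : StandingAssumptions c S) : 0 ≤ c.C₇ :=
  nonneg_of_mul_nonneg_left ((norm_nonneg _).trans (h.Q_bound 0 (Nat.zero_le _) 0))
    (zpow_pos (bracket_pos _) _)

/-- For `p = 0` and the positive sign, Φ is `e` plus a constant, which has no Hessian. -/
lemma uniformlyConvex (h : StandingAssumptions c S) (hd : 1 ≤ d) (hω : ∀ k, S.ω k = ω₀) :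
    UniformlyConvex c.C₃ c.C₄ S.e := by
  have e1 : (fun k' => S.Phi 1 0 k') = fun k' => S.e k' + ω₀ := by
    funext k
    simp [Model.Phi, Model.sgn, hω]
  have hsm : ContDiff ℝ ((2 : ℕ) : WithTop ℕ∞) S.e :=
    h.e_smooth.of_le (by exact_mod_cast (by omega : 2 ≤ 2 * d))
  have e2 : ∀ x v, iteratedFDeriv ℝ 2 (fun k' => S.Phi 1 0 k') x ![v, v] = dirDeriv 2 S.e v x := by
    intro x v
    have e3 : iteratedFDeriv ℝ 2 (fun k' => S.e k' + ω₀) x = iteratedFDeriv ℝ 2 S.e x := by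
      rw [fun_iteratedFDeriv_add_apply hsm.contDiffAt contDiffAt_const,
        iteratedFDeriv_const_of_ne two_ne_zero]
      simp
    have e4 : (![v, v] : Fin 2 → Momentum d) = fun _ => v := by
      ext i
      fin_cases i <;> rfl
    rw [e1, e3, e4, dirDeriv]
  refine ⟨h.e_even, hsm, fun x v => ?_, fun x v => ?_⟩
  · rw [← e2]
    exact (h.phi_hess 1 0 x v).1
  · rw [← e2]
    exact (h.phi_hess 1 0 x v).2

/-- Order five is available because `5 ≤ 2 * d`, and from order two on the powers of the bracket are
at most one. -/
lemma boundedDerivs (h : StandingAssumptions c S) (hd : 3 ≤ d) :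
    BoundedDerivs (2 * c.C₁) S.e := by
  refine ⟨h.e_smooth.of_le (by exact_mod_cast (by omega : 5 ≤ 2 * d)), fun l h2 h5 x => ?_⟩
  refine (h.e_bound l (by omega) x).trans ?_
  have := bracket_zpow_le_one x (i := 2 - (l : ℤ)) (by omega)
  nlinarith [h.C₁_nonneg]

/-- The base points are `0` and `-w`, the levels are shifted by `ω₀`, and the radius takes its
largest value. -/
lemma transversal_e (h : StandingAssumptions c S) (hω : ∀ k, S.ω k = ω₀) :
    Transversal c.C₅ c.ρ S.e := by
  intro w q θ θ' δ δ' hw h1 h2 h3 h4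
  have := h.transversal 1 1 0 (-w) (θ + ω₀) (θ' + ω₀) δ δ' c.ρ q
    (by simpa using hw) h1 h2 h3 h4 h.ρ_pos le_rfl
  simpa [Model.layer, Model.Phi, Model.sgn, hω, ← sub_eq_add_neg] using this

lemma dirBound_Q_sq (h : StandingAssumptions c S) (hd : 3 ≤ d) {v : Momentum d} (hv : ‖v‖ = 1) :
    DirBound v 3 (2 ^ 3 * (c.C₇ * c.C₇)) (fun x => wt x * wt x) fun k => S.Q k ^ 2 := by
  have h1 := dirBound_dirDeriv h.Q_smooth v (C := c.C₇) (w := wt) 3 0 (by omega)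
    fun l _ hl x => by
      refine (abs_dirDeriv_le S.Q v x).trans ?_
      rw [hv, one_pow, mul_one]
      exact (h.Q_bound l (by omega) x).trans
        (mul_le_mul_of_nonneg_left (bracket_zpow_le_wt x) h.C₇_nonneg)
  have e1 : dirDeriv 0 S.Q v = S.Q := funext fun x => dirDeriv_zero S.Q v x
  rw [e1] at h1
  have h2 := h1.mul h1
  simpa only [← pow_two] using h2

/-- The gap gives βω - μ ≥ βC₆, which keeps the denominator of the phonon number away from zero; the
constant depends on β through this bound. -/
lemma exp_le (h : StandingAssumptions c S) (k : Momentum d) :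
    Real.exp (-S.β * S.ω k + S.μ) ≤ Real.exp (-(S.β * c.C₆)) := by
  have hβ := h.β_pos
  refine Real.exp_le_exp.2 ?_
  have h1 := mul_le_mul_of_nonneg_left (h.gap k) hβ.le
  rw [mul_sub, mul_comm S.μ, mul_inv_cancel_left₀ hβ.ne'] at h1
  linarith

lemma exp_lt_one (h : StandingAssumptions c S) : Real.exp (-(S.β * c.C₆)) < 1 :=
  Real.exp_lt_one_iff.2 (neg_neg_of_pos (mul_pos h.β_pos h.C₆_pos))

lemma phononNumber_bounds (h : StandingAssumptions c S) (k : Momentum d) :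
    0 ≤ S.phononNumber k ∧ S.phononNumber k ≤ (1 - Real.exp (-(S.β * c.C₆)))⁻¹ := by
  have h1 := h.exp_le k
  have h2 := h.exp_lt_one
  have h3 := Real.exp_pos (-S.β * S.ω k + S.μ)
  rw [Model.phononNumber]
  refine ⟨div_nonneg h3.le (by linarith), ?_⟩
  rw [inv_eq_one_div]
  exact div_le_div₀ zero_le_one (by linarith) (by linarith) (by linarith)

lemma e_lip (h : StandingAssumptions c S) (hd : 1 ≤ d) (x y : Momentum d) :
    |S.e x - S.e y| ≤ 2 * c.C₁ * (1 + ‖x‖ + ‖y‖) * ‖x - y‖ := by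
  have hdiff : Differentiable ℝ S.e := h.e_smooth.differentiable (by exact_mod_cast (by omega))
  refine Convex.norm_image_sub_le_of_norm_fderiv_le (𝕜 := ℝ) (fun z _ => hdiff z) (fun z hz => ?_)
    (convex_closedBall (0 : Momentum d) (‖x‖ + ‖y‖)) ?_ ?_
  · rw [← norm_iteratedFDeriv_one]
    refine (h.e_bound 1 (by omega) z).trans ?_
    have h1 := bracket_le_one_add_norm z
    rw [mem_closedBall_zero_iff] at hz
    have h2 : bracket z ^ (2 - ((1 : ℕ) : ℤ)) = bracket z := by norm_num
    rw [h2]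
    nlinarith [h.C₁_nonneg, norm_nonneg x, norm_nonneg y]
  · simp
  · simp

lemma Q_lip (h : StandingAssumptions c S) (hd : 1 ≤ d) (x y : Momentum d) :
    |S.Q x - S.Q y| ≤ c.C₇ * ‖x - y‖ := by
  have hdiff : Differentiable ℝ S.Q := h.Q_smooth.differentiable (by exact_mod_cast (by omega))
  refine Convex.norm_image_sub_le_of_norm_fderiv_le (𝕜 := ℝ) (fun z _ => hdiff z) (fun z _ => ?_)
    (convex_univ : Convex ℝ (Set.univ : Set (Momentum d))) (Set.mem_univ _) (Set.mem_univ _)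
  rw [← norm_iteratedFDeriv_one]
  exact (h.Q_bound 1 (by omega) z).trans
    (mul_le_of_le_one_right h.C₇_nonneg (bracket_zpow_le_one z (by omega)))

/-- The constant of the regularity bounds for constant phonon dispersion. -/
noncomputable def regularityBound (c : Bounds) (β : ℝ) : ℝ :=
  1 + 2 * |c.C₁| + |c.C₇| + |(1 - Real.exp (-(β * c.C₆)))⁻¹|

lemma constantPhonon (h : StandingAssumptions c S) (hd : 1 ≤ d) (hω : ∀ k, S.ω k = ω₀) :
    ConstantPhonon S ω₀ (regularityBound c S.β) := by
  have h1 := abs_nonneg c.C₁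
  have h2 := abs_nonneg c.C₇
  have h3 := abs_nonneg (1 - Real.exp (-(S.β * c.C₆)))⁻¹
  have h1' := le_abs_self c.C₁
  have h2' := le_abs_self c.C₇
  have h3' := le_abs_self (1 - Real.exp (-(S.β * c.C₆)))⁻¹
  refine
    { one_le := by rw [regularityBound]; linarith
      ω_eq := hω
      e_cont := h.e_smooth.continuous
      Q_cont := h.Q_smooth.continuous
      e_lip := fun x y => (h.e_lip hd x y).trans ?_
      Q_le := fun x => ?_
      Q_lip := fun x y => (h.Q_lip hd x y).trans ?_
      phonon_nonneg := fun k => (h.phononNumber_bounds k).1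
      phonon_le := fun k => (h.phononNumber_bounds k).2.trans ?_ }
  · rw [mul_assoc, mul_assoc (regularityBound _ _)]
    exact mul_le_mul_of_nonneg_right (by rw [regularityBound]; linarith) (by positivity)
  · have h4 := h.Q_bound 0 (Nat.zero_le _) x
    rw [norm_iteratedFDeriv_zero, Real.norm_eq_abs] at h4
    refine h4.trans (mul_le_mul ?_ (bracket_zpow_le_wt_sq x) (zpow_pos (bracket_pos _) _).le ?_) <;>
    · rw [regularityBound]; linarith
  · exact mul_le_mul_of_nonneg_right (by rw [regularityBound]; linarith) (norm_nonneg _)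
  · rw [regularityBound]; linarith

end StandingAssumptions

/-- The bound on the pairing graphs of a model with constant phonon dispersion. -/
theorem exists_limsup_graphValue_le (d : ℕ) (hd : 3 ≤ d) (c : Bounds) (β : ℝ) (hC₃ : 0 < c.C₃)
    (hρ : 0 < c.ρ) :
    ∃ C : ℝ, 0 < C ∧ ∀ S : Model d, S.β = β → StandingAssumptions c S →
      (∃ ω₀ : ℝ, ∀ k, S.ω k = ω₀) →
      ∀ γ : ℝ → (ElectronSpace d →L[ℂ] ElectronSpace d),
      (∀ L : ℝ, 0 < L → IsDensityMatrix (γ L)) →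
      limsup (fun L : ℝ => momentumMoment L (γ L)) atTop ≤ ENNReal.ofReal c.C₈ →
      ∀ (n N κ : ℕ) (m m' : Fin (n + 1) → ℕ), m ∈ patterns n N → m' ∈ patterns n N →
      ∀ π : Equiv.Perm (Fin n), HasMonotonePeaks π κ → ∀ lam t : ℝ, 0 < t →
        limsup (fun L : ℝ => ‖graphValue S L (γ L) lam t N m m' π‖ₑ) atTop ≤
          ENNReal.ofReal ((t ^ κ)⁻¹ * (C * lam ^ 2 * t) ^ N * logStar t ^ (n + κ + 2)) := by
  have hd0 : 0 < d := by omega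
  obtain ⟨D, hD⟩ : ∃ D : ℝ, D = StandingAssumptions.regularityBound c β := ⟨_, rfl⟩
  have hD1 : 1 ≤ D := by
    rw [hD, StandingAssumptions.regularityBound]
    have h1 := abs_nonneg c.C₁
    have h2 := abs_nonneg c.C₇
    have h3 := abs_nonneg (1 - Real.exp (-(β * c.C₆)))⁻¹
    linarith
  -- The upper Hessian constant is enlarged to `max c.C₄ 1`, because its positivity is not given
  -- before a model is.
  obtain ⟨K, hK1, hK⟩ := exists_lintegral_oscInt_le d hd (B := max c.C₄ 1) (B' := 2 * c.C₁)
    (D := 2 ^ 3 * (c.C₇ * c.C₇)) hC₃ (mul_nonneg (by norm_num) (mul_self_nonneg _))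
  obtain ⟨K', hK'1, hK'⟩ := exists_lintegral_amp_mul_amp_le d hd (B := max c.C₄ 1) (κ₀ := c.C₅)
    hC₃ (lt_max_of_lt_right one_pos) hρ hD1 hK1
  have hcb := ConstantPhonon.one_le_couplingBound (d := d) hD1
  refine ⟨2 * ConstantPhonon.couplingBound d D * K', by positivity, ?_⟩
  rintro S rfl h ⟨ω₀, hω⟩ γ hγ hmom n N κ m m' hm hm' π hπ lam t ht
  have hS : ConstantPhonon S ω₀ D := hD ▸ h.constantPhonon hd0 hω
  have he : UniformlyConvex c.C₃ (max c.C₄ 1) S.e := by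
    have he' := h.uniformlyConvex hd0 hω
    exact ⟨he'.even, he'.smooth, he'.hess_ge, fun x v => (he'.hess_le x v).trans
      (mul_le_mul_of_nonneg_right (le_max_left _ _) (sq_nonneg _))⟩
  have hl := logStar_pos t
  have hX0 : 0 ≤ (t ^ κ)⁻¹ * (K' * t) ^ N * logStar t ^ (n + κ + 2) := by positivity
  refine (hS.limsup_graphValue_le hd0 hγ hmom hm hm' π lam ht.le hX0 fun p σ =>
    hK' S ω₀ hS he (h.transversal_e hω) (hK S.e he (h.boundedDerivs hd) _
      fun v hv => h.dirBound_Q_sq hd hv) n N κ m m' hm hm' π hπ p σ t ht).trans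
    (ENNReal.ofReal_le_ofReal ?_)
  have hnN : n ≤ N := by
    simp only [patterns, Set.mem_ofPred_eq] at hm
    omega
  obtain ⟨q, hq⟩ : ∃ q : ℝ, q = ConstantPhonon.couplingBound d D := ⟨_, rfl⟩
  rw [← hq] at hcb ⊢
  -- The number of sign choices and the coupling constants enter to the power `n ≤ N` and are
  -- absorbed in the `N`-th power.
  calc _ = (2 ^ n * q ^ n) *
        ((lam ^ 2) ^ N * ((t ^ κ)⁻¹ * (K' * t) ^ N * logStar t ^ (n + κ + 2))) := by ring
    _ ≤ (2 ^ N * q ^ N) *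
        ((lam ^ 2) ^ N * ((t ^ κ)⁻¹ * (K' * t) ^ N * logStar t ^ (n + κ + 2))) := by
        refine mul_le_mul_of_nonneg_right ?_ (by positivity)
        exact mul_le_mul (pow_le_pow_right₀ one_le_two hnN) (pow_le_pow_right₀ hcb hnN)
          (by positivity) (by positivity)
    _ = _ := by simp only [mul_pow]; ring

end ElectronPhonon

theorem mainTheorem6 (d : ℕ) (hd : 3 ≤ d) (c : ElectronPhonon.Bounds) (β : ℝ) :
    ∃ C : ℝ, 0 < C ∧
      ∀ S : ElectronPhonon.Model d, S.β = β → ElectronPhonon.StandingAssumptions c S →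
      (∃ ω₀ : ℝ, ∀ k, S.ω k = ω₀) →
      ∀ γ : ℝ → (ElectronPhonon.ElectronSpace d →L[ℂ] ElectronPhonon.ElectronSpace d),
      (∀ L : ℝ, 0 < L → ElectronPhonon.IsDensityMatrix (γ L)) →
      Filter.limsup (fun L : ℝ => ElectronPhonon.momentumMoment L (γ L)) Filter.atTop ≤
        ENNReal.ofReal c.C₈ →
      ∀ (n N κ : ℕ) (m m' : Fin (n + 1) → ℕ),
      m ∈ ElectronPhonon.patterns n N → m' ∈ ElectronPhonon.patterns n N →
      ∀ π : Equiv.Perm (Fin n), ElectronPhonon.HasMonotonePeaks π κ →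
      ∀ lam t : ℝ, 0 < t →
        Filter.limsup
            (fun L : ℝ => ‖ElectronPhonon.graphValue S L (γ L) lam t N m m' π‖ₑ) Filter.atTop ≤
          ENNReal.ofReal ((t ^ κ)⁻¹ * (C * lam ^ 2 * t) ^ N *
            ElectronPhonon.logStar t ^ (n + κ + 2)) := by
  by_cases h : 0 < c.C₃ ∧ 0 < c.ρ
  · exact ElectronPhonon.exists_limsup_graphValue_le d hd c β h.1 h.2
  -- If `c.C₃` or `c.ρ` is not positive, no model satisfies the assumptions and any constant will
  -- do.
  · exact ⟨1, one_pos, fun S _ hS => absurd ⟨hS.C₃_pos, hS.ρ_pos⟩ h⟩
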